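/- **Setting.** For $c=(c_1,c_2,c_3)\in\mathbb R^3$ let $P_c(x)=c_1(1-x)+c_2(1+x)+c_3(1-x^2)$, let $\bar c_3(c_1,c_2)=-\frac12(\sqrt{1+c_1}+\sqrt{1+c_2})(\sqrt{1+c_1}+\sqrt{1+c_2}+2)$ and $J=\{c: c_1\ge-1,\ c_2\ge -1,\ c_3\ge\bar c_3(c_1,c_2)\}$. Let $U^{c,\gamma}_\theta$ be the solution on $(-1,1)$ of $$(1-x^2)U_\theta'+2xU_\theta+\tfrac12U_\theta^2=P_c(x),\qquad U_\theta(0)=\gamma ,$$ and $U^{c,\gamma}=(U^{c,\gamma}_\theta,0)$; for $c\in J$ such a solution on all of $(-1,1)$ exists exactly for $\gamma\in[\gamma^-(c),\gamma^+(c)]$, so $\gamma^-(c)$ and $\gamma^+(c)$ are the infimum and the supremum of the admissible values $\gamma$. Put $$I_{2,1}=\{(c,\gamma): c_1=-1,\ c_2>-1,\ c_3>\bar c_3,\ \gamma^-(c)<\gamma<\gamma^+(c)\},$$ $$I_{3,1}=\{(c,\gamma): c_1>-1,\ c_2=-1,\ c_3>\bar c_3,\ \gamma^-(c)<\gamma<\gamma^+(c)\}.$$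 The reduced Navier–Stokes system for $U=(U_\theta,U_\phi)$, $U_\theta\in C^1(-1,1)$, $U_\phi\in C^2(-1,1)$, with constants $\hat c$ is $$(1-x^2)U_\theta'+2xU_\theta+\tfrac12U_\theta^2+\psi[U_\phi]=P_{\hat c},\qquad (1-x^2)U_\phi''+U_\theta U_\phi'=0\quad\text{on }(-1,1),\tag{1}$$ where $\psi[f](x)=\int_0^x\int_0^l\int_0^t\frac{2f(s)f'(s)}{1-s^2}\,ds\,dt\,dl$. Let also $\varphi_{c,\gamma}[f]=(1-x^2)f'+(2x+U^{c,\gamma}_\theta)f+\frac12f^2$. With $a_{c,\gamma}(x)=\int_0^x\frac{2s+U^{c,\gamma}_\theta}{1-s^2}ds$ and $b_{c,\gamma}(x)=\int_0^x\frac{U^{c,\gamma}_\theta}{1-s^2}ds$ put $$V^1_{c,\gamma}=(e^{-a_{c,\gamma}},0),\quad V^2_{c,\gamma}=\Big(e^{-a_{c,\gamma}}\int_0^xe^{a_{c,\gamma}}ds,\,0\Big),\quad V^3_{c,\gamma}=\Big(0,\int_0^xe^{-b_{c,\gamma}}dt\Big),\quad V^4_{c,\gamma}=(0,1).$$ **Spaces.**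 For $0<\epsilon<\frac12$ let $\mathbf M_1$ be the space of $f\in C^3(-\frac12,\frac12)\cap C^1(-1,1)\cap C[-1,1]$ with $f(\pm1)=0$ and finite norm $$\big\|\ln\tfrac{1+x}3\,(1-x)^{-1+2\epsilon}f\big\|_{L^\infty(-1,1)}+\big\|(1+x)\big(\ln\tfrac{1+x}3\big)^2(1-x)^{2\epsilon}f'\big\|_{L^\infty(-1,1)}+\|f''\|_{L^\infty(-\frac12,\frac12)}+\|f'''\|_{L^\infty(-\frac12,\frac12)},$$ and let $\mathbf M_2$ be the space of $f\in C^2(-1,1)$ with finite norm $\sum_{k=0}^2\|(1-x^2)^{k+\epsilon}f^{(k)}\|_{L^\infty(-1,1)}$. Let $\mathbf X=\mathbf M_1\times\mathbf M_2$ with the sum norm and $\mathbf X_1=\{V\in\mathbf X: V_\theta(0)=V_\theta'(0)=V_\phi'(0)=V_\phi(0)=0\}$. In the case of $I_{3,1}$ the weights of $\mathbf M_1$ are those with $x$ replaced by $-x$. **Theorem.** Let $K$ be a compact subset of $I_{2,1}$ (respectively of $I_{3,1}$), and let $0<\epsilon<\frac12$ satisfy $\epsilon>-\frac14U^{c,\gamma}_\theta(1)$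 (respectively $\epsilon>\frac14U^{c,\gamma}_\theta(-1)$) for all $(c,\gamma)\in K$, where boundary values are limits. For $(c,\gamma)\in K$ one has $U^{c,\gamma}_\theta(-1)=2$ and $\eta_1:=\lim_{x\to-1}(U^{c,\gamma}_\theta-2)\ln(1+x)=4$ (respectively $U^{c,\gamma}_\theta(1)=-2$ and $\eta_2:=\lim_{x\to1}(U^{c,\gamma}_\theta+2)\ln(1-x)=-4$). Moreover, there exist $\delta>0$ and $V\in C^\infty(K\times B_\delta(0),\mathbf X_1)$, $B_\delta(0)\subset\mathbb R^4$ (that is, $V$ is the restriction of a $C^\infty$ map on $O\times B_\delta(0)$ for some open $O\supset K$ in $\mathbb R^4$), such that for every $(c,\gamma)\in K$: (i) $V(c,\gamma,0)=0$ and $\partial V/\partial\beta_i|_{\beta=0}=0$, $1\le i\le4$; (ii) for every $\beta\in B_\delta(0)$, with $\tilde U=\sum_{i=1}^4\beta_iV^i_{c,\gamma}+V(c,\gamma,\beta)$, the values $\psi[\tilde U_\phi](\pm1)$ are given by convergent integrals and $$U=U^{c,\gamma}+\sum_{i=1}^4\beta_iV^i_{c,\gamma}+V(c,\gamma,\beta)\tag{2}$$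 satisfies (1) with $\hat c_1=c_1+\frac12\psi[\tilde U_\phi](-1)$, $\hat c_2=c_2+\frac12\psi[\tilde U_\phi](1)$, $\hat c_3=c_3-\frac12(\varphi_{c,\gamma}[\tilde U_\theta])''(0)$. Finally (local uniqueness), there is $\delta'>0$ such that whenever $(c,\gamma)\in K$, $U-U^{c,\gamma}\in\mathbf X$, $\|U-U^{c,\gamma}\|_{\mathbf X}<\delta'$ and $U$ satisfies (1) with some constants $\hat c_1,\hat c_2,\hat c_3$, then (2) holds for some $\beta$ with $|\beta|<\delta$. -/

import Mathlib

open Set Filter Topology MeasureTheory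
open scoped ContDiff

noncomputable section

namespace SwirlNSE

/-! ### The axisymmetric no-swirl solutions `U^{c,γ}` and their parameter sets

Everything is written in the variable `x = cos θ ∈ (-1,1)`, with `U_θ = u_θ sin θ` and
`U_φ = u_φ sin θ`. The triple `c = (c₁,c₂,c₃)` is `c 0, c 1, c 2`. -/

/-- `P_c(x) = c₁ (1 - x) + c₂ (1 + x) + c₃ (1 - x²)`. -/
def P (c : Fin 3 → ℝ) (x : ℝ) : ℝ :=
  c 0 * (1 - x) + c 1 * (1 + x) + c 2 * (1 - x ^ 2)

/-- `U` solves `(1 - x²) U' + 2 x U + U² / 2 = P_c` on `(-1,1)`. -/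
def IsNoSwirlSol (c : Fin 3 → ℝ) (U : ℝ → ℝ) : Prop :=
  ∀ x ∈ Ioo (-1 : ℝ) 1, DifferentiableAt ℝ U x ∧
    (1 - x ^ 2) * deriv U x + 2 * x * U x + U x ^ 2 / 2 = P c x

/-- The values `U(0)` of the solutions on the whole of `(-1,1)`. For `c ∈ J` this is the
interval `[γ⁻(c), γ⁺(c)]`. -/
def initialValues (c : Fin 3 → ℝ) : Set ℝ :=
  {γ | ∃ U : ℝ → ℝ, IsNoSwirlSol c U ∧ U 0 = γ}

def gammaPlus (c : Fin 3 → ℝ) : ℝ := sSup (initialValues c)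

def gammaMinus (c : Fin 3 → ℝ) : ℝ := sInf (initialValues c)

open Classical in
/-- `U_θ^{c,γ}`: the solution on `(-1,1)` with value `γ` at `0`. It is unique there; values
outside `(-1,1)` are never used. -/
def Ubar (c : Fin 3 → ℝ) (γ : ℝ) : ℝ → ℝ :=
  if h : ∃ U : ℝ → ℝ, IsNoSwirlSol c U ∧ U 0 = γ then h.choose else 0

/-- `c̄₃(c₁,c₂)`. -/
def c3bar (c₁ c₂ : ℝ) : ℝ :=
  -(1 / 2) * (√(1 + c₁) + √(1 + c₂)) * (√(1 + c₁) + √(1 + c₂) + 2)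

def J : Set (Fin 3 → ℝ) := {c | -1 ≤ c 0 ∧ -1 ≤ c 1 ∧ c3bar (c 0) (c 1) ≤ c 2}

def J2 : Set (Fin 3 → ℝ) := {c ∈ J | c 0 = -1 ∧ -1 < c 1 ∧ c3bar (c 0) (c 1) < c 2}

def J3 : Set (Fin 3 → ℝ) := {c ∈ J | -1 < c 0 ∧ c 1 = -1 ∧ c3bar (c 0) (c 1) < c 2}

/-- The parameter set `I` of all pairs `(c,γ)`. -/
def I : Set ((Fin 3 → ℝ) × ℝ) :=
  {q | q.1 ∈ J ∧ gammaMinus q.1 ≤ q.2 ∧ q.2 ≤ gammaPlus q.1}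

/-- `I_{2,1}`. -/
def I21 : Set ((Fin 3 → ℝ) × ℝ) :=
  {q ∈ I | q.1 ∈ J2 ∧ gammaMinus q.1 < q.2 ∧ q.2 < gammaPlus q.1}

/-- `I_{3,1}`. -/
def I31 : Set ((Fin 3 → ℝ) × ℝ) :=
  {q ∈ I | q.1 ∈ J3 ∧ gammaMinus q.1 < q.2 ∧ q.2 < gammaPlus q.1}

/-- The boundary value `U_θ^{c,γ}(-1)`. -/
def UbarLeft (c : Fin 3 → ℝ) (γ : ℝ) : ℝ := limUnder (𝓝[>] (-1 : ℝ)) (Ubar c γ)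

/-- The boundary value `U_θ^{c,γ}(1)`. -/
def UbarRight (c : Fin 3 → ℝ) (γ : ℝ) : ℝ := limUnder (𝓝[<] (1 : ℝ)) (Ubar c γ)

/-! ### The reduced Navier-Stokes system -/

/-- The integrand in `l` of the triple integral `ψ[f,g]`. -/
def psiInner (f g : ℝ → ℝ) (l : ℝ) : ℝ :=
  ∫ t in (0 : ℝ)..l, ∫ s in (0 : ℝ)..t, 2 * f s * deriv g s / (1 - s ^ 2)

/-- `ψ[f,g](x) = ∫₀ˣ ∫₀ˡ ∫₀ᵗ 2 f g' / (1 - s²) ds dt dl`. -/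
def psi (f g : ℝ → ℝ) (x : ℝ) : ℝ := ∫ l in (0 : ℝ)..x, psiInner f g l

/-- `φ_{c,γ}[f] = (1 - x²) f' + (2 x + Ū_θ) f + f² / 2`. -/
def phi (c : Fin 3 → ℝ) (γ : ℝ) (f : ℝ → ℝ) (x : ℝ) : ℝ :=
  (1 - x ^ 2) * deriv f x + (2 * x + Ubar c γ x) * f x + f x ^ 2 / 2

/-- `U = (U_θ, U_φ)` is a classical solution on `(-1,1)` of
`(1 - x²) U_θ' + 2 x U_θ + U_θ² / 2 + ψ[U_φ,U_φ] = P_ĉ`, `(1 - x²) U_φ'' + U_θ U_φ' = 0`. -/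
def SolvesNSE (chat : Fin 3 → ℝ) (U : (ℝ → ℝ) × (ℝ → ℝ)) : Prop :=
  ContDiffOn ℝ 1 U.1 (Ioo (-1) 1) ∧ ContDiffOn ℝ 2 U.2 (Ioo (-1) 1) ∧
    ∀ x ∈ Ioo (-1 : ℝ) 1,
      (1 - x ^ 2) * deriv U.1 x + 2 * x * U.1 x + U.1 x ^ 2 / 2 + psi U.2 U.2 x = P chat x ∧
      (1 - x ^ 2) * iteratedDeriv 2 U.2 x + U.1 x * deriv U.2 x = 0

/-! ### The functions `V^i_{c,γ}` -/

/-- `a_{c,γ}(x) = ∫₀ˣ (2 s + Ū_θ) / (1 - s²) ds`. -/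
def aFun (c : Fin 3 → ℝ) (γ x : ℝ) : ℝ :=
  ∫ s in (0 : ℝ)..x, (2 * s + Ubar c γ s) / (1 - s ^ 2)

/-- `b_{c,γ}(x) = ∫₀ˣ Ū_θ / (1 - s²) ds`. -/
def bFun (c : Fin 3 → ℝ) (γ x : ℝ) : ℝ :=
  ∫ s in (0 : ℝ)..x, Ubar c γ s / (1 - s ^ 2)

/-- `V¹, V², V³, V⁴` (indexed by `0, 1, 2, 3`) as pairs (θ-component, φ-component). -/
def basisV (c : Fin 3 → ℝ) (γ : ℝ) : Fin 4 → (ℝ → ℝ) × (ℝ → ℝ) :=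
  ![(fun x => Real.exp (-aFun c γ x), 0),
    (fun x => Real.exp (-aFun c γ x) * ∫ s in (0 : ℝ)..x, Real.exp (aFun c γ s), 0),
    (0, fun x => ∫ t in (0 : ℝ)..x, Real.exp (-bFun c γ t)),
    (0, fun _ => 1)]

/-! ### The two cases -/

/-- The pole at which the logarithmic singular behaviour occurs:
`south` is `x = -1`, `north` is `x = 1`. -/
inductive Pole where
  | south : Pole
  | north : Pole

/-- The case `north` is obtained from `south` by replacing `x` with `-x` in the weights. -/
def Pole.sign : Pole → ℝ
  | .south => 1
  | .north => -1

/-- `I_{2,1}` for the south pole, `I_{3,1}` for the north pole. -/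
def Pole.region : Pole → Set ((Fin 3 → ℝ) × ℝ)
  | .south => I21
  | .north => I31

/-- The restriction on the exponent `ε` coming from the other pole:
`ε > -Ū_θ(1)/4` for the south pole and `ε > Ū_θ(-1)/4` for the north pole. -/
def Pole.Admissible (p : Pole) (ε : ℝ) (c : Fin 3 → ℝ) (γ : ℝ) : Prop :=
  match p with
  | .south => -UbarRight c γ / 4 < ε
  | .north => UbarLeft c γ / 4 < ε

/-- `Ū_θ(-1) = 2` and `(Ū_θ - 2) ln (1 + x) → 4` at the south pole, respectively
`Ū_θ(1) = -2` and `(Ū_θ + 2) ln (1 - x) → -4` at the north pole. -/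
def Pole.LogSingular (p : Pole) (c : Fin 3 → ℝ) (γ : ℝ) : Prop :=
  match p with
  | .south => Tendsto (Ubar c γ) (𝓝[>] (-1)) (𝓝 2) ∧
      Tendsto (fun x => (Ubar c γ x - 2) * Real.log (1 + x)) (𝓝[>] (-1)) (𝓝 4)
  | .north => Tendsto (Ubar c γ) (𝓝[<] 1) (𝓝 (-2)) ∧
      Tendsto (fun x => (Ubar c γ x + 2) * Real.log (1 - x)) (𝓝[<] 1) (𝓝 (-4))

lemma Pole.sign_mul_mem (p : Pole) {x : ℝ} (hx : x ∈ Ioo (-1 : ℝ) 1) :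
    p.sign * x ∈ Ioo (-1 : ℝ) 1 := by
  cases p <;> simp only [Pole.sign, mem_Ioo] at hx ⊢ <;> constructor <;> linarith [hx.1, hx.2]

/-! ### Weighted supremum norms -/

/-- `w f` is bounded on `S`. -/
def WBdd (S : Set ℝ) (w f : ℝ → ℝ) : Prop := BddAbove (range fun x : S => |w x * f x|)

/-- `‖w f‖_{L^∞(S)}` (used for continuous `w f` on open `S`, where it is the supremum). -/
def wnorm (S : Set ℝ) (w f : ℝ → ℝ) : ℝ := ⨆ x : S, |w x * f x|

lemma wnorm_nonneg (S : Set ℝ) (w f : ℝ → ℝ) : 0 ≤ wnorm S w f :=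
  Real.iSup_nonneg fun _ => abs_nonneg _

lemma le_wnorm {S : Set ℝ} {w f : ℝ → ℝ} (h : WBdd S w f) {x : ℝ} (hx : x ∈ S) :
    |w x * f x| ≤ wnorm S w f :=
  le_ciSup (f := fun x : S => |w x * f x|) h ⟨x, hx⟩

lemma wnorm_le {S : Set ℝ} {w f : ℝ → ℝ} {C : ℝ} (hC : 0 ≤ C)
    (h : ∀ x ∈ S, |w x * f x| ≤ C) : wnorm S w f ≤ C :=
  Real.iSup_le (fun x => h x x.2) hC

lemma wbdd_of_le {S : Set ℝ} {w f : ℝ → ℝ} {C : ℝ} (h : ∀ x ∈ S, |w x * f x| ≤ C) :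
    WBdd S w f := by
  refine ⟨C, ?_⟩
  rintro _ ⟨x, rfl⟩
  exact h x x.2

lemma abs_add_le_wnorm {S : Set ℝ} {w f g h : ℝ → ℝ} (hf : WBdd S w f) (hg : WBdd S w g)
    (e : ∀ x ∈ S, h x = f x + g x) : ∀ x ∈ S, |w x * h x| ≤ wnorm S w f + wnorm S w g := by
  intro x hx
  rw [e x hx, mul_add]
  exact (abs_add_le _ _).trans (add_le_add (le_wnorm hf hx) (le_wnorm hg hx))

lemma WBdd.add {S : Set ℝ} {w f g h : ℝ → ℝ} (hf : WBdd S w f) (hg : WBdd S w g)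
    (e : ∀ x ∈ S, h x = f x + g x) : WBdd S w h :=
  wbdd_of_le (abs_add_le_wnorm hf hg e)

lemma wnorm_add_le {S : Set ℝ} {w f g h : ℝ → ℝ} (hf : WBdd S w f) (hg : WBdd S w g)
    (e : ∀ x ∈ S, h x = f x + g x) : wnorm S w h ≤ wnorm S w f + wnorm S w g :=
  wnorm_le (add_nonneg (wnorm_nonneg _ _ _) (wnorm_nonneg _ _ _)) (abs_add_le_wnorm hf hg e)

lemma wnorm_smul {S : Set ℝ} {w f h : ℝ → ℝ} {a : ℝ} (e : ∀ x ∈ S, h x = a * f x) :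
    wnorm S w h = |a| * wnorm S w f := by
  unfold wnorm
  rw [Real.mul_iSup_of_nonneg (abs_nonneg a)]
  refine iSup_congr fun x => ?_
  rw [e x x.2, ← abs_mul]
  congr 1
  ring

lemma WBdd.smul {S : Set ℝ} {w f h : ℝ → ℝ} {a : ℝ} (hf : WBdd S w f)
    (e : ∀ x ∈ S, h x = a * f x) : WBdd S w h := by
  refine wbdd_of_le (C := |a| * wnorm S w f) fun x hx => ?_
  rw [e x hx, show w x * (a * f x) = a * (w x * f x) by ring, abs_mul]
  exact mul_le_mul_of_nonneg_left (le_wnorm hf hx) (abs_nonneg a)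

lemma wnorm_zero {S : Set ℝ} {w f : ℝ → ℝ} (e : ∀ x ∈ S, f x = 0) : wnorm S w f = 0 :=
  le_antisymm (wnorm_le le_rfl fun x hx => by simp [e x hx]) (wnorm_nonneg _ _ _)

lemma wbdd_zero {S : Set ℝ} {w f : ℝ → ℝ} (e : ∀ x ∈ S, f x = 0) : WBdd S w f :=
  wbdd_of_le (C := 0) fun x hx => by simp [e x hx]

lemma eq_zero_of_wnorm {S : Set ℝ} {w f : ℝ → ℝ} (hf : WBdd S w f) (h0 : wnorm S w f = 0)
    {x : ℝ} (hx : x ∈ S) (hw : w x ≠ 0) : f x = 0 := by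
  have h1 := le_wnorm hf hx
  rw [h0] at h1
  have h2 : w x * f x = 0 := abs_eq_zero.1 (le_antisymm h1 (abs_nonneg _))
  exact (mul_eq_zero.1 h2).resolve_left hw

lemma iteratedDeriv_add_of {f g : ℝ → ℝ} {S : Set ℝ} (hS : IsOpen S) {n : ℕ}
    (hf : ContDiffOn ℝ n f S) (hg : ContDiffOn ℝ n g S) {x : ℝ} (hx : x ∈ S) :
    iteratedDeriv n (f + g) x = iteratedDeriv n f x + iteratedDeriv n g x :=
  iteratedDeriv_add (hf.contDiffAt (hS.mem_nhds hx)) (hg.contDiffAt (hS.mem_nhds hx))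

lemma iteratedDeriv_smul_of {f : ℝ → ℝ} {S : Set ℝ} (hS : IsOpen S) {n : ℕ}
    (hf : ContDiffOn ℝ n f S) (a : ℝ) {x : ℝ} (hx : x ∈ S) :
    iteratedDeriv n (a • f) x = a * iteratedDeriv n f x := by
  rw [iteratedDeriv_const_smul (hf.contDiffAt (hS.mem_nhds hx))]
  simp

/-! ### The space `M₁` of θ-components -/

/-- `ln ((1 + x)/3) (1 - x)^{-1+2ε}` for the south pole. -/
def wt0 (p : Pole) (ε x : ℝ) : ℝ :=
  Real.log ((1 + p.sign * x) / 3) * (1 - p.sign * x) ^ (-1 + 2 * ε)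

/-- `(1 + x) (ln ((1 + x)/3))² (1 - x)^{2ε}` for the south pole. -/
def wt1 (p : Pole) (ε x : ℝ) : ℝ :=
  (1 + p.sign * x) * Real.log ((1 + p.sign * x) / 3) ^ 2 * (1 - p.sign * x) ^ (2 * ε)

lemma wt0_ne_zero (p : Pole) (ε : ℝ) {x : ℝ} (hx : x ∈ Ioo (-1 : ℝ) 1) : wt0 p ε x ≠ 0 := by
  obtain ⟨h1, h2⟩ := p.sign_mul_mem hx
  refine mul_ne_zero ?_ (Real.rpow_pos_of_pos (by linarith) _).ne'
  exact (Real.log_neg (by linarith) (by linarith)).ne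

/-- Membership in `M₁(ε)`. A function on `[-1,1]` is represented by its extension by `0`. -/
structure IsM1 (p : Pole) (ε : ℝ) (f : ℝ → ℝ) : Prop where
  outside : ∀ x, x ∉ Icc (-1 : ℝ) 1 → f x = 0
  smooth3 : ContDiffOn ℝ 3 f (Ioo (-(1 / 2)) (1 / 2))
  smooth1 : ContDiffOn ℝ 1 f (Ioo (-1) 1)
  cont : ContinuousOn f (Icc (-1) 1)
  left : f (-1) = 0
  right : f 1 = 0
  bdd0 : WBdd (Ioo (-1) 1) (wt0 p ε) f
  bdd1 : WBdd (Ioo (-1) 1) (wt1 p ε) (deriv f)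
  bdd2 : WBdd (Ioo (-(1 / 2)) (1 / 2)) (fun _ => 1) (iteratedDeriv 2 f)
  bdd3 : WBdd (Ioo (-(1 / 2)) (1 / 2)) (fun _ => 1) (iteratedDeriv 3 f)

lemma deriv_add_of {f g : ℝ → ℝ} (hf : ContDiffOn ℝ 1 f (Ioo (-1) 1))
    (hg : ContDiffOn ℝ 1 g (Ioo (-1) 1)) :
    ∀ x ∈ Ioo (-1 : ℝ) 1, deriv (f + g) x = deriv f x + deriv g x := by
  intro x hx
  have := iteratedDeriv_add_of (n := 1) isOpen_Ioo (by exact_mod_cast hf)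
    (by exact_mod_cast hg) hx
  simpa [iteratedDeriv_one] using this

lemma deriv_smul_of {f : ℝ → ℝ} (hf : ContDiffOn ℝ 1 f (Ioo (-1) 1)) (a : ℝ) :
    ∀ x ∈ Ioo (-1 : ℝ) 1, deriv (a • f) x = a * deriv f x := by
  intro x hx
  have := iteratedDeriv_smul_of (n := 1) isOpen_Ioo (by exact_mod_cast hf) a hx
  rwa [iteratedDeriv_one, iteratedDeriv_one] at this

lemma IsM1.smooth2 {p : Pole} {ε : ℝ} {f : ℝ → ℝ} (hf : IsM1 p ε f) :
    ContDiffOn ℝ 2 f (Ioo (-(1 / 2)) (1 / 2)) :=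
  hf.smooth3.of_le (by norm_num)

/-- `M₁(ε)` as a linear space of functions. -/
def M1sub (p : Pole) (ε : ℝ) : Submodule ℝ (ℝ → ℝ) where
  carrier := {f | IsM1 p ε f}
  zero_mem' :=
    { outside := fun _ _ => rfl
      smooth3 := contDiffOn_const
      smooth1 := contDiffOn_const
      cont := continuousOn_const
      left := rfl
      right := rfl
      bdd0 := wbdd_zero fun _ _ => rfl
      bdd1 := wbdd_zero fun _ _ => by simp
      bdd2 := wbdd_zero fun _ _ => by simp
      bdd3 := wbdd_zero fun _ _ => by simp }
  add_mem' := fun {f g} hf hg =>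
    { outside := fun x hx => by simp [hf.outside x hx, hg.outside x hx]
      smooth3 := hf.smooth3.add hg.smooth3
      smooth1 := hf.smooth1.add hg.smooth1
      cont := hf.cont.add hg.cont
      left := by simp [hf.left, hg.left]
      right := by simp [hf.right, hg.right]
      bdd0 := hf.bdd0.add hg.bdd0 fun _ _ => rfl
      bdd1 := hf.bdd1.add hg.bdd1 (deriv_add_of hf.smooth1 hg.smooth1)
      bdd2 := hf.bdd2.add hg.bdd2 fun _ hx =>
        iteratedDeriv_add_of isOpen_Ioo hf.smooth2 hg.smooth2 hx
      bdd3 := hf.bdd3.add hg.bdd3 fun _ hx =>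
        iteratedDeriv_add_of isOpen_Ioo hf.smooth3 hg.smooth3 hx }
  smul_mem' := fun a f hf =>
    { outside := fun x hx => by simp [hf.outside x hx]
      smooth3 := hf.smooth3.const_smul a
      smooth1 := hf.smooth1.const_smul a
      cont := hf.cont.const_smul a
      left := by simp [hf.left]
      right := by simp [hf.right]
      bdd0 := hf.bdd0.smul fun _ _ => rfl
      bdd1 := hf.bdd1.smul (deriv_smul_of hf.smooth1 a)
      bdd2 := hf.bdd2.smul fun _ hx => iteratedDeriv_smul_of isOpen_Ioo hf.smooth2 a hx
      bdd3 := hf.bdd3.smul fun _ hx => iteratedDeriv_smul_of isOpen_Ioo hf.smooth3 a hx }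

/-- The space `M₁(ε)` (a type synonym, so that its only topology is that of its norm). -/
def M1 (p : Pole) (ε : ℝ) : Type := M1sub p ε

instance (p : Pole) (ε : ℝ) : AddCommGroup (M1 p ε) := inferInstanceAs (AddCommGroup (M1sub p ε))

instance (p : Pole) (ε : ℝ) : Module ℝ (M1 p ε) := inferInstanceAs (Module ℝ (M1sub p ε))

/-- The underlying function. -/
def M1.fn {p : Pole} {ε : ℝ} (f : M1 p ε) : ℝ → ℝ := Subtype.val (p := (· ∈ M1sub p ε)) f

lemma M1.isM1 {p : Pole} {ε : ℝ} (f : M1 p ε) : IsM1 p ε f.fn :=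
  Subtype.property (p := (· ∈ M1sub p ε)) f

lemma M1.fn_add {p : Pole} {ε : ℝ} (f g : M1 p ε) : (f + g).fn = f.fn + g.fn := rfl

lemma M1.fn_smul {p : Pole} {ε : ℝ} (a : ℝ) (f : M1 p ε) : (a • f).fn = a • f.fn := rfl

lemma M1.fn_zero {p : Pole} {ε : ℝ} : (0 : M1 p ε).fn = 0 := rfl

lemma M1.fn_injective {p : Pole} {ε : ℝ} : Function.Injective (M1.fn : M1 p ε → ℝ → ℝ) :=
  Subtype.val_injective

instance (p : Pole) (ε : ℝ) : Norm (M1 p ε) where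
  norm f := wnorm (Ioo (-1) 1) (wt0 p ε) f.fn + wnorm (Ioo (-1) 1) (wt1 p ε) (deriv f.fn)
    + wnorm (Ioo (-(1 / 2)) (1 / 2)) (fun _ => 1) (iteratedDeriv 2 f.fn)
    + wnorm (Ioo (-(1 / 2)) (1 / 2)) (fun _ => 1) (iteratedDeriv 3 f.fn)

lemma M1.norm_def {p : Pole} {ε : ℝ} (f : M1 p ε) :
    ‖f‖ = wnorm (Ioo (-1) 1) (wt0 p ε) f.fn + wnorm (Ioo (-1) 1) (wt1 p ε) (deriv f.fn)
      + wnorm (Ioo (-(1 / 2)) (1 / 2)) (fun _ => 1) (iteratedDeriv 2 f.fn)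
      + wnorm (Ioo (-(1 / 2)) (1 / 2)) (fun _ => 1) (iteratedDeriv 3 f.fn) := rfl

lemma M1.core (p : Pole) (ε : ℝ) : NormedSpace.Core ℝ (M1 p ε) where
  norm_nonneg f := by
    have h := @wnorm_nonneg
    rw [M1.norm_def]
    exact add_nonneg (add_nonneg (add_nonneg (h _ _ _) (h _ _ _)) (h _ _ _)) (h _ _ _)
  norm_smul a f := by
    have hf := f.isM1
    rw [M1.norm_def, M1.norm_def, M1.fn_smul, wnorm_smul (f := f.fn) (h := a • f.fn) (a := a) fun _ _ => rfl,
      wnorm_smul (deriv_smul_of hf.smooth1 a),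
      wnorm_smul fun _ hx => iteratedDeriv_smul_of isOpen_Ioo hf.smooth2 a hx,
      wnorm_smul fun _ hx => iteratedDeriv_smul_of isOpen_Ioo hf.smooth3 a hx, Real.norm_eq_abs]
    ring
  norm_triangle f g := by
    have hf := f.isM1
    have hg := g.isM1
    have h0 := wnorm_add_le hf.bdd0 hg.bdd0 (h := f.fn + g.fn) fun _ _ => rfl
    have h1 := wnorm_add_le hf.bdd1 hg.bdd1 (deriv_add_of hf.smooth1 hg.smooth1)
    have h2 := wnorm_add_le hf.bdd2 hg.bdd2 fun _ hx =>
      iteratedDeriv_add_of isOpen_Ioo hf.smooth2 hg.smooth2 hx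
    have h3 := wnorm_add_le hf.bdd3 hg.bdd3 fun _ hx =>
      iteratedDeriv_add_of isOpen_Ioo hf.smooth3 hg.smooth3 hx
    rw [M1.norm_def, M1.norm_def, M1.norm_def, M1.fn_add]
    linarith
  norm_eq_zero_iff f := by
    have hf := f.isM1
    constructor
    · intro h
      have h0 : wnorm (Ioo (-1) 1) (wt0 p ε) f.fn = 0 := by
        have n := @wnorm_nonneg
        rw [M1.norm_def] at h
        linarith [n (Ioo (-1) 1) (wt0 p ε) f.fn, n (Ioo (-1) 1) (wt1 p ε) (deriv f.fn),
          n (Ioo (-(1 / 2)) (1 / 2)) (fun _ => 1) (iteratedDeriv 2 f.fn),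
          n (Ioo (-(1 / 2)) (1 / 2)) (fun _ => 1) (iteratedDeriv 3 f.fn)]
      apply M1.fn_injective
      funext x
      rw [M1.fn_zero]
      by_cases hx : x ∈ Ioo (-1 : ℝ) 1
      · exact eq_zero_of_wnorm hf.bdd0 h0 hx (wt0_ne_zero p ε hx)
      · by_cases hx' : x ∈ Icc (-1 : ℝ) 1
        · rcases eq_or_lt_of_le hx'.1 with e | l
          · rw [← e]; exact hf.left
          · rcases eq_or_lt_of_le hx'.2 with e | l'
            · rw [e]; exact hf.right
            · exact absurd ⟨l, l'⟩ hx
        · exact hf.outside x hx'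
    · rintro rfl
      rw [M1.norm_def, M1.fn_zero, wnorm_zero (f := 0) fun _ _ => rfl, wnorm_zero fun _ _ => by simp,
        wnorm_zero fun _ _ => by simp, wnorm_zero fun _ _ => by simp]
      simp

instance (p : Pole) (ε : ℝ) : NormedAddCommGroup (M1 p ε) :=
  NormedAddCommGroup.ofCore (M1.core p ε)

instance (p : Pole) (ε : ℝ) : NormedSpace ℝ (M1 p ε) :=
  NormedSpace.ofCore (M1.core p ε)

/-! ### The space `M₂` of φ-components -/

/-- `(1 - x²)^α`. -/
def wphi (α x : ℝ) : ℝ := (1 - x ^ 2) ^ α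

lemma wphi_ne_zero (α : ℝ) {x : ℝ} (hx : x ∈ Ioo (-1 : ℝ) 1) : wphi α x ≠ 0 :=
  (Real.rpow_pos_of_pos (by nlinarith [hx.1, hx.2]) _).ne'

/-- Membership in `M₂(ε)`. A function on `(-1,1)` is represented by its extension by `0`. -/
structure IsM2 (ε : ℝ) (f : ℝ → ℝ) : Prop where
  outside : ∀ x, x ∉ Ioo (-1 : ℝ) 1 → f x = 0
  smooth2 : ContDiffOn ℝ 2 f (Ioo (-1) 1)
  bdd0 : WBdd (Ioo (-1) 1) (wphi ε) f
  bdd1 : WBdd (Ioo (-1) 1) (wphi (1 + ε)) (deriv f)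
  bdd2 : WBdd (Ioo (-1) 1) (wphi (2 + ε)) (iteratedDeriv 2 f)

lemma IsM2.smooth1 {ε : ℝ} {f : ℝ → ℝ} (hf : IsM2 ε f) : ContDiffOn ℝ 1 f (Ioo (-1) 1) :=
  hf.smooth2.of_le (by norm_num)

/-- `M₂(ε)` as a linear space of functions. -/
def M2sub (ε : ℝ) : Submodule ℝ (ℝ → ℝ) where
  carrier := {f | IsM2 ε f}
  zero_mem' :=
    { outside := fun _ _ => rfl
      smooth2 := contDiffOn_const
      bdd0 := wbdd_zero fun _ _ => rfl
      bdd1 := wbdd_zero fun _ _ => by simp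
      bdd2 := wbdd_zero fun _ _ => by simp }
  add_mem' := fun {f g} hf hg =>
    { outside := fun x hx => by simp [hf.outside x hx, hg.outside x hx]
      smooth2 := hf.smooth2.add hg.smooth2
      bdd0 := hf.bdd0.add hg.bdd0 fun _ _ => rfl
      bdd1 := hf.bdd1.add hg.bdd1 (deriv_add_of hf.smooth1 hg.smooth1)
      bdd2 := hf.bdd2.add hg.bdd2 fun _ hx =>
        iteratedDeriv_add_of isOpen_Ioo hf.smooth2 hg.smooth2 hx }
  smul_mem' := fun a f hf =>
    { outside := fun x hx => by simp [hf.outside x hx]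
      smooth2 := hf.smooth2.const_smul a
      bdd0 := hf.bdd0.smul fun _ _ => rfl
      bdd1 := hf.bdd1.smul (deriv_smul_of hf.smooth1 a)
      bdd2 := hf.bdd2.smul fun _ hx => iteratedDeriv_smul_of isOpen_Ioo hf.smooth2 a hx }

/-- The space `M₂(ε)` (a type synonym, so that its only topology is that of its norm). -/
def M2 (ε : ℝ) : Type := M2sub ε

instance (ε : ℝ) : AddCommGroup (M2 ε) := inferInstanceAs (AddCommGroup (M2sub ε))

instance (ε : ℝ) : Module ℝ (M2 ε) := inferInstanceAs (Module ℝ (M2sub ε))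

/-- The underlying function. -/
def M2.fn {ε : ℝ} (f : M2 ε) : ℝ → ℝ := Subtype.val (p := (· ∈ M2sub ε)) f

lemma M2.isM2 {ε : ℝ} (f : M2 ε) : IsM2 ε f.fn :=
  Subtype.property (p := (· ∈ M2sub ε)) f

lemma M2.fn_add {ε : ℝ} (f g : M2 ε) : (f + g).fn = f.fn + g.fn := rfl

lemma M2.fn_smul {ε : ℝ} (a : ℝ) (f : M2 ε) : (a • f).fn = a • f.fn := rfl

lemma M2.fn_zero {ε : ℝ} : (0 : M2 ε).fn = 0 := rfl

lemma M2.fn_injective {ε : ℝ} : Function.Injective (M2.fn : M2 ε → ℝ → ℝ) :=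
  Subtype.val_injective

instance (ε : ℝ) : Norm (M2 ε) where
  norm f := wnorm (Ioo (-1) 1) (wphi ε) f.fn + wnorm (Ioo (-1) 1) (wphi (1 + ε)) (deriv f.fn)
    + wnorm (Ioo (-1) 1) (wphi (2 + ε)) (iteratedDeriv 2 f.fn)

lemma M2.norm_def {ε : ℝ} (f : M2 ε) :
    ‖f‖ = wnorm (Ioo (-1) 1) (wphi ε) f.fn + wnorm (Ioo (-1) 1) (wphi (1 + ε)) (deriv f.fn)
      + wnorm (Ioo (-1) 1) (wphi (2 + ε)) (iteratedDeriv 2 f.fn) := rfl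

lemma M2.core (ε : ℝ) : NormedSpace.Core ℝ (M2 ε) where
  norm_nonneg f := by
    have h := @wnorm_nonneg
    rw [M2.norm_def]
    exact add_nonneg (add_nonneg (h _ _ _) (h _ _ _)) (h _ _ _)
  norm_smul a f := by
    have hf := f.isM2
    rw [M2.norm_def, M2.norm_def, M2.fn_smul, wnorm_smul (f := f.fn) (h := a • f.fn) (a := a) fun _ _ => rfl,
      wnorm_smul (deriv_smul_of hf.smooth1 a),
      wnorm_smul fun _ hx => iteratedDeriv_smul_of isOpen_Ioo hf.smooth2 a hx, Real.norm_eq_abs]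
    ring
  norm_triangle f g := by
    have hf := f.isM2
    have hg := g.isM2
    have h0 := wnorm_add_le hf.bdd0 hg.bdd0 (h := f.fn + g.fn) fun _ _ => rfl
    have h1 := wnorm_add_le hf.bdd1 hg.bdd1 (deriv_add_of hf.smooth1 hg.smooth1)
    have h2 := wnorm_add_le hf.bdd2 hg.bdd2 fun _ hx =>
      iteratedDeriv_add_of isOpen_Ioo hf.smooth2 hg.smooth2 hx
    rw [M2.norm_def, M2.norm_def, M2.norm_def, M2.fn_add]
    linarith
  norm_eq_zero_iff f := by
    have hf := f.isM2
    constructor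
    · intro h
      have h0 : wnorm (Ioo (-1) 1) (wphi ε) f.fn = 0 := by
        have n := @wnorm_nonneg
        rw [M2.norm_def] at h
        linarith [n (Ioo (-1) 1) (wphi ε) f.fn, n (Ioo (-1) 1) (wphi (1 + ε)) (deriv f.fn),
          n (Ioo (-1) 1) (wphi (2 + ε)) (iteratedDeriv 2 f.fn)]
      apply M2.fn_injective
      funext x
      rw [M2.fn_zero]
      by_cases hx : x ∈ Ioo (-1 : ℝ) 1
      · exact eq_zero_of_wnorm hf.bdd0 h0 hx (wphi_ne_zero ε hx)
      · exact hf.outside x hx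
    · rintro rfl
      rw [M2.norm_def, M2.fn_zero, wnorm_zero (f := 0) fun _ _ => rfl, wnorm_zero fun _ _ => by simp,
        wnorm_zero fun _ _ => by simp]
      simp

instance (ε : ℝ) : NormedAddCommGroup (M2 ε) :=
  NormedAddCommGroup.ofCore (M2.core ε)

instance (ε : ℝ) : NormedSpace ℝ (M2 ε) :=
  NormedSpace.ofCore (M2.core ε)

/-! ### The spaces `X` and `X₁` -/

/-- `X = M₁ × M₂` with the norm `‖Ũ_θ‖ + ‖Ũ_φ‖`. -/
abbrev X (p : Pole) (ε : ℝ) : Type := WithLp 1 (M1 p ε × M2 ε)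

/-- The pair of functions `(Ũ_θ, Ũ_φ)` underlying an element of `X`. -/
def X.pair {p : Pole} {ε : ℝ} (W : X p ε) : (ℝ → ℝ) × (ℝ → ℝ) := (W.fst.fn, W.snd.fn)

/-- `X₁ = ker l₁ ∩ ker l₂ ∩ ker l₃ ∩ ker l₄`, where `l₁ V = V_θ(0)`, `l₂ V = V_θ'(0)`,
`l₃ V = V_φ'(0)`, `l₄ V = V_φ(0)`. -/
def X1 (p : Pole) (ε : ℝ) : Submodule ℝ (X p ε) where
  carrier := {W | W.pair.1 0 = 0 ∧ deriv W.pair.1 0 = 0 ∧ deriv W.pair.2 0 = 0 ∧ W.pair.2 0 = 0}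
  zero_mem' := by
    have h1 : (0 : X p ε).pair.1 = 0 := rfl
    have h2 : (0 : X p ε).pair.2 = 0 := rfl
    simp [h1, h2]
  add_mem' := fun {V W} hV hW => by
    have h0 : (0 : ℝ) ∈ Ioo (-1 : ℝ) 1 := by simp
    have h1 : (V + W).pair.1 = V.pair.1 + W.pair.1 := rfl
    have h2 : (V + W).pair.2 = V.pair.2 + W.pair.2 := rfl
    have d1 := deriv_add_of V.fst.isM1.smooth1 W.fst.isM1.smooth1 0 h0
    have d2 := deriv_add_of V.snd.isM2.smooth1 W.snd.isM2.smooth1 0 h0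
    obtain ⟨a1, a2, a3, a4⟩ := hV
    obtain ⟨b1, b2, b3, b4⟩ := hW
    simp only [mem_ofPred_eq, h1, h2, Pi.add_apply, a1, a4, b1, b4, add_zero, true_and, and_true]
    constructor
    · exact d1.trans (by rw [show deriv V.fst.fn 0 = 0 from a2, show deriv W.fst.fn 0 = 0 from b2,
        add_zero])
    · exact d2.trans (by rw [show deriv V.snd.fn 0 = 0 from a3, show deriv W.snd.fn 0 = 0 from b3,
        add_zero])
  smul_mem' := fun a V hV => by
    have h0 : (0 : ℝ) ∈ Ioo (-1 : ℝ) 1 := by simp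
    have h1 : (a • V).pair.1 = a • V.pair.1 := rfl
    have h2 : (a • V).pair.2 = a • V.pair.2 := rfl
    have d1 := deriv_smul_of V.fst.isM1.smooth1 a 0 h0
    have d2 := deriv_smul_of V.snd.isM2.smooth1 a 0 h0
    obtain ⟨a1, a2, a3, a4⟩ := hV
    simp only [mem_ofPred_eq, h1, h2, Pi.smul_apply, a1, a4, smul_zero, true_and, and_true]
    constructor
    · exact d1.trans (by rw [show deriv V.fst.fn 0 = 0 from a2, mul_zero])
    · exact d2.trans (by rw [show deriv V.snd.fn 0 = 0 from a3, mul_zero])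

/-- `Ũ = ∑ᵢ βᵢ V^i_{c,γ} + W`. -/
def perturbation {p : Pole} {ε : ℝ} (c : Fin 3 → ℝ) (γ : ℝ) (β : EuclideanSpace ℝ (Fin 4))
    (W : X p ε) : (ℝ → ℝ) × (ℝ → ℝ) :=
  ∑ i, β i • basisV c γ i + W.pair

/-- `U = U^{c,γ} + ∑ᵢ βᵢ V^i_{c,γ} + W`. -/
def total {p : Pole} {ε : ℝ} (c : Fin 3 → ℝ) (γ : ℝ) (β : EuclideanSpace ℝ (Fin 4))
    (W : X p ε) : (ℝ → ℝ) × (ℝ → ℝ) :=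
  (Ubar c γ, 0) + perturbation c γ β W

/-- The constants `ĉ` attached to a perturbation `Ũ` of `U^{c,γ}`. -/
def cHat (c : Fin 3 → ℝ) (γ : ℝ) (U : (ℝ → ℝ) × (ℝ → ℝ)) : Fin 3 → ℝ :=
  ![c 0 + psi U.2 U.2 (-1) / 2,
    c 1 + psi U.2 U.2 1 / 2,
    c 2 - iteratedDeriv 2 (phi c γ U.1) 0 / 2]

end SwirlNSE

end

open SwirlNSE

noncomputable section

namespace SwirlNSE

open scoped BoundedContinuousFunction

/-! ### Functional analytic preliminaries -/

/-! Write U = U^{c,γ} + W with W = (f, g) and α = 2x + U^{c,γ}. Then f satisfies (1-x²)f' + αf +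
f²/2 + ψ[g] = P_ĉ - P_c, and g satisfies (1-x²)g'' + (U^{c,γ}+f)g' = 0. The constants ĉ are not
unknowns: letting x → ±1 and putting x = 0 determines them, so they can be eliminated by subtracting
from ψ the quadratic polynomial that matches its values at -1, 0, 1 (`corr`, `IsCorrSol`,
`isCorrSol_of_isSol`). What is left is a quadratic equation for W whose linear part is invertible
once four numbers β at x = 0 are prescribed. The inverse function theorem then gives a unique small
solution S(c,γ,β).

Invertibility in the weighted spaces depends on α at the two poles. The substitution U = 2(w/v - x)
turns the Riccati equation into a linear system (`IsLinSol`). A solution strictly between two global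
ones comes from a positive combination of their linear solutions, so at each pole it has the
dominant behaviour: α ln(3/(1+x)) → -4 at x = -1, and α → 2√(1 + c 1) at x = 1 (`Ubar_asymptotics`).
With these limits the weights of M₁ and M₂ are barriers for the linear equations (`barrier_bound`,
`IsBase.theta_bound`, `IsBase.phi_bound`). For M₁ this is exactly where ε > -U^{c,γ}(1)/4 is used.

Smooth dependence on (c,γ) is obtained by linearizing at one fixed base parameter. The deviation of
U^{c,γ} from the base solution solves a quadratic equation of its own, in a space whose weight
imposes no decay at x = 1. The deviation and W form a triangular quadratic system, solved in one
stroke by `exists_triangular_solution`. The fixed point runs in Banach spaces of weighted continuous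
functions (`Z`, and bounded continuous functions); the solution operators map back into X, so
completeness of X is not needed. The outcome is `IsBase.exists_local`.

The local families agree where they overlap, by local uniqueness, and are glued over the compact set
K after retracting the parameters onto the slice where one coordinate of c equals -1
(`exists_glued_family`). The derivative of S in β at 0 solves the homogeneous linearized equations,
whose solutions are the combinations of V¹,…,V⁴ (`eqOn_sum_basisV`). Subtracting this linear part
from S leaves V, with values in X₁ on K (`exists_map_of_family`). The north pole follows from the
south pole by x ↦ -x, which swaps c₁ with c₂ and changes the sign of γ and of U_θ. -/

/-- A continuous linear map from a linear relation which is total, single valued and bounded. -/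
lemma exists_clm_of_rel {A T : Type*} [NormedAddCommGroup A] [NormedSpace ℝ A]
    [NormedAddCommGroup T] [NormedSpace ℝ T] (R : A → T → Prop)
    (hadd : ∀ a b s t, R a s → R b t → R (a + b) (s + t))
    (hsmul : ∀ (r : ℝ) a t, R a t → R (r • a) (r • t))
    (huniq : ∀ t, R 0 t → t = 0) (C : ℝ) (hex : ∀ a, ∃ t, R a t ∧ ‖t‖ ≤ C * ‖a‖) :
    ∃ L : A →L[ℝ] T, ∀ a, R a (L a) := by
  choose f hf hb using hex
  -- Single-valuedness at 0 spreads by linearity to every argument, so the function picked by choice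
  -- is automatically linear.
  have key : ∀ a t, R a t → t = f a := by
    intro a t h
    have h1 := hadd _ _ _ _ h (hsmul (-1) _ _ (hf a))
    have h2 := huniq _ (by simpa using h1)
    simpa [sub_eq_zero, ← sub_eq_add_neg] using h2
  let L : A →ₗ[ℝ] T :=
    { toFun := f
      map_add' := fun a b => (key _ _ (hadd _ _ _ _ (hf a) (hf b))).symm
      map_smul' := fun r a => (key _ _ (hsmul r _ _ (hf a))).symm }
  exact ⟨L.mkContinuous C hb, fun a => hf a⟩

/-- A continuous bilinear map from an operation on functions. -/
lemma exists_bilin {A B T : Type*} [NormedAddCommGroup A] [NormedSpace ℝ A]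
    [NormedAddCommGroup B] [NormedSpace ℝ B] [NormedAddCommGroup T] [NormedSpace ℝ T]
    (D : Set ℝ) (ev : T →ₗ[ℝ] (ℝ → ℝ)) (hinj : ∀ t, (∀ x ∈ D, ev t x = 0) → t = 0)
    (op : A → B → ℝ → ℝ)
    (hadd₁ : ∀ a a' b, ∀ x ∈ D, op (a + a') b x = op a b x + op a' b x)
    (hsmul₁ : ∀ (r : ℝ) a b, ∀ x ∈ D, op (r • a) b x = r * op a b x)
    (hadd₂ : ∀ a b b', ∀ x ∈ D, op a (b + b') x = op a b x + op a b' x)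
    (hsmul₂ : ∀ (r : ℝ) a b, ∀ x ∈ D, op a (r • b) x = r * op a b x)
    (C : ℝ) (hex : ∀ a b, ∃ t, (∀ x ∈ D, ev t x = op a b x) ∧ ‖t‖ ≤ C * ‖a‖ * ‖b‖) :
    ∃ L : A →L[ℝ] B →L[ℝ] T, ∀ a b, ∀ x ∈ D, ev (L a b) x = op a b x := by
  choose f hf hb using hex
  have inj : ∀ s t, (∀ x ∈ D, ev s x = ev t x) → s = t := fun s t h =>
    sub_eq_zero.1 (hinj _ fun x hx => by simp [h x hx])
  let L : A →ₗ[ℝ] B →ₗ[ℝ] T := LinearMap.mk₂ ℝ f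
    (fun a a' b => inj _ _ fun x hx => by simp [hf _ _ x hx, hadd₁ _ _ _ x hx])
    (fun r a b => inj _ _ fun x hx => by simp [hf _ _ x hx, hsmul₁ _ _ _ x hx])
    (fun a b b' => inj _ _ fun x hx => by simp [hf _ _ x hx, hadd₂ _ _ _ x hx])
    (fun r a b => inj _ _ fun x hx => by simp [hf _ _ x hx, hsmul₂ _ _ _ x hx])
  exact ⟨L.mkContinuous₂ C hb, fun a b => hf a b⟩

/-- The quadratic equation `z - B(z,z) = y` has a unique small solution depending smoothly on `y`. -/
lemma exists_quadratic_inverse {E : Type*} [NormedAddCommGroup E] [NormedSpace ℝ E]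
    [CompleteSpace E] (B : E →L[ℝ] E →L[ℝ] E) :
    ∃ r > 0, ∃ r' > 0, ∃ Φ : E → E, ContDiffOn ℝ ∞ Φ (Metric.ball 0 r') ∧ Φ 0 = 0 ∧
      (∀ y ∈ Metric.ball (0 : E) r', Φ y ∈ Metric.ball (0 : E) r ∧ Φ y - B (Φ y) (Φ y) = y) ∧
      ∀ y ∈ Metric.ball (0 : E) r', ∀ z ∈ Metric.ball (0 : E) r, z - B z z = y → z = Φ y := by
  set F : E → E := fun z => z - B z z with hF
  -- The exponent is ω and not ∞: `ContDiffAt` at a point passes to a whole neighbourhood for ω, but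
  -- not for ∞.
  have hsm : ContDiff ℝ ω F := contDiff_id.sub (B.isBoundedBilinearMap.contDiff.comp
    (contDiff_id.prodMk contDiff_id))
  have h0 : F 0 = 0 := by simp [hF]
  -- The quadratic term has zero derivative at 0, so the linear part is the identity and is
  -- invertible whatever `B` is.
  have hd : HasFDerivAt F ((ContinuousLinearEquiv.refl ℝ E : E ≃L[ℝ] E) : E →L[ℝ] E) 0 := by
    have h1 := HasFDerivAt.comp (f := fun z : E => (z, z)) (0 : E)
      (B.isBoundedBilinearMap.hasFDerivAt ((0 : E), (0 : E)))
      ((hasFDerivAt_id (0 : E)).prodMk (hasFDerivAt_id (0 : E)))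
    have h2 := (hasFDerivAt_id (0 : E)).sub h1
    refine h2.congr_fderiv ?_
    ext v
    simp [IsBoundedBilinearMap.deriv]
  have hc : ContDiffAt ℝ ω F 0 := hsm.contDiffAt
  have hn : (ω : WithTop ℕ∞) ≠ 0 := by simp
  set e := hc.toOpenPartialHomeomorph F hd hn with he
  have hsrc : (0 : E) ∈ e.source := hc.mem_toOpenPartialHomeomorph_source hd hn
  have htgt : (0 : E) ∈ e.target := by
    have := hc.image_mem_toOpenPartialHomeomorph_target hd hn
    rwa [h0] at this
  have ef : ∀ z, e z = F z := fun z => rfl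
  have es0 : e.symm 0 = 0 := by
    have := e.left_inv hsrc
    rwa [ef, h0] at this
  have hs : ContDiffAt ℝ ω e.symm 0 := by
    have := hc.to_localInverse hd hn
    rwa [h0] at this
  obtain ⟨r, hr, hrs⟩ := Metric.isOpen_iff.1 e.open_source 0 hsrc
  have hev : ∀ᶠ y in 𝓝 (0 : E), ContDiffAt ℝ ω e.symm y := hs.eventually (by simp)
  have hmem : ∀ᶠ y in 𝓝 (0 : E), e.symm y ∈ Metric.ball (0 : E) r := by
    refine hs.continuousAt.eventually_mem ?_
    rw [es0]
    exact Metric.ball_mem_nhds _ hr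
  obtain ⟨r', hr', hall⟩ := Metric.eventually_nhds_iff_ball.1
    ((hev.and hmem).and (e.open_target.eventually_mem htgt))
  refine ⟨r, hr, r', hr', e.symm, fun y hy => ?_, es0, fun y hy => ⟨(hall y hy).1.2, ?_⟩, ?_⟩
  · exact ((hall y hy).1.1.of_le le_top).contDiffWithinAt
  · exact e.right_inv (hall y hy).2
  · intro y hy z hz hzy
    rw [← e.left_inv (hrs hz), ef]
    exact congrArg _ hzy

/-! ### First order linear equations on `(-1,1)` -/

lemma one_sub_sq_pos {x : ℝ} (hx : x ∈ Ioo (-1 : ℝ) 1) : 0 < 1 - x ^ 2 := by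
  nlinarith [hx.1, hx.2]

lemma zero_mem_Ioo : (0 : ℝ) ∈ Ioo (-1 : ℝ) 1 := by simp

lemma uIcc_subset_Ioo {x y : ℝ} (hx : x ∈ Ioo (-1 : ℝ) 1) (hy : y ∈ Ioo (-1 : ℝ) 1) :
    uIcc x y ⊆ Ioo (-1 : ℝ) 1 := (convex_Ioo _ _).ordConnected.uIcc_subset hx hy

lemma intervalIntegrable_of_Ioo {f : ℝ → ℝ} (hf : ContinuousOn f (Ioo (-1) 1)) {x y : ℝ}
    (hx : x ∈ Ioo (-1 : ℝ) 1) (hy : y ∈ Ioo (-1 : ℝ) 1) : IntervalIntegrable f volume x y :=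
  (hf.mono (uIcc_subset_Ioo hx hy)).intervalIntegrable

lemma hasDerivAt_integral_Ioo {f : ℝ → ℝ} (hf : ContinuousOn f (Ioo (-1) 1)) {x : ℝ}
    (hx : x ∈ Ioo (-1 : ℝ) 1) : HasDerivAt (fun y => ∫ s in (0 : ℝ)..y, f s) (f x) x :=
  intervalIntegral.integral_hasDerivAt_right (intervalIntegrable_of_Ioo hf zero_mem_Ioo hx)
    (hf.stronglyMeasurableAtFilter isOpen_Ioo x hx) (hf.continuousAt (isOpen_Ioo.mem_nhds hx))

lemma continuousOn_div_one_sub_sq {f : ℝ → ℝ} (hf : ContinuousOn f (Ioo (-1) 1)) :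
    ContinuousOn (fun x => f x / (1 - x ^ 2)) (Ioo (-1) 1) :=
  hf.div (by fun_prop) fun _ hx => (one_sub_sq_pos hx).ne'

lemma abs_integral_le_abs_integral_Ioo {h g : ℝ → ℝ} (hg : ContinuousOn g (Ioo (-1) 1))
    (hb : ∀ s ∈ Ioo (-1 : ℝ) 1, |h s| ≤ g s) {x : ℝ} (hx : x ∈ Ioo (-1 : ℝ) 1) :
    |∫ s in (0 : ℝ)..x, h s| ≤ |∫ s in (0 : ℝ)..x, g s| :=
  intervalIntegral.norm_integral_le_abs_of_norm_le (f := h) (g := g) (μ := volume)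
    ((ae_restrict_iff' measurableSet_uIoc).2 (Eventually.of_forall fun s hs =>
      hb s (uIcc_subset_Ioo zero_mem_Ioo hx (uIoc_subset_uIcc hs))))
    (intervalIntegrable_of_Ioo hg zero_mem_Ioo hx)

/-- The integrating factor `exp ∫₀ˣ α/(1-s²) ds`. -/
def intFactor (α : ℝ → ℝ) (x : ℝ) : ℝ := Real.exp (∫ s in (0 : ℝ)..x, α s / (1 - s ^ 2))

lemma intFactor_pos (α : ℝ → ℝ) (x : ℝ) : 0 < intFactor α x := Real.exp_pos _

lemma intFactor_zero (α : ℝ → ℝ) : intFactor α 0 = 1 := by simp [intFactor]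

lemma hasDerivAt_intFactor {α : ℝ → ℝ} (hα : ContinuousOn α (Ioo (-1) 1)) {x : ℝ}
    (hx : x ∈ Ioo (-1 : ℝ) 1) :
    HasDerivAt (intFactor α) (intFactor α x * (α x / (1 - x ^ 2))) x :=
  (hasDerivAt_integral_Ioo (continuousOn_div_one_sub_sq hα) hx).exp

lemma continuousOn_intFactor {α : ℝ → ℝ} (hα : ContinuousOn α (Ioo (-1) 1)) :
    ContinuousOn (intFactor α) (Ioo (-1) 1) := fun _ hx =>
  (hasDerivAt_intFactor hα hx).continuousAt.continuousWithinAt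

/-- A differentiable function on `(-1,1)` with vanishing derivative is constant. -/
lemma eq_of_deriv_zero {f : ℝ → ℝ} (hf : ∀ x ∈ Ioo (-1 : ℝ) 1, HasDerivAt f 0 x) :
    ∀ x ∈ Ioo (-1 : ℝ) 1, f x = f 0 := fun x hx =>
  (convex_Ioo (-1 : ℝ) 1).is_const_of_fderivWithin_eq_zero (𝕜 := ℝ)
    (fun y hy => (hf y hy).differentiableAt.differentiableWithinAt)
    (fun y hy => by
      rw [fderivWithin_of_isOpen isOpen_Ioo hy]
      ext
      simpa using (hf y hy).deriv) hx zero_mem_Ioo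

/-- The solution formula for `(1 - x²) f' + α f = h`. -/
lemma linear_ode_formula {α h f : ℝ → ℝ} (hα : ContinuousOn α (Ioo (-1) 1))
    (hh : ContinuousOn h (Ioo (-1) 1))
    (hf : ∀ x ∈ Ioo (-1 : ℝ) 1, HasDerivAt f ((h x - α x * f x) / (1 - x ^ 2)) x) :
    ∀ x ∈ Ioo (-1 : ℝ) 1,
      intFactor α x * f x = f 0 + ∫ s in (0 : ℝ)..x, intFactor α s * h s / (1 - s ^ 2) := by
  intro x hx
  have hc := continuousOn_div_one_sub_sq ((continuousOn_intFactor hα).mul hh)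
  have := eq_of_deriv_zero (f := fun x => intFactor α x * f x
    - ∫ s in (0 : ℝ)..x, intFactor α s * h s / (1 - s ^ 2)) (fun y hy => by
      have h1 := ((hasDerivAt_intFactor hα hy).mul (hf y hy)).sub (hasDerivAt_integral_Ioo hc hy)
      refine h1.congr_deriv ?_
      have := (one_sub_sq_pos hy).ne'
      simp only [Pi.mul_apply]
      field_simp
      ring) x hx
  simp only [intFactor_zero, intervalIntegral.integral_same] at this
  linarith

/-- Uniqueness for `(1 - x²) f' + α f = 0`, `f(0) = 0`. -/
lemma linear_ode_unique {α f : ℝ → ℝ} (hα : ContinuousOn α (Ioo (-1) 1))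
    (hf : ∀ x ∈ Ioo (-1 : ℝ) 1, HasDerivAt f ((-α x * f x) / (1 - x ^ 2)) x) (h0 : f 0 = 0) :
    ∀ x ∈ Ioo (-1 : ℝ) 1, f x = 0 := by
  intro x hx
  have := linear_ode_formula (h := fun _ => 0) hα continuousOn_const
    (fun y hy => by simpa using hf y hy) x hx
  simp only [h0, mul_zero, zero_div, intervalIntegral.integral_zero, add_zero] at this
  exact (mul_eq_zero.1 this).resolve_left (intFactor_pos α x).ne'

lemma linear_ode_exists {α h : ℝ → ℝ} (hα : ContinuousOn α (Ioo (-1) 1))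
    (hh : ContinuousOn h (Ioo (-1) 1)) (v : ℝ) :
    ∃ f : ℝ → ℝ, f 0 = v ∧
      ∀ x ∈ Ioo (-1 : ℝ) 1, HasDerivAt f ((h x - α x * f x) / (1 - x ^ 2)) x := by
  have hc := continuousOn_div_one_sub_sq ((continuousOn_intFactor hα).mul hh)
  refine ⟨fun x => (v + ∫ s in (0 : ℝ)..x, intFactor α s * h s / (1 - s ^ 2)) / intFactor α x,
    by simp [intFactor_zero], fun x hx => ?_⟩
  have h1 := ((hasDerivAt_integral_Ioo hc hx).const_add v).div (hasDerivAt_intFactor hα hx)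
    (intFactor_pos α x).ne'
  refine h1.congr_deriv ?_
  have := (one_sub_sq_pos hx).ne'
  have := (intFactor_pos α x).ne'
  simp only [Pi.mul_apply]
  field_simp


/-! ### A priori bounds from barriers -/

/-- Up to `x₀` compactness gives a constant. Beyond `x₀`, monotonicity of `C * A - Φ` says that `Φ`
grows no faster than `C * A`, and that `A` never drops below its value at `x₀`. In the application
`A` is the integrating factor times a supersolution and `Φ` the integrated source; the summand 1
pays for the initial value. -/
lemma barrier_half {A Φ : ℝ → ℝ} {x₀ C : ℝ} (hA : ContinuousOn A (Ico 0 1))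
    (hΦ : ContinuousOn Φ (Ico 0 1)) (hpos : ∀ x ∈ Ico (0 : ℝ) 1, 0 < A x)
    (hmono : MonotoneOn Φ (Ico 0 1)) (hΦ0 : Φ 0 = 0) (hx₀ : x₀ ∈ Ico (0 : ℝ) 1) (hC : 0 < C)
    (hAΦ : MonotoneOn (fun x => C * A x - Φ x) (Ico x₀ 1)) :
    ∃ C', ∀ x ∈ Ico (0 : ℝ) 1, 1 + Φ x ≤ C' * A x := by
  have hsub : Icc 0 x₀ ⊆ Ico (0 : ℝ) 1 := fun y hy => ⟨hy.1, hy.2.trans_lt hx₀.2⟩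
  obtain ⟨C₁, hC₁⟩ := (isCompact_Icc (a := (0 : ℝ)) (b := x₀)).bddAbove_image
    (f := fun x => (1 + Φ x) / A x) ((continuousOn_const.add (hΦ.mono hsub)).div (hA.mono hsub)
      fun y hy => (hpos y (hsub hy)).ne')
  refine ⟨max C₁ (C + (1 + Φ x₀) / A x₀), fun x hx => ?_⟩
  have hAx := hpos x hx
  rcases le_total x x₀ with h | h
  · have h1 : (1 + Φ x) / A x ≤ C₁ := hC₁ ⟨x, ⟨hx.1, h⟩, rfl⟩
    rw [div_le_iff₀ hAx] at h1
    exact h1.trans (mul_le_mul_of_nonneg_right (le_max_left _ _) hAx.le)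
  · have hA0 := hpos x₀ hx₀
    have h1 : C * A x₀ - Φ x₀ ≤ C * A x - Φ x := hAΦ ⟨le_rfl, hx₀.2⟩ ⟨h, hx.2⟩ h
    have h2 := hmono hx₀ hx h
    have h2' : 0 ≤ Φ x₀ := hΦ0 ▸ hmono ⟨le_rfl, zero_lt_one⟩ hx₀ hx₀.1
    have h3 : A x₀ ≤ A x := by
      have : C * A x₀ ≤ C * A x := by linarith
      exact le_of_mul_le_mul_left this hC
    have h4 : 1 + Φ x₀ ≤ (1 + Φ x₀) / A x₀ * A x := by
      rw [div_mul_eq_mul_div, le_div_iff₀ hA0]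
      exact mul_le_mul_of_nonneg_left h3 (by linarith)
    have h5 : 0 < C * A x₀ := by positivity
    calc 1 + Φ x ≤ (C + (1 + Φ x₀) / A x₀) * A x := by linarith
      _ ≤ _ := mul_le_mul_of_nonneg_right (le_max_right _ _) hAx.le

/-- Weighted a priori bound for `(1 - x²) f' + α f = h` from a supersolution `G` near both ends. -/
lemma barrier_bound {α G G' H : ℝ → ℝ} (hα : ContinuousOn α (Ioo (-1) 1))
    (hG : ∀ x ∈ Ioo (-1 : ℝ) 1, HasDerivAt G (G' x) x) (hGpos : ∀ x ∈ Ioo (-1 : ℝ) 1, 0 < G x)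
    (hH : ContinuousOn H (Ioo (-1) 1)) (hHpos : ∀ x ∈ Ioo (-1 : ℝ) 1, 0 ≤ H x) {C : ℝ} (hC : 0 < C)
    (hr : ∀ᶠ x in 𝓝[<] (1 : ℝ), H x ≤ C * ((1 - x ^ 2) * G' x + α x * G x))
    (hl : ∀ᶠ x in 𝓝[>] (-1 : ℝ), H x ≤ -C * ((1 - x ^ 2) * G' x + α x * G x)) :
    ∃ C' ≥ 0, ∀ (f h : ℝ → ℝ) (N : ℝ), ContinuousOn h (Ioo (-1) 1) →
      (∀ x ∈ Ioo (-1 : ℝ) 1, HasDerivAt f ((h x - α x * f x) / (1 - x ^ 2)) x) →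
      (∀ x ∈ Ioo (-1 : ℝ) 1, |h x| ≤ N * H x) → 0 ≤ N →
      ∀ x ∈ Ioo (-1 : ℝ) 1, |f x| ≤ C' * (|f 0| + N) * G x := by
  set E := intFactor α with hE
  have hEH : ContinuousOn (fun s => E s * H s / (1 - s ^ 2)) (Ioo (-1) 1) :=
    continuousOn_div_one_sub_sq ((continuousOn_intFactor hα).mul hH)
  have hEH0 : ∀ s ∈ Ioo (-1 : ℝ) 1, 0 ≤ E s * H s / (1 - s ^ 2) := fun s hs =>
    div_nonneg (mul_nonneg (intFactor_pos _ _).le (hHpos s hs)) (one_sub_sq_pos hs).le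
  set Φ : ℝ → ℝ := fun x => ∫ s in (0 : ℝ)..x, E s * H s / (1 - s ^ 2) with hΦdef
  have hΦd : ∀ x ∈ Ioo (-1 : ℝ) 1, HasDerivAt Φ (E x * H x / (1 - x ^ 2)) x := fun x hx =>
    hasDerivAt_integral_Ioo hEH hx
  have hΦmono : MonotoneOn Φ (Ioo (-1) 1) := by
    refine monotoneOn_of_deriv_nonneg (convex_Ioo _ _)
      (fun x hx => (hΦd x hx).continuousAt.continuousWithinAt)
      (fun x hx => ?_) (fun x hx => ?_) <;> rw [interior_Ioo] at hx
    · exact (hΦd x hx).differentiableAt.differentiableWithinAt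
    · rw [(hΦd x hx).deriv]; exact hEH0 x hx
  have hΦ0 : Φ 0 = 0 := intervalIntegral.integral_same
  -- The solution formula bounds `E * |f|` by `|f 0| + N * |Φ|`, so the whole claim reduces to `1 +
  -- |Φ| ≤ C' * A`, checked separately on the two halves.
  set A : ℝ → ℝ := fun x => E x * G x with hAdef
  have hAd : ∀ x ∈ Ioo (-1 : ℝ) 1,
      HasDerivAt A (E x * (α x / (1 - x ^ 2)) * G x + E x * G' x) x := fun x hx =>
    (hasDerivAt_intFactor hα hx).mul (hG x hx)
  have hApos : ∀ x ∈ Ioo (-1 : ℝ) 1, 0 < A x := fun x hx => mul_pos (intFactor_pos _ _) (hGpos x hx)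
  have hsub : Ico (0 : ℝ) 1 ⊆ Ioo (-1) 1 := fun x hx => ⟨by linarith [hx.1], hx.2⟩
  have hneg : ∀ x ∈ Ioo (-1 : ℝ) 1, -x ∈ Ioo (-1 : ℝ) 1 := fun x hx =>
    ⟨by linarith [hx.2], by linarith [hx.1]⟩
  have hpick : ∀ p : ℝ → Prop, (∀ᶠ x in 𝓝[<] (1 : ℝ), p x) →
      ∃ x₀ ∈ Ico (0 : ℝ) 1, ∀ x ∈ Ioo x₀ 1, p x := by
    intro p hp
    obtain ⟨a, ha, hap⟩ := (mem_nhdsLT_iff_exists_Ioo_subset (a := (1 : ℝ))).1 hp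
    exact ⟨max a 0, ⟨le_max_right _ _, max_lt ha zero_lt_one⟩,
      fun x hx => hap ⟨(le_max_left _ _).trans_lt hx.1, hx.2⟩⟩
  obtain ⟨x₁, hx₁, hr₁⟩ := hpick _ hr
  have hl' : ∀ᶠ x in 𝓝[<] (1 : ℝ),
      H (-x) ≤ -C * ((1 - (-x) ^ 2) * G' (-x) + α (-x) * G (-x)) := by
    have : Tendsto (fun x : ℝ => -x) (𝓝[<] 1) (𝓝[>] (-1)) := tendsto_neg_nhdsLT
    exact this.eventually hl
  obtain ⟨x₂, hx₂, hl₂⟩ := hpick _ hl'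
  obtain ⟨C₁, hC₁⟩ := barrier_half (A := A) (Φ := Φ) (x₀ := x₁) (C := C)
    (fun x hx => (hAd x (hsub hx)).continuousAt.continuousWithinAt)
    (fun x hx => (hΦd x (hsub hx)).continuousAt.continuousWithinAt)
    (fun x hx => hApos x (hsub hx)) (hΦmono.mono hsub) hΦ0 hx₁ hC (by
      have hs : Ico x₁ 1 ⊆ Ioo (-1 : ℝ) 1 := fun x hx => hsub ⟨hx₁.1.trans hx.1, hx.2⟩
      have hd : ∀ x ∈ Ico x₁ 1, HasDerivAt (fun x => C * A x - Φ x) _ x := fun x hx =>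
        ((hAd x (hs hx)).const_mul C).sub (hΦd x (hs hx))
      refine monotoneOn_of_deriv_nonneg (convex_Ico _ _)
        (fun x hx => (hd x hx).continuousAt.continuousWithinAt)
        (fun x hx => (hd x (interior_subset hx)).differentiableAt.differentiableWithinAt)
        fun x hx => ?_
      rw [(hd x (interior_subset hx)).deriv]
      rw [interior_Ico] at hx
      have hx' := hs (Ioo_subset_Ico_self hx)
      have h1 := one_sub_sq_pos hx'
      have h2 := hr₁ x hx
      -- The derivative of `C * A - Φ` is a positive factor times the supersolution inequality at
      -- the right end.
      have : C * (E x * (α x / (1 - x ^ 2)) * G x + E x * G' x) - E x * H x / (1 - x ^ 2)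
          = E x / (1 - x ^ 2) * (C * ((1 - x ^ 2) * G' x + α x * G x) - H x) := by
        field_simp
        ring
      rw [this]
      exact mul_nonneg (div_nonneg (intFactor_pos _ _).le h1.le) (by linarith))
  -- The left end is reflected onto [0,1). Integration there runs towards -1, which reverses the
  -- sign of the differential expression and explains `-C` in `hl`.
  obtain ⟨C₂, hC₂⟩ := barrier_half (A := fun x => A (-x)) (Φ := fun x => -Φ (-x)) (x₀ := x₂) (C := C)
    (fun x hx => ((hAd _ (hneg _ (hsub hx))).continuousAt.comp
      continuous_neg.continuousAt).continuousWithinAt)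
    (fun x hx => ((hΦd _ (hneg _ (hsub hx))).continuousAt.comp
      continuous_neg.continuousAt).neg.continuousWithinAt)
    (fun x hx => hApos _ (hneg _ (hsub hx)))
    (fun x hx y hy hxy => neg_le_neg (hΦmono (hneg _ (hsub hy)) (hneg _ (hsub hx))
      (neg_le_neg hxy))) (by simp [hΦ0]) hx₂ hC (by
      have hs : ∀ x ∈ Ico x₂ 1, -x ∈ Ioo (-1 : ℝ) 1 := fun x hx =>
        hneg _ (hsub ⟨hx₂.1.trans hx.1, hx.2⟩)
      have hd : ∀ x ∈ Ico x₂ 1, HasDerivAt (fun x => C * A (-x) - -Φ (-x)) _ x := fun x hx =>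
        (((hAd _ (hs x hx)).comp x (hasDerivAt_neg x)).const_mul C).sub
          ((hΦd _ (hs x hx)).comp x (hasDerivAt_neg x)).neg
      refine monotoneOn_of_deriv_nonneg (convex_Ico _ _)
        (fun x hx => (hd x hx).continuousAt.continuousWithinAt)
        (fun x hx => (hd x (interior_subset hx)).differentiableAt.differentiableWithinAt)
        fun x hx => ?_
      rw [(hd x (interior_subset hx)).deriv]
      rw [interior_Ico] at hx
      have hx' := hs x (Ioo_subset_Ico_self hx)
      have h1 := one_sub_sq_pos hx'
      have h2 := hl₂ x hx
      have : C * ((E (-x) * (α (-x) / (1 - (-x) ^ 2)) * G (-x) + E (-x) * G' (-x)) * -1)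
          - -(E (-x) * H (-x) / (1 - (-x) ^ 2) * -1)
          = E (-x) / (1 - (-x) ^ 2)
            * (-C * ((1 - (-x) ^ 2) * G' (-x) + α (-x) * G (-x)) - H (-x)) := by
        have h3 := h1.ne'
        generalize 1 - (-x) ^ 2 = d at h3 ⊢
        field_simp
        ring
      rw [this]
      exact mul_nonneg (div_nonneg (intFactor_pos _ _).le h1.le) (by linarith))
  refine ⟨max (max C₁ C₂) 0, le_max_right _ _, fun f h N hh hf hN hN0 x hx => ?_⟩
  have hEx := intFactor_pos α x
  have hbd : 1 + |Φ x| ≤ max (max C₁ C₂) 0 * A x := by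
    rcases le_total 0 x with h0 | h0
    · have h1 : 0 ≤ Φ x := hΦ0 ▸ hΦmono zero_mem_Ioo hx h0
      rw [abs_of_nonneg h1]
      exact (hC₁ x ⟨h0, hx.2⟩).trans (mul_le_mul_of_nonneg_right
        ((le_max_left _ _).trans (le_max_left _ _)) (hApos x hx).le)
    · have h1 : Φ x ≤ 0 := hΦ0 ▸ hΦmono hx zero_mem_Ioo h0
      rw [abs_of_nonpos h1]
      have := hC₂ (-x) ⟨by linarith, by linarith [hx.1]⟩
      simp only [neg_neg] at this
      exact this.trans (mul_le_mul_of_nonneg_right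
        ((le_max_right _ _).trans (le_max_left _ _)) (hApos x hx).le)
  have hint : |∫ s in (0 : ℝ)..x, E s * h s / (1 - s ^ 2)| ≤ N * |Φ x| := by
    have h1 := abs_integral_le_abs_integral_Ioo (h := fun s => E s * h s / (1 - s ^ 2))
      (g := fun s => N * (E s * H s / (1 - s ^ 2))) (continuousOn_const.mul hEH)
      (fun s hs => by
        have hs1 := one_sub_sq_pos hs
        have hs2 : 0 < E s := intFactor_pos α s
        rw [abs_div, abs_mul, abs_of_pos hs1, abs_of_pos hs2]
        rw [← mul_div_assoc]
        refine div_le_div_of_nonneg_right ?_ hs1.le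
        calc E s * |h s| ≤ E s * (N * H s) := mul_le_mul_of_nonneg_left (hN s hs) hs2.le
          _ = _ := by ring) hx
    rwa [intervalIntegral.integral_const_mul, abs_mul, abs_of_nonneg hN0] at h1
  have hform := linear_ode_formula hα hh hf x hx
  have h1 : E x * |f x| ≤ |f 0| + N * |Φ x| := by
    have h0 : E x * |f x| = |E x * f x| := by rw [abs_mul, abs_of_pos (show 0 < E x from hEx)]
    rw [h0, show E x * f x = _ from hform]
    exact (abs_add_le _ _).trans (by gcongr)
  have h2 : |f 0| + N * |Φ x| ≤ (|f 0| + N) * (1 + |Φ x|) := by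
    nlinarith [abs_nonneg (f 0), abs_nonneg (Φ x), mul_nonneg (abs_nonneg (f 0)) (abs_nonneg (Φ x))]
  have h3 : E x * |f x| ≤ E x * (max (max C₁ C₂) 0 * (|f 0| + N) * G x) := by
    calc E x * |f x| ≤ (|f 0| + N) * (1 + |Φ x|) := h1.trans h2
      _ ≤ (|f 0| + N) * (max (max C₁ C₂) 0 * A x) :=
        mul_le_mul_of_nonneg_left hbd (add_nonneg (abs_nonneg _) hN0)
      _ = _ := by rw [hAdef]; ring
  exact le_of_mul_le_mul_left h3 hEx

/-! ### The Riccati equation and its linearization -/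

lemma IsNoSwirlSol.hasDerivAt {c : Fin 3 → ℝ} {U : ℝ → ℝ} (h : IsNoSwirlSol c U) {x : ℝ}
    (hx : x ∈ Ioo (-1 : ℝ) 1) :
    HasDerivAt U ((P c x - 2 * x * U x - U x ^ 2 / 2) / (1 - x ^ 2)) x := by
  obtain ⟨h1, h2⟩ := h x hx
  have h3 := (one_sub_sq_pos hx).ne'
  refine h1.hasDerivAt.congr_deriv ?_
  rw [eq_div_iff h3]
  linarith

lemma isNoSwirlSol_of_hasDerivAt {c : Fin 3 → ℝ} {U : ℝ → ℝ} (h : ∀ x ∈ Ioo (-1 : ℝ) 1,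
    HasDerivAt U ((P c x - 2 * x * U x - U x ^ 2 / 2) / (1 - x ^ 2)) x) : IsNoSwirlSol c U := by
  intro x hx
  have h3 := (one_sub_sq_pos hx).ne'
  refine ⟨(h x hx).differentiableAt, ?_⟩
  rw [(h x hx).deriv]
  field_simp
  ring

lemma IsNoSwirlSol.continuousOn {c : Fin 3 → ℝ} {U : ℝ → ℝ} (h : IsNoSwirlSol c U) :
    ContinuousOn U (Ioo (-1) 1) := fun _ hx =>
  (h.hasDerivAt hx).continuousAt.continuousWithinAt

lemma continuous_P (c : Fin 3 → ℝ) : Continuous (P c) := by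
  unfold P
  fun_prop

/-- The difference of two Riccati solutions satisfies a homogeneous linear equation, because U² -
U'² factors; the coefficient is 2x + (U + U')/2. -/
lemma IsNoSwirlSol.eqOn {c : Fin 3 → ℝ} {U U' : ℝ → ℝ} (h : IsNoSwirlSol c U)
    (h' : IsNoSwirlSol c U') (h0 : U 0 = U' 0) : EqOn U U' (Ioo (-1) 1) := by
  intro x hx
  have := linear_ode_unique (α := fun x => 2 * x + (U x + U' x) / 2) (f := fun x => U x - U' x)
    ((by fun_prop : Continuous fun x : ℝ => 2 * x).continuousOn.add
      ((h.continuousOn.add h'.continuousOn).div_const 2)) (fun y hy => by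
      refine ((h.hasDerivAt hy).sub (h'.hasDerivAt hy)).congr_deriv ?_
      rw [← sub_div]
      congr 1
      ring) (by simp [h0]) x hx
  simpa [sub_eq_zero] using this

lemma Ubar_spec {c : Fin 3 → ℝ} {γ : ℝ} (h : γ ∈ initialValues c) :
    IsNoSwirlSol c (Ubar c γ) ∧ Ubar c γ 0 = γ := by
  have h' : ∃ U : ℝ → ℝ, IsNoSwirlSol c U ∧ U 0 = γ := h
  unfold Ubar
  rw [dif_pos h']
  exact h'.choose_spec

lemma Ubar_eqOn {c : Fin 3 → ℝ} {γ : ℝ} {U : ℝ → ℝ} (h : IsNoSwirlSol c U) (h0 : U 0 = γ) :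
    EqOn (Ubar c γ) U (Ioo (-1) 1) :=
  have hs := Ubar_spec ⟨U, h, h0⟩
  hs.1.eqOn h (hs.2.trans h0.symm)

/-- `(1 - x²) v' = w`, `(1 - x²) w' = (1 + P_c / 2) v` on `(-1,1)`. -/
def IsLinSol (c : Fin 3 → ℝ) (v w : ℝ → ℝ) : Prop :=
  ∀ x ∈ Ioo (-1 : ℝ) 1, HasDerivAt v (w x / (1 - x ^ 2)) x ∧
    HasDerivAt w ((1 + P c x / 2) * v x / (1 - x ^ 2)) x

/-- The Riccati substitution U = 2(w/v - x), with v the integrating factor of x + U/2. It makes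
superposition available: global Riccati solutions correspond to positive `v`, and positive
combinations of positive functions stay positive. -/
lemma IsNoSwirlSol.exists_linSol {c : Fin 3 → ℝ} {U : ℝ → ℝ} (h : IsNoSwirlSol c U) :
    ∃ v w : ℝ → ℝ, IsLinSol c v w ∧ (∀ x, 0 < v x) ∧ v 0 = 1 ∧ w 0 = U 0 / 2 := by
  have hc : ContinuousOn (fun x => x + U x / 2) (Ioo (-1) 1) :=
    continuousOn_id.add (h.continuousOn.div_const 2)
  refine ⟨intFactor fun x => x + U x / 2, fun x => (x + U x / 2) * intFactor (fun x => x + U x / 2) x,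
    fun x hx => ⟨?_, ?_⟩, fun x => intFactor_pos _ x, intFactor_zero _, by simp [intFactor_zero]⟩
  · refine (hasDerivAt_intFactor hc hx).congr_deriv ?_
    ring
  · refine (((hasDerivAt_id x).add ((h.hasDerivAt hx).div_const 2)).mul
      (hasDerivAt_intFactor hc hx)).congr_deriv ?_
    have := (one_sub_sq_pos hx).ne'
    simp only [Pi.add_apply, id]
    field_simp
    ring

lemma IsLinSol.isNoSwirlSol {c : Fin 3 → ℝ} {v w : ℝ → ℝ} (h : IsLinSol c v w)
    (hv : ∀ x ∈ Ioo (-1 : ℝ) 1, 0 < v x) : IsNoSwirlSol c fun x => 2 * (w x / v x - x) := by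
  refine isNoSwirlSol_of_hasDerivAt fun x hx => ?_
  have h1 := (one_sub_sq_pos hx).ne'
  have h2 := (hv x hx).ne'
  refine ((((h x hx).2.div (h x hx).1 h2).sub (hasDerivAt_id x)).const_mul 2).congr_deriv ?_
  field_simp
  ring

lemma IsLinSol.combine {c : Fin 3 → ℝ} {v w v' w' : ℝ → ℝ} (h : IsLinSol c v w)
    (h' : IsLinSol c v' w') (a b : ℝ) :
    IsLinSol c (fun x => a * v x + b * v' x) (fun x => a * w x + b * w' x) := by
  intro x hx
  constructor
  · refine (((h x hx).1.const_mul a).add ((h' x hx).1.const_mul b)).congr_deriv ?_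
    ring
  · refine (((h x hx).2.const_mul a).add ((h' x hx).2.const_mul b)).congr_deriv ?_
    ring

/-- The coefficient matrix of the system has zero trace. The constant is the tool for excluding that
two different solutions are both recessive at the same pole. -/
lemma IsLinSol.wronskian {c : Fin 3 → ℝ} {v w v' w' : ℝ → ℝ} (h : IsLinSol c v w)
    (h' : IsLinSol c v' w') :
    ∀ x ∈ Ioo (-1 : ℝ) 1, v x * w' x - w x * v' x = v 0 * w' 0 - w 0 * v' 0 := by
  refine eq_of_deriv_zero fun x hx => ?_
  refine (((h x hx).1.mul (h' x hx).2).sub ((h x hx).2.mul (h' x hx).1)).congr_deriv ?_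
  ring

/-! ### Behaviour near the regular pole -/

/-- `artanh x`. -/
def artanh (x : ℝ) : ℝ := (Real.log (1 + x) - Real.log (1 - x)) / 2

lemma hasDerivAt_artanh {x : ℝ} (hx : x ∈ Ioo (-1 : ℝ) 1) :
    HasDerivAt artanh (1 / (1 - x ^ 2)) x := by
  have h1 : 1 + x ≠ 0 := by linarith [hx.1]
  have h2 : 1 - x ≠ 0 := by linarith [hx.2]
  have h3 : 1 - x ^ 2 ≠ 0 := (one_sub_sq_pos hx).ne'
  refine (((((hasDerivAt_id x).const_add 1).log h1).sub
    (((hasDerivAt_id x).const_sub 1).log h2)).div_const 2).congr_deriv ?_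
  have h4 : (1 - x ^ 2) = (1 + x) * (1 - x) := by ring
  rw [h4]
  simp only [id]
  field_simp
  ring

lemma tendsto_artanh : Tendsto artanh (𝓝[<] 1) atTop := by
  have h1 : Tendsto (fun x : ℝ => Real.log (1 + x)) (𝓝[<] 1) (𝓝 (Real.log (1 + 1))) :=
    (ContinuousAt.log (by fun_prop) (by norm_num)).continuousWithinAt
  have h2 : Tendsto (fun x : ℝ => 1 - x) (𝓝[<] 1) (𝓝[>] 0) := by
    refine tendsto_nhdsWithin_iff.2 ⟨?_, ?_⟩
    · have : Tendsto (fun x : ℝ => 1 - x) (𝓝 1) (𝓝 (1 - 1)) := by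
        exact (continuous_const.sub continuous_id).tendsto 1
      rw [sub_self] at this
      exact this.mono_left nhdsWithin_le_nhds
    · filter_upwards [self_mem_nhdsWithin] with x hx
      simpa using hx
  have h3 : Tendsto (fun x : ℝ => -Real.log (1 - x)) (𝓝[<] 1) atTop :=
    tendsto_neg_atBot_atTop.comp (Real.tendsto_log_nhdsGT_zero.comp h2)
  have h4 := (h1.add_atTop h3).atTop_mul_const (r := 1 / 2) (by norm_num)
  refine h4.congr fun x => ?_
  unfold artanh
  ring

lemma eventually_left_iff {p : ℝ → Prop} :
    (∀ᶠ x in 𝓝[<] (1 : ℝ), p x) ↔ ∃ x₀ ∈ Ico (0 : ℝ) 1, ∀ x ∈ Ico x₀ 1, p x := by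
  constructor
  · intro hp
    obtain ⟨a, ha, hap⟩ := (mem_nhdsLT_iff_exists_Ioo_subset (a := (1 : ℝ))).1 hp
    have ha' : a < 1 := ha
    refine ⟨max ((a + 1) / 2) 0, ⟨le_max_right _ _, max_lt (by linarith) zero_lt_one⟩,
      fun x hx => hap ⟨?_, hx.2⟩⟩
    have := (le_max_left ((a + 1) / 2) 0).trans hx.1
    linarith
  · rintro ⟨x₀, hx₀, h⟩
    filter_upwards [Ico_mem_nhdsLT hx₀.2] with x hx using h x hx

lemma monotoneOn_of_hasDerivAt {f f' : ℝ → ℝ} {D : Set ℝ} (hD : Convex ℝ D)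
    (hf : ∀ x ∈ D, HasDerivAt f (f' x) x) (h : ∀ x ∈ D, 0 ≤ f' x) : MonotoneOn f D := by
  refine monotoneOn_of_deriv_nonneg hD (fun x hx => (hf x hx).continuousAt.continuousWithinAt)
    (fun x hx => (hf x (interior_subset hx)).differentiableAt.differentiableWithinAt) fun x hx => ?_
  rw [(hf x (interior_subset hx)).deriv]
  exact h x (interior_subset hx)

lemma antitoneOn_of_hasDerivAt {f f' : ℝ → ℝ} {D : Set ℝ} (hD : Convex ℝ D)
    (hf : ∀ x ∈ D, HasDerivAt f (f' x) x) (h : ∀ x ∈ D, f' x ≤ 0) : AntitoneOn f D := by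
  have := monotoneOn_of_hasDerivAt hD (fun x hx => (hf x hx).neg) fun x hx => by
    have := h x hx
    linarith
  intro x hx y hy hxy
  exact neg_le_neg_iff.1 (this hx hy hxy)

lemma tendsto_one_add_P_half (c : Fin 3 → ℝ) :
    Tendsto (fun x => 1 + P c x / 2) (𝓝[<] 1) (𝓝 (1 + c 1)) := by
  have h : Continuous fun x => 1 + P c x / 2 := by
    have := continuous_P c
    fun_prop
  have h1 := h.tendsto 1
  have h2 : 1 + P c 1 / 2 = 1 + c 1 := by
    simp only [P]
    ring
  rw [h2] at h1
  exact h1.mono_left nhdsWithin_le_nhds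

/-- Near 1 the coefficient 1 + P/2 tends to 1 + `c 1` > 0, so `w` increases while `v` is positive.
If `w` ever becomes positive it stays above a positive bound: the dominant case. Otherwise `w ≤ 0`
and `v` decreases, hence is bounded, and `w` must tend to 0: the recessive case. -/
lemma IsLinSol.right_dichotomy {c : Fin 3 → ℝ} (hc : -1 < c 1) {v w : ℝ → ℝ}
    (h : IsLinSol c v w) (hv : ∀ x ∈ Ioo (-1 : ℝ) 1, 0 < v x) :
    (∃ η > 0, ∀ᶠ x in 𝓝[<] (1 : ℝ), η ≤ w x) ∨
      (Tendsto w (𝓝[<] 1) (𝓝 0) ∧ ∃ C, ∀ᶠ x in 𝓝[<] (1 : ℝ), |v x| ≤ C) := by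
  obtain ⟨x₀, hx₀, hQ⟩ := eventually_left_iff.1
    ((tendsto_one_add_P_half c).eventually (lt_mem_nhds (show (0 : ℝ) < 1 + c 1 by linarith)))
  have hs : Ico x₀ 1 ⊆ Ioo (-1 : ℝ) 1 := fun x hx => ⟨by linarith [hx₀.1, hx.1], hx.2⟩
  have hwm : MonotoneOn w (Ico x₀ 1) := monotoneOn_of_hasDerivAt (convex_Ico _ _)
    (fun x hx => (h x (hs hx)).2) fun x hx =>
      div_nonneg (mul_nonneg (hQ x hx).le (hv x (hs hx)).le) (one_sub_sq_pos (hs hx)).le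
  have hx₀m : x₀ ∈ Ico x₀ 1 := ⟨le_rfl, hx₀.2⟩
  by_cases hw : ∃ x₁ ∈ Ico x₀ 1, 0 < w x₁
  · obtain ⟨x₁, hx₁, hpos⟩ := hw
    refine Or.inl ⟨w x₁, hpos, ?_⟩
    filter_upwards [Ico_mem_nhdsLT hx₁.2] with x hx
    exact hwm hx₁ ⟨hx₁.1.trans hx.1, hx.2⟩ hx.1
  · push Not at hw
    have hva : AntitoneOn v (Ico x₀ 1) := antitoneOn_of_hasDerivAt (convex_Ico _ _)
      (fun x hx => (h x (hs hx)).1) fun x hx =>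
        div_nonpos_of_nonpos_of_nonneg (hw x hx) (one_sub_sq_pos (hs hx)).le
    refine Or.inr ⟨?_, v x₀, ?_⟩
    · refine (tendsto_order.2 ⟨fun L hL => ?_, fun L hL => ?_⟩)
      · by_contra hcon
        have hwL : ∀ x ∈ Ico x₀ 1, w x ≤ L := by
          intro x hx
          by_contra hlt
          push Not at hlt
          refine hcon ?_
          filter_upwards [Ico_mem_nhdsLT hx.2] with y hy
          exact hlt.trans_le (hwm hx ⟨hx.1.trans hy.1, hy.2⟩ hy.1)
        -- A bound `w ≤ L < 0` would force `v` below a negative multiple of `artanh`, which tends to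
        -- infinity, against `v > 0`.
        have hanti : AntitoneOn (fun x => v x - L * artanh x) (Ico x₀ 1) :=
          antitoneOn_of_hasDerivAt (convex_Ico _ _)
            (fun x hx => (h x (hs hx)).1.sub ((hasDerivAt_artanh (hs hx)).const_mul L))
            fun x hx => by
              have h1 := one_sub_sq_pos (hs hx)
              rw [mul_one_div, ← sub_div]
              exact div_nonpos_of_nonpos_of_nonneg (by linarith [hwL x hx]) h1.le
        obtain ⟨x, hx, hxx⟩ := ((tendsto_artanh.eventually
          (eventually_gt_atTop (artanh x₀ + v x₀ / (-L)))).and (Ico_mem_nhdsLT hx₀.2)).exists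
        have h1 : v x - L * artanh x ≤ v x₀ - L * artanh x₀ := hanti hx₀m hxx hxx.1
        have h2 := hv x (hs hxx)
        have h3 : v x₀ = (-L) * (v x₀ / (-L)) := by
          have := hL.ne
          field_simp
        nlinarith
      · filter_upwards [Ico_mem_nhdsLT hx₀.2] with x hx using (hw x hx).trans_lt hL
    · filter_upwards [Ico_mem_nhdsLT hx₀.2] with x hx
      rw [abs_of_pos (hv x (hs hx))]
      exact hva hx₀m hx hx.1

/-- In the time variable `artanh x`, which runs to infinity, the ratio ρ = w/v satisfies ρ' = q - ρ²
with q → κ², and ρ > 0 is attracted by κ. Quantitatively, ((ρ-κ)² - η) exp(κ artanh x) is decreasing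
near 1, so (ρ-κ)² is eventually below 2η. -/
lemma IsLinSol.tendsto_right {c : Fin 3 → ℝ} (hc : -1 < c 1) {v w : ℝ → ℝ}
    (h : IsLinSol c v w) (hv : ∀ x ∈ Ioo (-1 : ℝ) 1, 0 < v x)
    (hw : ∀ᶠ x in 𝓝[<] (1 : ℝ), 0 < w x) :
    Tendsto (fun x => w x / v x) (𝓝[<] 1) (𝓝 √(1 + c 1)) := by
  set κ := √(1 + c 1) with hκ
  have hκpos : 0 < κ := Real.sqrt_pos.2 (by linarith)
  have hκ2 : κ ^ 2 = 1 + c 1 := Real.sq_sqrt (by linarith)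
  have key : ∀ η > 0, ∀ᶠ x in 𝓝[<] (1 : ℝ), (w x / v x - κ) ^ 2 < 2 * η := by
    intro η hη
    -- The threshold is what Young's inequality needs: 2κ(ρ-κ)(q-κ²) is at most κ²(ρ-κ)² + (q-κ²)²,
    -- and the last term must be absorbed by κ²η.
    have hq : ∀ᶠ x in 𝓝[<] (1 : ℝ), (1 + P c x / 2 - κ ^ 2) ^ 2 < κ ^ 2 * η := by
      have h1 := ((tendsto_one_add_P_half c).sub_const (κ ^ 2)).pow 2
      rw [hκ2, sub_self, zero_pow two_ne_zero] at h1
      rw [hκ2]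
      exact h1.eventually (gt_mem_nhds (mul_pos (by linarith) hη))
    obtain ⟨x₀, hx₀, hall⟩ := eventually_left_iff.1 (hw.and hq)
    have hs : Ico x₀ 1 ⊆ Ioo (-1 : ℝ) 1 := fun x hx => ⟨by linarith [hx₀.1, hx.1], hx.2⟩
    have hanti : AntitoneOn (fun x => ((w x / v x - κ) ^ 2 - η) * Real.exp (κ * artanh x))
        (Ico x₀ 1) := by
      refine antitoneOn_of_hasDerivAt (convex_Ico _ _) (fun x hx =>
        ((((((h x (hs hx)).2.div (h x (hs hx)).1 (hv x (hs hx)).ne').sub_const κ).pow 2).sub_const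
          η).mul ((hasDerivAt_artanh (hs hx)).const_mul κ).exp)) fun x hx => ?_
      have h1 := one_sub_sq_pos (hs hx)
      have h2 := hv x (hs hx)
      obtain ⟨hw1, hq1⟩ := hall x hx
      simp only [Pi.div_apply, Pi.pow_apply]
      set e := Real.exp (κ * artanh x)
      have he : 0 < e := Real.exp_pos _
      set ρ := w x / v x with hρ
      have hρpos : 0 < ρ := div_pos hw1 h2
      have hwρ : w x = ρ * v x := by rw [hρ]; field_simp
      set q := 1 + P c x / 2 with hqdef
      have hrew : ((2 : ℕ) : ℝ) * (ρ - κ) ^ (2 - 1)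
          * ((q * v x / (1 - x ^ 2) * v x - w x * (w x / (1 - x ^ 2))) / v x ^ 2) * e
          + ((ρ - κ) ^ 2 - η) * (e * (κ * (1 / (1 - x ^ 2))))
          = e / (1 - x ^ 2) * (2 * (ρ - κ) * (q - ρ ^ 2) + κ * ((ρ - κ) ^ 2 - η)) := by
        rw [hwρ]
        have h3 := h1.ne'
        norm_num
        generalize 1 - x ^ 2 = d at h3 ⊢
        field_simp
      rw [hrew]
      refine mul_nonpos_of_nonneg_of_nonpos (div_nonneg he.le h1.le) ?_
      have h4 : κ * (2 * (ρ - κ) * (q - ρ ^ 2) + κ * ((ρ - κ) ^ 2 - η)) ≤ 0 := by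
        have h5 : 0 ≤ (κ * (ρ - κ) - (q - κ ^ 2)) ^ 2 := sq_nonneg _
        have h6 : 0 ≤ κ * ρ * (ρ - κ) ^ 2 := by positivity
        nlinarith
      exact nonpos_of_mul_nonpos_right h4 hκpos
    have hlim : Tendsto (fun x => ((w x₀ / v x₀ - κ) ^ 2 - η) * Real.exp (κ * artanh x₀)
        * Real.exp (-(κ * artanh x))) (𝓝[<] 1) (𝓝 0) := by
      have : Tendsto (fun x => Real.exp (-(κ * artanh x))) (𝓝[<] 1) (𝓝 0) :=
        Real.tendsto_exp_neg_atTop_nhds_zero.comp (tendsto_artanh.const_mul_atTop hκpos)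
      simpa using this.const_mul (((w x₀ / v x₀ - κ) ^ 2 - η) * Real.exp (κ * artanh x₀))
    filter_upwards [hlim.eventually (gt_mem_nhds hη), Ico_mem_nhdsLT hx₀.2] with x hx1 hx
    have h1 : ((w x / v x - κ) ^ 2 - η) * Real.exp (κ * artanh x)
      ≤ ((w x₀ / v x₀ - κ) ^ 2 - η) * Real.exp (κ * artanh x₀) := hanti ⟨le_rfl, hx₀.2⟩ hx hx.1
    have h2 : (w x / v x - κ) ^ 2 - η ≤ ((w x₀ / v x₀ - κ) ^ 2 - η) * Real.exp (κ * artanh x₀)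
        * Real.exp (-(κ * artanh x)) := by
      rw [Real.exp_neg, ← div_eq_mul_inv, le_div_iff₀ (Real.exp_pos _)]
      exact h1
    linarith
  rw [Metric.tendsto_nhds]
  intro r hr
  filter_upwards [key (r ^ 2 / 2) (by positivity)] with x hx
  rw [Real.dist_eq]
  exact abs_lt_of_sq_lt_sq (by linarith) hr.le


/-! ### Behaviour near the logarithmic pole -/

/-- A function on `(-1,0]` with derivative `O((1+x)^{-1/2})` has a limit at `-1`. -/
lemma exists_tendsto_of_deriv_le {f f' : ℝ → ℝ} {M : ℝ}
    (hf : ∀ x ∈ Ioc (-1 : ℝ) 0, HasDerivAt f (f' x) x)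
    (hb : ∀ x ∈ Ioc (-1 : ℝ) 0, |f' x| * √(1 + x) ≤ M) :
    ∃ A, Tendsto f (𝓝[>] (-1)) (𝓝 A) := by
  have hr : ∀ x ∈ Ioc (-1 : ℝ) 0, HasDerivAt (fun x => √(1 + x)) (1 / (2 * √(1 + x))) x := by
    intro x hx
    exact ((hasDerivAt_id x).const_add 1).sqrt (by simp only [id]; linarith [hx.1])
  have hpos : ∀ x ∈ Ioc (-1 : ℝ) 0, 0 < √(1 + x) := fun x hx => Real.sqrt_pos.2 (by linarith [hx.1])
  have h2 : ∀ x ∈ Ioc (-1 : ℝ) 0, |f' x| ≤ 2 * M * (1 / (2 * √(1 + x))) := by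
    intro x hx
    have := hpos x hx
    rw [show 2 * M * (1 / (2 * √(1 + x))) = M / √(1 + x) by field_simp, le_div_iff₀ this]
    exact hb x hx
  have hm : MonotoneOn (fun x => f x + 2 * M * √(1 + x)) (Ioc (-1) 0) :=
    monotoneOn_of_hasDerivAt (convex_Ioc _ _) (fun x hx => (hf x hx).add ((hr x hx).const_mul _))
      fun x hx => by linarith [(abs_le.1 (h2 x hx)).1]
  have ha : AntitoneOn (fun x => f x - 2 * M * √(1 + x)) (Ioc (-1) 0) :=
    antitoneOn_of_hasDerivAt (convex_Ioc _ _) (fun x hx => (hf x hx).sub ((hr x hx).const_mul _))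
      fun x hx => by linarith [(abs_le.1 (h2 x hx)).2]
  have hM : 0 ≤ M := by
    refine le_trans ?_ (hb 0 ⟨by norm_num, le_rfl⟩)
    positivity
  have h3 := (hm.mono Ioo_subset_Ioc_self).tendsto_nhdsWithin_Ioo_right
    (nonempty_Ioo.2 (by norm_num)) ⟨f 0 - 2 * M * √(1 + 0), by
      rintro _ ⟨x, hx, rfl⟩
      have h4 : f 0 - 2 * M * √(1 + 0) ≤ f x - 2 * M * √(1 + x) :=
        ha (Ioo_subset_Ioc_self hx) ⟨by norm_num, le_rfl⟩ hx.2.le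
      have h5 : 0 ≤ 2 * M * √(1 + x) := by positivity
      change _ ≤ f x + 2 * M * √(1 + x)
      linarith⟩
  have h4 : Tendsto (fun x : ℝ => 2 * M * √(1 + x)) (𝓝[>] (-1)) (𝓝 (2 * M * √(1 + -1))) := by
    refine Tendsto.mono_left ?_ nhdsWithin_le_nhds
    exact (by fun_prop : Continuous fun x : ℝ => 2 * M * √(1 + x)).tendsto (-1)
  refine ⟨_, (h3.sub h4).congr fun x => ?_⟩
  ring

/-- `artanh` has only logarithmic growth. The bound serves as an integrable majorant in the Gronwall
argument at x = -1; the constant 9 is not sharp. -/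
lemma one_add_artanh_sq_mul_sqrt_le {x : ℝ} (hx : x ∈ Ioc (-1 : ℝ) 0) :
    artanh x ≤ 0 ∧ (1 + artanh x ^ 2) * √(1 + x) ≤ 9 := by
  have hy : 0 < 1 + x := by linarith [hx.1]
  have hy1 : 1 + x ≤ 1 := by linarith [hx.2]
  have hlog : Real.log (1 + x) ≤ Real.log (1 - x) := Real.log_le_log hy (by linarith [hx.2])
  have h0 : artanh x ≤ 0 := by
    unfold artanh
    linarith
  refine ⟨h0, ?_⟩
  -- With t the fourth root of 2/(1+x), -artanh x ≤ 2 ln t ≤ 2t, and t²√(1+x) = √2; this gives 1 +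
  -- 4·2 = 9.
  set t := √√(2 / (1 + x)) with ht
  have ht2 : t ^ 2 = √(2 / (1 + x)) := Real.sq_sqrt (Real.sqrt_nonneg _)
  have htpos : 0 < t := Real.sqrt_pos.2 (Real.sqrt_pos.2 (by positivity))
  have hlt : Real.log t = (Real.log 2 - Real.log (1 + x)) / 4 := by
    rw [ht, Real.log_sqrt (Real.sqrt_nonneg _), Real.log_sqrt (by positivity),
      Real.log_div (by norm_num) hy.ne']
    ring
  have hle := Real.log_le_sub_one_of_pos htpos
  have h2 : Real.log (1 - x) ≤ Real.log 2 :=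
    Real.log_le_log (by linarith [hx.2]) (by linarith [hx.1])
  have h3 : -artanh x ≤ 2 * t := by
    unfold artanh
    linarith
  have h4 : artanh x ^ 2 ≤ 4 * t ^ 2 := by nlinarith
  have h5 : t ^ 2 * √(1 + x) ≤ 2 := by
    rw [ht2, ← Real.sqrt_mul (by positivity), div_mul_cancel₀ _ hy.ne']
    exact (Real.sqrt_le_left (by norm_num)).2 (by norm_num)
  have h6 : √(1 + x) ≤ 1 := Real.sqrt_le_one.2 hy1
  nlinarith [Real.sqrt_nonneg (1 + x)]

/-- The condition `c 0 = -1` makes 1 + P/2 vanish at -1, so in the variable `artanh x` the system is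
a small perturbation of v' = w, w' = 0. Variation of constants with respect to the solutions 1 and
`artanh` leads to a = -w and b = v - artanh·w, whose derivatives are integrable against the
logarithm; a Gronwall bound on a² + b² then gives the limits. -/
lemma IsLinSol.exists_tendsto_left {c : Fin 3 → ℝ} (hc : c 0 = -1) {v w : ℝ → ℝ}
    (h : IsLinSol c v w) : ∃ A B, Tendsto (fun x => -w x) (𝓝[>] (-1)) (𝓝 A) ∧
      Tendsto (fun x => v x - artanh x * w x) (𝓝[>] (-1)) (𝓝 B) := by
  set K := (1 + |c 1|) + |c 2| with hK
  have hs : Ioc (-1 : ℝ) 0 ⊆ Ioo (-1 : ℝ) 1 := fun x hx => ⟨hx.1, by linarith [hx.2]⟩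
  have hKpos : 0 ≤ K := by positivity
  set Q : ℝ → ℝ := fun x => (1 + P c x / 2) / (1 - x ^ 2) with hQ
  have hQb : ∀ x ∈ Ioc (-1 : ℝ) 0, |Q x| ≤ K := by
    intro x hx
    have h1 := one_sub_sq_pos (hs hx)
    have h2 : 0 < 1 - x := by linarith [hx.2]
    -- For `c 0 = -1` the factor 1 + x cancels, so `Q` has no singularity at -1.
    have h3 : Q x = ((1 + c 1) / 2) / (1 - x) + c 2 / 2 := by
      rw [hQ]
      have : (1 - x ^ 2) = (1 + x) * (1 - x) := by ring
      have h4 : 1 + x ≠ 0 := by linarith [hx.1]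
      simp only [P, hc, this]
      field_simp
      ring
    rw [h3]
    have h5 : |((1 + c 1) / 2) / (1 - x)| ≤ 1 + |c 1| := by
      rw [abs_div, abs_of_pos h2, div_le_iff₀ h2]
      have h6 : |(1 + c 1) / 2| ≤ 1 + |c 1| := by
        rw [abs_div, abs_two]
        have h7 : |1 + c 1| ≤ 1 + |c 1| := (abs_add_le _ _).trans (by simp)
        have : 0 ≤ |c 1| := abs_nonneg _
        linarith
      have h8 : 0 ≤ |c 1| := abs_nonneg _
      nlinarith [hx.2]
    have h6 : |c 2 / 2| ≤ |c 2| := by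
      rw [abs_div, abs_two]
      linarith [abs_nonneg (c 2)]
    exact (abs_add_le _ _).trans (add_le_add h5 h6)
  set a : ℝ → ℝ := fun x => -w x with ha
  set b : ℝ → ℝ := fun x => v x - artanh x * w x with hb
  have had : ∀ x ∈ Ioc (-1 : ℝ) 0, HasDerivAt a (-(Q x * v x)) x := fun x hx => by
    refine (h x (hs hx)).2.neg.congr_deriv ?_
    simp only [hQ]
    ring
  have hbd : ∀ x ∈ Ioc (-1 : ℝ) 0, HasDerivAt b (-(artanh x * (Q x * v x))) x := fun x hx => by
    refine ((h x (hs hx)).1.sub ((hasDerivAt_artanh (hs hx)).mul (h x (hs hx)).2)).congr_deriv ?_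
    simp only [hQ]
    ring
  have hv : ∀ x, v x = b x - artanh x * a x := fun x => by simp only [ha, hb]; ring
  set n : ℝ → ℝ := fun x => a x ^ 2 + b x ^ 2 with hn
  have hr : ∀ x ∈ Ioc (-1 : ℝ) 0, HasDerivAt (fun x => √(1 + x)) (1 / (2 * √(1 + x))) x := by
    intro x hx
    exact ((hasDerivAt_id x).const_add 1).sqrt (by simp only [id]; linarith [hx.1])
  have hrpos : ∀ x ∈ Ioc (-1 : ℝ) 0, 0 < √(1 + x) :=
    fun x hx => Real.sqrt_pos.2 (by linarith [hx.1])
  -- Gronwall: |n'| ≤ 2K(1 + artanh²)n ≤ 18K n/√(1+x), and 18K/√(1+x) is the derivative of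
  -- 36K√(1+x).
  have hnmono : MonotoneOn (fun x => n x * Real.exp (36 * K * √(1 + x))) (Ioc (-1) 0) := by
    refine monotoneOn_of_hasDerivAt (convex_Ioc _ _) (fun x hx =>
      ((((had x hx).pow 2).add ((hbd x hx).pow 2)).mul ((hr x hx).const_mul (36 * K)).exp))
      fun x hx => ?_
    simp only [Pi.add_apply, Pi.pow_apply]
    set e := Real.exp (36 * K * √(1 + x))
    have he : 0 < e := Real.exp_pos _
    have hrx := hrpos x hx
    set r := √(1 + x) with hrdef
    have hT := (one_add_artanh_sq_mul_sqrt_le hx).2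
    set T := artanh x with hTdef
    have hfac : ((2 : ℕ) : ℝ) * a x ^ (2 - 1) * -(Q x * v x) + ((2 : ℕ) : ℝ) * b x ^ (2 - 1)
        * -(T * (Q x * v x)) = -(2 * Q x * ((b x - T * a x) * (a x + T * b x))) := by
      rw [hv x]
      norm_num
      ring
    rw [hfac]
    have h1 : |(b x - T * a x) * (a x + T * b x)| ≤ (1 + T ^ 2) * n x := by
      rw [hn, abs_le]
      constructor <;> nlinarith [sq_nonneg ((b x - T * a x) - (a x + T * b x)),
        sq_nonneg ((b x - T * a x) + (a x + T * b x)), sq_nonneg (b x + T * a x),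
        sq_nonneg (a x - T * b x)]
    have h2 : |2 * Q x * ((b x - T * a x) * (a x + T * b x))| ≤ 2 * K * ((1 + T ^ 2) * n x) := by
      rw [abs_mul, abs_mul, abs_two]
      have := hQb x hx
      gcongr
    have hn0 : 0 ≤ n x := by simp only [hn]; positivity
    have h3 : 2 * K * ((1 + T ^ 2) * n x) ≤ n x * (36 * K * (1 / (2 * r))) := by
      rw [show n x * (36 * K * (1 / (2 * r))) = (18 * K * n x) / r by field_simp; ring, le_div_iff₀ hrx]
      nlinarith [mul_nonneg hKpos hn0]
    have h4 : -(2 * Q x * ((b x - T * a x) * (a x + T * b x))) * e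
        + (a x ^ 2 + b x ^ 2) * (e * (36 * K * (1 / (2 * r))))
        = e * (n x * (36 * K * (1 / (2 * r))) - 2 * Q x * ((b x - T * a x) * (a x + T * b x))) := by
      simp only [hn]
      ring
    rw [h4]
    exact mul_nonneg he.le (by linarith [(abs_le.1 h2).2])
  set M := n 0 * Real.exp (36 * K * √(1 + 0)) with hM
  have hnM : ∀ x ∈ Ioc (-1 : ℝ) 0, n x ≤ M := by
    intro x hx
    have h1 := hnmono hx ⟨by norm_num, le_rfl⟩ hx.2
    have h2 : 1 ≤ Real.exp (36 * K * √(1 + x)) :=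
      Real.one_le_exp (mul_nonneg (by positivity) (Real.sqrt_nonneg _))
    have hn0 : 0 ≤ n x := by simp only [hn]; positivity
    change n x * _ ≤ M at h1
    nlinarith
  have hvb : ∀ x ∈ Ioc (-1 : ℝ) 0, |v x| ≤ (1 + artanh x ^ 2) * (1 + M) ∧
      |artanh x * v x| ≤ (1 + artanh x ^ 2) * (1 + M) := by
    intro x hx
    set T := artanh x with hT
    have hn0 : 0 ≤ n x := by simp only [hn]; positivity
    have hM1 : n x ≤ (1 + M) ^ 2 := by nlinarith [hnM x hx]
    have h1 : v x ^ 2 ≤ (1 + T ^ 2) * (1 + M) ^ 2 := by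
      have : v x ^ 2 ≤ (1 + T ^ 2) * n x := by
        rw [hv x, hn]
        nlinarith [sq_nonneg (a x + T * b x)]
      exact this.trans (mul_le_mul_of_nonneg_left hM1 (by positivity))
    have h0 : 0 ≤ (1 + T ^ 2) * (1 + M) := mul_nonneg (by positivity) (by linarith [hnM x hx])
    constructor <;> refine abs_le_of_sq_le_sq ?_ h0
    · rw [mul_pow]
      refine h1.trans (mul_le_mul_of_nonneg_right ?_ (sq_nonneg _))
      nlinarith [sq_nonneg T, sq_nonneg (T ^ 2)]
    · rw [mul_pow, mul_pow]
      calc T ^ 2 * v x ^ 2 ≤ T ^ 2 * ((1 + T ^ 2) * (1 + M) ^ 2) :=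
            mul_le_mul_of_nonneg_left h1 (sq_nonneg _)
        _ = (T ^ 2 * (1 + T ^ 2)) * (1 + M) ^ 2 := by ring
        _ ≤ _ := mul_le_mul_of_nonneg_right (by nlinarith [sq_nonneg T]) (sq_nonneg _)
  have hM0 : 0 ≤ 1 + M := by
    have : 0 ≤ M := by simp only [hM, hn]; positivity
    linarith
  have hfin : ∀ x ∈ Ioc (-1 : ℝ) 0, ∀ y, |y| ≤ (1 + artanh x ^ 2) * (1 + M) →
      |-(Q x * y)| * √(1 + x) ≤ K * 9 * (1 + M) := by
    intro x hx y hy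
    rw [abs_neg, abs_mul]
    calc |Q x| * |y| * √(1 + x) ≤ K * ((1 + artanh x ^ 2) * (1 + M)) * √(1 + x) := by
          have := hQb x hx
          gcongr
      _ = K * ((1 + artanh x ^ 2) * √(1 + x)) * (1 + M) := by ring
      _ ≤ _ := by
          have := (one_add_artanh_sq_mul_sqrt_le hx).2
          gcongr
  obtain ⟨A, hA⟩ := exists_tendsto_of_deriv_le had fun x hx => hfin x hx _ (hvb x hx).1
  obtain ⟨B, hB⟩ := exists_tendsto_of_deriv_le hbd fun x hx => by
    have := hfin x hx _ (hvb x hx).2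
    rwa [show Q x * (artanh x * v x) = artanh x * (Q x * v x) by ring] at this
  exact ⟨A, B, hA, hB⟩

/-- The positive logarithm `ln (3/(1+x))`. -/
def lam (x : ℝ) : ℝ := -Real.log ((1 + x) / 3)

lemma tendsto_one_add_nhdsGT : Tendsto (fun x : ℝ => 1 + x) (𝓝[>] (-1)) (𝓝[>] 0) := by
  refine tendsto_nhdsWithin_iff.2 ⟨?_, ?_⟩
  · have : Tendsto (fun x : ℝ => 1 + x) (𝓝 (-1)) (𝓝 (1 + -1)) :=
      (continuous_const.add continuous_id).tendsto (-1)
    rw [add_neg_cancel] at this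
    exact this.mono_left nhdsWithin_le_nhds
  · filter_upwards [self_mem_nhdsWithin] with x hx
    have : -1 < x := hx
    simp only [mem_Ioi]
    linarith

lemma tendsto_log_one_add : Tendsto (fun x : ℝ => Real.log (1 + x)) (𝓝[>] (-1)) atBot :=
  Real.tendsto_log_nhdsGT_zero.comp tendsto_one_add_nhdsGT

lemma lam_eq {x : ℝ} (hx : -1 < x) : lam x = Real.log 3 - Real.log (1 + x) := by
  unfold lam
  rw [Real.log_div (by linarith) (by norm_num)]
  ring

lemma tendsto_lam : Tendsto lam (𝓝[>] (-1)) atTop := by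
  have h1 : Tendsto (fun x : ℝ => Real.log 3 + -Real.log (1 + x)) (𝓝[>] (-1)) atTop :=
    tendsto_const_nhds.add_atTop (tendsto_neg_atBot_atTop.comp tendsto_log_one_add)
  refine h1.congr' ?_
  filter_upwards [self_mem_nhdsWithin] with x hx
  rw [lam_eq hx]
  ring

lemma tendsto_artanh_left : Tendsto artanh (𝓝[>] (-1)) atBot := by
  have h1 : Tendsto (fun x : ℝ => Real.log (1 - x)) (𝓝[>] (-1)) (𝓝 (Real.log (1 - -1))) :=
    (ContinuousAt.log (by fun_prop) (by norm_num)).continuousWithinAt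
  have h2 := (h1.neg.add_atBot tendsto_log_one_add).atBot_mul_const (r := 1 / 2) (by norm_num)
  refine h2.congr fun x => ?_
  unfold artanh
  ring

lemma tendsto_lam_div_artanh : Tendsto (fun x => lam x / artanh x) (𝓝[>] (-1)) (𝓝 (-2)) := by
  have h1 : Tendsto (fun x : ℝ => Real.log 3 - Real.log (1 - x)) (𝓝[>] (-1))
      (𝓝 (Real.log 3 - Real.log (1 - -1))) :=
    (tendsto_const_nhds.sub (ContinuousAt.log (by fun_prop) (by norm_num))).mono_left
      nhdsWithin_le_nhds
  have h2 := (h1.mul tendsto_artanh_left.inv_tendsto_atBot).add_const (-2)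
  rw [mul_zero, zero_add] at h2
  refine h2.congr' ?_
  filter_upwards [self_mem_nhdsWithin, tendsto_artanh_left.eventually (eventually_lt_atBot 0)]
    with x hx h3
  have h4 : lam x = Real.log 3 - Real.log (1 - x) - 2 * artanh x := by
    rw [lam_eq hx]
    unfold artanh
    ring
  rw [h4]
  have := h3.ne
  simp only [Pi.inv_apply]
  field_simp
  ring

/-- Asymptotics at both poles of the solutions strictly between two other ones. -/
lemma Ubar_asymptotics {c : Fin 3 → ℝ} (hc0 : c 0 = -1) (hc1 : -1 < c 1) {γ γ₁ γ₂ : ℝ}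
    (h1 : γ₁ ∈ initialValues c) (h2 : γ₂ ∈ initialValues c) (hγ1 : γ₁ < γ) (hγ2 : γ < γ₂) :
    IsNoSwirlSol c (Ubar c γ) ∧ Ubar c γ 0 = γ ∧
      Tendsto (fun x => (2 * x + Ubar c γ x) * lam x) (𝓝[>] (-1)) (𝓝 (-4)) ∧
      Tendsto (fun x => 2 * x + Ubar c γ x) (𝓝[<] 1) (𝓝 (2 * √(1 + c 1))) := by
  obtain ⟨U₁, hU₁, rfl⟩ := h1
  obtain ⟨U₂, hU₂, rfl⟩ := h2
  obtain ⟨v₁, w₁, hl₁, hp₁, hv₁, hw₁⟩ := hU₁.exists_linSol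
  obtain ⟨v₂, w₂, hl₂, hp₂, hv₂, hw₂⟩ := hU₂.exists_linSol
  -- The weight for which the convex combination of the two linear solutions has v(0) = 1 and w(0) =
  -- γ/2, hence represents U^{c,γ}.
  set b := (γ - U₁ 0) / (U₂ 0 - U₁ 0) with hb
  have hd : 0 < U₂ 0 - U₁ 0 := by linarith
  have hb0 : 0 < b := div_pos (by linarith) hd
  have hb1 : b < 1 := (div_lt_one hd).2 (by linarith)
  set a := 1 - b with ha
  have ha0 : 0 < a := by linarith
  set v : ℝ → ℝ := fun x => a * v₁ x + b * v₂ x with hvdef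
  set w : ℝ → ℝ := fun x => a * w₁ x + b * w₂ x with hwdef
  have hl : IsLinSol c v w := hl₁.combine hl₂ a b
  have hp : ∀ x, 0 < v x := fun x => add_pos (mul_pos ha0 (hp₁ x)) (mul_pos hb0 (hp₂ x))
  have hsol := hl.isNoSwirlSol fun x _ => hp x
  have hv0 : v 0 = 1 := by simp only [hvdef, hv₁, hv₂, ha]; ring
  have hw0 : w 0 = γ / 2 := by
    have h3 : b * (U₂ 0 - U₁ 0) = γ - U₁ 0 := by
      rw [hb, div_mul_cancel₀ _ hd.ne']
    simp only [hwdef, hw₁, hw₂, ha]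
    linarith
  have h0 : (fun x => 2 * (w x / v x - x)) 0 = γ := by
    simp only [hv0, hw0]
    ring
  have heq := Ubar_eqOn hsol h0
  have hspec := Ubar_spec ⟨_, hsol, h0⟩
  have hα : ∀ x ∈ Ioo (-1 : ℝ) 1, 2 * x + Ubar c γ x = 2 * (w x / v x) := fun x hx => by
    rw [heq hx]
    ring
  have hwr := hl₁.wronskian hl₂
  rw [hv₁, hv₂, hw₁, hw₂] at hwr
  refine ⟨hspec.1, hspec.2, ?_, ?_⟩
  · obtain ⟨A₁, B₁, hA₁, hB₁⟩ := hl₁.exists_tendsto_left hc0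
    obtain ⟨A₂, B₂, hA₂, hB₂⟩ := hl₂.exists_tendsto_left hc0
    -- Near -1 the quotient v/artanh tends to -A while `artanh` is negative, so positivity of `v`
    -- forces A ≥ 0.
    have hnn : ∀ {A B : ℝ} {v w : ℝ → ℝ}, (∀ x, 0 < v x) →
        Tendsto (fun x => -w x) (𝓝[>] (-1)) (𝓝 A) →
        Tendsto (fun x => v x - artanh x * w x) (𝓝[>] (-1)) (𝓝 B) → 0 ≤ A := by
      intro A B v w hp hA hB
      have h3 := hA.sub (hB.mul tendsto_artanh_left.inv_tendsto_atBot)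
      rw [mul_zero, sub_zero] at h3
      refine ge_of_tendsto h3 ?_
      filter_upwards [tendsto_artanh_left.eventually (eventually_lt_atBot 0)] with x hx
      have h5 : -w x - (v x - artanh x * w x) * artanh⁻¹ x = -(v x * (artanh x)⁻¹) := by
        simp only [Pi.inv_apply]
        field_simp [hx.ne]
        ring
      rw [h5]
      exact neg_nonneg.2 (mul_nonpos_of_nonneg_of_nonpos (hp x).le (inv_nonpos.2 hx.le))
    have hA₁0 := hnn hp₁ hA₁ hB₁
    have hA₂0 := hnn hp₂ hA₂ hB₂
    -- The Wronskian in the limit x → -1. It is nonzero, so `A₁` and `A₂` cannot both vanish and the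
    -- combination is dominant at -1.
    have hW : A₁ * B₂ - B₁ * A₂ = (U₂ 0 - U₁ 0) / 2 := by
      have h3 := (hA₁.mul hB₂).sub (hB₁.mul hA₂)
      refine tendsto_nhds_unique (h3.congr' ?_) tendsto_const_nhds
      filter_upwards [Ioo_mem_nhdsGT (show (-1 : ℝ) < 1 by norm_num)] with x hx
      have := hwr x hx
      linarith
    have hA : 0 < a * A₁ + b * A₂ := by
      rcases hA₁0.lt_or_eq with h3 | h3
      · exact add_pos_of_pos_of_nonneg (mul_pos ha0 h3) (mul_nonneg hb0.le hA₂0)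
      · refine add_pos_of_nonneg_of_pos (mul_nonneg ha0.le hA₁0) (mul_pos hb0 ?_)
        refine lt_of_le_of_ne hA₂0 fun h4 => ?_
        rw [← h3, ← h4] at hW
        linarith
    have hAl : Tendsto (fun x => -w x) (𝓝[>] (-1)) (𝓝 (a * A₁ + b * A₂)) :=
      ((hA₁.const_mul a).add (hA₂.const_mul b)).congr fun x => by simp only [hwdef]; ring
    have hBl : Tendsto (fun x => v x - artanh x * w x) (𝓝[>] (-1)) (𝓝 (a * B₁ + b * B₂)) :=
      ((hB₁.const_mul a).add (hB₂.const_mul b)).congr fun x => by simp only [hwdef, hvdef]; ring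
    have h3 := hBl.mul tendsto_artanh_left.inv_tendsto_atBot
    have h4 : Tendsto (fun x => v x / artanh x) (𝓝[>] (-1)) (𝓝 (-(a * A₁ + b * A₂))) := by
      have h5 := h3.sub hAl
      rw [mul_zero, zero_sub] at h5
      refine h5.congr' ?_
      filter_upwards [tendsto_artanh_left.eventually (eventually_lt_atBot 0)] with x hx
      simp only [Pi.inv_apply]
      field_simp [hx.ne]
      ring
    -- Here (-w)/(v/artanh) tends to -1 and `lam`/`artanh` to -2, so with the factor -2 the limit of
    -- 2(w/v)·`lam` is -4.
    have h5 := ((hAl.div h4 (neg_ne_zero.2 hA.ne')).mul tendsto_lam_div_artanh).const_mul (-2)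
    have h6 : -2 * ((a * A₁ + b * A₂) / -(a * A₁ + b * A₂) * -2) = -4 := by
      field_simp
      norm_num
    rw [h6] at h5
    refine h5.congr' ?_
    filter_upwards [Ioo_mem_nhdsGT (show (-1 : ℝ) < 1 by norm_num),
      tendsto_artanh_left.eventually (eventually_lt_atBot 0)] with x hx hx0
    rw [hα x hx]
    have h7 := (hp x).ne'
    have h8 := hx0.ne
    simp only [Pi.div_apply]
    field_simp
  · have hw : ∀ᶠ x in 𝓝[<] (1 : ℝ), 0 < w x := by
      rcases hl₁.right_dichotomy hc1 (fun x _ => hp₁ x) with ⟨η₁, hη₁, he₁⟩ | ⟨ht₁, C₁, hb₁⟩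
      · rcases hl₂.right_dichotomy hc1 (fun x _ => hp₂ x) with ⟨η₂, hη₂, he₂⟩ | ⟨ht₂, C₂, hb₂⟩
        · filter_upwards [he₁, he₂] with x hx1 hx2
          exact add_pos (mul_pos ha0 (by linarith)) (mul_pos hb0 (by linarith))
        · filter_upwards [he₁, (ht₂.const_mul b).eventually
            (lt_mem_nhds (show -(a * η₁) < b * 0 by simp; positivity))] with x hx1 hx2
          have := mul_le_mul_of_nonneg_left hx1 ha0.le
          simp only [hwdef]
          linarith
      · rcases hl₂.right_dichotomy hc1 (fun x _ => hp₂ x) with ⟨η₂, hη₂, he₂⟩ | ⟨ht₂, C₂, hb₂⟩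
        · filter_upwards [he₂, (ht₁.const_mul a).eventually
            (lt_mem_nhds (show -(b * η₂) < a * 0 by simp; positivity))] with x hx1 hx2
          have := mul_le_mul_of_nonneg_left hx1 hb0.le
          simp only [hwdef]
          linarith
        -- If both solutions were recessive at 1, each product of a bounded `v` with a vanishing `w`
        -- would tend to 0, against the nonzero Wronskian.
        · exfalso
          have h3 : Tendsto (fun x => v₁ x * w₂ x) (𝓝[<] 1) (𝓝 0) :=
            bdd_le_mul_tendsto_zero' C₁ hb₁ ht₂
          have h4 : Tendsto (fun x => v₂ x * w₁ x) (𝓝[<] 1) (𝓝 0) :=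
            bdd_le_mul_tendsto_zero' C₂ hb₂ ht₁
          have h5 := tendsto_nhds_unique ((h3.sub h4).congr' (f₂ := fun _ => (U₂ 0 - U₁ 0) / 2) (by
            filter_upwards [Ioo_mem_nhdsLT (show (-1 : ℝ) < 1 by norm_num)] with x hx
            have := hwr x hx
            linarith)) tendsto_const_nhds
          linarith
    refine ((hl.tendsto_right hc1 (fun x _ => hp x) hw).const_mul 2).congr' ?_
    filter_upwards [Ioo_mem_nhdsLT (show (-1 : ℝ) < 1 by norm_num)] with x hx
    rw [hα x hx]

open scoped BoundedContinuousFunction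

/-! ### Weighted function spaces -/

/-- The open interval `(-1,1)`. -/
abbrev Dom : Set ℝ := Ioo (-1) 1

/-- The open interval `(-1/2,1/2)`. -/
abbrev Half : Set ℝ := Ioo (-(1 / 2)) (1 / 2)

lemma half_subset_dom : Half ⊆ Dom := fun x hx => ⟨by linarith [hx.1], by linarith [hx.2]⟩

open Classical in
/-- Extension by zero of a bounded continuous function. -/
def extz {s : Set ℝ} (F : s →ᵇ ℝ) (x : ℝ) : ℝ := if h : x ∈ s then F ⟨x, h⟩ else 0

lemma extz_add {s : Set ℝ} (F G : s →ᵇ ℝ) (x : ℝ) : extz (F + G) x = extz F x + extz G x := by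
  unfold extz
  split_ifs <;> simp

lemma extz_smul {s : Set ℝ} (r : ℝ) (F : s →ᵇ ℝ) (x : ℝ) : extz (r • F) x = r * extz F x := by
  unfold extz
  split_ifs <;> simp

lemma extz_zero {s : Set ℝ} (x : ℝ) : extz (0 : s →ᵇ ℝ) x = 0 := by
  unfold extz
  split_ifs <;> simp

lemma abs_extz_le {s : Set ℝ} (F : s →ᵇ ℝ) (x : ℝ) : |extz F x| ≤ ‖F‖ := by
  unfold extz
  split_ifs with h
  · exact F.norm_coe_le_norm _
  · simp

lemma extz_sub_le {s : Set ℝ} (F G : s →ᵇ ℝ) (x : ℝ) : |extz F x - extz G x| ≤ ‖F - G‖ := by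
  have h : F = F - G + G := (sub_add_cancel F G).symm
  have h1 : extz F x = extz (F - G) x + extz G x := by
    conv_lhs => rw [h]
    exact extz_add _ _ _
  rw [h1, add_sub_cancel_right]
  exact abs_extz_le _ _

lemma continuousOn_extz {s : Set ℝ} (F : s →ᵇ ℝ) : ContinuousOn (extz F) s := by
  rw [continuousOn_iff_continuous_domRestrict]
  refine F.continuous.congr fun x => ?_
  simp [extz]

lemma extz_eq_zero {s : Set ℝ} {F : s →ᵇ ℝ} (h : ∀ x ∈ s, extz F x = 0) : F = 0 := by
  ext ⟨x, hx⟩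
  simpa [extz, hx] using h x hx

lemma exists_bcf {s : Set ℝ} {g : ℝ → ℝ} (hg : ContinuousOn g s) {N : ℝ} (hN : 0 ≤ N)
    (hb : ∀ x ∈ s, |g x| ≤ N) : ∃ F : s →ᵇ ℝ, (∀ x ∈ s, extz F x = g x) ∧ ‖F‖ ≤ N := by
  refine ⟨BoundedContinuousFunction.ofNormedAddCommGroup (fun x : s => g x)
    (continuousOn_iff_continuous_domRestrict.1 hg) N fun x => hb x x.2, fun x hx => ?_, ?_⟩
  · simp only [extz, hx, dite_true]
    rfl
  · exact BoundedContinuousFunction.norm_ofNormedAddCommGroup_le _ hN _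

/-- Functions on `(-1,1)` which are `O(w)` and `C²` with bounded derivatives on `(-1/2,1/2)`, as a
closed space of triples. -/
def Zsub (w : ℝ → ℝ) : Submodule ℝ ((Dom →ᵇ ℝ) × (Half →ᵇ ℝ) × (Half →ᵇ ℝ)) where
  carrier := {F | ∀ x ∈ Half, HasDerivAt (fun y => w y * extz F.1 y) (extz F.2.1 x) x ∧
    HasDerivAt (extz F.2.1) (extz F.2.2 x) x}
  zero_mem' := fun x _ => by
    have h1 : ∀ s : Set ℝ, extz (0 : s →ᵇ ℝ) = fun _ => 0 := fun s => funext fun x => extz_zero x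
    simp only [Prod.fst_zero, Prod.snd_zero, h1, mul_zero]
    exact ⟨hasDerivAt_const _ _, hasDerivAt_const _ _⟩
  add_mem' := fun {F G} hF hG x hx => by
    constructor
    · refine (((hF x hx).1.add (hG x hx).1).congr_of_eventuallyEq
        (Eventually.of_forall fun y => ?_)).congr_deriv (extz_add _ _ _).symm
      simp only [Prod.fst_add, extz_add, Pi.add_apply]
      ring
    · refine (((hF x hx).2.add (hG x hx).2).congr_of_eventuallyEq
        (Eventually.of_forall fun y => ?_)).congr_deriv (extz_add _ _ _).symm
      simp [extz_add]
  smul_mem' := fun r F hF x hx => by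
    constructor
    · refine (((hF x hx).1.const_mul r).congr_of_eventuallyEq
        (Eventually.of_forall fun y => ?_)).congr_deriv (extz_smul _ _ _).symm
      simp only [Prod.smul_fst, extz_smul]
      ring
    · refine (((hF x hx).2.const_mul r).congr_of_eventuallyEq
        (Eventually.of_forall fun y => ?_)).congr_deriv (extz_smul _ _ _).symm
      simp [extz_smul]

lemma tendstoUniformlyOn_extz {s : Set ℝ} {u : ℕ → s →ᵇ ℝ} {F : s →ᵇ ℝ}
    (h : Tendsto u atTop (𝓝 F)) (t : Set ℝ) :
    TendstoUniformlyOn (fun n => extz (u n)) (extz F) atTop t := by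
  rw [Metric.tendstoUniformlyOn_iff]
  intro r hr
  filter_upwards [(Metric.tendsto_nhds.1 h) r hr] with n hn x _
  rw [dist_comm, Real.dist_eq]
  refine (extz_sub_le _ _ _).trans_lt ?_
  rwa [← dist_eq_norm]

/-- Uniform convergence of the derivatives allows differentiation of the limit. Closedness makes `Z
w` complete, which the inverse function theorem requires. -/
lemma isClosed_Zsub (w : ℝ → ℝ) : IsClosed
    (Zsub w : Set ((Dom →ᵇ ℝ) × (Half →ᵇ ℝ) × (Half →ᵇ ℝ))) := by
  refine IsSeqClosed.isClosed fun u F hu hF x hx => ?_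
  have h1 : Tendsto (fun n => (u n).1) atTop (𝓝 F.1) := (continuous_fst.tendsto F).comp hF
  have h2 : Tendsto (fun n => (u n).2.1) atTop (𝓝 F.2.1) :=
    ((continuous_fst.comp continuous_snd).tendsto F).comp hF
  have h3 : Tendsto (fun n => (u n).2.2) atTop (𝓝 F.2.2) :=
    ((continuous_snd.comp continuous_snd).tendsto F).comp hF
  constructor
  · refine hasDerivAt_of_tendstoUniformlyOn (s := Half) (l := atTop) isOpen_Ioo
      (f := fun n y => w y * extz (u n).1 y) (tendstoUniformlyOn_extz h2 _)
      (Eventually.of_forall fun n y hy => (hu n y hy).1) (fun y hy => ?_) hx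
    exact ((tendstoUniformlyOn_extz h1 univ).tendsto_at (mem_univ y)).const_mul _
  · exact hasDerivAt_of_tendstoUniformlyOn (s := Half) (l := atTop) isOpen_Ioo
      (tendstoUniformlyOn_extz h3 _) (Eventually.of_forall fun n y hy => (hu n y hy).2)
      (fun y _ => (tendstoUniformlyOn_extz h2 univ).tendsto_at (mem_univ y)) hx

/-- The Banach space of functions `O(w)` on `(-1,1)`, `C²` on `(-1/2,1/2)`. -/
abbrev Z (w : ℝ → ℝ) : Type := Zsub w

instance (w : ℝ → ℝ) : NormedAddCommGroup (Z w) := Submodule.normedAddCommGroup _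

instance (w : ℝ → ℝ) : NormedSpace ℝ (Z w) := Submodule.normedSpace _

instance (w : ℝ → ℝ) : CompleteSpace (Z w) := (isClosed_Zsub w).completeSpace_coe

namespace Z

variable {w : ℝ → ℝ}

/-- The underlying function. -/
def fn (F : Z w) (x : ℝ) : ℝ := w x * extz F.1.1 x

/-- The first derivative on `(-1/2,1/2)`. -/
def d1 (F : Z w) : ℝ → ℝ := extz F.1.2.1

/-- The second derivative on `(-1/2,1/2)`. -/
def d2 (F : Z w) : ℝ → ℝ := extz F.1.2.2

lemma fn_add (F G : Z w) (x : ℝ) : fn (F + G) x = fn F x + fn G x := by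
  unfold fn
  rw [← mul_add, ← extz_add]
  rfl

lemma fn_smul (r : ℝ) (F : Z w) (x : ℝ) : fn (r • F) x = r * fn F x := by
  have : extz (r • F).1.1 x = r * extz F.1.1 x := extz_smul _ _ _
  unfold fn
  rw [this, mul_left_comm]

/-- `fn` as a linear map. -/
def fnₗ (w : ℝ → ℝ) : Z w →ₗ[ℝ] (ℝ → ℝ) where
  toFun := fn
  map_add' := fun F G => funext fun x => fn_add F G x
  map_smul' := fun r F => funext fun x => fn_smul r F x

lemma hasDerivAt_fn (F : Z w) {x : ℝ} (hx : x ∈ Half) : HasDerivAt (fn F) (d1 F x) x := (F.2 x hx).1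

lemma hasDerivAt_d1 (F : Z w) {x : ℝ} (hx : x ∈ Half) : HasDerivAt (d1 F) (d2 F x) x := (F.2 x hx).2

lemma continuousOn_d2 (F : Z w) : ContinuousOn (d2 F) Half := continuousOn_extz _

lemma continuousOn_fn (hw : ContinuousOn w Dom) (F : Z w) : ContinuousOn (fn F) Dom :=
  hw.mul (continuousOn_extz _)

lemma norm_parts (F : Z w) : ‖F.1.1‖ ≤ ‖F‖ ∧ ‖F.1.2.1‖ ≤ ‖F‖ ∧ ‖F.1.2.2‖ ≤ ‖F‖ :=
  ⟨norm_fst_le F.1, (norm_fst_le F.1.2).trans (norm_snd_le F.1),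
    (norm_snd_le F.1.2).trans (norm_snd_le F.1)⟩

lemma abs_fn_le (hw : ∀ x ∈ Dom, 0 < w x) (F : Z w) {x : ℝ} (hx : x ∈ Dom) :
    |fn F x| ≤ ‖F‖ * w x := by
  unfold fn
  rw [abs_mul, abs_of_pos (hw x hx), mul_comm]
  exact mul_le_mul_of_nonneg_right ((abs_extz_le _ _).trans (norm_parts F).1) (hw x hx).le

lemma abs_d1_le (F : Z w) (x : ℝ) : |d1 F x| ≤ ‖F‖ := (abs_extz_le _ _).trans (norm_parts F).2.1

lemma abs_d2_le (F : Z w) (x : ℝ) : |d2 F x| ≤ ‖F‖ := (abs_extz_le _ _).trans (norm_parts F).2.2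

/-- The two derivative components are determined by the function on the half interval, so the values
alone identify an element. -/
lemma eq_zero (hw : ∀ x ∈ Dom, 0 < w x) (F : Z w) (h : ∀ x ∈ Dom, fn F x = 0) : F = 0 := by
  have h0 : ∀ x ∈ Half, fn F x = 0 := fun x hx => h x (half_subset_dom hx)
  have h1 : ∀ x ∈ Half, d1 F x = 0 := fun x hx =>
    (hasDerivAt_fn F hx).unique (((hasDerivAt_const x 0).congr_of_eventuallyEq
      (eventuallyEq_of_mem (isOpen_Ioo.mem_nhds hx) h0)))
  have h2 : ∀ x ∈ Half, d2 F x = 0 := fun x hx =>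
    (hasDerivAt_d1 F hx).unique (((hasDerivAt_const x 0).congr_of_eventuallyEq
      (eventuallyEq_of_mem (isOpen_Ioo.mem_nhds hx) h1)))
  apply Subtype.ext
  refine Prod.ext (extz_eq_zero fun x hx => ?_) (Prod.ext (extz_eq_zero h1) (extz_eq_zero h2))
  exact (mul_eq_zero.1 (h x hx)).resolve_left (hw x hx).ne'

lemma exists_of (hw : ∀ x ∈ Dom, 0 < w x) (hwc : ContinuousOn w Dom) {f f1 f2 : ℝ → ℝ} {N : ℝ}
    (hN : 0 ≤ N) (hf : ContinuousOn f Dom) (h1 : ∀ x ∈ Half, HasDerivAt f (f1 x) x)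
    (h2 : ∀ x ∈ Half, HasDerivAt f1 (f2 x) x) (h3 : ContinuousOn f2 Half)
    (b0 : ∀ x ∈ Dom, |f x| ≤ N * w x) (b1 : ∀ x ∈ Half, |f1 x| ≤ N) (b2 : ∀ x ∈ Half, |f2 x| ≤ N) :
    ∃ F : Z w, (∀ x ∈ Dom, fn F x = f x) ∧ ‖F‖ ≤ N := by
  obtain ⟨F0, e0, n0⟩ := exists_bcf (g := fun x => f x / w x) (hf.div hwc fun x hx => (hw x hx).ne')
    hN fun x hx => by
      rw [abs_div, abs_of_pos (hw x hx), div_le_iff₀ (hw x hx)]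
      exact b0 x hx
  obtain ⟨F1, e1, n1⟩ := exists_bcf (fun x hx => (h2 x hx).continuousAt.continuousWithinAt) hN b1
  obtain ⟨F2, e2, n2⟩ := exists_bcf h3 hN b2
  have e0' : ∀ x ∈ Dom, w x * extz F0 x = f x := fun x hx => by
    rw [e0 x hx, mul_div_cancel₀ _ (hw x hx).ne']
  refine ⟨⟨(F0, F1, F2), fun x hx => ⟨?_, ?_⟩⟩, e0', ?_⟩
  · refine ((h1 x hx).congr_of_eventuallyEq ?_).congr_deriv (e1 x hx).symm
    exact eventuallyEq_of_mem (isOpen_Ioo.mem_nhds (half_subset_dom hx)) e0'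
  · refine ((h2 x hx).congr_of_eventuallyEq ?_).congr_deriv (e2 x hx).symm
    exact eventuallyEq_of_mem (isOpen_Ioo.mem_nhds hx) e1
  · exact max_le n0 (max_le n1 n2)

/-- Products as a bounded bilinear map. -/
lemma exists_mul {w₁ w₂ w₃ : ℝ → ℝ} (hw₁ : ∀ x ∈ Dom, 0 < w₁ x) (hw₂ : ∀ x ∈ Dom, 0 < w₂ x)
    (hw₃ : ∀ x ∈ Dom, 0 < w₃ x) (hc₁ : ContinuousOn w₁ Dom) (hc₂ : ContinuousOn w₂ Dom)
    (hc₃ : ContinuousOn w₃ Dom) {C : ℝ} (hC : 0 ≤ C) (hle : ∀ x ∈ Dom, w₁ x * w₂ x ≤ C * w₃ x) :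
    ∃ L : Z w₁ →L[ℝ] Z w₂ →L[ℝ] Z w₃, ∀ F G, ∀ x ∈ Dom, fn (L F G) x = fn F x * fn G x := by
  -- bounds of `w₁`, `w₂` on the half interval
  have hbd : ∀ w : ℝ → ℝ, ContinuousOn w Dom → ∃ K, 0 ≤ K ∧ ∀ x ∈ Half, w x ≤ K := by
    intro w hw
    obtain ⟨K, hK⟩ := (isCompact_Icc (a := -(1 / 2 : ℝ)) (b := 1 / 2)).bddAbove_image
      (hw.mono fun x hx => ⟨by linarith [hx.1], by linarith [hx.2]⟩)
    exact ⟨max K 0, le_max_right _ _, fun x hx =>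
      (hK ⟨x, Ioo_subset_Icc_self hx, rfl⟩).trans (le_max_left _ _)⟩
  obtain ⟨K₁, hK₁0, hK₁⟩ := hbd w₁ hc₁
  obtain ⟨K₂, hK₂0, hK₂⟩ := hbd w₂ hc₂
  refine exists_bilin Dom (fnₗ w₃) (fun t ht => eq_zero hw₃ t ht) (fun F G x => fn F x * fn G x)
    (fun F F' G x _ => by simp only [fn_add]; ring) (fun r F G x _ => by simp only [fn_smul]; ring)
    (fun F G G' x _ => by simp only [fn_add]; ring) (fun r F G x _ => by simp only [fn_smul]; ring)
    (C + K₁ + K₂ + 2) fun F G => ?_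
  have hF : ∀ x ∈ Half, |fn F x| ≤ ‖F‖ * K₁ := fun x hx =>
    (abs_fn_le hw₁ F (half_subset_dom hx)).trans
      (mul_le_mul_of_nonneg_left (hK₁ x hx) (norm_nonneg _))
  have hG : ∀ x ∈ Half, |fn G x| ≤ ‖G‖ * K₂ := fun x hx =>
    (abs_fn_le hw₂ G (half_subset_dom hx)).trans
      (mul_le_mul_of_nonneg_left (hK₂ x hx) (norm_nonneg _))
  have n1 := norm_nonneg F
  have n2 := norm_nonneg G
  have hn : 0 ≤ ‖F‖ * ‖G‖ := mul_nonneg n1 n2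
  refine exists_of hw₃ hc₃ (f1 := fun x => d1 F x * fn G x + fn F x * d1 G x)
    (f2 := fun x => d2 F x * fn G x + d1 F x * d1 G x + (d1 F x * d1 G x + fn F x * d2 G x))
    (by positivity) ((continuousOn_fn hc₁ F).mul (continuousOn_fn hc₂ G))
    (fun x hx => (hasDerivAt_fn F hx).mul (hasDerivAt_fn G hx))
    (fun x hx => ((hasDerivAt_d1 F hx).mul (hasDerivAt_fn G hx)).add
      ((hasDerivAt_fn F hx).mul (hasDerivAt_d1 G hx))) ?_ ?_ ?_ ?_
  · have a1 := (continuousOn_fn hc₁ F).mono half_subset_dom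
    have a2 := (continuousOn_fn hc₂ G).mono half_subset_dom
    have a3 : ContinuousOn (d1 F) Half := continuousOn_extz _
    have a4 : ContinuousOn (d1 G) Half := continuousOn_extz _
    exact (((continuousOn_d2 F).mul a2).add (a3.mul a4)).add
      ((a3.mul a4).add (a1.mul (continuousOn_d2 G)))
  · intro x hx
    rw [abs_mul]
    have h3 := hw₃ x hx
    calc |fn F x| * |fn G x| ≤ (‖F‖ * w₁ x) * (‖G‖ * w₂ x) :=
          mul_le_mul (abs_fn_le hw₁ F hx) (abs_fn_le hw₂ G hx) (abs_nonneg _)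
            (mul_nonneg n1 (hw₁ x hx).le)
      _ = ‖F‖ * ‖G‖ * (w₁ x * w₂ x) := by ring
      _ ≤ ‖F‖ * ‖G‖ * (C * w₃ x) := mul_le_mul_of_nonneg_left (hle x hx) hn
      _ ≤ _ := by
          have : 0 ≤ ‖F‖ * ‖G‖ * (K₁ + K₂ + 2) * w₃ x := by positivity
          linarith
  · intro x hx
    have e1 : |d1 F x * fn G x| ≤ ‖F‖ * (‖G‖ * K₂) := by
      rw [abs_mul]
      exact mul_le_mul (abs_d1_le F x) (hG x hx) (abs_nonneg _) n1
    have e2 : |fn F x * d1 G x| ≤ ‖F‖ * K₁ * ‖G‖ := by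
      rw [abs_mul]
      exact mul_le_mul (hF x hx) (abs_d1_le G x) (abs_nonneg _) (mul_nonneg n1 hK₁0)
    have := abs_add_le (d1 F x * fn G x) (fn F x * d1 G x)
    have h5 : 0 ≤ (C + 2) * (‖F‖ * ‖G‖) := by positivity
    linarith
  · intro x hx
    have e1 : |d2 F x * fn G x| ≤ ‖F‖ * (‖G‖ * K₂) := by
      rw [abs_mul]
      exact mul_le_mul (abs_d2_le F x) (hG x hx) (abs_nonneg _) n1
    have e2 : |fn F x * d2 G x| ≤ ‖F‖ * K₁ * ‖G‖ := by
      rw [abs_mul]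
      exact mul_le_mul (hF x hx) (abs_d2_le G x) (abs_nonneg _) (mul_nonneg n1 hK₁0)
    have e3 : |d1 F x * d1 G x| ≤ ‖F‖ * ‖G‖ := by
      rw [abs_mul]
      exact mul_le_mul (abs_d1_le F x) (abs_d1_le G x) (abs_nonneg _) n1
    have i1 := abs_add_le (d2 F x * fn G x + d1 F x * d1 G x) (d1 F x * d1 G x + fn F x * d2 G x)
    have i2 := abs_add_le (d2 F x * fn G x) (d1 F x * d1 G x)
    have i3 := abs_add_le (d1 F x * d1 G x) (fn F x * d2 G x)
    have h5 : 0 ≤ C * (‖F‖ * ‖G‖) := by positivity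
    linarith

end Z

/-! ### The weights -/

lemma lam_ge {x : ℝ} (hx : x ∈ Dom) : Real.log (3 / 2) ≤ lam x := by
  have h1 : 0 < 1 + x := by linarith [hx.1]
  rw [lam_eq hx.1, Real.log_div (by norm_num) (by norm_num)]
  have := Real.log_le_log h1 (by linarith [hx.2] : 1 + x ≤ 2)
  linarith

lemma log_three_half_pos : 0 < Real.log (3 / 2) := Real.log_pos (by norm_num)

lemma lam_pos {x : ℝ} (hx : x ∈ Dom) : 0 < lam x := log_three_half_pos.trans_le (lam_ge hx)

lemma hasDerivAt_lam {x : ℝ} (hx : x ∈ Dom) : HasDerivAt lam (-(1 / (1 + x))) x := by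
  have h1 : 1 + x ≠ 0 := by linarith [hx.1]
  refine (((((hasDerivAt_id x).const_add 1).div_const 3).log (by
    simp only [id]
    exact div_ne_zero h1 (by norm_num))).neg).congr_deriv ?_
  simp only [id]
  field_simp

lemma continuousOn_lam : ContinuousOn lam Dom := fun _ hx =>
  (hasDerivAt_lam hx).continuousAt.continuousWithinAt

/-- `(1-x)^σ / λ(x)`. -/
def Gw (σ x : ℝ) : ℝ := (1 - x) ^ σ / lam x

/-- `(1-x)^σ / λ(x)²`. -/
def Hw (σ x : ℝ) : ℝ := (1 - x) ^ σ / lam x ^ 2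

lemma Gw_pos (σ : ℝ) : ∀ x ∈ Dom, 0 < Gw σ x := fun _ hx =>
  div_pos (Real.rpow_pos_of_pos (by linarith [hx.2]) _) (lam_pos hx)

lemma Hw_pos (σ : ℝ) : ∀ x ∈ Dom, 0 < Hw σ x := fun _ hx =>
  div_pos (Real.rpow_pos_of_pos (by linarith [hx.2]) _) (pow_pos (lam_pos hx) 2)

lemma continuousOn_one_sub_rpow (σ : ℝ) : ContinuousOn (fun x : ℝ => (1 - x) ^ σ) Dom :=
  ContinuousOn.rpow_const (by fun_prop) fun x hx => Or.inl (by linarith [hx.2])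

lemma continuousOn_Gw (σ : ℝ) : ContinuousOn (Gw σ) Dom :=
  (continuousOn_one_sub_rpow σ).div continuousOn_lam fun _ hx => (lam_pos hx).ne'

lemma continuousOn_Hw (σ : ℝ) : ContinuousOn (Hw σ) Dom :=
  (continuousOn_one_sub_rpow σ).div (continuousOn_lam.pow 2) fun _ hx => (pow_pos (lam_pos hx) 2).ne'

/-- A product of two functions of size 1/λ gains a logarithm and lands in the weight 1/λ² of
admissible sources for the θ-equation. This closes the quadratic fixed point. -/
lemma Gw_zero_mul (σ x : ℝ) : Gw 0 x * Gw σ x = Hw σ x := by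
  unfold Gw Hw
  rw [Real.rpow_zero, div_mul_div_comm, one_mul, sq]

lemma Gw_mul_self_le {σ : ℝ} (hσ : 0 ≤ σ) {x : ℝ} (hx : x ∈ Dom) :
    Gw σ x * Gw σ x ≤ 2 ^ σ * Hw σ x := by
  have h1 : 0 < 1 - x := by linarith [hx.2]
  have h2 : (1 - x) ^ σ ≤ 2 ^ σ := Real.rpow_le_rpow h1.le (by linarith [hx.1]) hσ
  have h3 : Gw σ x * Gw σ x = (1 - x) ^ σ * Hw σ x := by
    unfold Gw Hw
    ring
  rw [h3]
  exact mul_le_mul_of_nonneg_right h2 (Hw_pos σ x hx).le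

lemma Hw_eq (σ x : ℝ) : Hw σ x = Gw σ x / lam x := by
  unfold Gw Hw
  rw [div_div, sq]

lemma Hw_le_Gw (σ : ℝ) {x : ℝ} (hx : x ∈ Dom) : Hw σ x ≤ (Real.log (3 / 2))⁻¹ * Gw σ x := by
  rw [Hw_eq, div_eq_inv_mul]
  exact mul_le_mul_of_nonneg_right (inv_anti₀ log_three_half_pos (lam_ge hx)) (Gw_pos σ x hx).le

/-- A continuous function on `(-1,1)` is bounded on the half interval. -/
lemma exists_bounds_half {g : ℝ → ℝ} (hg : ContinuousOn g Dom) :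
    ∃ K, 0 ≤ K ∧ ∀ x ∈ Half, |g x| ≤ K := by
  obtain ⟨K, hK⟩ := (isCompact_Icc (a := -(1 / 2 : ℝ)) (b := 1 / 2)).bddAbove_image
    (hg.abs.mono fun x hx => ⟨by linarith [hx.1], by linarith [hx.2]⟩)
  exact ⟨max K 0, le_max_right _ _, fun x hx =>
    (hK ⟨x, Ioo_subset_Icc_self hx, rfl⟩).trans (le_max_left _ _)⟩

open scoped BoundedContinuousFunction

/-! ### Constructing and reading elements of `M₁` and `M₂` -/

lemma IsM1.zero_outside_dom {p : Pole} {ε : ℝ} {f : ℝ → ℝ} (hf : IsM1 p ε f) {x : ℝ}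
    (hx : x ∉ Dom) : f x = 0 := by
  by_cases h : x ∈ Icc (-1 : ℝ) 1
  · rcases eq_or_lt_of_le h.1 with e | l
    · rw [← e]; exact hf.left
    · rcases eq_or_lt_of_le h.2 with e | l'
      · rw [e]; exact hf.right
      · exact absurd ⟨l, l'⟩ hx
  · exact hf.outside x h

lemma M1.ext_dom {p : Pole} {ε : ℝ} {F G : M1 p ε} (h : ∀ x ∈ Dom, F.fn x = G.fn x) : F = G := by
  apply M1.fn_injective
  funext x
  by_cases hx : x ∈ Dom
  · exact h x hx
  · rw [F.isM1.zero_outside_dom hx, G.isM1.zero_outside_dom hx]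

lemma M2.ext_dom {ε : ℝ} {F G : M2 ε} (h : ∀ x ∈ Dom, F.fn x = G.fn x) : F = G := by
  apply M2.fn_injective
  funext x
  by_cases hx : x ∈ Dom
  · exact h x hx
  · rw [F.isM2.outside x hx, G.isM2.outside x hx]

lemma deriv_eq_of_hasDerivAt {f g f1 : ℝ → ℝ} {D : Set ℝ} (hD : IsOpen D)
    (h1 : ∀ x ∈ D, HasDerivAt f (f1 x) x) (he : ∀ x ∈ D, g x = f x) :
    ∀ x ∈ D, HasDerivAt g (f1 x) x := fun x hx =>
  (h1 x hx).congr_of_eventuallyEq (eventuallyEq_of_mem (hD.mem_nhds hx) he)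

lemma contDiffOn_one_of_hasDerivAt {f f1 : ℝ → ℝ} {D : Set ℝ} (hD : IsOpen D)
    (h1 : ∀ x ∈ D, HasDerivAt f (f1 x) x) (hc : ContinuousOn f1 D) : ContDiffOn ℝ 1 f D := by
  rw [show (1 : WithTop ℕ∞) = 0 + 1 from rfl, contDiffOn_succ_iff_deriv_of_isOpen hD]
  exact ⟨fun x hx => (h1 x hx).differentiableAt.differentiableWithinAt, by simp,
    contDiffOn_zero.2 (hc.congr fun x hx => (h1 x hx).deriv)⟩

lemma contDiffOn_succ_of_hasDerivAt {f f1 : ℝ → ℝ} {D : Set ℝ} (hD : IsOpen D) {n : ℕ}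
    (h1 : ∀ x ∈ D, HasDerivAt f (f1 x) x) (hc : ContDiffOn ℝ n f1 D) :
    ContDiffOn ℝ (n + 1 : ℕ) f D := by
  rw [show ((n + 1 : ℕ) : WithTop ℕ∞) = (n : WithTop ℕ∞) + 1 from rfl,
    contDiffOn_succ_iff_deriv_of_isOpen hD]
  exact ⟨fun x hx => (h1 x hx).differentiableAt.differentiableWithinAt, by simp,
    hc.congr fun x hx => (h1 x hx).deriv⟩

lemma iteratedDeriv_succ_eq_of_hasDerivAt {f f1 f2 : ℝ → ℝ} {D : Set ℝ} (hD : IsOpen D) {n : ℕ}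
    (h1 : ∀ x ∈ D, HasDerivAt f1 (f2 x) x) (he : ∀ x ∈ D, iteratedDeriv n f x = f1 x) :
    ∀ x ∈ D, iteratedDeriv (n + 1) f x = f2 x := by
  intro x hx
  rw [iteratedDeriv_succ]
  exact (deriv_eq_of_hasDerivAt hD h1 he x hx).deriv

lemma wt0_south (ε x : ℝ) : wt0 .south ε x = -(lam x * (1 - x) ^ (-1 + 2 * ε)) := by
  simp only [wt0, Pole.sign, lam, one_mul]
  ring

lemma wt1_south (ε x : ℝ) : wt1 .south ε x = (1 + x) * lam x ^ 2 * (1 - x) ^ (2 * ε) := by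
  simp only [wt1, Pole.sign, lam, one_mul]
  ring

/-- This fixes the exponent σ = 1 - 2ε: the weights of M₁ are, up to sign, exact reciprocals of the
barrier functions, so pointwise bounds and norms convert without loss. -/
lemma abs_wt0_mul_Gw (ε : ℝ) {x : ℝ} (hx : x ∈ Dom) : |wt0 .south ε x| * Gw (1 - 2 * ε) x = 1 := by
  have h1 : 0 < 1 - x := by linarith [hx.2]
  have h2 := lam_pos hx
  rw [wt0_south, abs_neg, abs_of_pos (mul_pos h2 (Real.rpow_pos_of_pos h1 _)), Gw]
  have h3 : (1 - x) ^ (-1 + 2 * ε) * (1 - x) ^ (1 - 2 * ε) = 1 := by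
    rw [← Real.rpow_add h1]
    simp
  field_simp
  linarith

lemma abs_wt1_mul_Hw (ε : ℝ) {x : ℝ} (hx : x ∈ Dom) :
    |wt1 .south ε x| * (Hw (1 - 2 * ε) x / (1 - x ^ 2)) = 1 := by
  have h1 : 0 < 1 - x := by linarith [hx.2]
  have h1' : 0 < 1 + x := by linarith [hx.1]
  have h2 := lam_pos hx
  rw [wt1_south, abs_of_pos (mul_pos (mul_pos h1' (pow_pos h2 2)) (Real.rpow_pos_of_pos h1 _)), Hw]
  have h3 : (1 - x) ^ (2 * ε) * (1 - x) ^ (1 - 2 * ε) = 1 - x := by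
    rw [← Real.rpow_add h1]
    simp
  rw [show 1 - x ^ 2 = (1 + x) * (1 - x) by ring]
  field_simp
  linarith

lemma tendsto_Gw_left (σ : ℝ) : Tendsto (Gw σ) (𝓝[>] (-1)) (𝓝 0) := by
  have h1 : Tendsto (fun x : ℝ => (1 - x) ^ σ) (𝓝[>] (-1)) (𝓝 ((1 - -1) ^ σ)) := by
    refine Tendsto.mono_left ?_ nhdsWithin_le_nhds
    exact ContinuousAt.rpow_const (by fun_prop) (Or.inl (by norm_num))
  have := h1.mul tendsto_lam.inv_tendsto_atTop
  rw [mul_zero] at this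
  exact this

lemma tendsto_Gw_right {σ : ℝ} (hσ : 0 < σ) : Tendsto (Gw σ) (𝓝[<] 1) (𝓝 0) := by
  have h1 : Tendsto (fun x : ℝ => (1 - x) ^ σ) (𝓝[<] 1) (𝓝 ((1 - 1) ^ σ)) := by
    refine Tendsto.mono_left ?_ nhdsWithin_le_nhds
    exact ContinuousAt.rpow_const (by fun_prop) (Or.inr hσ.le)
  rw [sub_self, Real.zero_rpow hσ.ne'] at h1
  have h2 : ContinuousAt lam 1 := by
    unfold lam
    exact (ContinuousAt.log (by fun_prop) (by norm_num)).neg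
  have h3 : Tendsto (fun x => (lam x)⁻¹) (𝓝[<] 1) (𝓝 (lam 1)⁻¹) :=
    (h2.inv₀ (by
      unfold lam
      rw [neg_ne_zero]
      exact (Real.log_neg (by norm_num) (by norm_num)).ne)).mono_left nhdsWithin_le_nhds
  have := h1.mul h3
  rw [zero_mul] at this
  exact this

lemma tendsto_zero_of_abs_le {f g : ℝ → ℝ} {l : Filter ℝ} {N : ℝ} (hg : Tendsto g l (𝓝 0))
    (h : ∀ᶠ x in l, |f x| ≤ N * g x) : Tendsto f l (𝓝 0) := by
  have := hg.const_mul N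
  rw [mul_zero] at this
  exact squeeze_zero_norm' h this

lemma dom_mem_left : Dom ∈ 𝓝[>] (-1 : ℝ) := Ioo_mem_nhdsGT (by norm_num)

lemma dom_mem_right : Dom ∈ 𝓝[<] (1 : ℝ) := Ioo_mem_nhdsLT (by norm_num)

lemma M1.exists_mk {p : Pole} {ε : ℝ} {f : ℝ → ℝ} (h : IsM1 p ε f) : ∃ F : M1 p ε, F.fn = f :=
  ⟨(⟨f, h⟩ : M1sub p ε), rfl⟩

lemma M2.exists_mk {ε : ℝ} {f : ℝ → ℝ} (h : IsM2 ε f) : ∃ F : M2 ε, F.fn = f :=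
  ⟨(⟨f, h⟩ : M2sub ε), rfl⟩

/-- Extension by zero is continuous on [-1,1] because `Gw (1 - 2 * ε)` vanishes at both ends:
logarithmically at -1, and as a positive power of 1 - x at 1. The factor 4 counts the summands of
the norm. -/
lemma M1.exists_of {ε : ℝ} (hε : ε < 1 / 2) {f f1 f2 f3 : ℝ → ℝ} {N : ℝ} (hN : 0 ≤ N)
    (h1 : ∀ x ∈ Dom, HasDerivAt f (f1 x) x) (hc1 : ContinuousOn f1 Dom)
    (h2 : ∀ x ∈ Half, HasDerivAt f1 (f2 x) x) (h3 : ∀ x ∈ Half, HasDerivAt f2 (f3 x) x)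
    (hc3 : ContinuousOn f3 Half) (b0 : ∀ x ∈ Dom, |f x| ≤ N * Gw (1 - 2 * ε) x)
    (b1 : ∀ x ∈ Dom, |f1 x| ≤ N * (Hw (1 - 2 * ε) x / (1 - x ^ 2)))
    (b2 : ∀ x ∈ Half, |f2 x| ≤ N) (b3 : ∀ x ∈ Half, |f3 x| ≤ N) :
    ∃ F : M1 .south ε, (∀ x ∈ Dom, F.fn x = f x) ∧ ‖F‖ ≤ 4 * N := by
  have hσ : 0 < 1 - 2 * ε := by linarith
  set g : ℝ → ℝ := Dom.indicator f with hg
  have hgf : ∀ x ∈ Dom, g x = f x := fun x hx => indicator_of_mem hx f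
  have hgo : ∀ x, x ∉ Dom → g x = 0 := fun x hx => indicator_of_notMem hx f
  have hg1 : ∀ x ∈ Dom, HasDerivAt g (f1 x) x := deriv_eq_of_hasDerivAt isOpen_Ioo h1 hgf
  have i1 : ∀ x ∈ Half, iteratedDeriv 1 g x = f1 x := fun x hx => by
    rw [iteratedDeriv_one]
    exact (hg1 x (half_subset_dom hx)).deriv
  have i2 : ∀ x ∈ Half, iteratedDeriv 2 g x = f2 x :=
    iteratedDeriv_succ_eq_of_hasDerivAt isOpen_Ioo h2 i1
  have i3 : ∀ x ∈ Half, iteratedDeriv 3 g x = f3 x :=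
    iteratedDeriv_succ_eq_of_hasDerivAt isOpen_Ioo h3 i2
  have hl : Tendsto g (𝓝[>] (-1)) (𝓝 (g (-1))) := by
    rw [hgo (-1) (by simp)]
    refine tendsto_zero_of_abs_le (tendsto_Gw_left (1 - 2 * ε)) (N := N) ?_
    filter_upwards [dom_mem_left] with x hx
    rw [hgf x hx]
    exact b0 x hx
  have hr : Tendsto g (𝓝[<] 1) (𝓝 (g 1)) := by
    rw [hgo 1 (by simp)]
    refine tendsto_zero_of_abs_le (tendsto_Gw_right hσ) (N := N) ?_
    filter_upwards [dom_mem_right] with x hx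
    rw [hgf x hx]
    exact b0 x hx
  have hcont : ContinuousOn g (Icc (-1) 1) := by
    intro x hx
    rcases eq_or_lt_of_le hx.1 with e | l
    · rw [← e]
      refine ContinuousWithinAt.mono (t := Ici (-1)) ?_ Icc_subset_Ici_self
      exact continuousWithinAt_Ioi_iff_Ici.1 hl
    · rcases eq_or_lt_of_le hx.2 with e | l'
      · rw [e]
        refine ContinuousWithinAt.mono (t := Iic 1) ?_ Icc_subset_Iic_self
        exact continuousWithinAt_Iio_iff_Iic.1 hr
      · exact (hg1 x ⟨l, l'⟩).continuousAt.continuousWithinAt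
  have c0 : ∀ x ∈ Dom, |wt0 .south ε x * g x| ≤ N := fun x hx => by
    rw [abs_mul, hgf x hx]
    calc |wt0 .south ε x| * |f x| ≤ |wt0 .south ε x| * (N * Gw (1 - 2 * ε) x) :=
          mul_le_mul_of_nonneg_left (b0 x hx) (abs_nonneg _)
      _ = N * (|wt0 .south ε x| * Gw (1 - 2 * ε) x) := by ring
      _ = N := by rw [abs_wt0_mul_Gw ε hx, mul_one]
  have c1 : ∀ x ∈ Dom, |wt1 .south ε x * deriv g x| ≤ N := fun x hx => by
    rw [abs_mul, (hg1 x hx).deriv]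
    calc |wt1 .south ε x| * |f1 x| ≤ |wt1 .south ε x| * (N * (Hw (1 - 2 * ε) x / (1 - x ^ 2))) :=
          mul_le_mul_of_nonneg_left (b1 x hx) (abs_nonneg _)
      _ = N * (|wt1 .south ε x| * (Hw (1 - 2 * ε) x / (1 - x ^ 2))) := by ring
      _ = N := by rw [abs_wt1_mul_Hw ε hx, mul_one]
  have c2 : ∀ x ∈ Half, |(1 : ℝ) * iteratedDeriv 2 g x| ≤ N := fun x hx => by
    rw [one_mul, i2 x hx]
    exact b2 x hx
  have c3 : ∀ x ∈ Half, |(1 : ℝ) * iteratedDeriv 3 g x| ≤ N := fun x hx => by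
    rw [one_mul, i3 x hx]
    exact b3 x hx
  have hM : IsM1 .south ε g :=
    { outside := fun x hx => hgo x fun h => hx (Ioo_subset_Icc_self h)
      smooth3 := by
        have s1 := contDiffOn_succ_of_hasDerivAt isOpen_Ioo (n := 0) h3
          (by rw [Nat.cast_zero]; exact contDiffOn_zero.2 hc3)
        have s2 := contDiffOn_succ_of_hasDerivAt isOpen_Ioo h2 s1
        have s3 := contDiffOn_succ_of_hasDerivAt isOpen_Ioo
          (fun x hx => hg1 x (half_subset_dom hx)) s2
        exact_mod_cast s3
      smooth1 := contDiffOn_one_of_hasDerivAt isOpen_Ioo hg1 hc1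
      cont := hcont
      left := hgo _ (by simp)
      right := hgo _ (by simp)
      bdd0 := wbdd_of_le c0
      bdd1 := wbdd_of_le c1
      bdd2 := wbdd_of_le c2
      bdd3 := wbdd_of_le c3 }
  obtain ⟨F, hF⟩ := M1.exists_mk hM
  refine ⟨F, hF ▸ hgf, ?_⟩
  have n0 := wnorm_le hN c0
  have n1 := wnorm_le hN c1
  have n2 := wnorm_le (w := fun _ => 1) hN c2
  have n3 := wnorm_le (w := fun _ => 1) hN c3
  rw [M1.norm_def, hF]
  linarith

lemma wphi_pos (a : ℝ) {x : ℝ} (hx : x ∈ Dom) : 0 < wphi a x :=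
  Real.rpow_pos_of_pos (one_sub_sq_pos hx) _

lemma wphi_mul (a b : ℝ) {x : ℝ} (hx : x ∈ Dom) : wphi a x * wphi b x = wphi (a + b) x :=
  (Real.rpow_add (one_sub_sq_pos hx) _ _).symm

lemma wphi_zero (x : ℝ) : wphi 0 x = 1 := Real.rpow_zero _

lemma wphi_one (x : ℝ) : wphi 1 x = 1 - x ^ 2 := Real.rpow_one _

lemma wphi_neg_mul (a : ℝ) {x : ℝ} (hx : x ∈ Dom) : wphi (-a) x * wphi a x = 1 := by
  rw [wphi_mul _ _ hx, neg_add_cancel, wphi_zero]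

lemma continuousOn_wphi (a : ℝ) : ContinuousOn (wphi a) Dom :=
  ContinuousOn.rpow_const (by fun_prop) fun _ hx => Or.inl (one_sub_sq_pos hx).ne'

lemma wphi_le_one {a : ℝ} (ha : 0 ≤ a) {x : ℝ} (hx : x ∈ Dom) : wphi a x ≤ 1 :=
  Real.rpow_le_one (one_sub_sq_pos hx).le (by nlinarith [sq_nonneg x]) ha

lemma hasDerivAt_wphi (a : ℝ) {x : ℝ} (hx : x ∈ Dom) :
    HasDerivAt (wphi a) (-2 * a * x * wphi (a - 1) x) x := by
  have h1 : HasDerivAt (fun x : ℝ => 1 - x ^ 2) (-(2 * x)) x := by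
    simpa using (hasDerivAt_pow 2 x).const_sub 1
  refine (h1.rpow_const (p := a) (Or.inl (one_sub_sq_pos hx).ne')).congr_deriv ?_
  unfold wphi
  ring

lemma M2.exists_of {ε : ℝ} {g g1 g2 : ℝ → ℝ} {N : ℝ} (hN : 0 ≤ N)
    (h1 : ∀ x ∈ Dom, HasDerivAt g (g1 x) x) (h2 : ∀ x ∈ Dom, HasDerivAt g1 (g2 x) x)
    (hc : ContinuousOn g2 Dom) (b0 : ∀ x ∈ Dom, |g x| ≤ N * wphi (-ε) x)
    (b1 : ∀ x ∈ Dom, |g1 x| ≤ N * wphi (-(1 + ε)) x)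
    (b2 : ∀ x ∈ Dom, |g2 x| ≤ N * wphi (-(2 + ε)) x) :
    ∃ F : M2 ε, (∀ x ∈ Dom, F.fn x = g x) ∧ ‖F‖ ≤ 3 * N := by
  set f : ℝ → ℝ := Dom.indicator g with hf
  have hgf : ∀ x ∈ Dom, f x = g x := fun x hx => indicator_of_mem hx g
  have hf1 : ∀ x ∈ Dom, HasDerivAt f (g1 x) x := deriv_eq_of_hasDerivAt isOpen_Ioo h1 hgf
  have i1 : ∀ x ∈ Dom, iteratedDeriv 1 f x = g1 x := fun x hx => by
    rw [iteratedDeriv_one]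
    exact (hf1 x hx).deriv
  have i2 : ∀ x ∈ Dom, iteratedDeriv 2 f x = g2 x :=
    iteratedDeriv_succ_eq_of_hasDerivAt isOpen_Ioo h2 i1
  have key : ∀ (a : ℝ) (u v : ℝ → ℝ), (∀ x ∈ Dom, u x = v x) →
      (∀ x ∈ Dom, |v x| ≤ N * wphi (-a) x) → ∀ x ∈ Dom, |wphi a x * u x| ≤ N := by
    intro a u v huv hv x hx
    rw [abs_mul, huv x hx, abs_of_pos (wphi_pos a hx)]
    calc wphi a x * |v x| ≤ wphi a x * (N * wphi (-a) x) :=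
          mul_le_mul_of_nonneg_left (hv x hx) (wphi_pos a hx).le
      _ = N * (wphi (-a) x * wphi a x) := by ring
      _ = N := by rw [wphi_neg_mul a hx, mul_one]
  have c0 := key ε f g hgf b0
  have c1 := key (1 + ε) (deriv f) g1 (fun x hx => (hf1 x hx).deriv) b1
  have c2 := key (2 + ε) (iteratedDeriv 2 f) g2 i2 b2
  have hM : IsM2 ε f :=
    { outside := fun x hx => indicator_of_notMem hx g
      smooth2 := by
        have s1 := contDiffOn_succ_of_hasDerivAt isOpen_Ioo (n := 0) h2
          (by rw [Nat.cast_zero]; exact contDiffOn_zero.2 hc)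
        have s2 := contDiffOn_succ_of_hasDerivAt isOpen_Ioo hf1 s1
        exact_mod_cast s2
      bdd0 := wbdd_of_le c0
      bdd1 := wbdd_of_le c1
      bdd2 := wbdd_of_le c2 }
  obtain ⟨F, hF⟩ := M2.exists_mk hM
  refine ⟨F, hF ▸ hgf, ?_⟩
  have n0 := wnorm_le hN c0
  have n1 := wnorm_le hN c1
  have n2 := wnorm_le hN c2
  rw [M2.norm_def, hF]
  linarith

/-! ### Pointwise bounds read off the M₁ norm -/

section M1read

variable {p : Pole} {ε : ℝ} (F : M1 p ε)

lemma M1.wnorm_le_norm : wnorm Dom (wt0 p ε) F.fn ≤ ‖F‖ ∧ wnorm Dom (wt1 p ε) (deriv F.fn) ≤ ‖F‖ ∧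
    wnorm Half (fun _ => 1) (iteratedDeriv 2 F.fn) ≤ ‖F‖ := by
  have h := @wnorm_nonneg
  have h0 := h Dom (wt0 p ε) F.fn
  have h1 := h Dom (wt1 p ε) (deriv F.fn)
  have h2 := h Half (fun _ => 1) (iteratedDeriv 2 F.fn)
  have h3 := h Half (fun _ => 1) (iteratedDeriv 3 F.fn)
  rw [M1.norm_def]
  refine ⟨?_, ?_, ?_⟩ <;> linarith

lemma M1.hasDerivAt_fn {x : ℝ} (hx : x ∈ Dom) : HasDerivAt F.fn (deriv F.fn x) x :=
  ((F.isM1.smooth1.differentiableOn (by norm_num)).differentiableAt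
    (isOpen_Ioo.mem_nhds hx)).hasDerivAt

lemma M1.continuousOn_fn : ContinuousOn F.fn Dom := F.isM1.smooth1.continuousOn

end M1read

lemma M1.abs_fn_le {ε : ℝ} (F : M1 .south ε) {x : ℝ} (hx : x ∈ Dom) :
    |F.fn x| ≤ ‖F‖ * Gw (1 - 2 * ε) x := by
  have h1 := (le_wnorm F.isM1.bdd0 hx).trans F.wnorm_le_norm.1
  rw [abs_mul] at h1
  calc |F.fn x| = |wt0 .south ε x| * |F.fn x| * Gw (1 - 2 * ε) x := by
        rw [mul_right_comm, abs_wt0_mul_Gw ε hx, one_mul]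
    _ ≤ _ := mul_le_mul_of_nonneg_right h1 (Gw_pos _ x hx).le

lemma M1.abs_deriv_le {ε : ℝ} (F : M1 .south ε) {x : ℝ} (hx : x ∈ Dom) :
    |deriv F.fn x| ≤ ‖F‖ * (Hw (1 - 2 * ε) x / (1 - x ^ 2)) := by
  have h1 := (le_wnorm F.isM1.bdd1 hx).trans F.wnorm_le_norm.2.1
  rw [abs_mul] at h1
  calc |deriv F.fn x| = |wt1 .south ε x| * |deriv F.fn x| * (Hw (1 - 2 * ε) x / (1 - x ^ 2)) := by
        rw [mul_right_comm, abs_wt1_mul_Hw ε hx, one_mul]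
    _ ≤ _ := mul_le_mul_of_nonneg_right h1 (div_pos (Hw_pos _ x hx) (one_sub_sq_pos hx)).le

/-- The inclusion of `M₁` into the space of functions `O(Gw)`. -/
lemma M1.exists_toZ (ε : ℝ) : ∃ L : M1 .south ε →L[ℝ] Z (Gw (1 - 2 * ε)),
    ∀ F, ∀ x ∈ Dom, Z.fn (L F) x = F.fn x := by
  obtain ⟨K, hK0, hK⟩ := exists_bounds_half (g := fun x => Hw (1 - 2 * ε) x / (1 - x ^ 2))
    (continuousOn_div_one_sub_sq (continuousOn_Hw _))
  refine exists_clm_of_rel (fun (F : M1 .south ε) t => ∀ x ∈ Dom, Z.fn t x = F.fn x)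
    (fun a b s t h h' x hx => by rw [Z.fn_add, h x hx, h' x hx, M1.fn_add, Pi.add_apply])
    (fun r a t h x hx => by rw [Z.fn_smul, h x hx, M1.fn_smul, Pi.smul_apply, smul_eq_mul])
    (fun t h => Z.eq_zero (Gw_pos _) t fun x hx => by rw [h x hx, M1.fn_zero]; rfl) (1 + K) fun F => ?_
  have n0 := norm_nonneg F
  have hs2 := F.isM1.smooth2
  refine Z.exists_of (Gw_pos _) (continuousOn_Gw _) (f1 := deriv F.fn) (f2 := iteratedDeriv 2 F.fn)
    (by positivity) F.continuousOn_fn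
    (fun x hx => F.hasDerivAt_fn (half_subset_dom hx)) (fun x hx => ?_) ?_ ?_ ?_ ?_
  · have h1 : ContDiffOn ℝ 1 (deriv F.fn) Half :=
      ((contDiffOn_succ_iff_deriv_of_isOpen (n := 1) isOpen_Ioo).1 (by exact_mod_cast hs2)).2.2
    have h2 := ((h1.differentiableOn (by norm_num)).differentiableAt
      (isOpen_Ioo.mem_nhds hx)).hasDerivAt
    rwa [← iteratedDeriv_one, ← iteratedDeriv_succ, iteratedDeriv_one] at h2
  · exact (hs2.continuousOn_iteratedDerivWithin (m := 2) le_rfl isOpen_Ioo.uniqueDiffOn).congr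
      fun x hx => (iteratedDerivWithin_of_isOpen isOpen_Ioo hx).symm
  · intro x hx
    refine (F.abs_fn_le hx).trans (mul_le_mul_of_nonneg_right ?_ (Gw_pos _ x hx).le)
    nlinarith
  · intro x hx
    refine (F.abs_deriv_le (half_subset_dom hx)).trans ?_
    have := (le_abs_self _).trans (hK x hx)
    nlinarith [mul_le_mul_of_nonneg_left this n0]
  · intro x hx
    have h1 := (le_wnorm F.isM1.bdd2 hx).trans F.wnorm_le_norm.2.2
    rw [one_mul] at h1
    nlinarith

/-! ### Continuous functions with a weight `(1-x²)^{-a}` -/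

/-- The function `(1-x²)^{-a} F`. -/
def wfn (a : ℝ) (F : Dom →ᵇ ℝ) (x : ℝ) : ℝ := wphi (-a) x * extz F x

/-- `wfn a` as a linear map. -/
def wfnₗ (a : ℝ) : (Dom →ᵇ ℝ) →ₗ[ℝ] (ℝ → ℝ) where
  toFun := wfn a
  map_add' := fun F G => funext fun x => by simp only [wfn, extz_add, Pi.add_apply]; ring
  map_smul' := fun r F => funext fun x => by
    simp only [wfn, extz_smul, Pi.smul_apply, smul_eq_mul, RingHom.id_apply]; ring

lemma wfn_add (a : ℝ) (F G : Dom →ᵇ ℝ) (x : ℝ) : wfn a (F + G) x = wfn a F x + wfn a G x :=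
  congrFun ((wfnₗ a).map_add F G) x

lemma wfn_smul (a r : ℝ) (F : Dom →ᵇ ℝ) (x : ℝ) : wfn a (r • F) x = r * wfn a F x :=
  congrFun ((wfnₗ a).map_smul r F) x

lemma wfn_zero (a x : ℝ) : wfn a 0 x = 0 := congrFun (wfnₗ a).map_zero x

lemma wfn_eq_zero {a : ℝ} {F : Dom →ᵇ ℝ} (h : ∀ x ∈ Dom, wfn a F x = 0) : F = 0 :=
  extz_eq_zero fun x hx => (mul_eq_zero.1 (h x hx)).resolve_left (wphi_pos _ hx).ne'

lemma continuousOn_wfn (a : ℝ) (F : Dom →ᵇ ℝ) : ContinuousOn (wfn a F) Dom :=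
  (continuousOn_wphi _).mul (continuousOn_extz F)

lemma abs_wfn_le (a : ℝ) (F : Dom →ᵇ ℝ) {x : ℝ} (hx : x ∈ Dom) :
    |wfn a F x| ≤ ‖F‖ * wphi (-a) x := by
  unfold wfn
  rw [abs_mul, abs_of_pos (wphi_pos _ hx), mul_comm]
  exact mul_le_mul_of_nonneg_right (abs_extz_le _ _) (wphi_pos _ hx).le

lemma exists_wfn {a : ℝ} {g : ℝ → ℝ} {N : ℝ} (hN : 0 ≤ N) (hg : ContinuousOn g Dom)
    (hb : ∀ x ∈ Dom, |g x| ≤ N * wphi (-a) x) :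
    ∃ F : Dom →ᵇ ℝ, (∀ x ∈ Dom, wfn a F x = g x) ∧ ‖F‖ ≤ N := by
  obtain ⟨F, h1, h2⟩ := exists_bcf (g := fun x => wphi a x * g x) ((continuousOn_wphi a).mul hg) hN
    fun x hx => by
      rw [abs_mul, abs_of_pos (wphi_pos _ hx)]
      calc wphi a x * |g x| ≤ wphi a x * (N * wphi (-a) x) :=
            mul_le_mul_of_nonneg_left (hb x hx) (wphi_pos a hx).le
        _ = N * (wphi (-a) x * wphi a x) := by ring
        _ = N := by rw [wphi_neg_mul a hx, mul_one]
  refine ⟨F, fun x hx => ?_, h2⟩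
  rw [wfn, h1 x hx, ← mul_assoc, wphi_neg_mul a hx, one_mul]

/-! ### Pointwise bounds read off the M₂ norm -/

section M2read

variable {ε : ℝ} (F : M2 ε)

lemma M2.hasDerivAt_fn {x : ℝ} (hx : x ∈ Dom) : HasDerivAt F.fn (deriv F.fn x) x :=
  ((F.isM2.smooth1.differentiableOn (by norm_num)).differentiableAt
    (isOpen_Ioo.mem_nhds hx)).hasDerivAt

lemma M2.hasDerivAt_deriv {x : ℝ} (hx : x ∈ Dom) :
    HasDerivAt (deriv F.fn) (iteratedDeriv 2 F.fn x) x := by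
  have h1 : ContDiffOn ℝ 1 (deriv F.fn) Dom :=
    ((contDiffOn_succ_iff_deriv_of_isOpen (n := 1) isOpen_Ioo).1
      (by exact_mod_cast F.isM2.smooth2)).2.2
  have h2 := ((h1.differentiableOn (by norm_num)).differentiableAt
    (isOpen_Ioo.mem_nhds hx)).hasDerivAt
  rwa [← iteratedDeriv_one, ← iteratedDeriv_succ, iteratedDeriv_one] at h2

lemma M2.continuousOn_fn : ContinuousOn F.fn Dom := F.isM2.smooth2.continuousOn

lemma M2.continuousOn_deriv : ContinuousOn (deriv F.fn) Dom := fun _ hx =>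
  (F.hasDerivAt_deriv hx).continuousAt.continuousWithinAt

lemma M2.abs_fn_le {x : ℝ} (hx : x ∈ Dom) : |F.fn x| ≤ ‖F‖ * wphi (-ε) x := by
  have h0 : wnorm Dom (wphi ε) F.fn ≤ ‖F‖ := by
    rw [M2.norm_def]
    have := wnorm_nonneg Dom (wphi (1 + ε)) (deriv F.fn)
    have := wnorm_nonneg Dom (wphi (2 + ε)) (iteratedDeriv 2 F.fn)
    linarith
  have h1 := (le_wnorm F.isM2.bdd0 hx).trans h0
  rw [abs_mul, abs_of_pos (wphi_pos _ hx)] at h1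
  calc |F.fn x| = wphi (-ε) x * wphi ε x * |F.fn x| := by rw [wphi_neg_mul _ hx, one_mul]
    _ = wphi ε x * |F.fn x| * wphi (-ε) x := by ring
    _ ≤ _ := mul_le_mul_of_nonneg_right h1 (wphi_pos _ hx).le

lemma M2.abs_deriv_le {x : ℝ} (hx : x ∈ Dom) : |deriv F.fn x| ≤ ‖F‖ * wphi (-(1 + ε)) x := by
  have h0 : wnorm Dom (wphi (1 + ε)) (deriv F.fn) ≤ ‖F‖ := by
    rw [M2.norm_def]
    have := wnorm_nonneg Dom (wphi ε) F.fn
    have := wnorm_nonneg Dom (wphi (2 + ε)) (iteratedDeriv 2 F.fn)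
    linarith
  have h1 := (le_wnorm F.isM2.bdd1 hx).trans h0
  rw [abs_mul, abs_of_pos (wphi_pos _ hx)] at h1
  calc |deriv F.fn x| = wphi (-(1 + ε)) x * wphi (1 + ε) x * |deriv F.fn x| := by
        rw [wphi_neg_mul _ hx, one_mul]
    _ = wphi (1 + ε) x * |deriv F.fn x| * wphi (-(1 + ε)) x := by ring
    _ ≤ _ := mul_le_mul_of_nonneg_right h1 (wphi_pos _ hx).le

/-- An element of `M₂` as a weighted continuous function. -/
lemma M2.exists_toBCF (ε : ℝ) : ∃ L : M2 ε →L[ℝ] (Dom →ᵇ ℝ),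
    ∀ F, ∀ x ∈ Dom, wfn ε (L F) x = F.fn x :=
  exists_clm_of_rel (fun (F : M2 ε) t => ∀ x ∈ Dom, wfn ε t x = F.fn x)
    (fun a b s t h h' x hx => by rw [wfn_add, h x hx, h' x hx, M2.fn_add, Pi.add_apply])
    (fun r a t h x hx => by rw [wfn_smul, h x hx, M2.fn_smul, Pi.smul_apply, smul_eq_mul])
    (fun t h => wfn_eq_zero (a := ε) fun x hx => by rw [h x hx, M2.fn_zero]; rfl) 1 fun F => by
      rw [one_mul]
      exact exists_wfn (norm_nonneg _) F.continuousOn_fn fun x hx => F.abs_fn_le hx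

/-- The derivative of an element of `M₂` as a weighted continuous function. -/
lemma M2.exists_derivBCF (ε : ℝ) : ∃ L : M2 ε →L[ℝ] (Dom →ᵇ ℝ),
    ∀ F, ∀ x ∈ Dom, wfn (1 + ε) (L F) x = deriv F.fn x :=
  exists_clm_of_rel (fun (F : M2 ε) t => ∀ x ∈ Dom, wfn (1 + ε) t x = deriv F.fn x)
    (fun a b s t h h' x hx => by
      rw [wfn_add, h x hx, h' x hx, M2.fn_add, deriv_add_of a.isM2.smooth1 b.isM2.smooth1 x hx])
    (fun r a t h x hx => by
      rw [wfn_smul, h x hx, M2.fn_smul, deriv_smul_of a.isM2.smooth1 r x hx])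
    (fun t h => wfn_eq_zero (a := 1 + ε) fun x hx => by rw [h x hx, M2.fn_zero]; simp) 1 fun F => by
      rw [one_mul]
      exact exists_wfn (norm_nonneg _) F.continuousOn_deriv fun x hx => F.abs_deriv_le hx

end M2read

open scoped BoundedContinuousFunction

/-! ### The linear operators at a base solution -/

lemma exists_bound_of_tendsto {g : ℝ → ℝ} (hg : ContinuousOn g Dom) {a b : ℝ}
    (ha : Tendsto g (𝓝[>] (-1)) (𝓝 a)) (hb : Tendsto g (𝓝[<] 1) (𝓝 b)) :
    ∃ C, 0 ≤ C ∧ ∀ x ∈ Dom, |g x| ≤ C := by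
  have h1 := continuousOn_Icc_extendFrom_Ioo hg ha hb
  obtain ⟨C, hC⟩ := isCompact_Icc.bddAbove_image h1.abs
  refine ⟨max C 0, le_max_right _ _, fun x hx => ?_⟩
  have h2 : extendFrom Dom g x = g x := extendFrom_eq
    (subset_closure hx) (hg.continuousAt (isOpen_Ioo.mem_nhds hx)).continuousWithinAt
  rw [← h2]
  have h3 := hC (mem_image_of_mem (fun x => |extendFrom Dom g x|) (Ioo_subset_Icc_self hx))
  exact h3.trans (le_max_left _ _)

/-- The data of a solution `U^{c,γ}` with logarithmic behaviour at `x = -1`. -/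
structure IsBase (c : Fin 3 → ℝ) (γ ε : ℝ) : Prop where
  eps_pos : 0 < ε
  eps_lt : ε < 1 / 2
  c0 : c 0 = -1
  c1 : -1 < c 1
  sol : IsNoSwirlSol c (Ubar c γ)
  init : Ubar c γ 0 = γ
  left : Tendsto (fun x => (2 * x + Ubar c γ x) * lam x) (𝓝[>] (-1)) (𝓝 (-4))
  right : Tendsto (fun x => 2 * x + Ubar c γ x) (𝓝[<] 1) (𝓝 (2 * √(1 + c 1)))
  -- Since U^{c,γ}(1) = 2√(1 + c 1) - 2, this is the condition ε > -U^{c,γ}(1)/4.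
  admissible : 1 - 2 * ε < √(1 + c 1)

/-- Bootstrap: the equation expresses U' through U, so each degree of smoothness yields the next.
Two degrees suffice for the third derivative of the θ-component. -/
lemma contDiffOn_two_of_sol {c : Fin 3 → ℝ} {U : ℝ → ℝ} (h : IsNoSwirlSol c U) :
    ContDiffOn ℝ 2 U Dom := by
  have hP : ∀ n : ℕ, ContDiffOn ℝ n (P c) Dom := fun n => by
    unfold P
    exact (by fun_prop : ContDiff ℝ n fun x : ℝ =>
      c 0 * (1 - x) + c 1 * (1 + x) + c 2 * (1 - x ^ 2)).contDiffOn
  have step : ∀ n : ℕ, ContDiffOn ℝ n U Dom → ContDiffOn ℝ (n + 1 : ℕ) U Dom := by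
    intro n hn
    refine contDiffOn_succ_of_hasDerivAt isOpen_Ioo (fun x hx => h.hasDerivAt hx) ?_
    refine ContDiffOn.div ?_ (by fun_prop) fun x hx => (one_sub_sq_pos hx).ne'
    have h2 : ContDiffOn ℝ n (fun x : ℝ => 2 * x) Dom := by fun_prop
    exact ((hP n).sub (h2.mul hn)).sub ((hn.pow 2).div_const 2)
  have h0 : ContDiffOn ℝ (0 : ℕ) U Dom := by
    rw [Nat.cast_zero]
    exact contDiffOn_zero.2 h.continuousOn
  exact_mod_cast step 1 (step 0 h0)

lemma contDiffOn_two_derivs {k : ℝ → ℝ} (hk : ContDiffOn ℝ 2 k Dom) :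
    (∀ x ∈ Dom, HasDerivAt k (deriv k x) x) ∧
    (∀ x ∈ Dom, HasDerivAt (deriv k) (deriv (deriv k) x) x) ∧ ContinuousOn (deriv k) Dom ∧
    ContinuousOn (deriv (deriv k)) Dom := by
  have h1 : ContDiffOn ℝ 1 (deriv k) Dom :=
    ((contDiffOn_succ_iff_deriv_of_isOpen (n := 1) isOpen_Ioo).1 hk).2.2
  refine ⟨fun x hx => ?_, fun x hx => ?_, h1.continuousOn,
    h1.continuousOn_deriv_of_isOpen isOpen_Ioo le_rfl⟩
  · exact ((hk.differentiableOn (by norm_num)).differentiableAt (isOpen_Ioo.mem_nhds hx)).hasDerivAt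
  · exact ((h1.differentiableOn (by norm_num)).differentiableAt (isOpen_Ioo.mem_nhds hx)).hasDerivAt

section base

variable {c : Fin 3 → ℝ} {γ ε : ℝ}

/-- `2x + U^{c,γ}`. -/
def alph (c : Fin 3 → ℝ) (γ x : ℝ) : ℝ := 2 * x + Ubar c γ x

lemma IsBase.continuousOn_alph (hb : IsBase c γ ε) : ContinuousOn (alph c γ) Dom :=
  (by fun_prop : Continuous fun x : ℝ => 2 * x).continuousOn.add hb.sol.continuousOn

lemma IsBase.contDiffOn_alph (hb : IsBase c γ ε) : ContDiffOn ℝ 2 (alph c γ) Dom := by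
  have h2 : ContDiffOn ℝ 2 (fun x : ℝ => 2 * x) Dom := by fun_prop
  exact h2.add (contDiffOn_two_of_sol hb.sol)

lemma tendsto_lam_right : Tendsto lam (𝓝[<] 1) (𝓝 (lam 1)) := by
  have h2 : ContinuousAt lam 1 := by
    unfold lam
    exact (ContinuousAt.log (by fun_prop) (by norm_num)).neg
  exact h2.mono_left nhdsWithin_le_nhds

/-- The product of α with λ has finite limits at both ends. The rate 1/λ is what turns α·`Gw` into
`Hw` and gives the weight of f' in M₁. -/
lemma IsBase.alph_bound (hb : IsBase c γ ε) :
    ∃ C, 0 ≤ C ∧ ∀ x ∈ Dom, |alph c γ x| ≤ C / lam x := by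
  obtain ⟨C, hC, h⟩ := exists_bound_of_tendsto (g := fun x => alph c γ x * lam x)
    (hb.continuousOn_alph.mul continuousOn_lam) hb.left (hb.right.mul tendsto_lam_right)
  refine ⟨C, hC, fun x hx => ?_⟩
  have h1 := h x hx
  rwa [abs_mul, abs_of_pos (lam_pos hx), ← le_div_iff₀ (lam_pos hx)] at h1

lemma IsBase.Ubar_bound (hb : IsBase c γ ε) : ∃ C, 0 ≤ C ∧ ∀ x ∈ Dom, |Ubar c γ x| ≤ C := by
  obtain ⟨C, hC, h⟩ := hb.alph_bound
  refine ⟨C / Real.log (3 / 2) + 2, by have := log_three_half_pos; positivity, fun x hx => ?_⟩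
  have h1 : |alph c γ x| ≤ C / Real.log (3 / 2) :=
    (h x hx).trans (div_le_div_of_nonneg_left hC log_three_half_pos (lam_ge hx))
  have h2 : Ubar c γ x = alph c γ x - 2 * x := by unfold alph; ring
  rw [h2]
  refine (abs_sub _ _).trans (add_le_add h1 ?_)
  rw [abs_le]
  constructor <;> linarith [hx.1, hx.2]

lemma hasDerivAt_Gw (σ : ℝ) {x : ℝ} (hx : x ∈ Dom) :
    HasDerivAt (Gw σ) (Gw σ x * (1 / ((1 + x) * lam x) - σ / (1 - x))) x := by
  have h1 : 0 < 1 - x := by linarith [hx.2]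
  have h2 : 0 < 1 + x := by linarith [hx.1]
  have h3 := lam_pos hx
  have h4 : HasDerivAt (fun x : ℝ => 1 - x) (-1) x := by
    simpa using (hasDerivAt_id x).const_sub 1
  refine ((h4.rpow_const (p := σ) (Or.inl h1.ne')).div (hasDerivAt_lam hx) h3.ne').congr_deriv ?_
  rw [Real.rpow_sub_one h1.ne']
  unfold Gw
  field_simp
  ring

lemma tendsto_one_add_mul_lam : Tendsto (fun x => (1 + x) * lam x) (𝓝[>] (-1)) (𝓝 0) := by
  have h0 : Tendsto (fun x : ℝ => 1 + x) (𝓝[>] (-1)) (𝓝 0) :=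
    tendsto_one_add_nhdsGT.mono_right nhdsWithin_le_nhds
  have h1 := (tendsto_log_mul_rpow_nhdsGT_zero zero_lt_one).comp tendsto_one_add_nhdsGT
  simp only [Real.rpow_one] at h1
  have h2 := (h0.mul_const (Real.log 3)).sub h1
  rw [zero_mul, sub_zero] at h2
  refine h2.congr' ?_
  filter_upwards [self_mem_nhdsWithin] with x hx
  rw [lam_eq hx]
  simp only [Function.comp]
  ring

/-- The weights `Gw σ`, `Hw σ` satisfy the barrier conditions for the `θ`-equation. -/
lemma IsBase.theta_bound (hb : IsBase c γ ε) {σ : ℝ} (hσ : σ < √(1 + c 1)) :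
    ∃ C' ≥ 0, ∀ (f h : ℝ → ℝ) (N : ℝ), ContinuousOn h Dom →
      (∀ x ∈ Dom, HasDerivAt f ((h x - alph c γ x * f x) / (1 - x ^ 2)) x) →
      (∀ x ∈ Dom, |h x| ≤ N * Hw σ x) → 0 ≤ N →
      ∀ x ∈ Dom, |f x| ≤ C' * (|f 0| + N) * Gw σ x := by
  set κ := √(1 + c 1) with hκ
  set η := κ - σ with hη
  have hηpos : 0 < η := sub_pos.2 hσ
  set m := Real.log (3 / 2) with hm
  have hmpos : 0 < m := log_three_half_pos
  have hform : ∀ x ∈ Dom, (1 - x ^ 2) * (Gw σ x * (1 / ((1 + x) * lam x) - σ / (1 - x)))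
      + alph c γ x * Gw σ x = Gw σ x * ((1 - x) / lam x - σ * (1 + x) + alph c γ x) := by
    intro x hx
    have h1 : 1 - x ≠ 0 := by linarith [hx.2]
    have h2 : 1 + x ≠ 0 := by linarith [hx.1]
    have h3 := (lam_pos hx).ne'
    rw [show 1 - x ^ 2 = (1 + x) * (1 - x) by ring]
    field_simp
  refine barrier_bound (G := Gw σ) (G' := fun x => Gw σ x * (1 / ((1 + x) * lam x) - σ / (1 - x)))
    (H := Hw σ) (C := 1 + (m * η)⁻¹) hb.continuousOn_alph (fun x hx => hasDerivAt_Gw σ hx)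
    (Gw_pos σ) (continuousOn_Hw σ) (fun x hx => (Hw_pos σ x hx).le) (by positivity) ?_ ?_
  -- At x = 1 the bracket tends to 2κ - 2σ = 2η, which is positive exactly because σ < κ.
  · have hev : ∀ᶠ x in 𝓝[<] (1 : ℝ), η < (1 - x) / lam x - σ * (1 + x) + alph c γ x := by
      have h1 : Tendsto (fun x : ℝ => 1 - x) (𝓝[<] 1) (𝓝 (1 - 1)) :=
        ((continuous_const.sub continuous_id).tendsto 1).mono_left nhdsWithin_le_nhds
      have h2 : Tendsto (fun x : ℝ => σ * (1 + x)) (𝓝[<] 1) (𝓝 (σ * (1 + 1))) :=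
        ((continuous_const.mul (continuous_const.add continuous_id)).tendsto 1).mono_left
          nhdsWithin_le_nhds
      have hl1 : lam 1 ≠ 0 := by
        unfold lam
        rw [neg_ne_zero]
        exact (Real.log_neg (by norm_num) (by norm_num)).ne
      have h3 := ((h1.div tendsto_lam_right hl1).sub h2).add hb.right
      have h4 : (1 - 1) / lam 1 - σ * (1 + 1) + 2 * κ = 2 * η := by rw [hη]; simp; ring
      rw [h4] at h3
      exact h3.eventually (lt_mem_nhds (by linarith))
    filter_upwards [hev, dom_mem_right] with x hx1 hx
    rw [hform x hx]
    have hG := Gw_pos σ x hx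
    calc Hw σ x ≤ m⁻¹ * Gw σ x := Hw_le_Gw σ hx
      _ = (m * η)⁻¹ * (Gw σ x * η) := by field_simp
      _ ≤ (1 + (m * η)⁻¹) * (Gw σ x * η) :=
        mul_le_mul_of_nonneg_right (by linarith) (by positivity)
      _ ≤ _ := by gcongr
  -- At x = -1 the bracket times λ tends to 2 - 0 - 4 = -2: the logarithmic rate -4 of α outweighs
  -- the 2 produced by differentiating 1/λ.
  · have hev : ∀ᶠ x in 𝓝[>] (-1 : ℝ),
        ((1 - x) - σ * ((1 + x) * lam x)) + alph c γ x * lam x < -1 := by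
      have h1 : Tendsto (fun x : ℝ => 1 - x) (𝓝[>] (-1)) (𝓝 (1 - -1)) :=
        ((continuous_const.sub continuous_id).tendsto (-1)).mono_left nhdsWithin_le_nhds
      have h3 := (h1.sub (tendsto_one_add_mul_lam.const_mul σ)).add hb.left
      exact h3.eventually (gt_mem_nhds (by norm_num))
    filter_upwards [hev, dom_mem_left] with x hx1 hx
    rw [hform x hx, Hw_eq]
    have hG := Gw_pos σ x hx
    have hl := lam_pos hx
    have h2 : (1 - x) / lam x - σ * (1 + x) + alph c γ x ≤ -1 / lam x := by
      rw [le_div_iff₀ hl]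
      have : ((1 - x) / lam x - σ * (1 + x) + alph c γ x) * lam x
        = ((1 - x) - σ * ((1 + x) * lam x)) + alph c γ x * lam x := by field_simp
      linarith
    have h3 : Gw σ x / lam x = -(Gw σ x * (-1 / lam x)) := by ring
    have h4 : Gw σ x * ((1 - x) / lam x - σ * (1 + x) + alph c γ x) ≤ Gw σ x * (-1 / lam x) :=
      mul_le_mul_of_nonneg_left h2 hG.le
    have h5 : 0 ≤ Gw σ x / lam x := by positivity
    have h6 : 0 ≤ (m * η)⁻¹ := by positivity
    rw [neg_mul]
    nlinarith

/-- `f` solves `(1 - x²) f' + α f = h` on `(-1,1)` with `f(0) = v`. -/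
def LinRel (α : ℝ → ℝ) (v : ℝ) (h f : ℝ → ℝ) : Prop :=
  f 0 = v ∧ ∀ x ∈ Dom, HasDerivAt f ((h x - α x * f x) / (1 - x ^ 2)) x

lemma LinRel.congr {α h h' f f' : ℝ → ℝ} {v : ℝ} (H : LinRel α v h f) (hh : ∀ x ∈ Dom, h x = h' x)
    (hf : ∀ x ∈ Dom, f x = f' x) : LinRel α v h' f' := by
  refine ⟨by rw [← hf 0 zero_mem_Ioo, H.1], fun x hx => ?_⟩
  have := deriv_eq_of_hasDerivAt isOpen_Ioo H.2 (fun x hx => (hf x hx).symm) x hx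
  rwa [hh x hx, hf x hx] at this

lemma LinRel.add {α h h' f f' : ℝ → ℝ} {v v' : ℝ} (H : LinRel α v h f) (H' : LinRel α v' h' f') :
    LinRel α (v + v') (fun x => h x + h' x) (fun x => f x + f' x) := by
  refine ⟨by simp only [H.1, H'.1], fun x hx => ((H.2 x hx).add (H'.2 x hx)).congr_deriv ?_⟩
  rw [← add_div]
  ring

lemma LinRel.smul {α h f : ℝ → ℝ} {v : ℝ} (r : ℝ) (H : LinRel α v h f) :
    LinRel α (r * v) (fun x => r * h x) (fun x => r * f x) := by
  refine ⟨by simp only [H.1], fun x hx => ((H.2 x hx).const_mul r).congr_deriv ?_⟩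
  rw [mul_div_assoc']
  ring

lemma LinRel.unique {α h f f' : ℝ → ℝ} {v : ℝ} (hα : ContinuousOn α Dom) (H : LinRel α v h f)
    (H' : LinRel α v h f') : ∀ x ∈ Dom, f x = f' x := by
  intro x hx
  have := linear_ode_unique (f := fun x => f x + -1 * f' x) hα (fun y hy => by
    refine ((H.2 y hy).add ((H'.2 y hy).const_mul (-1))).congr_deriv ?_
    rw [mul_div_assoc', ← add_div]
    ring) (by rw [H.1, H'.1]; ring) x hx
  linarith

/-- Solutions of the `θ`-equation with all bounds. -/
lemma IsBase.theta_solve (hb : IsBase c γ ε) {σ : ℝ} (hσ : σ < √(1 + c 1)) :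
    ∃ C ≥ 0, ∀ (v : ℝ) (h : Z (Hw σ)), ∃ f f1 f2 f3 : ℝ → ℝ, LinRel (alph c γ) v (Z.fn h) f ∧
      (∀ x ∈ Dom, HasDerivAt f (f1 x) x) ∧ ContinuousOn f1 Dom ∧
      (∀ x ∈ Half, HasDerivAt f1 (f2 x) x) ∧ (∀ x ∈ Half, HasDerivAt f2 (f3 x) x) ∧
      ContinuousOn f3 Half ∧
      (∀ x ∈ Dom, |f x| ≤ C * (|v| + ‖h‖) * Gw σ x) ∧
      (∀ x ∈ Dom, |f1 x| ≤ C * (|v| + ‖h‖) * (Hw σ x / (1 - x ^ 2))) ∧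
      (∀ x ∈ Half, |f1 x| ≤ C * (|v| + ‖h‖)) ∧
      (∀ x ∈ Half, |f2 x| ≤ C * (|v| + ‖h‖)) ∧ (∀ x ∈ Half, |f3 x| ≤ C * (|v| + ‖h‖)) := by
  obtain ⟨C₀, hC₀, hbound⟩ := hb.theta_bound hσ
  obtain ⟨C₁, hC₁, hα⟩ := hb.alph_bound
  set m : ℝ → ℝ := fun x => 1 / (1 - x ^ 2) with hm
  set k : ℝ → ℝ := fun x => alph c γ x / (1 - x ^ 2) with hk
  have hq : ContDiffOn ℝ 2 (fun x : ℝ => 1 - x ^ 2) Dom := by fun_prop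
  have hmc : ContDiffOn ℝ 2 m Dom :=
    contDiffOn_const.div hq fun x hx => (one_sub_sq_pos hx).ne'
  have hkc : ContDiffOn ℝ 2 k Dom :=
    hb.contDiffOn_alph.div hq fun x hx => (one_sub_sq_pos hx).ne'
  obtain ⟨dm1, dm2, cm1, cm2⟩ := contDiffOn_two_derivs hmc
  obtain ⟨dk1, dk2, ck1, ck2⟩ := contDiffOn_two_derivs hkc
  obtain ⟨A0, hA0, bm0⟩ := exists_bounds_half hmc.continuousOn
  obtain ⟨A1, hA1, bm1⟩ := exists_bounds_half cm1
  obtain ⟨A2, hA2, bm2⟩ := exists_bounds_half cm2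
  obtain ⟨B0, hB0, bk0⟩ := exists_bounds_half hkc.continuousOn
  obtain ⟨B1, hB1, bk1⟩ := exists_bounds_half ck1
  obtain ⟨B2, hB2, bk2⟩ := exists_bounds_half ck2
  obtain ⟨Gb, hGb, bG⟩ := exists_bounds_half (continuousOn_Gw σ)
  obtain ⟨Hb, hHb, bH⟩ := exists_bounds_half (continuousOn_Hw σ)
  -- successive constants for `f, f', f'', f'''` on the half interval
  set F0 := C₀ * Gb with hF0
  set F1 := A0 * Hb + B0 * F0 with hF1
  set F2 := A1 * Hb + A0 + (B1 * F0 + B0 * F1) with hF2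
  set F3 := (A2 * Hb + A1) + (A1 + A0) + ((B2 * F0 + B1 * F1) + (B1 * F1 + B0 * F2)) with hF3
  have pF0 : 0 ≤ F0 := by positivity
  have pF1 : 0 ≤ F1 := by positivity
  have pF2 : 0 ≤ F2 := by positivity
  have pF3 : 0 ≤ F3 := by positivity
  refine ⟨C₀ + (1 + C₁ * C₀) + F1 + F2 + F3, by positivity, fun v h => ?_⟩
  have hh := Z.continuousOn_fn (continuousOn_Hw σ) h
  obtain ⟨f, hf0, hf⟩ := linear_ode_exists hb.continuousOn_alph hh v
  set N := |v| + ‖h‖ with hN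
  have hN0 : 0 ≤ N := by positivity
  have hhN : ‖h‖ ≤ N := by rw [hN]; linarith [abs_nonneg v]
  have hfb : ∀ x ∈ Dom, |f x| ≤ C₀ * N * Gw σ x := by
    have := hbound f (Z.fn h) ‖h‖ hh hf (fun x hx => Z.abs_fn_le (Hw_pos σ) h hx) (norm_nonneg _)
    rwa [hf0] at this
  set f1 : ℝ → ℝ := fun x => m x * Z.fn h x - k x * f x with hf1
  have hff1 : ∀ x ∈ Dom, HasDerivAt f (f1 x) x := fun x hx => (hf x hx).congr_deriv (by
    simp only [hf1, hm, hk]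
    ring)
  have hfc : ContinuousOn f Dom := fun x hx => (hf x hx).continuousAt.continuousWithinAt
  have hf1c : ContinuousOn f1 Dom := (hmc.continuousOn.mul hh).sub (hkc.continuousOn.mul hfc)
  set f2 : ℝ → ℝ := fun x => (deriv m x * Z.fn h x + m x * Z.d1 h x)
    - (deriv k x * f x + k x * f1 x) with hf2
  have hsub : ∀ x ∈ Half, x ∈ Dom := fun x hx => half_subset_dom hx
  have hff2 : ∀ x ∈ Half, HasDerivAt f1 (f2 x) x := fun x hx =>
    ((dm1 x (hsub x hx)).mul (Z.hasDerivAt_fn h hx)).sub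
      ((dk1 x (hsub x hx)).mul (hff1 x (hsub x hx)))
  set f3 : ℝ → ℝ := fun x => ((deriv (deriv m) x * Z.fn h x + deriv m x * Z.d1 h x)
    + (deriv m x * Z.d1 h x + m x * Z.d2 h x)) - ((deriv (deriv k) x * f x + deriv k x * f1 x)
    + (deriv k x * f1 x + k x * f2 x)) with hf3
  have hff3 : ∀ x ∈ Half, HasDerivAt f2 (f3 x) x := fun x hx =>
    (((dm2 x (hsub x hx)).mul (Z.hasDerivAt_fn h hx)).add
      ((dm1 x (hsub x hx)).mul (Z.hasDerivAt_d1 h hx))).sub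
      (((dk2 x (hsub x hx)).mul (hff1 x (hsub x hx))).add
        ((dk1 x (hsub x hx)).mul (hff2 x hx)))
  have hd1c : ContinuousOn (Z.d1 h) Half := fun x hx =>
    (Z.hasDerivAt_d1 h hx).continuousAt.continuousWithinAt
  have hf2c : ContinuousOn f2 Half := fun x hx => (hff3 x hx).continuousAt.continuousWithinAt
  have hf3c : ContinuousOn f3 Half := by
    have mo : ∀ {g : ℝ → ℝ}, ContinuousOn g Dom → ContinuousOn g Half := fun hg =>
      hg.mono half_subset_dom
    exact ((((mo cm2).mul (mo hh)).add ((mo cm1).mul hd1c)).add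
      (((mo cm1).mul hd1c).add ((mo hmc.continuousOn).mul (Z.continuousOn_d2 h)))).sub
      ((((mo ck2).mul (mo hfc)).add ((mo ck1).mul (mo hf1c))).add
      (((mo ck1).mul (mo hf1c)).add ((mo hkc.continuousOn).mul hf2c)))
  -- bounds
  have mulb : ∀ {a b A B : ℝ}, 0 ≤ A → |a| ≤ A → |b| ≤ B * N → |a * b| ≤ A * B * N := by
    intro a b A B hA ha hb'
    rw [abs_mul, mul_assoc]
    exact mul_le_mul ha hb' (abs_nonneg _) hA
  have b_h : ∀ x ∈ Half, |Z.fn h x| ≤ Hb * N := fun x hx => by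
    refine (Z.abs_fn_le (Hw_pos σ) h (hsub x hx)).trans ?_
    rw [mul_comm]
    exact mul_le_mul ((le_abs_self _).trans (bH x hx)) hhN (norm_nonneg _) hHb
  have b_h1 : ∀ x ∈ Half, |Z.d1 h x| ≤ 1 * N := fun x hx => by
    rw [one_mul]; exact (Z.abs_d1_le h x).trans hhN
  have b_h2 : ∀ x ∈ Half, |Z.d2 h x| ≤ 1 * N := fun x hx => by
    rw [one_mul]; exact (Z.abs_d2_le h x).trans hhN
  have b_f : ∀ x ∈ Half, |f x| ≤ F0 * N := fun x hx => by
    refine (hfb x (hsub x hx)).trans ?_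
    rw [hF0, mul_right_comm]
    exact mul_le_mul_of_nonneg_right (mul_le_mul_of_nonneg_left ((le_abs_self _).trans (bG x hx)) hC₀)
      hN0
  have b_f1 : ∀ x ∈ Half, |f1 x| ≤ F1 * N := fun x hx => by
    have e1 := mulb hA0 (bm0 x hx) (b_h x hx)
    have e2 := mulb hB0 (bk0 x hx) (b_f x hx)
    have := abs_sub (m x * Z.fn h x) (k x * f x)
    rw [hF1, add_mul]
    linarith
  have b_f2 : ∀ x ∈ Half, |f2 x| ≤ F2 * N := fun x hx => by
    have e1 := mulb hA1 (bm1 x hx) (b_h x hx)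
    have e2 := mulb hA0 (bm0 x hx) (b_h1 x hx)
    have e3 := mulb hB1 (bk1 x hx) (b_f x hx)
    have e4 := mulb hB0 (bk0 x hx) (b_f1 x hx)
    have i1 := abs_sub (deriv m x * Z.fn h x + m x * Z.d1 h x) (deriv k x * f x + k x * f1 x)
    have i2 := abs_add_le (deriv m x * Z.fn h x) (m x * Z.d1 h x)
    have i3 := abs_add_le (deriv k x * f x) (k x * f1 x)
    have : F2 * N = A1 * Hb * N + A0 * 1 * N + (B1 * F0 * N + B0 * F1 * N) := by rw [hF2]; ring
    rw [this]
    linarith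
  have b_f3 : ∀ x ∈ Half, |f3 x| ≤ F3 * N := fun x hx => by
    have e1 := mulb hA2 (bm2 x hx) (b_h x hx)
    have e2 := mulb hA1 (bm1 x hx) (b_h1 x hx)
    have e3 := mulb hA0 (bm0 x hx) (b_h2 x hx)
    have e4 := mulb hB2 (bk2 x hx) (b_f x hx)
    have e5 := mulb hB1 (bk1 x hx) (b_f1 x hx)
    have e6 := mulb hB0 (bk0 x hx) (b_f2 x hx)
    have i1 := abs_sub ((deriv (deriv m) x * Z.fn h x + deriv m x * Z.d1 h x)
      + (deriv m x * Z.d1 h x + m x * Z.d2 h x)) ((deriv (deriv k) x * f x + deriv k x * f1 x)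
      + (deriv k x * f1 x + k x * f2 x))
    have i2 := abs_add_le (deriv (deriv m) x * Z.fn h x + deriv m x * Z.d1 h x)
      (deriv m x * Z.d1 h x + m x * Z.d2 h x)
    have i3 := abs_add_le (deriv (deriv k) x * f x + deriv k x * f1 x)
      (deriv k x * f1 x + k x * f2 x)
    have i4 := abs_add_le (deriv (deriv m) x * Z.fn h x) (deriv m x * Z.d1 h x)
    have i5 := abs_add_le (deriv m x * Z.d1 h x) (m x * Z.d2 h x)
    have i6 := abs_add_le (deriv (deriv k) x * f x) (deriv k x * f1 x)
    have i7 := abs_add_le (deriv k x * f1 x) (k x * f2 x)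
    have : F3 * N = (A2 * Hb * N + A1 * 1 * N) + (A1 * 1 * N + A0 * 1 * N)
      + ((B2 * F0 * N + B1 * F1 * N) + (B1 * F1 * N + B0 * F2 * N)) := by rw [hF3]; ring
    rw [this]
    linarith
  have hmono : ∀ {A y : ℝ}, A ≤ C₀ + (1 + C₁ * C₀) + F1 + F2 + F3 → 0 ≤ y →
      A * N * y ≤ (C₀ + (1 + C₁ * C₀) + F1 + F2 + F3) * N * y := fun hA hy =>
    mul_le_mul_of_nonneg_right (mul_le_mul_of_nonneg_right hA hN0) hy
  have hCC : 0 ≤ C₁ * C₀ := mul_nonneg hC₁ hC₀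
  refine ⟨f, f1, f2, f3, ⟨hf0, hf⟩, hff1, hf1c, hff2, hff3, hf3c, fun x hx => ?_, fun x hx => ?_,
    fun x hx => ?_, fun x hx => ?_, fun x hx => ?_⟩
  · exact (hfb x hx).trans (hmono (by linarith) (Gw_pos σ x hx).le)
  · have h1 := one_sub_sq_pos hx
    have hH := Hw_pos σ x hx
    have e0 : f1 x = (Z.fn h x - alph c γ x * f x) / (1 - x ^ 2) := by
      simp only [hf1, hm, hk]
      ring
    have e1 : |Z.fn h x| ≤ N * Hw σ x := (Z.abs_fn_le (Hw_pos σ) h hx).trans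
      (mul_le_mul_of_nonneg_right hhN hH.le)
    -- The factor 1/λ from α improves `Gw` to `Hw`, so (1-x²)f' has the same weight as the source.
    have e2 : |alph c γ x * f x| ≤ C₁ * C₀ * N * Hw σ x := by
      rw [abs_mul, Hw_eq]
      calc |alph c γ x| * |f x| ≤ C₁ / lam x * (C₀ * N * Gw σ x) :=
            mul_le_mul (hα x hx) (hfb x hx) (abs_nonneg _) (div_nonneg hC₁ (lam_pos hx).le)
        _ = _ := by ring
    have e3 : |f1 x| ≤ (1 + C₁ * C₀) * N * (Hw σ x / (1 - x ^ 2)) := by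
      rw [e0, abs_div, abs_of_pos h1, mul_div_assoc']
      refine div_le_div_of_nonneg_right ?_ h1.le
      have := abs_sub (Z.fn h x) (alph c γ x * f x)
      linarith
    exact e3.trans (hmono (by linarith) (div_nonneg hH.le h1.le))
  · have := hmono (A := F1) (y := 1) (by linarith) zero_le_one
    rw [mul_one, mul_one] at this
    exact (b_f1 x hx).trans this
  · have := hmono (A := F2) (y := 1) (by linarith) zero_le_one
    rw [mul_one, mul_one] at this
    exact (b_f2 x hx).trans this
  · have := hmono (A := F3) (y := 1) (by linarith) zero_le_one
    rw [mul_one, mul_one] at this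
    exact (b_f3 x hx).trans this

lemma abs_add_norm_le {A : Type*} [NormedAddCommGroup A] (a : ℝ × A) :
    |a.1| + ‖a.2‖ ≤ 2 * ‖a‖ := by
  have h1 : |a.1| ≤ ‖a‖ := norm_fst_le a
  have h2 := norm_snd_le a
  linarith

/-- The solution operator of the `θ`-equation with values in `Z (Gw σ)`. -/
lemma IsBase.exists_thetaZ (hb : IsBase c γ ε) {σ : ℝ} (hσ : σ < √(1 + c 1)) :
    ∃ L : (ℝ × Z (Hw σ)) →L[ℝ] Z (Gw σ), ∀ a, LinRel (alph c γ) a.1 (Z.fn a.2) (Z.fn (L a)) := by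
  obtain ⟨C, hC, hex⟩ := hb.theta_solve hσ
  refine exists_clm_of_rel (fun (a : ℝ × Z (Hw σ)) t => LinRel (alph c γ) a.1 (Z.fn a.2) (Z.fn t))
    (fun a b s t h h' => ?_) (fun r a t h => ?_) (fun t h => ?_) (C * 2) fun a => ?_
  · exact (h.add h').congr (fun x _ => (Z.fn_add _ _ x).symm) fun x _ => (Z.fn_add _ _ x).symm
  · exact (h.smul r).congr (fun x _ => (Z.fn_smul _ _ x).symm) fun x _ => (Z.fn_smul _ _ x).symm
  · refine Z.eq_zero (Gw_pos σ) t (LinRel.unique hb.continuousOn_alph h ⟨rfl, fun x hx => ?_⟩)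
    have : Z.fn (0 : Z (Hw σ)) x = 0 := congrFun (Z.fnₗ (Hw σ)).map_zero x
    simp only [Prod.snd_zero, this]
    exact (hasDerivAt_const x (0 : ℝ)).congr_deriv (by simp)
  · obtain ⟨f, f1, f2, f3, hrel, h1, hc1, h2, h3, hc3, b0, b1, b1', b2, b3⟩ := hex a.1 a.2
    obtain ⟨F, hF, hn⟩ := Z.exists_of (Gw_pos σ) (continuousOn_Gw σ) (by positivity)
      (fun x hx => (h1 x hx).continuousAt.continuousWithinAt)
      (fun x hx => h1 x (half_subset_dom hx)) h2
      (fun x hx => (h3 x hx).continuousAt.continuousWithinAt) b0 b1' b2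
    refine ⟨F, hrel.congr (fun _ _ => rfl) fun x hx => (hF x hx).symm, hn.trans ?_⟩
    rw [mul_assoc]
    exact mul_le_mul_of_nonneg_left (abs_add_norm_le a) hC

/-- The solution operator of the `θ`-equation with values in `M₁`. -/
lemma IsBase.exists_thetaM1 (hb : IsBase c γ ε) :
    ∃ L : (ℝ × Z (Hw (1 - 2 * ε))) →L[ℝ] M1 .south ε,
      ∀ a, LinRel (alph c γ) a.1 (Z.fn a.2) (L a).fn := by
  obtain ⟨C, hC, hex⟩ := hb.theta_solve hb.admissible
  refine exists_clm_of_rel (fun (a : ℝ × Z (Hw (1 - 2 * ε))) (t : M1 .south ε) =>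
    LinRel (alph c γ) a.1 (Z.fn a.2) t.fn)
    (fun a b s t h h' => ?_) (fun r a t h => ?_) (fun t h => ?_) (8 * C) fun a => ?_
  · exact (h.add h').congr (fun x _ => (Z.fn_add _ _ x).symm) fun x _ => rfl
  · exact (h.smul r).congr (fun x _ => (Z.fn_smul _ _ x).symm) fun x _ => rfl
  · refine M1.ext_dom (LinRel.unique hb.continuousOn_alph h ⟨rfl, fun x hx => ?_⟩)
    have : Z.fn (0 : Z (Hw (1 - 2 * ε))) x = 0 := congrFun (Z.fnₗ (Hw (1 - 2 * ε))).map_zero x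
    simp only [Prod.snd_zero, this]
    exact (hasDerivAt_const x (0 : ℝ)).congr_deriv (by simp [M1.fn_zero])
  · obtain ⟨f, f1, f2, f3, hrel, h1, hc1, h2, h3, hc3, b0, b1, b1', b2, b3⟩ := hex a.1 a.2
    obtain ⟨F, hF, hn⟩ := M1.exists_of hb.eps_lt (by positivity) h1 hc1 h2 h3 hc3 b0 b1 b2 b3
    refine ⟨F, hrel.congr (fun _ _ => rfl) fun x hx => (hF x hx).symm, hn.trans ?_⟩
    have := mul_le_mul_of_nonneg_left (abs_add_norm_le a) hC
    linarith

end base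

open scoped BoundedContinuousFunction

/-! ### Primitives of weighted functions -/

/-- The primitive vanishing at `0`. -/
def prim (k : ℝ → ℝ) (x : ℝ) : ℝ := ∫ s in (0 : ℝ)..x, k s

lemma prim_zero (k : ℝ → ℝ) : prim k 0 = 0 := intervalIntegral.integral_same

lemma hasDerivAt_prim {k : ℝ → ℝ} (hk : ContinuousOn k Dom) {x : ℝ} (hx : x ∈ Dom) :
    HasDerivAt (prim k) (k x) x := hasDerivAt_integral_Ioo hk hx

lemma continuousOn_prim {k : ℝ → ℝ} (hk : ContinuousOn k Dom) : ContinuousOn (prim k) Dom :=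
  fun _ hx => (hasDerivAt_prim hk hx).continuousAt.continuousWithinAt

lemma uIoo_zero_subset {x : ℝ} (hx : x ∈ Icc (-1 : ℝ) 1) : uIoo 0 x ⊆ Dom := by
  intro y hy
  rcases le_total 0 x with h | h
  · rw [uIoo_of_le h] at hy
    exact ⟨by linarith [hy.1], hy.2.trans_le hx.2⟩
  · rw [uIoo_of_ge h] at hy
    exact ⟨hx.1.trans_lt hy.1, by linarith [hy.2]⟩

lemma prim_congr {k k' : ℝ → ℝ} (h : ∀ x ∈ Dom, k x = k' x) {x : ℝ} (hx : x ∈ Icc (-1 : ℝ) 1) :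
    prim k x = prim k' x :=
  intervalIntegral.integral_congr_uIoo fun y hy => h y (uIoo_zero_subset hx hy)

lemma prim_comp_neg (k : ℝ → ℝ) (x : ℝ) : prim (fun s => k (-s)) x = -prim k (-x) := by
  unfold prim
  rw [intervalIntegral.integral_comp_neg, neg_zero, intervalIntegral.integral_symm]

lemma abs_sub_le_of_deriv_le {A A' g g' : ℝ → ℝ} (hA : ∀ x ∈ Dom, HasDerivAt A (A' x) x)
    (hA0 : A 0 = 0) (hg : ∀ x ∈ Dom, HasDerivAt g (g' x) x) (h : ∀ x ∈ Dom, |g' x| ≤ A' x) :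
    ∀ x ∈ Dom, |g x - g 0| ≤ |A x| := by
  have h1 : MonotoneOn (fun x => A x - g x) Dom := monotoneOn_of_hasDerivAt (convex_Ioo _ _)
    (fun x hx => (hA x hx).sub (hg x hx)) fun x hx => by
      linarith [h x hx, le_abs_self (g' x)]
  have h2 : MonotoneOn (fun x => A x + g x) Dom := monotoneOn_of_hasDerivAt (convex_Ioo _ _)
    (fun x hx => (hA x hx).add (hg x hx)) fun x hx => by
      linarith [h x hx, neg_abs_le (g' x)]
  intro x hx
  rcases le_total 0 x with h0 | h0
  · have e1 := h1 zero_mem_Ioo hx h0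
    have e2 := h2 zero_mem_Ioo hx h0
    simp only [hA0] at e1 e2
    refine le_trans ?_ (le_abs_self _)
    rw [abs_le]
    constructor <;> linarith
  · have e1 := h1 hx zero_mem_Ioo h0
    have e2 := h2 hx zero_mem_Ioo h0
    simp only [hA0] at e1 e2
    refine le_trans ?_ (neg_le_abs _)
    rw [abs_le]
    constructor <;> linarith

/-- Comparison with x(1-x²)^{-p}, whose derivative is ((1-x²) + 2p x²)(1-x²)^{-(p+1)}, at least
min(1,2p) times (1-x²)^{-(p+1)}. -/
lemma abs_sub_le_wphi {p : ℝ} (hp : 0 < p) {g g' : ℝ → ℝ} {N : ℝ} (hN : 0 ≤ N)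
    (hg : ∀ x ∈ Dom, HasDerivAt g (g' x) x) (h : ∀ x ∈ Dom, |g' x| ≤ N * wphi (-(p + 1)) x) :
    ∀ x ∈ Dom, |g x - g 0| ≤ N / min 1 (2 * p) * wphi (-p) x := by
  set m := min 1 (2 * p) with hm
  have hm0 : 0 < m := lt_min one_pos (by linarith)
  have hA : ∀ x ∈ Dom, HasDerivAt (fun x => N / m * (x * wphi (-p) x))
      (N / m * (1 * wphi (-p) x + x * (-2 * -p * x * wphi (-p - 1) x))) x := fun x hx =>
    ((hasDerivAt_id x).mul (hasDerivAt_wphi (-p) hx)).const_mul _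
  intro x hx
  refine (abs_sub_le_of_deriv_le hA (by simp) hg (fun x hx => ?_) x hx).trans ?_
  · refine (h x hx).trans ?_
    have e1 : wphi (-p) x = (1 - x ^ 2) * wphi (-(p + 1)) x := by
      rw [← wphi_one, wphi_mul _ _ hx]
      congr 1
      ring
    rw [e1, show -p - 1 = -(p + 1) by ring]
    have h1 := wphi_pos (-(p + 1)) hx
    have h2 : m ≤ (1 - x ^ 2) + 2 * p * x ^ 2 := by
      have := one_sub_sq_pos hx
      nlinarith [mul_le_mul_of_nonneg_right (min_le_right 1 (2 * p)) (sq_nonneg x),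
        mul_le_mul_of_nonneg_right (min_le_left 1 (2 * p)) this.le]
    calc N * wphi (-(p + 1)) x = N / m * (m * wphi (-(p + 1)) x) := by field_simp
      _ ≤ N / m * (((1 - x ^ 2) + 2 * p * x ^ 2) * wphi (-(p + 1)) x) := by gcongr
      _ = _ := by ring
  · rw [abs_mul, abs_mul, abs_of_nonneg (by positivity : 0 ≤ N / m), abs_of_pos (wphi_pos _ hx)]
    have : |x| ≤ 1 := abs_le.2 ⟨hx.1.le, hx.2.le⟩
    have h1 := wphi_pos (-p) hx
    have : |x| * wphi (-p) x ≤ 1 * wphi (-p) x := mul_le_mul_of_nonneg_right this h1.le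
    rw [one_mul] at this
    exact mul_le_mul_of_nonneg_left this (by positivity)

lemma abs_prim_le_wphi {p : ℝ} (hp : 0 < p) {k : ℝ → ℝ} {N : ℝ} (hN : 0 ≤ N)
    (hk : ContinuousOn k Dom) (h : ∀ x ∈ Dom, |k x| ≤ N * wphi (-(p + 1)) x) :
    ∀ x ∈ Dom, |prim k x| ≤ N / min 1 (2 * p) * wphi (-p) x := by
  intro x hx
  have := abs_sub_le_wphi hp hN (fun x hx => hasDerivAt_prim hk hx) h x hx
  rwa [prim_zero, sub_zero] at this

lemma wphi_neg_le_one_sub {a : ℝ} (ha : 0 ≤ a) {x : ℝ} (hx : x ∈ Ico (0 : ℝ) 1) :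
    wphi (-a) x ≤ (1 - x) ^ (-a) := by
  have h1 : 0 < 1 - x := by linarith [hx.2]
  refine Real.rpow_le_rpow_of_nonpos h1 ?_ (by linarith)
  nlinarith [hx.1]

lemma intervalIntegrable_one_sub_rpow {a : ℝ} (ha : a < 1) (x y : ℝ) :
    IntervalIntegrable (fun s : ℝ => (1 - s) ^ (-a)) volume x y := by
  have := (intervalIntegral.intervalIntegrable_rpow' (a := 1 - x) (b := 1 - y)
    (r := -a) (by linarith)).comp_sub_left 1
  simpa using this

/-! ### Integrability up to the endpoints and decay of the corrected primitive -/

section integrability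

variable {a N : ℝ} {u : ℝ → ℝ}

lemma intervalIntegrable_right (ha0 : 0 ≤ a) (ha : a < 1) (hN : 0 ≤ N) (hu : ContinuousOn u Dom)
    (h : ∀ x ∈ Dom, |u x| ≤ N * wphi (-a) x) : IntervalIntegrable u volume 0 1 := by
  rw [intervalIntegrable_iff_integrableOn_Ioo_of_le zero_le_one]
  have h1 := ((intervalIntegrable_one_sub_rpow ha 0 1).const_mul N)
  rw [intervalIntegrable_iff_integrableOn_Ioo_of_le zero_le_one] at h1
  refine h1.mono' ((hu.mono fun x hx => ⟨by linarith [hx.1], hx.2⟩).aestronglyMeasurable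
    measurableSet_Ioo) ?_
  refine (ae_restrict_iff' measurableSet_Ioo).2 (Eventually.of_forall fun x hx => ?_)
  refine (h x ⟨by linarith [hx.1], hx.2⟩).trans (mul_le_mul_of_nonneg_left ?_ hN)
  exact wphi_neg_le_one_sub ha0 ⟨hx.1.le, hx.2⟩

lemma wphi_neg_arg (a x : ℝ) : wphi a (-x) = wphi a x := by
  unfold wphi
  rw [neg_sq]

lemma dom_neg {x : ℝ} (hx : x ∈ Dom) : -x ∈ Dom := ⟨by linarith [hx.2], by linarith [hx.1]⟩

lemma continuousOn_comp_neg (hu : ContinuousOn u Dom) : ContinuousOn (fun x => u (-x)) Dom :=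
  hu.comp (by fun_prop) fun _ hx => dom_neg hx

lemma intervalIntegrable_Icc (ha0 : 0 ≤ a) (ha : a < 1) (hN : 0 ≤ N) (hu : ContinuousOn u Dom)
    (h : ∀ x ∈ Dom, |u x| ≤ N * wphi (-a) x) {x y : ℝ} (hx : x ∈ Icc (-1 : ℝ) 1)
    (hy : y ∈ Icc (-1 : ℝ) 1) : IntervalIntegrable u volume x y := by
  have h1 := intervalIntegrable_right ha0 ha hN hu h
  have h2 := intervalIntegrable_right ha0 ha hN (continuousOn_comp_neg hu) fun x hx => by
    have := h (-x) (dom_neg hx)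
    rwa [wphi_neg_arg] at this
  have h3 := (IntervalIntegrable.iff_comp_neg (a := 0) (b := 1)).1 h2
  simp only [neg_neg, neg_zero] at h3
  refine (h3.symm.trans h1).mono_set ?_
  rw [uIcc_of_le (by norm_num : (-1 : ℝ) ≤ 1)]
  exact (convex_Icc _ _).ordConnected.uIcc_subset hx hy

lemma abs_prim_one_sub_le (ha0 : 0 ≤ a) (ha : a < 1) (hN : 0 ≤ N) (hu : ContinuousOn u Dom)
    (h : ∀ x ∈ Dom, |u x| ≤ N * wphi (-a) x) {x : ℝ} (hx : x ∈ Ico (0 : ℝ) 1) :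
    |prim u 1 - prim u x| ≤ N / (1 - a) * (1 - x) ^ (1 - a) := by
  have hx' : x ∈ Icc (-1 : ℝ) 1 := ⟨by linarith [hx.1], hx.2.le⟩
  have hi : ∀ {y z : ℝ}, y ∈ Icc (-1 : ℝ) 1 → z ∈ Icc (-1 : ℝ) 1 → IntervalIntegrable u volume y z :=
    intervalIntegrable_Icc ha0 ha hN hu h
  unfold prim
  rw [intervalIntegral.integral_interval_sub_left (hi (by simp) (by simp)) (hi (by simp) hx')]
  have h1 : ‖∫ s in x..1, u s‖ ≤ ∫ s in x..1, N * (1 - s) ^ (-a) := by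
    refine intervalIntegral.norm_integral_le_of_norm_le hx.2.le ?_
      ((intervalIntegrable_one_sub_rpow ha x 1).const_mul N)
    filter_upwards [compl_mem_ae_iff.2 (measure_singleton (1 : ℝ))] with s hs hs1
    have hs2 : s < 1 := lt_of_le_of_ne hs1.2 hs
    have hs0 : 0 ≤ s := hx.1.trans hs1.1.le
    exact (h s ⟨by linarith, hs2⟩).trans
      (mul_le_mul_of_nonneg_left (wphi_neg_le_one_sub ha0 ⟨hs0, hs2⟩) hN)
  refine h1.trans (le_of_eq ?_)
  rw [intervalIntegral.integral_const_mul,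
    intervalIntegral.integral_comp_sub_left (fun s : ℝ => s ^ (-a)) 1, sub_self,
    integral_rpow (Or.inl (by linarith)), Real.zero_rpow (by linarith), sub_zero,
    show -a + 1 = 1 - a by ring]
  ring

lemma abs_prim_neg_one_sub_le (ha0 : 0 ≤ a) (ha : a < 1) (hN : 0 ≤ N) (hu : ContinuousOn u Dom)
    (h : ∀ x ∈ Dom, |u x| ≤ N * wphi (-a) x) {x : ℝ} (hx : x ∈ Ioc (-1 : ℝ) 0) :
    |prim u (-1) - prim u x| ≤ N / (1 - a) * (1 + x) ^ (1 - a) := by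
  have := abs_prim_one_sub_le ha0 ha hN (continuousOn_comp_neg hu) (fun x hx => by
    have := h (-x) (dom_neg hx)
    rwa [wphi_neg_arg] at this) (x := -x) ⟨by linarith [hx.2], by linarith [hx.1]⟩
  rw [prim_comp_neg, prim_comp_neg, neg_neg, sub_neg_eq_add] at this
  rw [← abs_neg]
  convert this using 2 <;> ring_nf

/-- `ψ` minus the combination of `1 - x`, `1 + x`, `1 - x²` which makes it vanish at `-1,0,1`. -/
def corr (ψ : ℝ → ℝ) (x : ℝ) : ℝ :=
  ψ x - ψ (-1) / 2 * (1 - x) - ψ 1 / 2 * (1 + x) + (ψ (-1) + ψ 1) / 2 * (1 - x ^ 2)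

/-- The correction makes the primitive vanish at both endpoints. Its increment from an endpoint is
of order d^{1-a}, with d the distance to it, and the polynomial terms are of order d, which is no
larger. -/
lemma abs_corr_prim_le (ha0 : 0 ≤ a) (ha : a < 1) (hN : 0 ≤ N) (hu : ContinuousOn u Dom)
    (h : ∀ x ∈ Dom, |u x| ≤ N * wphi (-a) x) :
    ∀ x ∈ Dom, |corr (prim u) x| ≤ 4 * (N / (1 - a)) * wphi (1 - a) x := by
  set M := N / (1 - a) with hM
  have hM0 : 0 ≤ M := div_nonneg hN (by linarith)
  have b1 : |prim u 1| ≤ M := by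
    have := abs_prim_one_sub_le ha0 ha hN hu h (x := 0) (by simp)
    simpa [prim_zero] using this
  have b2 : |prim u (-1)| ≤ M := by
    have := abs_prim_neg_one_sub_le ha0 ha hN hu h (x := 0) (by simp)
    simpa [prim_zero] using this
  have le_w : ∀ y : ℝ, 0 < y → y ≤ 1 → y ≤ y ^ (1 - a) := fun y h0 h1 => by
    conv_lhs => rw [← Real.rpow_one y]
    exact Real.rpow_le_rpow_of_exponent_ge h0 h1 (by linarith)
  obtain ⟨b1l, b1u⟩ := abs_le.1 b1
  obtain ⟨b2l, b2u⟩ := abs_le.1 b2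
  intro x hx
  have hx1 : 0 < 1 - x := by linarith [hx.2]
  have hx2 : 0 < 1 + x := by linarith [hx.1]
  rcases le_total 0 x with h0 | h0
  · have e := abs_le.1 (abs_prim_one_sub_le ha0 ha hN hu h (x := x) ⟨h0, hx.2⟩)
    have e1 : (1 - x) ^ (1 - a) ≤ wphi (1 - a) x :=
      Real.rpow_le_rpow hx1.le (by nlinarith) (by linarith)
    have e2 := (le_w _ hx1 (by linarith)).trans e1
    have e3 := mul_le_mul_of_nonneg_left e1 hM0
    have e4 := mul_le_mul_of_nonneg_left e2 hM0
    -- Expansion about the endpoint 1: the increment of the primitive plus a polynomial remainder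
    -- divisible by 1 - x.
    have e5 : corr (prim u) x = -(prim u 1 - prim u x) + (1 - x) * (prim u 1 * (1 + x / 2)
        + prim u (-1) * (x / 2)) := by unfold corr; ring
    have e6 : |prim u 1 * (1 + x / 2) + prim u (-1) * (x / 2)| ≤ 2 * M := by
      rw [abs_le]
      constructor <;> nlinarith [hx.2]
    have e7 : |(1 - x) * (prim u 1 * (1 + x / 2) + prim u (-1) * (x / 2))| ≤ (1 - x) * (2 * M) := by
      rw [abs_mul, abs_of_pos hx1]
      exact mul_le_mul_of_nonneg_left e6 hx1.le
    obtain ⟨e8, e9⟩ := abs_le.1 e7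
    rw [e5, abs_le]
    constructor <;> nlinarith [e.1, e.2]
  · have e := abs_le.1 (abs_prim_neg_one_sub_le ha0 ha hN hu h (x := x) ⟨hx.1, h0⟩)
    have e1 : (1 + x) ^ (1 - a) ≤ wphi (1 - a) x :=
      Real.rpow_le_rpow hx2.le (by nlinarith) (by linarith)
    have e2 := (le_w _ hx2 (by linarith)).trans e1
    have e3 := mul_le_mul_of_nonneg_left e1 hM0
    have e4 := mul_le_mul_of_nonneg_left e2 hM0
    have e5 : corr (prim u) x = -(prim u (-1) - prim u x) + (1 + x) * (prim u (-1) * (1 - x / 2)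
        + prim u 1 * (-x / 2)) := by unfold corr; ring
    have e6 : |prim u (-1) * (1 - x / 2) + prim u 1 * (-x / 2)| ≤ 2 * M := by
      rw [abs_le]
      constructor <;> nlinarith [hx.1]
    have e7 : |(1 + x) * (prim u (-1) * (1 - x / 2) + prim u 1 * (-x / 2))| ≤ (1 + x) * (2 * M) := by
      rw [abs_mul, abs_of_pos hx2]
      exact mul_le_mul_of_nonneg_left e6 hx2.le
    obtain ⟨e8, e9⟩ := abs_le.1 e7
    rw [e5, abs_le]
    constructor <;> nlinarith [e.1, e.2]

end integrability

/-- At 1 both sides have the order (1-x)^σ; at -1 the power (1+x)^σ beats the logarithmic factor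
1/λ². -/
lemma wphi_le_Hw {σ : ℝ} (hσ : 0 < σ) : ∃ C, 0 ≤ C ∧ ∀ x ∈ Dom, wphi σ x ≤ C * Hw σ x := by
  have hc : ContinuousOn (fun x => ((1 + x) ^ (σ / 2) * lam x) ^ 2) Dom := by
    refine ContinuousOn.pow (ContinuousOn.mul ?_ continuousOn_lam) 2
    exact ContinuousOn.rpow_const (by fun_prop) fun x hx => Or.inl (by linarith [hx.1])
  have hl : Tendsto (fun x : ℝ => ((1 + x) ^ (σ / 2) * lam x) ^ 2) (𝓝[>] (-1)) (𝓝 0) := by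
    have h1 := (tendsto_log_mul_rpow_nhdsGT_zero (half_pos hσ)).comp tendsto_one_add_nhdsGT
    have h2 : Tendsto (fun y : ℝ => y ^ (σ / 2)) (𝓝[>] 0) (𝓝 0) := by
      have := (Real.continuousAt_rpow_const 0 (σ / 2) (Or.inr (half_pos hσ).le)).tendsto
      rw [Real.zero_rpow (half_pos hσ).ne'] at this
      exact this.mono_left nhdsWithin_le_nhds
    have h3 := ((h2.comp tendsto_one_add_nhdsGT).mul_const (Real.log 3)).sub h1
    have h4 := h3.pow 2
    rw [zero_mul, sub_zero, zero_pow two_ne_zero] at h4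
    refine h4.congr' ?_
    filter_upwards [self_mem_nhdsWithin] with x hx
    rw [lam_eq hx]
    simp only [Function.comp]
    ring
  have hr : Tendsto (fun x : ℝ => ((1 + x) ^ (σ / 2) * lam x) ^ 2) (𝓝[<] 1)
      (𝓝 (((1 + 1) ^ (σ / 2) * lam 1) ^ 2)) := by
    refine Tendsto.pow (Tendsto.mul ?_ tendsto_lam_right) 2
    have : ContinuousAt (fun x : ℝ => (1 + x) ^ (σ / 2)) 1 :=
      ContinuousAt.rpow_const (by fun_prop) (Or.inl (by norm_num))
    exact this.tendsto.mono_left nhdsWithin_le_nhds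
  obtain ⟨C, hC, h⟩ := exists_bound_of_tendsto hc hl hr
  refine ⟨C, hC, fun x hx => ?_⟩
  have h1 : 0 < 1 - x := by linarith [hx.2]
  have h2 : 0 < 1 + x := by linarith [hx.1]
  have hlp := lam_pos hx
  have e : wphi σ x = ((1 + x) ^ (σ / 2) * lam x) ^ 2 * Hw σ x := by
    unfold wphi Hw
    rw [show 1 - x ^ 2 = (1 - x) * (1 + x) by ring, Real.mul_rpow h1.le h2.le, mul_pow,
      ← Real.rpow_natCast ((1 + x) ^ (σ / 2)), ← Real.rpow_mul h2.le]
    rw [show σ / 2 * ((2 : ℕ) : ℝ) = σ by push_cast; ring]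
    field_simp
  rw [e]
  exact mul_le_mul_of_nonneg_right ((le_abs_self _).trans (h x hx)) (Hw_pos σ x hx).le

/-! ### The `ψ`-operator -/

/-- The integrand `2 f g / (1 - s²)`. -/
def psiIntegrand (f g : ℝ → ℝ) (s : ℝ) : ℝ := 2 * f s * g s / (1 - s ^ 2)

lemma psi_eq (f g : ℝ → ℝ) : psi f g = prim (prim (prim (psiIntegrand f (deriv g)))) := rfl

/-- Integrands of order `(1-x²)^{-(a+2)}`. -/
structure IsPsiInt (a N : ℝ) (k : ℝ → ℝ) : Prop where
  pos : 0 < a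
  lt : a < 1
  nonneg : 0 ≤ N
  cont : ContinuousOn k Dom
  bound : ∀ x ∈ Dom, |k x| ≤ N * wphi (-(a + 1 + 1)) x

namespace IsPsiInt

variable {a N N' : ℝ} {k k' : ℝ → ℝ}

lemma bound1 (h : IsPsiInt a N k) :
    ∀ x ∈ Dom, |prim k x| ≤ N * wphi (-(a + 1)) x := by
  have := abs_prim_le_wphi (by linarith [h.pos]) h.nonneg h.cont h.bound
  rwa [min_eq_left (by linarith [h.pos]), div_one] at this

lemma bound2 (h : IsPsiInt a N k) :
    ∀ x ∈ Dom, |prim (prim k) x| ≤ N / min 1 (2 * a) * wphi (-a) x :=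
  abs_prim_le_wphi h.pos h.nonneg (continuousOn_prim h.cont) h.bound1

lemma nonneg' (h : IsPsiInt a N k) : 0 ≤ N / min 1 (2 * a) :=
  div_nonneg h.nonneg (lt_min one_pos (by linarith [h.pos])).le

lemma intervalIntegrable (h : IsPsiInt a N k) {x y : ℝ} (hx : x ∈ Icc (-1 : ℝ) 1)
    (hy : y ∈ Icc (-1 : ℝ) 1) : IntervalIntegrable (prim (prim k)) volume x y :=
  intervalIntegrable_Icc h.pos.le h.lt h.nonneg' (continuousOn_prim (continuousOn_prim h.cont))
    h.bound2 hx hy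

/-- Inside (-1,1) additivity is continuity of the integrands. At x = ±1 it rests on convergence of
the outermost integral, since a divergent one would be replaced by the default value 0. -/
lemma prim_add (h : IsPsiInt a N k) (h' : IsPsiInt a N' k') {x : ℝ} (hx : x ∈ Icc (-1 : ℝ) 1) :
    prim (prim (prim fun x => k x + k' x)) x
      = prim (prim (prim k)) x + prim (prim (prim k')) x := by
  have e1 : ∀ x ∈ Dom, prim (fun x => k x + k' x) x = prim k x + prim k' x := fun x hx =>
    intervalIntegral.integral_add (intervalIntegrable_of_Ioo h.cont zero_mem_Ioo hx)
      (intervalIntegrable_of_Ioo h'.cont zero_mem_Ioo hx)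
  have e2 : ∀ x ∈ Dom, prim (prim fun x => k x + k' x) x
      = prim (prim k) x + prim (prim k') x := fun x hx => by
    rw [prim_congr e1 (Ioo_subset_Icc_self hx)]
    exact intervalIntegral.integral_add
      (intervalIntegrable_of_Ioo (continuousOn_prim h.cont) zero_mem_Ioo hx)
      (intervalIntegrable_of_Ioo (continuousOn_prim h'.cont) zero_mem_Ioo hx)
  rw [prim_congr e2 hx]
  exact intervalIntegral.integral_add (h.intervalIntegrable (by simp) hx)
    (h'.intervalIntegrable (by simp) hx)

lemma tendsto_right (h : IsPsiInt a N k) :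
    Tendsto (prim (prim (prim k))) (𝓝[<] 1) (𝓝 (prim (prim (prim k)) 1)) := by
  have hc : ContinuousOn (prim (prim (prim k))) (uIcc 0 1) :=
    intervalIntegral.continuousOn_primitive_interval
      ((intervalIntegrable_iff' (by simp)).1 (h.intervalIntegrable (x := 0) (y := 1) (by simp) (by simp)))
  rw [uIcc_of_le zero_le_one] at hc
  exact ((hc 1 (by simp)).mono Ioo_subset_Icc_self).mono_left
    (nhdsWithin_le_of_mem (Ioo_mem_nhdsLT one_pos))

end IsPsiInt

lemma prim_const_mul (r : ℝ) (k : ℝ → ℝ) (x : ℝ) : prim (fun s => r * k s) x = r * prim k x :=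
  intervalIntegral.integral_const_mul _ _

lemma corr_add (p q : ℝ → ℝ) (x : ℝ) :
    corr (fun x => p x + q x) x = corr p x + corr q x := by
  unfold corr
  ring

lemma corr_const_mul (r : ℝ) (p : ℝ → ℝ) (x : ℝ) : corr (fun x => r * p x) x = r * corr p x := by
  unfold corr
  ring

lemma corr_congr {p q : ℝ → ℝ} (h : ∀ x ∈ Icc (-1 : ℝ) 1, p x = q x) :
    ∀ x ∈ Dom, corr p x = corr q x := fun x hx => by
  unfold corr
  rw [h x (Ioo_subset_Icc_self hx), h (-1) (by simp), h 1 (by simp)]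

/-- The singular exponents add up to ε + (1+ε) + 1 = 2ε + 2. Two integrations bring this to 2ε, and
ε < 1/2 is exactly what makes the third converge at the poles. -/
lemma isPsiInt_wfn {ε : ℝ} (h0 : 0 < ε) (h1 : ε < 1 / 2) (F G : Dom →ᵇ ℝ) :
    IsPsiInt (2 * ε) (2 * ‖F‖ * ‖G‖) (psiIntegrand (wfn ε F) (wfn (1 + ε) G)) where
  pos := by linarith
  lt := by linarith
  nonneg := by positivity
  cont := continuousOn_div_one_sub_sq
    ((continuousOn_const.mul (continuousOn_wfn _ _)).mul (continuousOn_wfn _ _))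
  bound := fun x hx => by
    have hp := one_sub_sq_pos hx
    have e1 : wphi (-(2 * ε + 1 + 1)) x = wphi (-ε) x * wphi (-(1 + ε)) x / (1 - x ^ 2) := by
      rw [eq_div_iff hp.ne', ← wphi_one x, wphi_mul _ _ hx, wphi_mul _ _ hx]
      congr 1
      ring
    unfold psiIntegrand
    rw [abs_div, abs_of_pos hp, e1, mul_div_assoc']
    refine div_le_div_of_nonneg_right ?_ hp.le
    rw [abs_mul, abs_mul, abs_two]
    calc 2 * |wfn ε F x| * |wfn (1 + ε) G x|
        ≤ 2 * (‖F‖ * wphi (-ε) x) * (‖G‖ * wphi (-(1 + ε)) x) := by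
          have := abs_wfn_le ε F hx
          have := abs_wfn_le (1 + ε) G hx
          have := wphi_pos (-ε) hx
          gcongr
      _ = _ := by ring

/-- The operator `(F, G) ↦ R`, where `R` is the corrected `ψ`. -/
lemma exists_psiOp {ε : ℝ} (h0 : 0 < ε) (h1 : ε < 1 / 2) :
    ∃ L : (Dom →ᵇ ℝ) →L[ℝ] (Dom →ᵇ ℝ) →L[ℝ] Z (Hw (1 - 2 * ε)), ∀ F G, ∀ x ∈ Dom,
      Z.fn (L F G) x = corr (prim (prim (prim (psiIntegrand (wfn ε F) (wfn (1 + ε) G))))) x := by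
  obtain ⟨C, hC, hle⟩ := wphi_le_Hw (σ := 1 - 2 * ε) (by linarith)
  obtain ⟨K1, hK1, b1⟩ := exists_bounds_half (continuousOn_wphi (-(2 * ε + 1)))
  obtain ⟨K2, hK2, b2⟩ := exists_bounds_half (continuousOn_wphi (-(2 * ε)))
  set m := min 1 (2 * (2 * ε)) with hm
  have hm0 : 0 < m := lt_min one_pos (by linarith)
  have key : ∀ F G : Dom →ᵇ ℝ, IsPsiInt (2 * ε) (2 * ‖F‖ * ‖G‖)
    (psiIntegrand (wfn ε F) (wfn (1 + ε) G)) := fun F G => isPsiInt_wfn h0 h1 F G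
  have smul_aux : ∀ (r : ℝ) (k k' : ℝ → ℝ), (∀ x, k' x = r * k x) →
      ∀ x, corr (prim (prim (prim k'))) x = r * corr (prim (prim (prim k))) x := by
    intro r k k' hk x
    rw [show k' = fun x => r * k x from funext hk]
    simp only [funext (prim_const_mul r _), corr_const_mul]
  have hm1 : 0 < 1 - 2 * ε := by linarith
  refine exists_bilin Dom (Z.fnₗ (Hw (1 - 2 * ε))) (fun t ht => Z.eq_zero (Hw_pos _) t ht)
    (fun F G => corr (prim (prim (prim (psiIntegrand (wfn ε F) (wfn (1 + ε) G))))))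
    (fun F F' G x hx => ?_) (fun r F G x hx => smul_aux r _ _ (fun s => ?_) x)
    (fun F G G' x hx => ?_) (fun r F G x hx => smul_aux r _ _ (fun s => ?_) x)
    -- The three groups bound the function against `Hw`, its first derivative and its second
    -- derivative on the half interval.
    (8 / m / (1 - 2 * ε) * C + (2 / m * K2 + 6 / m / (1 - 2 * ε)) + (2 * K1 + 4 / m / (1 - 2 * ε)))
    fun F G => ?_
  · rw [← corr_add]
    refine corr_congr (fun y hy => ?_) x hx
    rw [← (key F G).prim_add (key F' G) hy]
    congr 4
    funext s
    simp only [psiIntegrand, wfn_add]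
    ring
  · simp only [psiIntegrand, wfn_smul]
    ring
  · rw [← corr_add]
    refine corr_congr (fun y hy => ?_) x hx
    rw [← (key F G).prim_add (key F G') hy]
    congr 4
    funext s
    simp only [psiIntegrand, wfn_add]
    ring
  · simp only [psiIntegrand, wfn_smul]
    ring
  · have hk := key F G
    set k := psiIntegrand (wfn ε F) (wfn (1 + ε) G) with hkdef
    set Nn := ‖F‖ * ‖G‖ with hNn
    have hNn0 : 0 ≤ Nn := by positivity
    set A := (prim (prim (prim k)) (-1)) with hA
    set B := (prim (prim (prim k)) 1) with hB
    have hc1 := continuousOn_prim hk.cont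
    have hc2 := continuousOn_prim hc1
    have hbd : |A| ≤ 2 * Nn / m / (1 - 2 * ε) ∧ |B| ≤ 2 * Nn / m / (1 - 2 * ε) := by
      have h1 := abs_prim_one_sub_le hk.pos.le hk.lt hk.nonneg' hc2 hk.bound2 (x := 0) (by simp)
      have h2 := abs_prim_neg_one_sub_le hk.pos.le hk.lt hk.nonneg' hc2 hk.bound2 (x := 0) (by simp)
      simp only [prim_zero, sub_zero, add_zero, Real.one_rpow, mul_one] at h1 h2
      rw [hNn, ← mul_assoc]
      exact ⟨h2, h1⟩
    obtain ⟨hA1, hA2⟩ := abs_le.1 hbd.1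
    obtain ⟨hB1, hB2⟩ := abs_le.1 hbd.2
    have hD1 : ∀ x ∈ Half, HasDerivAt (corr (prim (prim (prim k))))
        (prim (prim k) x + A / 2 - B / 2 - (A + B) * x) x := fun x hx => by
      have hx' := half_subset_dom hx
      have e1 : HasDerivAt (fun x : ℝ => A / 2 * (1 - x)) (-(A / 2)) x := by
        simpa using ((hasDerivAt_id x).const_sub 1).const_mul (A / 2)
      have e2 : HasDerivAt (fun x : ℝ => B / 2 * (1 + x)) (B / 2) x := by
        simpa using ((hasDerivAt_id x).const_add 1).const_mul (B / 2)
      have e3 : HasDerivAt (fun x : ℝ => (A + B) / 2 * (1 - x ^ 2)) ((A + B) / 2 * -(2 * x)) x := by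
        simpa using ((hasDerivAt_pow 2 x).const_sub 1).const_mul ((A + B) / 2)
      refine ((((hasDerivAt_prim hc2 hx').sub e1).sub e2).add e3).congr_deriv ?_
      ring
    have hD2 : ∀ x ∈ Half, HasDerivAt (fun x => prim (prim k) x + A / 2 - B / 2 - (A + B) * x)
        (prim k x - (A + B)) x := fun x hx => by
      have e3 : HasDerivAt (fun x : ℝ => (A + B) * x) (A + B) x := by
        simpa using (hasDerivAt_id x).const_mul (A + B)
      exact (((hasDerivAt_prim hc1 (half_subset_dom hx)).add_const (A / 2)).sub_const (B / 2)).sub e3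
    have hp1 : 0 ≤ 8 / m / (1 - 2 * ε) * C := by positivity
    have hp2 : 0 ≤ 2 / m * K2 + 6 / m / (1 - 2 * ε) := by positivity
    have hp3 : 0 ≤ 2 * K1 + 4 / m / (1 - 2 * ε) := by positivity
    rw [mul_assoc, ← hNn]
    refine Z.exists_of (Hw_pos _) (continuousOn_Hw _) (by positivity)
      (f := corr (prim (prim (prim k)))) ?_ hD1 hD2
      ((hc1.mono half_subset_dom).sub continuousOn_const) ?_ ?_ ?_
    · unfold corr
      exact (((continuousOn_prim hc2).sub (by fun_prop)).sub (by fun_prop)).add (by fun_prop)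
    · intro x hx
      have hH := Hw_pos (1 - 2 * ε) x hx
      calc |corr (prim (prim (prim k))) x|
          ≤ 4 * (2 * ‖F‖ * ‖G‖ / m / (1 - 2 * ε)) * wphi (1 - 2 * ε) x :=
            abs_corr_prim_le hk.pos.le hk.lt hk.nonneg' hc2 hk.bound2 x hx
        _ ≤ 4 * (2 * ‖F‖ * ‖G‖ / m / (1 - 2 * ε)) * (C * Hw (1 - 2 * ε) x) :=
            mul_le_mul_of_nonneg_left (hle x hx) (by positivity)
        _ = 8 / m / (1 - 2 * ε) * C * Nn * Hw (1 - 2 * ε) x := by rw [hNn]; ring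
        _ ≤ _ := by
            refine mul_le_mul_of_nonneg_right (mul_le_mul_of_nonneg_right ?_ hNn0) hH.le
            linarith
    · intro x hx
      have e1 : |prim (prim k) x| ≤ 2 / m * K2 * Nn := by
        refine (hk.bound2 x (half_subset_dom hx)).trans ?_
        calc 2 * ‖F‖ * ‖G‖ / m * wphi (-(2 * ε)) x ≤ 2 * ‖F‖ * ‖G‖ / m * K2 :=
              mul_le_mul_of_nonneg_left ((le_abs_self _).trans (b2 x hx)) (by positivity)
          _ = _ := by rw [hNn]; ring
      have e2 : |A / 2 - B / 2 - (A + B) * x| ≤ 3 * (2 * Nn / m / (1 - 2 * ε)) := by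
        rw [abs_le]
        constructor <;> nlinarith [hx.1, hx.2]
      have e3 := abs_add_le (prim (prim k) x) (A / 2 - B / 2 - (A + B) * x)
      have e4 : 3 * (2 * Nn / m / (1 - 2 * ε)) = 6 / m / (1 - 2 * ε) * Nn := by ring
      rw [show prim (prim k) x + A / 2 - B / 2 - (A + B) * x
        = prim (prim k) x + (A / 2 - B / 2 - (A + B) * x) by ring]
      nlinarith [mul_nonneg hp1 hNn0, mul_nonneg hp3 hNn0]
    · intro x hx
      have e1 : |prim k x| ≤ 2 * K1 * Nn := by
        refine (hk.bound1 x (half_subset_dom hx)).trans ?_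
        calc 2 * ‖F‖ * ‖G‖ * wphi (-(2 * ε + 1)) x ≤ 2 * ‖F‖ * ‖G‖ * K1 :=
              mul_le_mul_of_nonneg_left ((le_abs_self _).trans (b1 x hx)) (by positivity)
          _ = _ := by rw [hNn]; ring
      have e2 : |A + B| ≤ 2 * (2 * Nn / m / (1 - 2 * ε)) := by
        rw [abs_le]
        constructor <;> linarith
      have e3 := abs_sub (prim k x) (A + B)
      have e4 : 2 * (2 * Nn / m / (1 - 2 * ε)) = 4 / m / (1 - 2 * ε) * Nn := by ring
      nlinarith [mul_nonneg hp1 hNn0, mul_nonneg hp2 hNn0]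

/-! ### The `φ`-operator -/

/-- `g(0) = s`, `g'(0) = v` and `(1-x²) g'' + U g' = k` on `(-1,1)`. -/
def PhiRel (U : ℝ → ℝ) (s v : ℝ) (k g : ℝ → ℝ) : Prop := g 0 = s ∧ LinRel U v k (deriv g)

section base

variable {c : Fin 3 → ℝ} {γ ε : ℝ}

lemma IsBase.tendsto_alph_left (hb : IsBase c γ ε) : Tendsto (alph c γ) (𝓝[>] (-1)) (𝓝 0) := by
  have h := hb.left.mul (tendsto_inv_atTop_zero.comp tendsto_lam)
  rw [mul_zero] at h
  refine h.congr' ?_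
  filter_upwards [dom_mem_left] with x hx
  have := (lam_pos hx).ne'
  simp only [Function.comp, alph]
  field_simp

lemma IsBase.tendsto_Ubar_left (hb : IsBase c γ ε) : Tendsto (Ubar c γ) (𝓝[>] (-1)) (𝓝 2) := by
  have h1 : Tendsto (fun x : ℝ => 2 * x) (𝓝[>] (-1)) (𝓝 (2 * (-1))) :=
    ((continuous_const.mul continuous_id).tendsto (-1)).mono_left nhdsWithin_le_nhds
  have := hb.tendsto_alph_left.sub h1
  norm_num at this
  refine this.congr fun x => ?_
  unfold alph
  ring

lemma IsBase.tendsto_Ubar_right (hb : IsBase c γ ε) :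
    Tendsto (Ubar c γ) (𝓝[<] 1) (𝓝 (2 * √(1 + c 1) - 2)) := by
  have h1 : Tendsto (fun x : ℝ => 2 * x) (𝓝[<] 1) (𝓝 (2 * 1)) :=
    ((continuous_const.mul continuous_id).tendsto 1).mono_left nhdsWithin_le_nhds
  have := hb.right.sub h1
  rw [mul_one] at this
  refine this.congr fun x => ?_
  ring

/-- The power (1-x²)^{-(1+ε)} serves both as barrier and as source weight: the operator multiplies
it by 2(1+ε)x + U, which tends to 2ε + 2√(1 + c 1) > ε at 1 and to -2ε < -ε at -1. -/
lemma IsBase.phi_bound (hb : IsBase c γ ε) :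
    ∃ C' ≥ 0, ∀ (f h : ℝ → ℝ) (N : ℝ), ContinuousOn h Dom →
      (∀ x ∈ Dom, HasDerivAt f ((h x - Ubar c γ x * f x) / (1 - x ^ 2)) x) →
      (∀ x ∈ Dom, |h x| ≤ N * wphi (-(1 + ε)) x) → 0 ≤ N →
      ∀ x ∈ Dom, |f x| ≤ C' * (|f 0| + N) * wphi (-(1 + ε)) x := by
  have hε := hb.eps_pos
  have hform : ∀ x ∈ Dom, (1 - x ^ 2) * (-2 * -(1 + ε) * x * wphi (-(1 + ε) - 1) x)
      + Ubar c γ x * wphi (-(1 + ε)) x = wphi (-(1 + ε)) x * (2 * (1 + ε) * x + Ubar c γ x) := by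
    intro x hx
    have : wphi (-(1 + ε)) x = (1 - x ^ 2) * wphi (-(1 + ε) - 1) x := by
      rw [← wphi_one, wphi_mul _ _ hx]
      congr 1
      ring
    rw [this]
    ring
  have hlin : ∀ (a : ℝ) (s : Set ℝ), Tendsto (fun x : ℝ => 2 * (1 + ε) * x) (𝓝[s] a)
      (𝓝 (2 * (1 + ε) * a)) := fun a s =>
    ((continuous_const.mul continuous_id).tendsto a).mono_left nhdsWithin_le_nhds
  refine barrier_bound (G := wphi (-(1 + ε)))
    (G' := fun x => -2 * -(1 + ε) * x * wphi (-(1 + ε) - 1) x)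
    (H := wphi (-(1 + ε))) (C := ε⁻¹) hb.sol.continuousOn (fun x hx => hasDerivAt_wphi _ hx)
    (fun x hx => wphi_pos _ hx) (continuousOn_wphi _) (fun x hx => (wphi_pos _ hx).le)
    (by positivity) ?_ ?_
  · have hev : ∀ᶠ x in 𝓝[<] (1 : ℝ), ε < 2 * (1 + ε) * x + Ubar c γ x :=
      ((hlin 1 _).add hb.tendsto_Ubar_right).eventually (lt_mem_nhds (by
        have := Real.sqrt_nonneg (1 + c 1)
        linarith))
    filter_upwards [hev, dom_mem_right] with x hx1 hx
    rw [hform x hx]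
    have hG := wphi_pos (-(1 + ε)) hx
    calc wphi (-(1 + ε)) x = ε⁻¹ * (wphi (-(1 + ε)) x * ε) := by field_simp
      _ ≤ _ := by gcongr
  · have hev : ∀ᶠ x in 𝓝[>] (-1 : ℝ), 2 * (1 + ε) * x + Ubar c γ x < -ε :=
      ((hlin (-1) _).add hb.tendsto_Ubar_left).eventually (gt_mem_nhds (by linarith))
    filter_upwards [hev, dom_mem_left] with x hx1 hx
    rw [hform x hx]
    have hG := wphi_pos (-(1 + ε)) hx
    calc wphi (-(1 + ε)) x = -ε⁻¹ * (wphi (-(1 + ε)) x * -ε) := by field_simp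
      _ ≤ _ := by
        rw [neg_mul, neg_mul, neg_le_neg_iff]
        gcongr

/-- The solution operator of the `φ`-equation with values in `M₂`. -/
lemma IsBase.exists_phiM2 (hb : IsBase c γ ε) :
    ∃ L : (ℝ × ℝ × (Dom →ᵇ ℝ)) →L[ℝ] M2 ε,
      ∀ a, PhiRel (Ubar c γ) a.1 a.2.1 (wfn (1 + ε) a.2.2) (L a).fn := by
  obtain ⟨C, hC, hbound⟩ := hb.phi_bound
  obtain ⟨C₁, hC₁, hU⟩ := hb.Ubar_bound
  have hε := hb.eps_pos
  have hUc := hb.sol.continuousOn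
  have hmm : 0 < min 1 (2 * ε) := lt_min one_pos (by linarith)
  -- The summands serve the value at 0, the primitive, the first derivative and the second
  -- derivative.
  set D := 1 + C / min 1 (2 * ε) + C + (1 + C₁ * C) with hD
  have hD0 : 0 ≤ D := by positivity
  refine exists_clm_of_rel (fun (a : ℝ × ℝ × (Dom →ᵇ ℝ)) (t : M2 ε) =>
    PhiRel (Ubar c γ) a.1 a.2.1 (wfn (1 + ε) a.2.2) t.fn)
    (fun a b s t h h' => ⟨?_, ?_⟩) (fun r a t h => ⟨?_, ?_⟩) (fun t h => ?_) (3 * (D * 3))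
    fun a => ?_
  · rw [M2.fn_add, Pi.add_apply, h.1, h'.1]
    rfl
  · exact (h.2.add h'.2).congr (fun x _ => (wfn_add _ _ _ x).symm)
      fun x hx => (deriv_add_of s.isM2.smooth1 t.isM2.smooth1 x hx).symm
  · rw [M2.fn_smul, Pi.smul_apply, h.1]
    rfl
  · exact (h.2.smul r).congr (fun x _ => (wfn_smul _ _ _ x).symm)
      fun x hx => (deriv_smul_of t.isM2.smooth1 r x hx).symm
  · have h1 : ∀ x ∈ Dom, deriv t.fn x = 0 := LinRel.unique hUc h.2 ⟨rfl, fun x hx => by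
      have : wfn (1 + ε) (0 : Dom →ᵇ ℝ) x = 0 := wfn_zero _ _
      simp only [Prod.snd_zero, this]
      exact (hasDerivAt_const x (0 : ℝ)).congr_deriv (by simp)⟩
    refine M2.ext_dom fun x hx => ?_
    rw [eq_of_deriv_zero (f := t.fn) (fun y hy => by
      have := t.hasDerivAt_fn hy
      rwa [h1 y hy] at this) x hx, h.1]
    rfl
  · obtain ⟨s, v, k⟩ := a
    set N := |s| + |v| + ‖k‖ with hN
    have hN0 : 0 ≤ N := by positivity
    have hkc := continuousOn_wfn (1 + ε) k
    obtain ⟨g1, hg0, hg1⟩ := linear_ode_exists hUc hkc v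
    have hg1c : ContinuousOn g1 Dom := fun x hx => (hg1 x hx).continuousAt.continuousWithinAt
    have hb1 : ∀ x ∈ Dom, |g1 x| ≤ C * N * wphi (-(1 + ε)) x := fun x hx => by
      refine (hbound g1 _ ‖k‖ hkc hg1 (fun x hx => abs_wfn_le _ k hx) (norm_nonneg _) x hx).trans ?_
      refine mul_le_mul_of_nonneg_right (mul_le_mul_of_nonneg_left ?_ hC) (wphi_pos _ hx).le
      rw [hg0, hN]
      linarith [abs_nonneg s]
    set g : ℝ → ℝ := fun x => s + prim g1 x with hg
    have hgd : ∀ x ∈ Dom, HasDerivAt g (g1 x) x := fun x hx =>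
      (hasDerivAt_prim hg1c hx).const_add s
    have one_le : ∀ x ∈ Dom, 1 ≤ wphi (-ε) x := fun x hx => by
      have h1 := wphi_le_one hε.le hx
      have h2 := wphi_neg_mul ε hx
      have h3 := wphi_pos (-ε) hx
      nlinarith
    have hex : ∃ F : M2 ε, (∀ x ∈ Dom, F.fn x = g x) ∧ ‖F‖ ≤ 3 * (D * N) := by
      refine M2.exists_of (by positivity) hgd hg1
        (continuousOn_div_one_sub_sq (hkc.sub (hUc.mul hg1c))) (fun x hx => ?_)
        (fun x hx => ?_) (fun x hx => ?_)
      · have e := abs_prim_le_wphi hε (by positivity : 0 ≤ C * N) hg1c (fun x hx => by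
          rw [add_comm ε 1]
          exact hb1 x hx) x hx
        have e1 := abs_add_le s (prim g1 x)
        have e2 := one_le x hx
        have e3 : |s| ≤ N := by rw [hN]; linarith [abs_nonneg v, norm_nonneg k]
        have e4 : |s| ≤ N * wphi (-ε) x := by nlinarith
        calc |g x| ≤ N * wphi (-ε) x + C * N / min 1 (2 * ε) * wphi (-ε) x := by
              simp only [hg]; linarith
          _ = (1 + C / min 1 (2 * ε)) * N * wphi (-ε) x := by ring
          _ ≤ D * N * wphi (-ε) x := by
              refine mul_le_mul_of_nonneg_right (mul_le_mul_of_nonneg_right ?_ hN0) (by linarith)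
              have : 0 ≤ C₁ * C := by positivity
              rw [hD]
              linarith
      · refine (hb1 x hx).trans
          (mul_le_mul_of_nonneg_right (mul_le_mul_of_nonneg_right ?_ hN0) (wphi_pos _ hx).le)
        have : 0 ≤ C₁ * C := by positivity
        have : 0 ≤ C / min 1 (2 * ε) := by positivity
        rw [hD]
        linarith
      · have hp := one_sub_sq_pos hx
        have e0 : wphi (-(2 + ε)) x = wphi (-(1 + ε)) x / (1 - x ^ 2) := by
          rw [eq_div_iff hp.ne', ← wphi_one x, wphi_mul _ _ hx]
          congr 1
          ring
        rw [e0, abs_div, abs_of_pos hp, mul_div_assoc']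
        refine div_le_div_of_nonneg_right ?_ hp.le
        have e1 := abs_wfn_le (1 + ε) k hx
        have hw := wphi_pos (-(1 + ε)) hx
        have e2 : ‖k‖ * wphi (-(1 + ε)) x ≤ N * wphi (-(1 + ε)) x := by
          refine mul_le_mul_of_nonneg_right ?_ hw.le
          rw [hN]
          linarith [abs_nonneg v, abs_nonneg s]
        have e3 : |Ubar c γ x * g1 x| ≤ C₁ * (C * N * wphi (-(1 + ε)) x) := by
          rw [abs_mul]
          exact mul_le_mul (hU x hx) (hb1 x hx) (abs_nonneg _) hC₁
        have e4 := abs_sub (wfn (1 + ε) k x) (Ubar c γ x * g1 x)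
        calc |wfn (1 + ε) k x - Ubar c γ x * g1 x| ≤ (1 + C₁ * C) * N * wphi (-(1 + ε)) x := by
              linarith
          _ ≤ _ := by
              refine mul_le_mul_of_nonneg_right (mul_le_mul_of_nonneg_right ?_ hN0) hw.le
              have : 0 ≤ C / min 1 (2 * ε) := by positivity
              rw [hD]
              linarith
    obtain ⟨F, hF, hn⟩ := hex
    have hFd : ∀ x ∈ Dom, deriv F.fn x = g1 x := fun x hx =>
      (deriv_eq_of_hasDerivAt isOpen_Ioo hgd hF x hx).deriv
    refine ⟨F, ⟨?_, LinRel.congr ⟨hg0, hg1⟩ (fun _ _ => rfl) fun x hx => (hFd x hx).symm⟩,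
      hn.trans ?_⟩
    · rw [hF 0 zero_mem_Ioo]
      simp [hg, prim_zero]
    · have e1 : |s| ≤ ‖(s, v, k)‖ := norm_fst_le (s, v, k)
      have e2 : |v| ≤ ‖(s, v, k)‖ := (norm_fst_le (v, k)).trans (norm_snd_le (s, v, k))
      have e3 : ‖k‖ ≤ ‖(s, v, k)‖ := (norm_snd_le (v, k)).trans (norm_snd_le (s, v, k))
      have e4 : N ≤ 3 * ‖(s, v, k)‖ := by rw [hN]; linarith
      have := mul_le_mul_of_nonneg_left e4 hD0
      linarith

end base

open scoped BoundedContinuousFunction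

/-! ### A triangular quadratic fixed point problem -/

section abstract

variable {A B C D : Type*} [NormedAddCommGroup A] [NormedSpace ℝ A] [NormedAddCommGroup B]
  [NormedSpace ℝ B] [NormedAddCommGroup C] [NormedSpace ℝ C] [NormedAddCommGroup D]
  [NormedSpace ℝ D]

/-- Composition of a bilinear map with linear maps. -/
def bilin {E E' : Type*} [NormedAddCommGroup E] [NormedSpace ℝ E] [NormedAddCommGroup E']
    [NormedSpace ℝ E'] (T : C →L[ℝ] D) (b : A →L[ℝ] B →L[ℝ] C) (π : E →L[ℝ] A) (π' : E' →L[ℝ] B) :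
    E →L[ℝ] E' →L[ℝ] D :=
  (ContinuousLinearMap.compL ℝ E' C D T).comp (b.bilinearComp π π')

lemma bilin_apply {E E' : Type*} [NormedAddCommGroup E] [NormedSpace ℝ E] [NormedAddCommGroup E']
    [NormedSpace ℝ E'] (T : C →L[ℝ] D) (b : A →L[ℝ] B →L[ℝ] C) (π : E →L[ℝ] A) (π' : E' →L[ℝ] B)
    (x : E) (y : E') : bilin T b π π' x y = T (b (π x) (π' y)) := rfl

/-- The unknowns are `f` in `F`, depending on `q` alone, and `W` in `X`. Since `X` need not be
complete, the equation is solved for the pair (f, ιW) in the Banach space `F × Y` by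
`exists_quadratic_inverse`; `W` is then recovered as the right-hand side, which takes values in `X`.
In the application `f` is the deviation of U^{c,γ} from the base solution and `W` the perturbation
of U^{c,γ}. -/
lemma exists_triangular_solution {Q V F Y X : Type*} [NormedAddCommGroup Q] [NormedSpace ℝ Q]
    [NormedAddCommGroup V] [NormedSpace ℝ V] [NormedAddCommGroup F] [NormedSpace ℝ F]
    [CompleteSpace F] [NormedAddCommGroup Y] [NormedSpace ℝ Y] [CompleteSpace Y]
    [NormedAddCommGroup X] [NormedSpace ℝ X] (ι : X →L[ℝ] Y) {a : Q → F} (ha : ContDiff ℝ ∞ a)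
    {q₀ : Q} (ha0 : a q₀ = 0) {k : V → X} (hk : ContDiff ℝ ∞ k) (hk0 : k 0 = 0)
    (b₀ : F →L[ℝ] F →L[ℝ] F) (b₁ : F →L[ℝ] Y →L[ℝ] X) (b₂ : Y →L[ℝ] Y →L[ℝ] X) :
    ∃ r > 0, ∃ δ > 0, ∃ O : Set Q, IsOpen O ∧ q₀ ∈ O ∧ ∃ (f : Q → F) (S : Q × V → X),
      ContDiffOn ℝ ∞ S (O ×ˢ Metric.ball 0 δ) ∧ ∀ q ∈ O, f q = a q + b₀ (f q) (f q) ∧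
        ∀ β ∈ Metric.ball (0 : V) δ, ‖S (q, β)‖ < r ∧
          S (q, β) = k β + b₁ (f q) (ι (S (q, β))) + b₂ (ι (S (q, β))) (ι (S (q, β))) ∧
          ∀ W : X, ‖W‖ < r → W = k β + b₁ (f q) (ι W) + b₂ (ι W) (ι W) → W = S (q, β) := by
  let p₁ := ContinuousLinearMap.fst ℝ F Y
  let p₂ := ContinuousLinearMap.snd ℝ F Y
  let bb : (F × Y) →L[ℝ] (F × Y) →L[ℝ] (F × Y) :=
    bilin (ContinuousLinearMap.inl ℝ F Y) b₀ p₁ p₁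
      + (bilin ((ContinuousLinearMap.inr ℝ F Y).comp ι) b₁ p₁ p₂
        + bilin ((ContinuousLinearMap.inr ℝ F Y).comp ι) b₂ p₂ p₂)
  have hbb : ∀ z : F × Y, bb z z = (b₀ z.1 z.1, ι (b₁ z.1 z.2 + b₂ z.2 z.2)) := by
    intro z
    have h1 : bb z z = (b₀ z.1 z.1, (0 : Y)) + (((0 : F), ι (b₁ z.1 z.2)) + (0, ι (b₂ z.2 z.2))) := rfl
    rw [h1]
    ext <;> simp
  obtain ⟨R, hR, R', hR', Φ, hΦ, hΦ0, hsol, huniq⟩ := exists_quadratic_inverse bb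
  let y : Q × V → F × Y := fun p => (a p.1, ι (k p.2))
  have hy : ContDiff ℝ ∞ y :=
    (ha.comp contDiff_fst).prodMk (ι.contDiff.comp (hk.comp contDiff_snd))
  have hy0 : y (q₀, 0) = 0 := by
    simp only [y, ha0, hk0, map_zero]
    rfl
  -- The right-hand side evaluated at the solution in `F × Y`: smooth into `X`, and mapped by `ι` to
  -- the second component of the solution.
  let T : Q × V → X := fun p => k p.2 + b₁ (Φ (y p)).1 (Φ (y p)).2 + b₂ (Φ (y p)).2 (Φ (y p)).2
  have hopen : IsOpen (y ⁻¹' Metric.ball 0 R') := Metric.isOpen_ball.preimage hy.continuous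
  have hz : ContDiffOn ℝ ∞ (fun p => Φ (y p)) (y ⁻¹' Metric.ball 0 R') :=
    hΦ.comp hy.contDiffOn fun p hp => hp
  have hT : ContDiffOn ℝ ∞ T (y ⁻¹' Metric.ball 0 R') :=
    ((hk.comp contDiff_snd).contDiffOn.add
      ((b₁.isBoundedBilinearMap.contDiff (n := ∞)).comp_contDiffOn
        ((contDiff_fst.comp_contDiffOn hz).prodMk (contDiff_snd.comp_contDiffOn hz)))).add
      ((b₂.isBoundedBilinearMap.contDiff (n := ∞)).comp_contDiffOn
        ((contDiff_snd.comp_contDiffOn hz).prodMk (contDiff_snd.comp_contDiffOn hz)))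
  have hT0 : T (q₀, 0) = 0 := by
    simp [T, hy0, hΦ0, hk0]
  -- This radius guarantees that ‖W‖ < r puts `ι W` into the ball of uniqueness of radius `R`;
  -- adding 1 avoids division by zero.
  set r := R / (‖ι‖ + 1) with hr
  have hrpos : 0 < r := by positivity
  have hmem : (q₀, (0 : V)) ∈ y ⁻¹' Metric.ball 0 R' := by
    rw [mem_preimage, hy0]
    exact Metric.mem_ball_self hR'
  have hev : ∀ᶠ p in 𝓝 (q₀, (0 : V)), y p ∈ Metric.ball 0 R' ∧ ‖T p‖ < r := by
    refine Eventually.and (hopen.mem_nhds hmem) ?_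
    have hc : ContinuousAt T (q₀, 0) := hT.continuousOn.continuousAt (hopen.mem_nhds hmem)
    have : Tendsto (fun p => ‖T p‖) (𝓝 (q₀, 0)) (𝓝 0) := by
      have := hc.norm.tendsto
      rwa [hT0, norm_zero] at this
    exact this.eventually (gt_mem_nhds hrpos)
  rw [nhds_prod_eq] at hev
  obtain ⟨P, hP, P', hP', hPP⟩ := eventually_prod_iff.1 hev
  obtain ⟨δ, hδ, hball⟩ := Metric.eventually_nhds_iff_ball.1 hP'
  obtain ⟨O, hOP, hO, hqO⟩ := mem_nhds_iff.1 hP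
  have hin : ∀ q ∈ O, ∀ β ∈ Metric.ball (0 : V) δ,
      y (q, β) ∈ Metric.ball 0 R' ∧ ‖T (q, β)‖ < r := fun q hq β hβ => hPP (hOP hq) (hball β hβ)
  have h0δ : (0 : V) ∈ Metric.ball (0 : V) δ := Metric.mem_ball_self hδ
  let f : Q → F := fun q => (Φ (y (q, 0))).1
  have split : ∀ (z : F × Y) (p : Q × V), z - bb z z = y p ↔
      z.1 = a p.1 + b₀ z.1 z.1 ∧ z.2 = ι (k p.2 + b₁ z.1 z.2 + b₂ z.2 z.2) := by
    intro z p
    rw [hbb, Prod.ext_iff]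
    simp only [Prod.fst_sub, Prod.snd_sub, y]
    rw [sub_eq_iff_eq_add, sub_eq_iff_eq_add, ← map_add, ← add_assoc]
  have ballfst : ∀ z : F × Y, z ∈ Metric.ball (0 : F × Y) R → ‖z.1‖ < R := fun z hz =>
    (norm_fst_le z).trans_lt (by simpa using hz)
  -- The first equation contains neither β nor `W`; uniqueness for β = 0, applied to the pair with
  -- zero second component, shows that the first component does not see β.
  have hfeq : ∀ q ∈ O, ∀ β ∈ Metric.ball (0 : V) δ, (Φ (y (q, β))).1 = f q := by
    intro q hq β hβ
    obtain ⟨h1, h2⟩ := hsol _ (hin q hq β hβ).1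
    have h3 := ((split _ _).1 h2).1
    have h4 : ((Φ (y (q, β))).1, (0 : Y)) = Φ (y (q, 0)) := by
      refine huniq _ (hin q hq 0 h0δ).1 _ ?_ ((split _ _).2 ⟨h3, ?_⟩)
      · rw [mem_ball_zero_iff]
        refine max_lt (ballfst (Φ (y (q, β))) h1) ?_
        rw [norm_zero]
        exact hR
      · simp [hk0]
    rw [show f q = (Φ (y (q, 0))).1 from rfl, ← h4]
  refine ⟨r, hrpos, δ, hδ, O, hO, hqO, f, T, hT.mono fun p hp => (hin p.1 hp.1 p.2 hp.2).1,
    fun q hq => ⟨((split _ _).1 (hsol _ (hin q hq 0 h0δ).1).2).1, fun β hβ => ?_⟩⟩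
  obtain ⟨h1, h2⟩ := hsol _ (hin q hq β hβ).1
  have h3 := ((split _ _).1 h2).2
  have hTz : ι (T (q, β)) = (Φ (y (q, β))).2 := h3.symm
  refine ⟨(hin q hq β hβ).2, ?_, fun W hW hWe => ?_⟩
  · rw [hTz, ← hfeq q hq β hβ]
  · have h4 : (f q, ι W) = Φ (y (q, β)) := by
      refine huniq _ (hin q hq β hβ).1 _ ?_ ((split _ _).2 ⟨?_, ?_⟩)
      · rw [mem_ball_zero_iff]
        refine max_lt (ballfst (Φ (y (q, 0))) (hsol _ (hin q hq 0 h0δ).1).1) ?_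
        calc ‖ι W‖ ≤ ‖ι‖ * ‖W‖ := ι.le_opNorm W
          _ ≤ (‖ι‖ + 1) * ‖W‖ := by gcongr; linarith
          _ < (‖ι‖ + 1) * r := by gcongr
          _ = R := by rw [hr]; field_simp
      · exact ((split _ _).1 (hsol _ (hin q hq 0 h0δ).1).2).1
      · exact congrArg ι hWe
    have e1 : f q = (Φ (y (q, β))).1 := by rw [← h4]
    have e2 : ι W = (Φ (y (q, β))).2 := by rw [← h4]
    rw [hWe, e1, e2]

/-- Since `S 0 = 0`, the quadratic term contributes nothing at first order, and the derivative
solves the linearized equation. No invertibility is needed, because differentiability of `S` is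
assumed. -/
lemma hasFDerivAt_quadratic {V X Y : Type*} [NormedAddCommGroup V] [NormedSpace ℝ V]
    [NormedAddCommGroup X] [NormedSpace ℝ X] [NormedAddCommGroup Y] [NormedSpace ℝ Y]
    (ι : X →L[ℝ] Y) {k S : V → X} {k' D : V →L[ℝ] X} (hk : HasFDerivAt k k' 0)
    (hS : HasFDerivAt S D 0) (hS0 : S 0 = 0) (b₁ : Y →L[ℝ] X) (b₂ : Y →L[ℝ] Y →L[ℝ] X)
    (h : ∀ᶠ β in 𝓝 (0 : V), S β = k β + b₁ (ι (S β)) + b₂ (ι (S β)) (ι (S β))) (β : V) :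
    D β = k' β + b₁ (ι (D β)) := by
  have h1 : HasFDerivAt (fun β => ι (S β)) (ι.comp D) 0 := ι.hasFDerivAt.comp 0 hS
  have h2 : HasFDerivAt (fun β => b₁ (ι (S β))) (b₁.comp (ι.comp D)) 0 := b₁.hasFDerivAt.comp 0 h1
  have h3 := b₂.hasFDerivAt_of_bilinear h1 h1
  simp only [hS0, map_zero] at h3
  have h4 := ((hk.add h2).add h3).congr_of_eventuallyEq h
  have h5 := hS.unique h4
  have h6 := DFunLike.congr_fun h5 β
  simpa using h6

end abstract

/-! ### Elementary elements and products of the weighted spaces -/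

/-- The source direction multiplied by β₁ + β₀²/2. The condition σ < 1 gives 1 - x² ≤ (1-x²)^σ,
which the weight dominates. -/
lemma exists_one_sub_sq {σ : ℝ} (h0 : 0 < σ) (h1 : σ < 1) :
    ∃ q : Z (Hw σ), ∀ x ∈ Dom, Z.fn q x = 1 - x ^ 2 := by
  obtain ⟨C, hC, h⟩ := wphi_le_Hw h0
  obtain ⟨F, hF, -⟩ := Z.exists_of (Hw_pos σ) (continuousOn_Hw σ) (f := fun x => 1 - x ^ 2)
    (f1 := fun x => -(2 * x)) (f2 := fun _ => -2) (N := C + 2) (by positivity) (by fun_prop)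
    (fun x _ => by simpa using (hasDerivAt_pow 2 x).const_sub 1)
    (fun x _ => by simpa using ((hasDerivAt_id x).const_mul 2).fun_neg) continuousOn_const
    (fun x hx => by
      have hp := one_sub_sq_pos hx
      have e1 : 1 - x ^ 2 ≤ wphi σ x := by
        conv_lhs => rw [← wphi_one]
        exact Real.rpow_le_rpow_of_exponent_ge hp (by nlinarith [sq_nonneg x]) h1.le
      rw [abs_of_pos hp]
      have := Hw_pos σ x hx
      linarith [h x hx])
    (fun x hx => by
      rw [abs_le]
      constructor <;> linarith [hx.1, hx.2])
    (fun x hx => by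
      rw [abs_neg, abs_two]
      linarith)
  exact ⟨F, hF⟩

/-- A change of `c 1` alters P by a multiple of 1 + x, which decays at -1 but not at 1; this forces
σ = 0 for the deviation of the base solution. The direction 1 - x does not decay at -1, which is why
`c 0` has to stay at -1. -/
lemma exists_one_add : ∃ p : Z (Hw 0), ∀ x ∈ Dom, Z.fn p x = 1 + x := by
  obtain ⟨C, hC, h⟩ := wphi_le_Hw one_pos
  obtain ⟨F, hF, -⟩ := Z.exists_of (Hw_pos 0) (continuousOn_Hw 0) (f := fun x => 1 + x)
    (f1 := fun _ => 1) (f2 := fun _ => 0) (N := C + 1) (by positivity) (by fun_prop)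
    (fun x _ => by simpa using (hasDerivAt_id x).const_add 1)
    (fun x _ => hasDerivAt_const x 1) continuousOn_const
    (fun x hx => by
      have h1 : 0 < 1 - x := by linarith [hx.2]
      have h2 : 0 < 1 + x := by linarith [hx.1]
      have e1 := h x hx
      rw [wphi_one, show 1 - x ^ 2 = (1 + x) * (1 - x) by ring,
        show C * Hw 1 x = C * Hw 0 x * (1 - x) by
          unfold Hw; rw [Real.rpow_one, Real.rpow_zero]; ring] at e1
      have e2 := le_of_mul_le_mul_right e1 h1
      rw [abs_of_pos h2]
      have := Hw_pos 0 x hx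
      linarith)
    (fun x hx => by rw [abs_one]; linarith)
    (fun x hx => by rw [abs_zero]; linarith)
  exact ⟨F, hF⟩

lemma exists_one_sub_sq_zero : ∃ p : Z (Hw 0), ∀ x ∈ Dom, Z.fn p x = 1 - x ^ 2 := by
  obtain ⟨p, hp⟩ := exists_one_add
  obtain ⟨F, hF, -⟩ := Z.exists_of (Hw_pos 0) (continuousOn_Hw 0) (f := fun x => 1 - x ^ 2)
    (f1 := fun x => -(2 * x)) (f2 := fun _ => -2) (N := 2 * ‖p‖ + 2) (by positivity) (by fun_prop)
    (fun x _ => by simpa using (hasDerivAt_pow 2 x).const_sub 1)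
    (fun x _ => by simpa using ((hasDerivAt_id x).const_mul 2).fun_neg) continuousOn_const
    (fun x hx => by
      have e1 := (le_abs_self _).trans (Z.abs_fn_le (Hw_pos 0) p hx)
      rw [hp x hx] at e1
      rw [abs_of_pos (one_sub_sq_pos hx)]
      have := Hw_pos 0 x hx
      nlinarith [hx.1, hx.2])
    (fun x hx => by
      have := norm_nonneg p
      rw [abs_le]
      constructor <;> linarith [hx.1, hx.2])
    (fun x hx => by
      have := norm_nonneg p
      rw [abs_neg, abs_two]
      linarith)
  exact ⟨F, hF⟩

/-- Multiplication of a function with weight `Gw σ`, `σ ≥ 0`, and a weighted continuous function. -/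
lemma exists_mul_wfn {σ : ℝ} (hσ : 0 ≤ σ) (a : ℝ) :
    ∃ L : Z (Gw σ) →L[ℝ] (Dom →ᵇ ℝ) →L[ℝ] (Dom →ᵇ ℝ), ∀ f G, ∀ x ∈ Dom,
      wfn a (L f G) x = Z.fn f x * wfn a G x := by
  refine exists_bilin Dom (wfnₗ a) (fun t ht => wfn_eq_zero ht) (fun f G x => Z.fn f x * wfn a G x)
    (fun F F' G x _ => by simp only [Z.fn_add]; ring) (fun r F G x _ => by simp only [Z.fn_smul]; ring)
    (fun F G G' x _ => by simp only [wfn_add]; ring) (fun r F G x _ => by simp only [wfn_smul]; ring)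
    (2 ^ σ / Real.log (3 / 2)) fun f G => ?_
  have hm := log_three_half_pos
  refine exists_wfn (by positivity)
    ((Z.continuousOn_fn (continuousOn_Gw σ) f).mul (continuousOn_wfn a G)) fun x hx => ?_
  have h1 : Gw σ x ≤ 2 ^ σ / Real.log (3 / 2) := by
    refine div_le_div₀ (by positivity) ?_ hm (lam_ge hx)
    exact Real.rpow_le_rpow (by linarith [hx.2]) (by linarith [hx.1]) hσ
  have h2 := (Z.abs_fn_le (Gw_pos σ) f hx).trans (mul_le_mul_of_nonneg_left h1 (norm_nonneg _))
  rw [abs_mul]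
  calc |Z.fn f x| * |wfn a G x|
      ≤ (‖f‖ * (2 ^ σ / Real.log (3 / 2))) * (‖G‖ * wphi (-a) x) :=
        mul_le_mul h2 (abs_wfn_le a G hx) (abs_nonneg _) (by positivity)
    _ = _ := by ring

/-- The first factor is the deviation of the base solution, without decay at 1, so all of the power
of 1 - x comes from the second factor. -/
lemma exists_mul_zero (σ : ℝ) : ∃ L : Z (Gw 0) →L[ℝ] Z (Gw σ) →L[ℝ] Z (Hw σ), ∀ f g, ∀ x ∈ Dom,
    Z.fn (L f g) x = Z.fn f x * Z.fn g x :=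
  Z.exists_mul (Gw_pos 0) (Gw_pos σ) (Hw_pos σ) (continuousOn_Gw 0) (continuousOn_Gw σ)
    (continuousOn_Hw σ) zero_le_one fun x _ => by rw [one_mul, Gw_zero_mul]

lemma exists_mul_self {σ : ℝ} (hσ : 0 ≤ σ) : ∃ L : Z (Gw σ) →L[ℝ] Z (Gw σ) →L[ℝ] Z (Hw σ),
    ∀ f g, ∀ x ∈ Dom, Z.fn (L f g) x = Z.fn f x * Z.fn g x :=
  Z.exists_mul (Gw_pos σ) (Gw_pos σ) (Hw_pos σ) (continuousOn_Gw σ) (continuousOn_Gw σ)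
    (continuousOn_Hw σ) (by positivity) fun x hx => Gw_mul_self_le hσ hx

open scoped BoundedContinuousFunction

/-! ### The perturbation system -/

lemma IsPsiInt.congr {a N : ℝ} {k k' : ℝ → ℝ} (h : IsPsiInt a N k) (e : ∀ x ∈ Dom, k' x = k x) :
    IsPsiInt a N k' where
  pos := h.pos
  lt := h.lt
  nonneg := h.nonneg
  cont := h.cont.congr e
  bound := fun x hx => by rw [e x hx]; exact h.bound x hx

lemma IsPsiInt.tendsto_left {a N : ℝ} {k : ℝ → ℝ} (h : IsPsiInt a N k) :
    Tendsto (prim (prim (prim k))) (𝓝[>] (-1)) (𝓝 (prim (prim (prim k)) (-1))) := by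
  have hc : ContinuousOn (prim (prim (prim k))) (uIcc 0 (-1)) :=
    intervalIntegral.continuousOn_primitive_interval
      ((intervalIntegrable_iff' (by simp)).1
        (h.intervalIntegrable (x := 0) (y := -1) (by simp) (by simp)))
  rw [uIcc_of_ge (by norm_num)] at hc
  exact ((hc (-1) (by simp)).mono Ioo_subset_Icc_self).mono_left
    (nhdsWithin_le_of_mem (Ioo_mem_nhdsGT (by norm_num)))

lemma psiIntegrand_congr {f g f' g' : ℝ → ℝ} (h : ∀ x ∈ Dom, f x = f' x)
    (h' : ∀ x ∈ Dom, g x = g' x) : ∀ x ∈ Dom, psiIntegrand f g x = psiIntegrand f' g' x :=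
  fun x hx => by rw [psiIntegrand, psiIntegrand, h x hx, h' x hx]

lemma prim3_congr {k k' : ℝ → ℝ} (h : ∀ x ∈ Dom, k x = k' x) :
    ∀ x ∈ Icc (-1 : ℝ) 1, prim (prim (prim k)) x = prim (prim (prim k')) x := fun _ hx =>
  prim_congr (fun _ hy => prim_congr (fun _ hz => prim_congr h (Ioo_subset_Icc_self hz))
    (Ioo_subset_Icc_self hy)) hx

lemma deriv_congr_dom {f g : ℝ → ℝ} (h : ∀ x ∈ Dom, f x = g x) : ∀ x ∈ Dom, deriv f x = deriv g x :=
  fun _ hx => (eventuallyEq_of_mem (isOpen_Ioo.mem_nhds hx) h).deriv_eq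

lemma iteratedDeriv_congr_dom {f g : ℝ → ℝ} (h : ∀ x ∈ Dom, f x = g x) (n : ℕ) :
    ∀ x ∈ Dom, iteratedDeriv n f x = iteratedDeriv n g x :=
  fun _ hx => (eventuallyEq_of_mem (isOpen_Ioo.mem_nhds hx) h).iteratedDeriv_eq n

lemma psi_congr {f g f' g' : ℝ → ℝ} (h : ∀ x ∈ Dom, f x = f' x) (h' : ∀ x ∈ Dom, g x = g' x) :
    ∀ x ∈ Icc (-1 : ℝ) 1, psi f g x = psi f' g' x := by
  simp only [psi_eq]
  exact prim3_congr (psiIntegrand_congr h (deriv_congr_dom h'))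

lemma isPsiInt_M2 {ε : ℝ} (h0 : 0 < ε) (h1 : ε < 1 / 2) (F : M2 ε) :
    ∃ N, IsPsiInt (2 * ε) N (psiIntegrand F.fn (deriv F.fn)) := by
  obtain ⟨L, hL⟩ := M2.exists_toBCF ε
  obtain ⟨L', hL'⟩ := M2.exists_derivBCF ε
  exact ⟨_, (isPsiInt_wfn h0 h1 (L F) (L' F)).congr
    (psiIntegrand_congr (fun x hx => (hL F x hx).symm) fun x hx => (hL' F x hx).symm)⟩

lemma SolvesNSE.congr {chat : Fin 3 → ℝ} {U U' : (ℝ → ℝ) × (ℝ → ℝ)} (h : SolvesNSE chat U)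
    (h1 : ∀ x ∈ Dom, U'.1 x = U.1 x) (h2 : ∀ x ∈ Dom, U'.2 x = U.2 x) : SolvesNSE chat U' := by
  refine ⟨h.1.congr h1, h.2.1.congr h2, fun x hx => ?_⟩
  rw [deriv_congr_dom h1 x hx, h1 x hx, psi_congr h2 h2 x (Ioo_subset_Icc_self hx),
    iteratedDeriv_congr_dom h2 2 x hx, deriv_congr_dom h2 x hx]
  exact h.2.2 x hx

lemma cHat_congr {c : Fin 3 → ℝ} {γ : ℝ} {U U' : (ℝ → ℝ) × (ℝ → ℝ)}
    (h1 : ∀ x ∈ Dom, U'.1 x = U.1 x) (h2 : ∀ x ∈ Dom, U'.2 x = U.2 x) :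
    cHat c γ U' = cHat c γ U := by
  unfold cHat
  rw [psi_congr h2 h2 _ (by simp : (-1 : ℝ) ∈ Icc (-1 : ℝ) 1),
    psi_congr h2 h2 _ (by simp : (1 : ℝ) ∈ Icc (-1 : ℝ) 1),
    iteratedDeriv_congr_dom (fun x hx => ?_) 2 0 zero_mem_Ioo]
  unfold phi
  rw [deriv_congr_dom h1 x hx, h1 x hx]

/-- The values at `0` which parametrize the solutions near `U^{c,γ}`. -/
def HasData {p : Pole} {ε : ℝ} (γ : ℝ) (β : EuclideanSpace ℝ (Fin 4)) (W : X p ε) : Prop :=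
  W.fst.fn 0 = β 0 ∧ deriv W.fst.fn 0 = β 1 - γ * β 0 ∧ deriv W.snd.fn 0 = β 2 ∧ W.snd.fn 0 = β 3

/-- `U^{c,γ} + W` solves the reduced Navier-Stokes system, with prescribed data at `0`. -/
def IsSol {p : Pole} {ε : ℝ} (c : Fin 3 → ℝ) (γ : ℝ) (β : EuclideanSpace ℝ (Fin 4))
    (W : X p ε) : Prop :=
  (∃ chat, SolvesNSE chat ((Ubar c γ, 0) + W.pair)) ∧ HasData γ β W

/-- The equations for the perturbation `W`, with the constants eliminated. -/
def IsCorrSol {ε : ℝ} (c : Fin 3 → ℝ) (γ : ℝ) (β : EuclideanSpace ℝ (Fin 4))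
    (W : X .south ε) : Prop :=
  W.fst.fn 0 = β 0 ∧ deriv W.snd.fn 0 = β 2 ∧ W.snd.fn 0 = β 3 ∧ ∀ x ∈ Dom,
    (1 - x ^ 2) * deriv W.fst.fn x + (2 * x + Ubar c γ x) * W.fst.fn x + W.fst.fn x ^ 2 / 2
      + corr (psi W.snd.fn W.snd.fn) x = (β 1 + β 0 ^ 2 / 2) * (1 - x ^ 2) ∧
    (1 - x ^ 2) * iteratedDeriv 2 W.snd.fn x + (Ubar c γ x + W.fst.fn x) * deriv W.snd.fn x = 0

lemma corr_zero {ψ : ℝ → ℝ} (h : ψ 0 = 0) : corr ψ 0 = 0 := by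
  unfold corr
  rw [h]
  ring

lemma psi_zero_right (f g : ℝ → ℝ) : psi f g 0 = 0 := intervalIntegral.integral_same

section solutions

variable {ε : ℝ} {c : Fin 3 → ℝ} {γ : ℝ} {β : EuclideanSpace ℝ (Fin 4)} {W : X .south ε}

lemma pair_total_snd (c : Fin 3 → ℝ) (γ : ℝ) {p : Pole} (W : X p ε) :
    ((Ubar c γ, (0 : ℝ → ℝ)) + W.pair).2 = W.snd.fn := zero_add _

lemma pair_total_fst (c : Fin 3 → ℝ) (γ : ℝ) {p : Pole} (W : X p ε) :
    ((Ubar c γ, (0 : ℝ → ℝ)) + W.pair).1 = Ubar c γ + W.fst.fn := rfl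

lemma IsNoSwirlSol.hasDerivAt_deriv {U : ℝ → ℝ} (h : IsNoSwirlSol c U) {x : ℝ} (hx : x ∈ Dom) :
    HasDerivAt U (deriv U x) x := (h x hx).1.hasDerivAt

lemma solvesNSE_iff {p : Pole} {W : X p ε} (hs : IsNoSwirlSol c (Ubar c γ)) (chat : Fin 3 → ℝ) :
    SolvesNSE chat ((Ubar c γ, 0) + W.pair) ↔ ∀ x ∈ Dom,
      (1 - x ^ 2) * deriv W.fst.fn x + (2 * x + Ubar c γ x) * W.fst.fn x + W.fst.fn x ^ 2 / 2
        + psi W.snd.fn W.snd.fn x = P chat x - P c x ∧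
      (1 - x ^ 2) * iteratedDeriv 2 W.snd.fn x + (Ubar c γ x + W.fst.fn x) * deriv W.snd.fn x
        = 0 := by
  have hd : ∀ x ∈ Dom, deriv (Ubar c γ + W.fst.fn) x = deriv (Ubar c γ) x + deriv W.fst.fn x :=
    fun x hx => ((hs.hasDerivAt_deriv hx).add (W.fst.hasDerivAt_fn hx)).deriv
  unfold SolvesNSE
  rw [pair_total_fst, pair_total_snd]
  have hsm : ContDiffOn ℝ 1 (Ubar c γ + W.fst.fn) (Ioo (-1) 1) :=
    ((contDiffOn_two_of_sol hs).of_le (by norm_num)).add W.fst.isM1.smooth1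
  constructor
  · rintro ⟨-, -, h⟩ x hx
    obtain ⟨h1, h2⟩ := h x hx
    have h3 := (hs x hx).2
    rw [hd x hx] at h1
    simp only [Pi.add_apply] at h1 h2
    exact ⟨by linear_combination h1 - h3, h2⟩
  · intro h
    refine ⟨hsm, W.snd.isM2.smooth2, fun x hx => ?_⟩
    obtain ⟨h1, h2⟩ := h x hx
    have h3 := (hs x hx).2
    rw [hd x hx]
    simp only [Pi.add_apply]
    exact ⟨by linear_combination h1 + h3, h2⟩

/-- The polynomial hidden in `corr`, together with b(1-x²), is exactly P_ĉ - P_c for the stated ĉ.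
The first two constants are visible; the third requires φ''(0), computed from φ = b(1-x²) - corr ψ.
-/
lemma IsCorrSol.solvesNSE (hε0 : 0 < ε) (hε1 : ε < 1 / 2) (hs : IsNoSwirlSol c (Ubar c γ))
    (h : IsCorrSol c γ β W) : SolvesNSE (cHat c γ W.pair) ((Ubar c γ, 0) + W.pair) := by
  obtain ⟨N, hN⟩ := isPsiInt_M2 hε0 hε1 W.snd
  set k := psiIntegrand W.snd.fn (deriv W.snd.fn) with hk
  set A := psi W.snd.fn W.snd.fn (-1) with hA
  set B := psi W.snd.fn W.snd.fn 1 with hB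
  set b := β 1 + β 0 ^ 2 / 2 with hb
  have hc1 := continuousOn_prim hN.cont
  have hc2 := continuousOn_prim hc1
  have hphi : ∀ x ∈ Dom, phi c γ W.fst.fn x
      = b * (1 - x ^ 2) - corr (psi W.snd.fn W.snd.fn) x := fun x hx => by
    rw [← ((h.2.2.2 x hx).1)]
    unfold phi
    ring
  have hd1 : ∀ x ∈ Dom, HasDerivAt (phi c γ W.fst.fn)
      (b * -(2 * x) - (prim (prim k) x + A / 2 - B / 2 - (A + B) * x)) x := by
    refine deriv_eq_of_hasDerivAt isOpen_Ioo (fun x hx => ?_) hphi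
    have e0 : HasDerivAt (fun x : ℝ => b * (1 - x ^ 2)) (b * -(2 * x)) x := by
      simpa using ((hasDerivAt_pow 2 x).const_sub 1).const_mul b
    have e1 : HasDerivAt (fun x : ℝ => A / 2 * (1 - x)) (-(A / 2)) x := by
      simpa using ((hasDerivAt_id x).const_sub 1).const_mul (A / 2)
    have e2 : HasDerivAt (fun x : ℝ => B / 2 * (1 + x)) (B / 2) x := by
      simpa using ((hasDerivAt_id x).const_add 1).const_mul (B / 2)
    have e3 : HasDerivAt (fun x : ℝ => (A + B) / 2 * (1 - x ^ 2)) ((A + B) / 2 * -(2 * x)) x := by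
      simpa using ((hasDerivAt_pow 2 x).const_sub 1).const_mul ((A + B) / 2)
    refine (e0.sub ((((hasDerivAt_prim hc2 hx).sub e1).sub e2).add e3)).congr_deriv ?_
    ring
  -- The second derivative of ψ itself vanishes at 0, being an integral from 0 to 0; only the
  -- polynomial terms contribute.
  have hd2 : iteratedDeriv 2 (phi c γ W.fst.fn) 0 = -2 * b + (A + B) := by
    have i1 : ∀ x ∈ Dom, iteratedDeriv 1 (phi c γ W.fst.fn) x
        = b * -(2 * x) - (prim (prim k) x + A / 2 - B / 2 - (A + B) * x) := fun x hx => by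
      rw [iteratedDeriv_one]
      exact (hd1 x hx).deriv
    have := iteratedDeriv_succ_eq_of_hasDerivAt isOpen_Ioo
      (f2 := fun x => b * -2 - (prim k x - (A + B))) (fun x hx => ?_) i1 0 zero_mem_Ioo
    · rw [show (1 + 1 : ℕ) = 2 from rfl] at this
      rw [this, prim_zero]
      ring
    · have e0 : HasDerivAt (fun x : ℝ => b * -(2 * x)) (b * -2) x := by
        simpa using (((hasDerivAt_id x).const_mul 2).fun_neg).const_mul b
      have e3 : HasDerivAt (fun x : ℝ => (A + B) * x) (A + B) x := by
        simpa using (hasDerivAt_id x).const_mul (A + B)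
      exact e0.sub ((((hasDerivAt_prim hc1 hx).add_const (A / 2)).sub_const (B / 2)).sub e3)
  refine (solvesNSE_iff hs _).2 fun x hx => ⟨?_, (h.2.2.2 x hx).2⟩
  have h1 := (h.2.2.2 x hx).1
  have hP : P (cHat c γ W.pair) x - P c x
      = A / 2 * (1 - x) + B / 2 * (1 + x) - (-2 * b + (A + B)) / 2 * (1 - x ^ 2) := by
    rw [← hd2]
    simp only [P, cHat, X.pair, Matrix.cons_val_zero, Matrix.cons_val_one, Matrix.cons_val]
    ring
  rw [hP]
  unfold corr at h1
  linear_combination h1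

lemma tendsto_Hw_left (σ : ℝ) : Tendsto (Hw σ) (𝓝[>] (-1)) (𝓝 0) := by
  refine tendsto_zero_of_abs_le (tendsto_Gw_left σ) (N := (Real.log (3 / 2))⁻¹) ?_
  filter_upwards [dom_mem_left] with x hx
  rw [abs_of_pos (Hw_pos σ x hx)]
  exact Hw_le_Gw σ hx

lemma tendsto_Hw_right {σ : ℝ} (hσ : 0 < σ) : Tendsto (Hw σ) (𝓝[<] 1) (𝓝 0) := by
  refine tendsto_zero_of_abs_le (tendsto_Gw_right hσ) (N := (Real.log (3 / 2))⁻¹) ?_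
  filter_upwards [dom_mem_right] with x hx
  rw [abs_of_pos (Hw_pos σ x hx)]
  exact Hw_le_Gw σ hx

/-- The weights give f → 0 and (1-x²)f' → 0 at both poles, so in the limit only ψ survives on the
left of the θ-equation. -/
lemma tendsto_theta_part (l : Filter ℝ) (hl : Dom ∈ l) {C : ℝ}
    (hU : ∀ x ∈ Dom, |Ubar c γ x| ≤ C) (F : M1 .south ε)
    (hG : Tendsto (Gw (1 - 2 * ε)) l (𝓝 0)) (hH : Tendsto (Hw (1 - 2 * ε)) l (𝓝 0)) :
    Tendsto (fun x => (1 - x ^ 2) * deriv F.fn x + (2 * x + Ubar c γ x) * F.fn x + F.fn x ^ 2 / 2)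
      l (𝓝 0) := by
  have h1 : Tendsto F.fn l (𝓝 0) := by
    refine tendsto_zero_of_abs_le hG (N := ‖F‖) ?_
    filter_upwards [hl] with x hx using F.abs_fn_le hx
  have h2 : Tendsto (fun x => (1 - x ^ 2) * deriv F.fn x) l (𝓝 0) := by
    refine tendsto_zero_of_abs_le hH (N := ‖F‖) ?_
    filter_upwards [hl] with x hx
    have hp := one_sub_sq_pos hx
    rw [abs_mul, abs_of_pos hp]
    calc (1 - x ^ 2) * |deriv F.fn x| ≤ (1 - x ^ 2) * (‖F‖ * (Hw (1 - 2 * ε) x / (1 - x ^ 2))) :=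
          mul_le_mul_of_nonneg_left (F.abs_deriv_le hx) hp.le
      _ = _ := by field_simp
  have h3 : Tendsto (fun x => (2 * x + Ubar c γ x) * F.fn x) l (𝓝 0) := by
    refine tendsto_zero_of_abs_le (by simpa using h1.abs) (N := 2 + C) ?_
    filter_upwards [hl] with x hx
    rw [abs_mul]
    refine mul_le_mul_of_nonneg_right ?_ (abs_nonneg _)
    have e1 := abs_add_le (2 * x) (Ubar c γ x)
    have e2 : |2 * x| ≤ 2 := by
      rw [abs_le]
      constructor <;> linarith [hx.1, hx.2]
    linarith [hU x hx]
  have := (h2.add h3).add ((h1.pow 2).div_const 2)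
  simpa using this

/-- The constants of any solution are forced. Since P(-1) = 2c₁ and P(1) = 2c₂, the limits at the
poles give ĉ₁ and ĉ₂ in terms of ψ(±1), and the value at 0 gives the remaining one. Hence uniqueness
for the corrected system is uniqueness among all solutions, whatever their constants. -/
lemma isCorrSol_of_isSol (hε0 : 0 < ε) (hε1 : ε < 1 / 2) (hs : IsNoSwirlSol c (Ubar c γ))
    (h0 : Ubar c γ 0 = γ) {C : ℝ} (hU : ∀ x ∈ Dom, |Ubar c γ x| ≤ C)
    (h : IsSol c γ β W) : IsCorrSol c γ β W := by
  obtain ⟨⟨chat, hch⟩, hd1, hd2, hd3, hd4⟩ := h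
  rw [solvesNSE_iff hs] at hch
  refine ⟨hd1, hd3, hd4, fun x hx => ⟨?_, (hch x hx).2⟩⟩
  obtain ⟨N, hN⟩ := isPsiInt_M2 hε0 hε1 W.snd
  have hdiff : Continuous fun x => P chat x - P c x := (continuous_P _).sub (continuous_P _)
  have eL : psi W.snd.fn W.snd.fn (-1) = 2 * (chat 0 - c 0) := by
    have t1 := (tendsto_theta_part _ dom_mem_left hU W.fst (tendsto_Gw_left _)
      (tendsto_Hw_left _)).add hN.tendsto_left
    have t2 : Tendsto (fun x => P chat x - P c x) (𝓝[>] (-1)) (𝓝 (P chat (-1) - P c (-1))) :=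
      (hdiff.tendsto (-1)).mono_left nhdsWithin_le_nhds
    have t3 := tendsto_nhds_unique (t1.congr' (by
      filter_upwards [dom_mem_left] with x hx using (hch x hx).1)) t2
    rw [psi_eq]
    unfold P at t3
    linear_combination t3
  have eR : psi W.snd.fn W.snd.fn 1 = 2 * (chat 1 - c 1) := by
    have t1 := (tendsto_theta_part _ dom_mem_right hU W.fst (tendsto_Gw_right (by linarith))
      (tendsto_Hw_right (by linarith))).add hN.tendsto_right
    have t2 : Tendsto (fun x => P chat x - P c x) (𝓝[<] 1) (𝓝 (P chat 1 - P c 1)) :=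
      (hdiff.tendsto 1).mono_left nhdsWithin_le_nhds
    have t3 := tendsto_nhds_unique (t1.congr' (by
      filter_upwards [dom_mem_right] with x hx using (hch x hx).1)) t2
    rw [psi_eq]
    unfold P at t3
    linear_combination t3
  -- At x = 0, where ψ vanishes, the left side is (β₁ - γβ₀) + γβ₀ + β₀²/2; this is the origin of
  -- the coefficient β₁ + β₀²/2.
  have e0 := (hch 0 zero_mem_Ioo).1
  rw [hd1, hd2, h0, psi_zero_right] at e0
  have e1 := (hch x hx).1
  unfold P at e0 e1
  unfold corr
  rw [eL, eR]
  linear_combination e1 - (1 - x ^ 2) * e0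

lemma IsCorrSol.isSol (hε0 : 0 < ε) (hε1 : ε < 1 / 2) (hs : IsNoSwirlSol c (Ubar c γ))
    (h0 : Ubar c γ 0 = γ) (h : IsCorrSol c γ β W) : IsSol c γ β W := by
  refine ⟨⟨_, h.solvesNSE hε0 hε1 hs⟩, h.1, ?_, h.2.1, h.2.2.1⟩
  have e := (h.2.2.2 0 zero_mem_Ioo).1
  rw [corr_zero (psi_zero_right _ _), h0, h.1] at e
  linear_combination e

end solutions

open scoped BoundedContinuousFunction

/-! ### Local solvability near a base solution -/

/-- The parameters `(c,γ)`. -/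
abbrev Prm : Type := (Fin 3 → ℝ) × ℝ

/-- The parameters `β`. -/
abbrev B4 : Type := EuclideanSpace ℝ (Fin 4)

lemma Z.fn_sub {w : ℝ → ℝ} (F G : Z w) (x : ℝ) : Z.fn (F - G) x = Z.fn F x - Z.fn G x :=
  congrFun ((Z.fnₗ w).map_sub F G) x

lemma wfn_neg (a : ℝ) (F : Dom →ᵇ ℝ) (x : ℝ) : wfn a (-F) x = -wfn a F x :=
  congrFun ((wfnₗ a).map_neg F) x

lemma linRel_iff {α h f f1 : ℝ → ℝ} {v : ℝ} (hf : ∀ x ∈ Dom, HasDerivAt f (f1 x) x) :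
    LinRel α v h f ↔ f 0 = v ∧ ∀ x ∈ Dom, (1 - x ^ 2) * f1 x + α x * f x = h x := by
  refine and_congr_right fun _ => forall₂_congr fun x hx => ?_
  have hp := (one_sub_sq_pos hx).ne'
  constructor
  · intro h1
    rw [(hf x hx).unique h1]
    field_simp
    ring
  · intro h1
    refine (hf x hx).congr_deriv ?_
    rw [eq_div_iff hp]
    linarith

lemma phiRel_iff {ε : ℝ} {U k : ℝ → ℝ} {s v : ℝ} (F : M2 ε) :
    PhiRel U s v k F.fn ↔ F.fn 0 = s ∧ deriv F.fn 0 = v ∧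
      ∀ x ∈ Dom, (1 - x ^ 2) * iteratedDeriv 2 F.fn x + U x * deriv F.fn x = k x :=
  and_congr_right fun _ => linRel_iff fun _ hx => F.hasDerivAt_deriv hx

/-- The inclusion of `X` into a Banach space of weighted functions. -/
lemma exists_inclusion (ε : ℝ) :
    ∃ ι : X .south ε →L[ℝ] Z (Gw (1 - 2 * ε)) × (Dom →ᵇ ℝ) × (Dom →ᵇ ℝ), ∀ W, ∀ x ∈ Dom,
      Z.fn (ι W).1 x = W.fst.fn x ∧ wfn ε (ι W).2.1 x = W.snd.fn x ∧
        wfn (1 + ε) (ι W).2.2 x = deriv W.snd.fn x := by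
  obtain ⟨L₁, h₁⟩ := M1.exists_toZ ε
  obtain ⟨L₂, h₂⟩ := M2.exists_toBCF ε
  obtain ⟨L₃, h₃⟩ := M2.exists_derivBCF ε
  let e := (WithLp.prodContinuousLinearEquiv 1 ℝ (M1 .south ε) (M2 ε)).toContinuousLinearMap
  let e₁ := (ContinuousLinearMap.fst ℝ (M1 .south ε) (M2 ε)).comp e
  let e₂ := (ContinuousLinearMap.snd ℝ (M1 .south ε) (M2 ε)).comp e
  exact ⟨(L₁.comp e₁).prod ((L₂.comp e₂).prod (L₃.comp e₂)), fun W x hx =>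
    ⟨h₁ W.fst x hx, h₂ W.snd x hx, h₃ W.snd x hx⟩⟩

/-! ### Assembling the bilinear terms of the fixed point equation -/

section abstract

variable {F V H K X Y₁ Y₂ Y₃ : Type*} [NormedAddCommGroup F] [NormedSpace ℝ F]
  [NormedAddCommGroup V] [NormedSpace ℝ V] [NormedAddCommGroup H] [NormedSpace ℝ H]
  [NormedAddCommGroup K] [NormedSpace ℝ K] [NormedAddCommGroup X] [NormedSpace ℝ X]
  [NormedAddCommGroup Y₁] [NormedSpace ℝ Y₁] [NormedAddCommGroup Y₂] [NormedSpace ℝ Y₂]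
  [NormedAddCommGroup Y₃] [NormedSpace ℝ Y₃]

/-- The factor -1/2 is the term U²/2 of the Riccati equation, moved to the right-hand side. -/
lemma exists_bilin_self (L : (V × H) →L[ℝ] F) (m : F →L[ℝ] F →L[ℝ] H) :
    ∃ b : F →L[ℝ] F →L[ℝ] F, ∀ f g, b f g = L (0, (-(1 / 2 : ℝ)) • m f g) :=
  ⟨bilin (L.comp (ContinuousLinearMap.inr ℝ V H)) ((-(1 / 2 : ℝ)) • m)
    (ContinuousLinearMap.id ℝ F) (ContinuousLinearMap.id ℝ F), fun _ _ => rfl⟩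

/-- These are the cross terms of the deviation with `W`: deviation times W_θ in the first equation,
deviation times W_φ' in the second. -/
lemma exists_bilin_mixed (T : (V × H × K) →L[ℝ] X) (m : F →L[ℝ] Y₁ →L[ℝ] H)
    (k : F →L[ℝ] Y₃ →L[ℝ] K) : ∃ b : F →L[ℝ] (Y₁ × Y₂ × Y₃) →L[ℝ] X,
      ∀ f y, b f y = -T (0, m f y.1, k f y.2.2) := by
  refine ⟨-(bilin (T.comp ((ContinuousLinearMap.inr ℝ V (H × K)).comp
      (ContinuousLinearMap.inl ℝ H K))) m (ContinuousLinearMap.id ℝ F)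
        (ContinuousLinearMap.fst ℝ Y₁ (Y₂ × Y₃))
    + bilin (T.comp ((ContinuousLinearMap.inr ℝ V (H × K)).comp
      (ContinuousLinearMap.inr ℝ H K))) k (ContinuousLinearMap.id ℝ F)
        ((ContinuousLinearMap.snd ℝ Y₂ Y₃).comp (ContinuousLinearMap.snd ℝ Y₁ (Y₂ × Y₃)))),
    fun f y => ?_⟩
  simp only [neg_apply, add_apply, bilin_apply,
    ContinuousLinearMap.comp_apply, ContinuousLinearMap.inr_apply, ContinuousLinearMap.inl_apply,
    ContinuousLinearMap.id_apply, ContinuousLinearMap.coe_fst', ContinuousLinearMap.coe_snd']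
  rw [← map_add]
  simp

/-- These are the terms quadratic in `W`: W_θ²/2 and the corrected ψ in the first equation, W_θ W_φ'
in the second. The three slots hold W_θ, W_φ and W_φ'. -/
lemma exists_bilin_pair (T : (V × H × K) →L[ℝ] X) (m : Y₁ →L[ℝ] Y₁ →L[ℝ] H)
    (ψ : Y₂ →L[ℝ] Y₃ →L[ℝ] H) (k : Y₁ →L[ℝ] Y₃ →L[ℝ] K) :
    ∃ b : (Y₁ × Y₂ × Y₃) →L[ℝ] (Y₁ × Y₂ × Y₃) →L[ℝ] X, ∀ y z,
      b y z = -T (0, (1 / 2 : ℝ) • m y.1 z.1 + ψ y.2.1 z.2.2, k y.1 z.2.2) := by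
  let y₁ := ContinuousLinearMap.fst ℝ Y₁ (Y₂ × Y₃)
  let y₂ := (ContinuousLinearMap.fst ℝ Y₂ Y₃).comp (ContinuousLinearMap.snd ℝ Y₁ (Y₂ × Y₃))
  let y₃ := (ContinuousLinearMap.snd ℝ Y₂ Y₃).comp (ContinuousLinearMap.snd ℝ Y₁ (Y₂ × Y₃))
  let iH := T.comp ((ContinuousLinearMap.inr ℝ V (H × K)).comp (ContinuousLinearMap.inl ℝ H K))
  let iK := T.comp ((ContinuousLinearMap.inr ℝ V (H × K)).comp (ContinuousLinearMap.inr ℝ H K))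
  refine ⟨-(bilin iH ((1 / 2 : ℝ) • m) y₁ y₁ + bilin iH ψ y₂ y₃ + bilin iK k y₁ y₃), fun y z => ?_⟩
  have e : ∀ h h' k', T (0, h, 0) + T (0, h', 0) + T (0, 0, k') = T (0, h + h', k') := by
    intro h h' k'
    rw [← map_add, ← map_add]
    simp
  exact congrArg Neg.neg (e _ _ _)

lemma prod_combine {V H K : Type*} [AddCommGroup V] [AddCommGroup H] [AddCommGroup K]
    (v : V) (h a b : H) (k k' : K) :
    (v, h, (0 : K)) + -(0, a, k) + -(0, b, k') = (v, h - (a + b), -(k + k')) := by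
  refine Prod.ext ?_ (Prod.ext ?_ ?_)
  · simp
  · simp
    abel
  · simp
    abel

/-- The square β₀² disappears at first order, so β₁ alone multiplies 1 - x² in the linearized
equation; that is the source which produces V². -/
lemma exists_hasFDerivAt_source (T : (B4 × H × K) →L[ℝ] X) (q₀ : H) :
    ∃ κ' : B4 →L[ℝ] X, (∀ β, κ' β = T (β, β 1 • q₀, 0)) ∧
      HasFDerivAt (fun β : B4 => T (β, (β 1 + β 0 ^ 2 / 2) • q₀, 0)) κ' 0 := by
  let pr : Fin 4 → B4 →L[ℝ] ℝ := fun i => EuclideanSpace.proj i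
  refine ⟨T.comp ((ContinuousLinearMap.id ℝ B4).prod (((pr 1).smulRight q₀).prod 0)),
    fun _ => rfl, ?_⟩
  refine T.hasFDerivAt.comp 0 ((hasFDerivAt_id _).prodMk (HasFDerivAt.prodMk ?_
    (hasFDerivAt_const _ _)))
  refine HasFDerivAt.smul_const ?_ q₀
  have e1 : HasFDerivAt (fun β : B4 => β 1) (pr 1) 0 := (pr 1).hasFDerivAt
  have e0 : HasFDerivAt (fun β : B4 => β 0) (pr 0) 0 := (pr 0).hasFDerivAt
  have e2 := (e0.pow 2).mul_const (1 / 2 : ℝ)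
  refine ((e1.add e2).congr_of_eventuallyEq (Eventually.of_forall fun β => ?_)).congr_fderiv ?_
  · simp only [Pi.add_apply]
    ring
  · ext β
    simp

end abstract

/-! ### The linearized system and the solution family near a base parameter -/

section base

variable {c : Fin 3 → ℝ} {γ ε : ℝ}

/-- The solution operator of the linearized system. -/
lemma IsBase.exists_linear (hb : IsBase c γ ε) :
    ∃ T : (B4 × Z (Hw (1 - 2 * ε)) × (Dom →ᵇ ℝ)) →L[ℝ] X .south ε, ∀ a W, W = T a ↔
      LinRel (alph c γ) (a.1 0) (Z.fn a.2.1) W.fst.fn ∧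
      PhiRel (Ubar c γ) (a.1 3) (a.1 2) (wfn (1 + ε) a.2.2) W.snd.fn := by
  obtain ⟨L, hL⟩ := hb.exists_thetaM1
  obtain ⟨M, hM⟩ := hb.exists_phiM2
  let e := (WithLp.prodContinuousLinearEquiv 1 ℝ (M1 .south ε) (M2 ε)).symm.toContinuousLinearMap
  let q₁ := ContinuousLinearMap.fst ℝ B4 (Z (Hw (1 - 2 * ε)) × (Dom →ᵇ ℝ))
  let q₂ := ContinuousLinearMap.snd ℝ B4 (Z (Hw (1 - 2 * ε)) × (Dom →ᵇ ℝ))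
  let pr : Fin 4 → B4 →L[ℝ] ℝ := fun i => EuclideanSpace.proj i
  let T₁ := L.comp (((pr 0).comp q₁).prod ((ContinuousLinearMap.fst ℝ _ _).comp q₂))
  let T₂ := M.comp (((pr 3).comp q₁).prod (((pr 2).comp q₁).prod
    ((ContinuousLinearMap.snd ℝ _ _).comp q₂)))
  have hT₁ : ∀ a, T₁ a = L (a.1 0, a.2.1) := fun a => rfl
  have hT₂ : ∀ a, T₂ a = M (a.1 3, a.1 2, a.2.2) := fun a => rfl
  refine ⟨e.comp (T₁.prod T₂), fun a W => ⟨?_, ?_⟩⟩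
  · rintro rfl
    exact ⟨hL (a.1 0, a.2.1), hM (a.1 3, a.1 2, a.2.2)⟩
  · rintro ⟨h1, h2⟩
    have e1 : W.fst = T₁ a := M1.ext_dom
      (LinRel.unique hb.continuousOn_alph h1 (hL (a.1 0, a.2.1)))
    have e2 : W.snd = T₂ a := by
      have h3 := hM (a.1 3, a.1 2, a.2.2)
      have h4 := LinRel.unique hb.sol.continuousOn h2.2 h3.2
      refine M2.ext_dom fun x hx => ?_
      have := eq_of_deriv_zero (f := fun x => W.snd.fn x - (T₂ a).fn x) (fun y hy =>
        ((W.snd.hasDerivAt_fn hy).sub ((T₂ a).hasDerivAt_fn hy)).congr_deriv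
          (sub_eq_zero.2 (h4 y hy))) x hx
      have h5 : W.snd.fn 0 - (T₂ a).fn 0 = 0 := sub_eq_zero.2 (h2.1.trans h3.1.symm)
      simp only [h5] at this
      exact sub_eq_zero.1 this
    have e3 : W = WithLp.toLp 1 (W.fst, W.snd) := rfl
    rw [e3, e1, e2]
    rfl

/-- `W` solves the linearization at `U^{c,γ}` with data `β`. -/
def IsLinearized {p : Pole} {ε : ℝ} (c : Fin 3 → ℝ) (γ : ℝ) (β : B4) (W : X p ε) : Prop :=
  LinRel (alph c γ) (β 0) (fun x => β 1 * (1 - x ^ 2)) W.fst.fn ∧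
    PhiRel (Ubar c γ) (β 3) (β 2) (fun _ => 0) W.snd.fn

lemma sum_basisV_fst (c : Fin 3 → ℝ) (γ : ℝ) (β : B4) (x : ℝ) :
    (∑ i, β i • basisV c γ i).1 x = (intFactor (alph c γ) x)⁻¹
      * (β 0 + β 1 * prim (intFactor (alph c γ)) x) := by
  rw [Fin.sum_univ_four]
  simp only [basisV, Matrix.cons_val_zero, Matrix.cons_val_one, Matrix.cons_val, Prod.fst_add,
    Prod.smul_fst, Pi.add_apply, Pi.smul_apply, smul_eq_mul, smul_zero, add_zero, Pi.zero_apply,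
    Real.exp_neg]
  unfold intFactor prim aFun alph
  ring

lemma sum_basisV_snd (c : Fin 3 → ℝ) (γ : ℝ) (β : B4) (x : ℝ) :
    (∑ i, β i • basisV c γ i).2 x = β 2 * prim (fun t => (intFactor (Ubar c γ) t)⁻¹) x + β 3 := by
  rw [Fin.sum_univ_four]
  simp only [basisV, Matrix.cons_val_zero, Matrix.cons_val_one, Matrix.cons_val, Prod.snd_add,
    Prod.smul_snd, Pi.add_apply, Pi.smul_apply, smul_eq_mul, smul_zero, zero_add, Real.exp_neg,
    mul_one]
  rfl

/-- The functions `V^i` are the solutions of the linearized homogeneous equations. -/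
lemma eqOn_sum_basisV {p : Pole} (hs : IsNoSwirlSol c (Ubar c γ)) {β : B4} {W : X p ε}
    (h : IsLinearized c γ β W) :
    (∀ x ∈ Dom, W.fst.fn x = (∑ i, β i • basisV c γ i).1 x) ∧
      ∀ x ∈ Dom, W.snd.fn x = (∑ i, β i • basisV c γ i).2 x := by
  have hα : ContinuousOn (alph c γ) Dom :=
    (by fun_prop : Continuous fun x : ℝ => 2 * x).continuousOn.add hs.continuousOn
  have hU := hs.continuousOn
  obtain ⟨h1, h2⟩ := h
  constructor
  · refine LinRel.unique hα h1 ⟨?_, fun x hx => ?_⟩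
    · rw [sum_basisV_fst, intFactor_zero, prim_zero]
      simp
    · have hi := (intFactor_pos (alph c γ) x).ne'
      have hp := (one_sub_sq_pos hx).ne'
      have e1 := ((hasDerivAt_intFactor hα hx).inv hi).mul
        (((hasDerivAt_prim (continuousOn_intFactor hα) hx).const_mul (β 1)).const_add (β 0))
      refine (e1.congr_of_eventuallyEq (Eventually.of_forall fun y => ?_)).congr_deriv ?_
      · exact sum_basisV_fst c γ β y
      · rw [sum_basisV_fst]
        simp only [Pi.inv_apply]
        field_simp
        ring
  · have hic : ContinuousOn (fun t => (intFactor (Ubar c γ) t)⁻¹) Dom :=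
      (continuousOn_intFactor hU).inv₀ fun x _ => (intFactor_pos _ x).ne'
    have e1 : ∀ x ∈ Dom, HasDerivAt (fun x => (∑ i, β i • basisV c γ i).2 x)
        (β 2 * (intFactor (Ubar c γ) x)⁻¹) x := fun x hx => by
      refine ((((hasDerivAt_prim hic hx).const_mul (β 2)).add_const
        (β 3)).congr_of_eventuallyEq (Eventually.of_forall fun y => ?_))
      exact sum_basisV_snd c γ β y
    have e2 : LinRel (Ubar c γ) (β 2) (fun _ => 0) (fun x => β 2 * (intFactor (Ubar c γ) x)⁻¹) := by
      refine ⟨by simp [intFactor_zero], fun x hx => ?_⟩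
      have hi := (intFactor_pos (Ubar c γ) x).ne'
      have hp := (one_sub_sq_pos hx).ne'
      refine (((hasDerivAt_intFactor hU hx).inv hi).const_mul (β 2)).congr_deriv ?_
      field_simp
      ring
    have e3 := LinRel.unique hU h2.2 e2
    intro x hx
    have := eq_of_deriv_zero (f := fun x => W.snd.fn x - (∑ i, β i • basisV c γ i).2 x)
      (fun y hy => ((W.snd.hasDerivAt_fn hy).sub (e1 y hy)).congr_deriv
        (sub_eq_zero.2 (e3 y hy))) x hx
    have h5 : W.snd.fn 0 - (∑ i, β i • basisV c γ i).2 0 = 0 := by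
      rw [h2.1, sum_basisV_snd, prim_zero]
      ring
    simp only [h5] at this
    exact sub_eq_zero.1 this

/-- The properties of a local family of solutions. -/
structure IsSolFamily {p : Pole} {ε : ℝ} (r δ : ℝ) (c : Fin 3 → ℝ) (γ : ℝ) (S : B4 → X p ε) :
    Prop where
  sol : IsNoSwirlSol c (Ubar c γ)
  init : Ubar c γ 0 = γ
  isSol : ∀ β ∈ Metric.ball (0 : B4) δ, IsSol c γ β (S β)
  cHat : ∀ β ∈ Metric.ball (0 : B4) δ, SolvesNSE (cHat c γ (S β).pair) ((Ubar c γ, 0) + (S β).pair)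
  unique : ∀ β ∈ Metric.ball (0 : B4) δ, ∀ W : X p ε, ‖W‖ < r → IsSol c γ β W → W = S β
  zero : S 0 = 0
  deriv : ∀ D : B4 →L[ℝ] X p ε, HasFDerivAt S D 0 → ∀ β, IsLinearized c γ β (D β)

lemma isSol_zero {p : Pole} (hs : IsNoSwirlSol c (Ubar c γ)) :
    IsSol c γ (0 : B4) (0 : X p ε) := by
  have h1 : (0 : X p ε).fst.fn = 0 := rfl
  have h2 : (0 : X p ε).snd.fn = 0 := rfl
  refine ⟨⟨c, (solvesNSE_iff hs c).2 fun x hx => ?_⟩, ?_⟩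
  · rw [h1, h2]
    have h3 : psi (0 : ℝ → ℝ) 0 x = 0 := by
      simp [psi, psiInner]
    rw [h3]
    simp
  · unfold HasData
    rw [h1, h2]
    simp

-- With the solution operator `T` of the linearization at the base parameter, the corrected system
-- for nearby `q` is W = κ(β) + b₁(f, ιW) + b₂(ιW, ιW), where `f` is the deviation of the solution
-- at `q`, and `exists_triangular_solution` applies. The family is smooth on a full open set of
-- parameters, because the source for `f` ignores `q.1 0`, but it has the stated meaning only for
-- `q.1 0 = -1`.
set_option maxHeartbeats 1000000 in
lemma IsBase.exists_local (hb : IsBase c γ ε) :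
    ∃ r > 0, ∃ δ > 0, ∃ O : Set Prm, IsOpen O ∧ (c, γ) ∈ O ∧ ∃ S : Prm × B4 → X .south ε,
      ContDiffOn ℝ ∞ S (O ×ˢ Metric.ball 0 δ) ∧
      ∀ q ∈ O, q.1 0 = -1 → (IsSolFamily r δ q.1 q.2 fun β => S (q, β)) ∧
        ∀ β ∈ Metric.ball (0 : B4) δ, ‖S (q, β)‖ < r := by
  have hε0 := hb.eps_pos
  have hε1 := hb.eps_lt
  set σ := 1 - 2 * ε with hσ
  have hσ0 : 0 < σ := by linarith
  have hσ1 : σ < 1 := by linarith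
  obtain ⟨ι, hι⟩ := exists_inclusion ε
  obtain ⟨T, hT⟩ := hb.exists_linear
  -- The deviation is sought with σ = 0, which is below √(1 + c 1) without any condition on ε.
  obtain ⟨L₀, hL₀⟩ := hb.exists_thetaZ (σ := 0) (Real.sqrt_pos.2 (by linarith [hb.c1]))
  obtain ⟨p₁, hp₁⟩ := exists_one_add
  obtain ⟨p₂, hp₂⟩ := exists_one_sub_sq_zero
  obtain ⟨q₀, hq₀⟩ := exists_one_sub_sq hσ0 hσ1
  obtain ⟨m₀, hm₀⟩ := exists_mul_zero 0
  obtain ⟨m₁, hm₁⟩ := exists_mul_zero σ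
  obtain ⟨m₂, hm₂⟩ := exists_mul_self hσ0.le
  obtain ⟨ψ, hψ⟩ := exists_psiOp hε0 hε1
  obtain ⟨k₀, hk₀⟩ := exists_mul_wfn le_rfl (1 + ε)
  obtain ⟨k₁, hk₁⟩ := exists_mul_wfn hσ0.le (1 + ε)
  obtain ⟨b₀, hb₀⟩ := exists_bilin_self L₀ m₀
  obtain ⟨b₁, hb₁⟩ := exists_bilin_mixed (Y₂ := Dom →ᵇ ℝ) T m₁ k₀
  obtain ⟨b₂, hb₂⟩ := exists_bilin_pair T m₂ ψ k₁
  -- First-order response of the base solution to the change of the initial value and of the two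
  -- free coefficients of P.
  obtain ⟨a, hadef⟩ : ∃ a : Prm → Z (Gw 0), ∀ q,
      a q = L₀ (q.2 - γ, (q.1 1 - c 1) • p₁ + (q.1 2 - c 2) • p₂) := ⟨_, fun _ => rfl⟩
  obtain ⟨κ, hκdef⟩ : ∃ κ : B4 → X .south ε, ∀ β,
      κ β = T (β, (β 1 + β 0 ^ 2 / 2) • q₀, 0) := ⟨_, fun _ => rfl⟩
  have ha : ContDiff ℝ ∞ a := by
    have s1 : ContDiff ℝ ∞ fun q : Prm => q.1 1 - c 1 := by fun_prop
    have s2 : ContDiff ℝ ∞ fun q : Prm => q.1 2 - c 2 := by fun_prop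
    have s3 : ContDiff ℝ ∞ fun q : Prm => q.2 - γ := by fun_prop
    rw [funext hadef]
    exact L₀.contDiff.comp (s3.prodMk ((s1.smul contDiff_const).add (s2.smul contDiff_const)))
  have ha0 : a (c, γ) = 0 := by
    simp only [hadef, sub_self, zero_smul, add_zero]
    exact L₀.map_zero
  have hκ : ContDiff ℝ ∞ κ := by
    have s1 : ContDiff ℝ ∞ fun β : B4 => β 1 + β 0 ^ 2 / 2 := by fun_prop
    rw [funext hκdef]
    exact T.contDiff.comp (contDiff_id.prodMk ((s1.smul contDiff_const).prodMk contDiff_const))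
  have hκ0 : κ 0 = 0 := by
    have : ((0 : B4), (((0 : B4) 1 + (0 : B4) 0 ^ 2 / 2) • q₀ : Z (Hw σ)), (0 : Dom →ᵇ ℝ)) = 0 := by
      simp
    rw [hκdef, this, map_zero]
  obtain ⟨r, hr, δ, hδ, O, hO, hqO, f, S, hS, hmain⟩ :=
    exists_triangular_solution ι ha ha0 hκ hκ0 b₀ b₁ b₂
  refine ⟨r, hr, δ, hδ, O, hO, hqO, S, hS, fun q hq hq0 => ?_⟩
  obtain ⟨hf, hmain⟩ := hmain q hq
  -- the base solution at `q`
  have hfrel : LinRel (alph c γ) (q.2 - γ) (fun x => (q.1 1 - c 1) * (1 + x)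
      + (q.1 2 - c 2) * (1 - x ^ 2) - Z.fn (f q) x ^ 2 / 2) (Z.fn (f q)) := by
    have e1 : a q + b₀ (f q) (f q) = L₀ (q.2 - γ, (q.1 1 - c 1) • p₁ + (q.1 2 - c 2) • p₂
        + (-(1 / 2 : ℝ)) • m₀ (f q) (f q)) := by
      rw [hb₀, hadef, ← map_add]
      congr 1
      simp
    have e2 := hL₀ (q.2 - γ, (q.1 1 - c 1) • p₁ + (q.1 2 - c 2) • p₂
        + (-(1 / 2 : ℝ)) • m₀ (f q) (f q))
    rw [← e1, ← hf] at e2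
    refine e2.congr (fun x hx => ?_) fun _ _ => rfl
    simp only [Z.fn_add, Z.fn_smul, hp₁ x hx, hp₂ x hx, hm₀ _ _ x hx]
    ring
  -- The slice condition is used here: with equal zeroth coefficients, P at `q.1` minus P at `c` has
  -- no component along 1 - x.
  have hsol' : IsNoSwirlSol q.1 (fun x => Ubar c γ x + Z.fn (f q) x) := by
    refine isNoSwirlSol_of_hasDerivAt fun x hx => ?_
    refine ((hb.sol.hasDerivAt hx).add (hfrel.2 x hx)).congr_deriv ?_
    rw [← add_div]
    congr 1
    unfold P alph
    rw [hb.c0, hq0]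
    ring
  have hini' : Ubar c γ 0 + Z.fn (f q) 0 = q.2 := by
    rw [hb.init, hfrel.1]
    ring
  have hUq : EqOn (Ubar q.1 q.2) (fun x => Ubar c γ x + Z.fn (f q) x) Dom := Ubar_eqOn hsol' hini'
  obtain ⟨hsq, hiq⟩ := Ubar_spec (c := q.1) (γ := q.2) ⟨_, hsol', hini'⟩
  obtain ⟨C, hC, hCb⟩ := hb.Ubar_bound
  have hbq : ∀ x ∈ Dom, |Ubar q.1 q.2 x| ≤ C + ‖f q‖ * (1 / Real.log (3 / 2)) := fun x hx => by
    rw [hUq hx]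
    refine (abs_add_le _ _).trans (add_le_add (hCb x hx) ((Z.abs_fn_le (Gw_pos 0) (f q) hx).trans
      (mul_le_mul_of_nonneg_left ?_ (norm_nonneg _))))
    unfold Gw
    rw [Real.rpow_zero]
    exact one_div_le_one_div_of_le log_three_half_pos (lam_ge hx)
  -- the fixed point equation is the corrected system
  have heq : ∀ (β : B4) (W : X .south ε), κ β + b₁ (f q) (ι W) + b₂ (ι W) (ι W)
      = T (β, (β 1 + β 0 ^ 2 / 2) • q₀ - (m₁ (f q) (ι W).1 + (1 / 2 : ℝ) • m₂ (ι W).1 (ι W).1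
        + ψ (ι W).2.1 (ι W).2.2), -(k₀ (f q) (ι W).2.2 + k₁ (ι W).1 (ι W).2.2)) := by
    intro β W
    rw [hb₁, hb₂, hκdef, ← map_neg, ← map_neg, ← map_add, ← map_add, prod_combine, add_assoc]
  have hiff : ∀ (β : B4) (W : X .south ε), W = κ β + b₁ (f q) (ι W) + b₂ (ι W) (ι W) ↔
      IsCorrSol q.1 q.2 β W := by
    intro β W
    rw [heq, hT, linRel_iff (fun x hx => W.fst.hasDerivAt_fn hx), phiRel_iff]
    have hcorr : ∀ x ∈ Dom, Z.fn (ψ (ι W).2.1 (ι W).2.2) x = corr (psi W.snd.fn W.snd.fn) x :=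
      fun x hx => by
        rw [hψ _ _ x hx]
        refine corr_congr (fun y hy => prim3_congr (psiIntegrand_congr (fun z hz => ?_)
          fun z hz => ?_) y hy) x hx
        · exact (hι W z hz).2.1
        · exact (hι W z hz).2.2
    have hθ : ∀ x ∈ Dom, Z.fn ((β 1 + β 0 ^ 2 / 2) • q₀ - (m₁ (f q) (ι W).1
        + (1 / 2 : ℝ) • m₂ (ι W).1 (ι W).1 + ψ (ι W).2.1 (ι W).2.2)) x
        = (β 1 + β 0 ^ 2 / 2) * (1 - x ^ 2) - (Z.fn (f q) x * W.fst.fn x + W.fst.fn x ^ 2 / 2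
          + corr (psi W.snd.fn W.snd.fn) x) := fun x hx => by
      simp only [Z.fn_sub, Z.fn_add, Z.fn_smul, hq₀ x hx, hm₁ _ _ x hx, hm₂ _ _ x hx, (hι W x hx).1,
        hcorr x hx]
      ring
    have hφ : ∀ x ∈ Dom, wfn (1 + ε) (-(k₀ (f q) (ι W).2.2 + k₁ (ι W).1 (ι W).2.2)) x
        = -((Z.fn (f q) x + W.fst.fn x) * deriv W.snd.fn x) := fun x hx => by
      simp only [wfn_neg, wfn_add, hk₀ _ _ x hx, hk₁ _ _ x hx, (hι W x hx).1, (hι W x hx).2.2]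
      ring
    unfold IsCorrSol
    constructor
    · rintro ⟨⟨h1, h2⟩, h3, h4, h5⟩
      refine ⟨h1, h4, h3, fun x hx => ?_⟩
      have e1 := h2 x hx
      have e2 := h5 x hx
      rw [hθ x hx] at e1
      rw [hφ x hx] at e2
      rw [hUq hx]
      unfold alph at e1
      exact ⟨by linear_combination e1, by linear_combination e2⟩
    · rintro ⟨h1, h4, h3, h5⟩
      refine ⟨⟨h1, fun x hx => ?_⟩, h3, h4, fun x hx => ?_⟩
      · have e1 := (h5 x hx).1
        rw [hUq hx] at e1
        rw [hθ x hx]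
        unfold alph
        linear_combination e1
      · have e1 := (h5 x hx).2
        rw [hUq hx] at e1
        rw [hφ x hx]
        linear_combination e1
  have hcs : ∀ β ∈ Metric.ball (0 : B4) δ, IsCorrSol q.1 q.2 β (S (q, β)) := fun β hβ =>
    (hiff β _).1 (hmain β hβ).2.1
  have huniq : ∀ β ∈ Metric.ball (0 : B4) δ, ∀ W : X .south ε, ‖W‖ < r → IsSol q.1 q.2 β W →
      W = S (q, β) := fun β hβ W hW h =>
    (hmain β hβ).2.2 W hW ((hiff β W).2 (isCorrSol_of_isSol hε0 hε1 hsq hiq hbq h))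
  have hzero : S (q, 0) = 0 :=
    (huniq 0 (Metric.mem_ball_self hδ) 0 (by rwa [norm_zero]) (isSol_zero hsq)).symm
  refine ⟨⟨hsq, hiq, fun β hβ => (hcs β hβ).isSol hε0 hε1 hsq hiq,
    fun β hβ => (hcs β hβ).solvesNSE hε0 hε1 hsq, huniq, hzero,
    fun D hD β => ?_⟩, fun β hβ => (hmain β hβ).1⟩
  -- the derivative in `β`
  obtain ⟨κ', hκ'def, hκ'⟩ := exists_hasFDerivAt_source T q₀
  rw [← funext hκdef] at hκ'
  have hD' := hasFDerivAt_quadratic ι hκ' hD hzero (b₁ (f q)) b₂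
    (by filter_upwards [Metric.ball_mem_nhds (0 : B4) hδ] with β hβ using (hmain β hβ).2.1) β
  have e1 : κ' β + b₁ (f q) (ι (D β)) = T (β, β 1 • q₀ - m₁ (f q) (ι (D β)).1,
      -k₀ (f q) (ι (D β)).2.2) := by
    have e3 := prod_combine β (β 1 • q₀) (m₁ (f q) (ι (D β)).1) 0 (k₀ (f q) (ι (D β)).2.2) 0
    rw [Prod.mk_zero_zero, Prod.mk_zero_zero, neg_zero, add_zero, add_zero, add_zero] at e3
    rw [hκ'def, hb₁, ← map_neg, ← map_add, e3]
  rw [e1, hT, linRel_iff (fun x hx => (D β).fst.hasDerivAt_fn hx), phiRel_iff] at hD'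
  obtain ⟨⟨h1, h2⟩, h3, h4, h5⟩ := hD'
  refine ⟨(linRel_iff (fun x hx => (D β).fst.hasDerivAt_fn hx)).2
    ⟨h1, fun x hx => ?_⟩, (phiRel_iff _).2 ⟨h3, h4, fun x hx => ?_⟩⟩
  · have e2 := h2 x hx
    simp only [Z.fn_sub, Z.fn_smul, hq₀ x hx, hm₁ _ _ x hx, (hι _ x hx).1] at e2
    unfold alph at e2 ⊢
    rw [hUq hx]
    linear_combination e2
  · have e2 := h5 x hx
    simp only [wfn_neg, hk₀ _ _ x hx, (hι _ x hx).2.2] at e2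
    rw [hUq hx]
    linear_combination e2

end base

/-! ### Gluing the local families -/

section glue

variable {p : Pole} {ε : ℝ}

lemma IsSolFamily.congr {r r' δ δ' γ : ℝ} {c : Fin 3 → ℝ} {S S' : B4 → X p ε}
    (h : IsSolFamily r δ c γ S) (hr : r' ≤ r) (hδ0 : 0 < δ') (hδ : δ' ≤ δ)
    (he : ∀ β ∈ Metric.ball (0 : B4) δ', S' β = S β) : IsSolFamily r' δ' c γ S' := by
  have hsub : ∀ β ∈ Metric.ball (0 : B4) δ', β ∈ Metric.ball (0 : B4) δ :=
    fun β hβ => Metric.ball_subset_ball hδ hβ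
  have h0 : (0 : B4) ∈ Metric.ball (0 : B4) δ' := Metric.mem_ball_self hδ0
  refine ⟨h.sol, h.init, fun β hβ => ?_, fun β hβ => ?_, fun β hβ W hW hs => ?_, ?_,
    fun D hD => h.deriv D (hD.congr_of_eventuallyEq ?_)⟩
  · rw [he β hβ]
    exact h.isSol β (hsub β hβ)
  · rw [he β hβ]
    exact h.cHat β (hsub β hβ)
  · rw [he β hβ]
    exact h.unique β (hsub β hβ) W (hW.trans_le hr) hs
  · rw [he 0 h0, h.zero]
  · filter_upwards [Metric.ball_mem_nhds (0 : B4) hδ0] with β hβ using (he β hβ).symm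

lemma exists_pos_le_finset {ι : Type*} (t : Finset ι) (f : ι → ℝ) (hf : ∀ i, 0 < f i) :
    ∃ r > 0, ∀ i ∈ t, r ≤ f i := by
  classical
  induction t using Finset.induction_on with
  | empty => exact ⟨1, one_pos, by simp⟩
  | insert a s _ ih =>
    obtain ⟨r, hr, h⟩ := ih
    refine ⟨min r (f a), lt_min hr (hf a), fun i hi => ?_⟩
    rcases Finset.mem_insert.1 hi with rfl | hi
    · exact min_le_right _ _
    · exact (min_le_left _ _).trans (h i hi)

/-- Local uniqueness makes overlapping families agree, but only at parameters in `T`, where they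
consist of solutions. Composition with the retraction `π` onto `T` evaluates every local family in
`T`, so the glued map is well defined and smooth on an open neighbourhood of `K`. -/
lemma exists_glued_family {K : Set Prm} (hK : IsCompact K) {T : Set Prm} {π : Prm → Prm}
    (hπ : ContDiff ℝ ∞ π) (hπT : ∀ q, π q ∈ T) (hid : ∀ q ∈ K, π q = q)
    (hloc : ∀ q₀ ∈ K, ∃ r > 0, ∃ δ > 0, ∃ O : Set Prm, IsOpen O ∧ q₀ ∈ O ∧
      ∃ S : Prm × B4 → X p ε, ContDiffOn ℝ ∞ S (O ×ˢ Metric.ball 0 δ) ∧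
      ∀ q ∈ O, q ∈ T → (IsSolFamily r δ q.1 q.2 fun β => S (q, β)) ∧
        ∀ β ∈ Metric.ball (0 : B4) δ, ‖S (q, β)‖ < r) :
    ∃ r > 0, ∃ δ > 0, ∃ O : Set Prm, IsOpen O ∧ K ⊆ O ∧
      ∃ S : Prm × B4 → X p ε, ContDiffOn ℝ ∞ S (O ×ˢ Metric.ball 0 δ) ∧
      ∀ q ∈ K, IsSolFamily r δ q.1 q.2 fun β => S (q, β) := by
  classical
  choose! r hr δ hδ O hO hqO S hS hfam using hloc
  obtain ⟨t, htK, hcov⟩ := hK.elim_nhds_subcover (fun q => π ⁻¹' O q) fun q hq =>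
    ((hO q hq).preimage hπ.continuous).mem_nhds (by rw [mem_preimage, hid q hq]; exact hqO q hq)
  -- The radii produced by choice are known to be positive only on `K`; the value 1 elsewhere is a
  -- filler.
  obtain ⟨r₀, hr₀, hrle⟩ := exists_pos_le_finset t (fun q => if q ∈ K then r q else 1) fun q => by
    split_ifs with h
    · exact hr q h
    · exact one_pos
  obtain ⟨δ₀, hδ₀, hδle⟩ := exists_pos_le_finset t (fun q => if q ∈ K then δ q else 1) fun q => by
    split_ifs with h
    · exact hδ q h
    · exact one_pos
  have hrle' : ∀ i ∈ t, r₀ ≤ r i := fun i hi => by simpa [htK i hi] using hrle i hi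
  have hδle' : ∀ i ∈ t, δ₀ ≤ δ i := fun i hi => by simpa [htK i hi] using hδle i hi
  -- Of two families, the one with the smaller radius takes its values in the uniqueness ball of the
  -- other.
  have agree : ∀ i ∈ t, ∀ j ∈ t, ∀ q ∈ T, q ∈ O i → q ∈ O j → ∀ β ∈ Metric.ball (0 : B4) δ₀,
      S i (q, β) = S j (q, β) := by
    have main : ∀ i ∈ t, ∀ j ∈ t, r i ≤ r j → ∀ q ∈ T, q ∈ O i → q ∈ O j →
        ∀ β ∈ Metric.ball (0 : B4) δ₀, S i (q, β) = S j (q, β) := by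
      intro i hi j hj hij q hq hqi hqj β hβ
      obtain ⟨h1, h2⟩ := hfam i (htK i hi) q hqi hq
      obtain ⟨h3, -⟩ := hfam j (htK j hj) q hqj hq
      have hβi := Metric.ball_subset_ball (hδle' i hi) hβ
      have hβj := Metric.ball_subset_ball (hδle' j hj) hβ
      exact h3.unique β hβj _ ((h2 β hβi).trans_le hij) (h1.isSol β hβi)
    intro i hi j hj q hq hqi hqj β hβ
    rcases le_total (r i) (r j) with h | h
    · exact main i hi j hj h q hq hqi hqj β hβ
    · exact (main j hj i hi h q hq hqj hqi β hβ).symm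
  -- The index is an arbitrary choice, depending on the parameter; `agree` makes the value
  -- independent of it.
  let G : Prm × B4 → X p ε := fun x =>
    if h : ∃ i ∈ t, π x.1 ∈ O i then S h.choose (π x.1, x.2) else 0
  have hG : ∀ i ∈ t, ∀ q, π q ∈ O i → ∀ β ∈ Metric.ball (0 : B4) δ₀,
      G (q, β) = S i (π q, β) := by
    intro i hi q hq β hβ
    have h : ∃ i ∈ t, π q ∈ O i := ⟨i, hi, hq⟩
    have e : G (q, β) = S h.choose (π q, β) := dif_pos h
    rw [e]
    exact agree _ h.choose_spec.1 i hi _ (hπT q) h.choose_spec.2 hq β hβ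
  refine ⟨r₀, hr₀, δ₀, hδ₀, ⋃ i ∈ t, π ⁻¹' O i,
    isOpen_biUnion fun i hi => (hO i (htK i hi)).preimage hπ.continuous, hcov, G, ?_, ?_⟩
  · rintro ⟨q, β⟩ ⟨hq, hβ⟩
    obtain ⟨i, hi, hqi⟩ := mem_iUnion₂.1 hq
    have hopen : IsOpen ((π ⁻¹' O i) ×ˢ Metric.ball (0 : B4) δ₀) :=
      ((hO i (htK i hi)).preimage hπ.continuous).prod Metric.isOpen_ball
    have h1 : ContDiffOn ℝ ∞ (fun x : Prm × B4 => S i (π x.1, x.2))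
        ((π ⁻¹' O i) ×ˢ Metric.ball (0 : B4) δ₀) :=
      (hS i (htK i hi)).comp ((hπ.comp contDiff_fst).prodMk contDiff_snd).contDiffOn
        fun x hx => ⟨hx.1, Metric.ball_subset_ball (hδle' i hi) hx.2⟩
    have h2 : ContDiffOn ℝ ∞ G ((π ⁻¹' O i) ×ˢ Metric.ball (0 : B4) δ₀) :=
      h1.congr fun x hx => hG i hi x.1 hx.1 x.2 hx.2
    exact (h2.contDiffAt (hopen.mem_nhds ⟨hqi, hβ⟩)).contDiffWithinAt
  · intro q hq
    obtain ⟨i, hi, hqi⟩ := mem_iUnion₂.1 (hcov hq)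
    have hqi' : q ∈ O i := by
      have : π q ∈ O i := hqi
      rwa [hid q hq] at this
    have hqT : q ∈ T := by
      have := hπT q
      rwa [hid q hq] at this
    refine (hfam i (htK i hi) q hqi' hqT).1.congr (hrle' i hi) hδ₀ (hδle' i hi) fun β hβ => ?_
    have := hG i hi q hqi β hβ
    rwa [hid q hq] at this

end glue

/-! ### The data at `0` -/

section data

variable {p : Pole} {ε : ℝ}

lemma one_le_log_three : 1 ≤ Real.log 3 := by
  rw [Real.le_log_iff_exp_le (by norm_num)]
  exact Real.exp_one_lt_d9.le.trans (by norm_num)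

/-- At x = 0 the two weights have absolute values ln 3 and (ln 3)², both at least 1, independently
of ε and of the pole. -/
lemma M1.abs_zero_le (F : M1 p ε) : |F.fn 0| ≤ ‖F‖ ∧ |deriv F.fn 0| ≤ ‖F‖ := by
  have hl : Real.log (1 / 3) = -Real.log 3 := by rw [one_div, Real.log_inv]
  have h3 := one_le_log_three
  have h0 := (le_wnorm F.isM1.bdd0 zero_mem_Ioo).trans F.wnorm_le_norm.1
  have h1 := (le_wnorm F.isM1.bdd1 zero_mem_Ioo).trans F.wnorm_le_norm.2.1
  have e0 : |wt0 p ε 0| = Real.log 3 := by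
    simp only [wt0, mul_zero, add_zero, sub_zero, Real.one_rpow, mul_one]
    rw [hl, abs_neg, abs_of_nonneg (by linarith)]
  have e1 : |wt1 p ε 0| = Real.log 3 ^ 2 := by
    simp only [wt1, mul_zero, add_zero, sub_zero, Real.one_rpow, mul_one, one_mul]
    rw [hl, neg_sq, abs_of_nonneg (by positivity)]
  rw [abs_mul, e0] at h0
  rw [abs_mul, e1] at h1
  constructor
  · nlinarith [abs_nonneg (F.fn 0)]
  · have h4 : 1 ≤ Real.log 3 ^ 2 := one_le_pow₀ h3
    nlinarith [abs_nonneg (deriv F.fn 0)]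

lemma M2.abs_zero_le (F : M2 ε) : |F.fn 0| ≤ ‖F‖ ∧ |deriv F.fn 0| ≤ ‖F‖ := by
  have e : ∀ a : ℝ, wphi a 0 = 1 := fun a => by simp [wphi]
  have h0 := F.abs_fn_le zero_mem_Ioo
  have h1 := F.abs_deriv_le zero_mem_Ioo
  rw [e, mul_one] at h0 h1
  exact ⟨h0, h1⟩

lemma X.norm_eq (W : X p ε) : ‖W‖ = ‖W.fst‖ + ‖W.snd‖ := by
  rw [WithLp.prod_norm_eq_of_L1]

lemma X.abs_zero_le (W : X p ε) : |W.fst.fn 0| ≤ ‖W‖ ∧ |deriv W.fst.fn 0| ≤ ‖W‖ ∧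
    |deriv W.snd.fn 0| ≤ ‖W‖ ∧ |W.snd.fn 0| ≤ ‖W‖ := by
  have h1 := W.fst.abs_zero_le
  have h2 := W.snd.abs_zero_le
  have h3 := norm_nonneg W.fst
  have h4 := norm_nonneg W.snd
  rw [X.norm_eq]
  refine ⟨?_, ?_, ?_, ?_⟩ <;> linarith [h1.1, h1.2, h2.1, h2.2]

/-- A bounded projection onto `X₁`. -/
lemma exists_proj (p : Pole) (ε : ℝ) : ∃ pX : X p ε →L[ℝ] X1 p ε, ∀ W : X1 p ε, pX W = W := by
  have key : ∀ W W' : X p ε, ∀ r : ℝ, ((W + W').fst.fn 0 = W.fst.fn 0 + W'.fst.fn 0 ∧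
      deriv (W + W').fst.fn 0 = deriv W.fst.fn 0 + deriv W'.fst.fn 0 ∧
      deriv (W + W').snd.fn 0 = deriv W.snd.fn 0 + deriv W'.snd.fn 0 ∧
      (W + W').snd.fn 0 = W.snd.fn 0 + W'.snd.fn 0) ∧ ((r • W).fst.fn 0 = r * W.fst.fn 0 ∧
      deriv (r • W).fst.fn 0 = r * deriv W.fst.fn 0 ∧
      deriv (r • W).snd.fn 0 = r * deriv W.snd.fn 0 ∧ (r • W).snd.fn 0 = r * W.snd.fn 0) :=
    fun W W' r => ⟨⟨rfl, deriv_add_of W.fst.isM1.smooth1 W'.fst.isM1.smooth1 0 zero_mem_Ioo,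
      deriv_add_of W.snd.isM2.smooth1 W'.snd.isM2.smooth1 0 zero_mem_Ioo, rfl⟩,
      ⟨rfl, deriv_smul_of W.fst.isM1.smooth1 r 0 zero_mem_Ioo,
      deriv_smul_of W.snd.isM2.smooth1 r 0 zero_mem_Ioo, rfl⟩⟩
  let L : X p ε →ₗ[ℝ] (ℝ × ℝ) × (ℝ × ℝ) :=
    { toFun := fun W => ((W.fst.fn 0, deriv W.fst.fn 0), (deriv W.snd.fn 0, W.snd.fn 0))
      map_add' := fun W W' => by
        obtain ⟨⟨h1, h2, h3, h4⟩, -⟩ := key W W' 0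
        rw [h1, h2, h3, h4]
        rfl
      map_smul' := fun r W => by
        obtain ⟨-, h1, h2, h3, h4⟩ := key W W r
        rw [h1, h2, h3, h4]
        rfl }
  let Lc : X p ε →L[ℝ] (ℝ × ℝ) × (ℝ × ℝ) := L.mkContinuous 1 fun W => by
    obtain ⟨h1, h2, h3, h4⟩ := W.abs_zero_le
    rw [one_mul]
    exact max_le (max_le h1 h2) (max_le h3 h4)
  -- X₁ is the kernel of a continuous map of finite rank, hence complemented.
  have hker : LinearMap.ker Lc.toLinearMap = X1 p ε := by
    ext W
    have e : Lc W = ((W.fst.fn 0, deriv W.fst.fn 0), (deriv W.snd.fn 0, W.snd.fn 0)) := rfl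
    rw [LinearMap.mem_ker]
    change Lc W = 0 ↔ W.fst.fn 0 = 0 ∧ deriv W.fst.fn 0 = 0 ∧ deriv W.snd.fn 0 = 0 ∧ W.snd.fn 0 = 0
    rw [e]
    simp only [Prod.ext_iff, Prod.fst_zero, Prod.snd_zero, and_assoc]
  have hcc := Lc.ker_closedComplemented_of_finiteDimensional_range
  rw [hker] at hcc
  exact hcc

/-- At x = 0 the linearized θ-equation reads f' + γf = β₁; this is the origin of the shift γβ₀ in
`HasData`. A solution and its linear part therefore carry the same data, and their difference lies
in X₁. -/
lemma IsLinearized.hasData {c : Fin 3 → ℝ} {γ : ℝ} {β : B4} {W : X p ε} (h0 : Ubar c γ 0 = γ)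
    (h : IsLinearized c γ β W) : HasData γ β W := by
  refine ⟨h.1.1, ?_, h.2.2.1, h.2.1⟩
  rw [(h.1.2 0 zero_mem_Ioo).deriv, h.1.1]
  simp [alph, h0]

lemma hasData_sub {γ : ℝ} {β : B4} {W W' : X p ε} (h : HasData γ β W) (h' : HasData γ β W') :
    W - W' ∈ X1 p ε := by
  have e1 : deriv (W - W').fst.fn 0 = deriv W.fst.fn 0 - deriv W'.fst.fn 0 :=
    ((W.fst.hasDerivAt_fn zero_mem_Ioo).sub (W'.fst.hasDerivAt_fn zero_mem_Ioo)).deriv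
  have e2 : deriv (W - W').snd.fn 0 = deriv W.snd.fn 0 - deriv W'.snd.fn 0 :=
    ((W.snd.hasDerivAt_fn zero_mem_Ioo).sub (W'.snd.hasDerivAt_fn zero_mem_Ioo)).deriv
  refine ⟨?_, e1.trans ?_, e2.trans ?_, ?_⟩
  · exact sub_eq_zero.2 (h.1.trans h'.1.symm)
  · exact sub_eq_zero.2 (h.2.1.trans h'.2.1.symm)
  · exact sub_eq_zero.2 (h.2.2.1.trans h'.2.2.1.symm)
  · exact sub_eq_zero.2 (h.2.2.2.trans h'.2.2.2.symm)

end data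

/-! ### Removing the linear part of a smooth family -/

section slice

variable {E G F : Type*} [NormedAddCommGroup E] [NormedSpace ℝ E] [NormedAddCommGroup G]
  [NormedSpace ℝ G] [NormedAddCommGroup F] [NormedSpace ℝ F] {O : Set E} {δ : ℝ} {S : E × G → F}

lemma hasFDerivAt_slice (hO : IsOpen O) (hδ : 0 < δ)
    (hS : ContDiffOn ℝ ∞ S (O ×ˢ Metric.ball 0 δ)) {q : E} (hq : q ∈ O) :
    HasFDerivAt (fun β => S (q, β)) ((fderiv ℝ S (q, 0)).comp (ContinuousLinearMap.inr ℝ E G))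
      0 := by
  have hΩ : IsOpen (O ×ˢ Metric.ball (0 : G) δ) := hO.prod Metric.isOpen_ball
  have h1 : HasFDerivAt S (fderiv ℝ S (q, 0)) (q, 0) :=
    ((hS.differentiableOn (by simp)).differentiableAt
      (hΩ.mem_nhds ⟨hq, Metric.mem_ball_self hδ⟩)).hasFDerivAt
  exact h1.comp (0 : G) (hasFDerivAt_prodMk_right q 0)

/-- The derivative of a C^∞ map is again C^∞ in the parameter, so subtracting the linear part in β
costs no regularity in (c,γ). -/
lemma contDiffOn_sub_slice_deriv (hO : IsOpen O) (hδ : 0 < δ)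
    (hS : ContDiffOn ℝ ∞ S (O ×ˢ Metric.ball 0 δ)) :
    ContDiffOn ℝ ∞ (fun x => S x - fderiv ℝ S (x.1, 0) (0, x.2)) (O ×ˢ Metric.ball 0 δ) := by
  have h1 : ContDiffOn ℝ ∞ (fderiv ℝ S) (O ×ˢ Metric.ball 0 δ) :=
    hS.fderiv_of_isOpen (hO.prod Metric.isOpen_ball) (by simp)
  have h2 : ContDiffOn ℝ ∞ (fun x : E × G => fderiv ℝ S (x.1, 0)) (O ×ˢ Metric.ball 0 δ) :=
    h1.comp (contDiff_fst.prodMk contDiff_const).contDiffOn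
      fun x hx => ⟨hx.1, Metric.mem_ball_self hδ⟩
  exact hS.sub (h2.clm_apply (contDiff_const.prodMk contDiff_snd).contDiffOn)

lemma hasFDerivAt_sub_slice_deriv (hO : IsOpen O) (hδ : 0 < δ)
    (hS : ContDiffOn ℝ ∞ S (O ×ˢ Metric.ball 0 δ)) {q : E} (hq : q ∈ O) :
    HasFDerivAt (fun β => S (q, β) - fderiv ℝ S (q, 0) (0, β)) (0 : G →L[ℝ] F) 0 := by
  have h2 := (hasFDerivAt_slice hO hδ hS hq).sub
    ((fderiv ℝ S (q, 0)).comp (ContinuousLinearMap.inr ℝ E G)).hasFDerivAt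
  rw [sub_self] at h2
  exact h2

end slice

/-! ### The main conclusion from a glued family -/

/-- The linear part of S in β solves the linearized equations and equals Σβᵢ V^i on (-1,1), so V is
the remainder, and Σβᵢ V^i + V reproduces S there. For local uniqueness, β is read off the data of
the given perturbation at 0, and uniqueness of the family identifies that perturbation with S(q,β).
-/
lemma exists_map_of_family {p : Pole} {K : Set Prm} (hK : IsCompact K) {ε : ℝ} (hε0 : 0 < ε)
    (hε1 : ε < 1 / 2) {r δ : ℝ} (hr : 0 < r) (hδ : 0 < δ) {O : Set Prm} (hO : IsOpen O)
    (hKO : K ⊆ O) {S : Prm × B4 → X p ε} (hS : ContDiffOn ℝ ∞ S (O ×ˢ Metric.ball 0 δ))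
    (hfam : ∀ q ∈ K, IsSolFamily r δ q.1 q.2 fun β => S (q, β)) :
    ∃ V : Prm × B4 → X1 p ε,
      (∃ O : Set Prm, IsOpen O ∧ K ⊆ O ∧ ContDiffOn ℝ ∞ V (O ×ˢ Metric.ball 0 δ)) ∧
      (∀ q ∈ K, V (q, 0) = 0 ∧ HasFDerivAt (fun β => V (q, β)) (0 : B4 →L[ℝ] X1 p ε) 0) ∧
      (∀ q ∈ K, ∀ β ∈ Metric.ball (0 : B4) δ,
        let W : X p ε := (V (q, β) : X p ε)
        let Ut := perturbation q.1 q.2 β W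
        IntervalIntegrable (psiInner Ut.2 Ut.2) volume 0 (-1) ∧
        IntervalIntegrable (psiInner Ut.2 Ut.2) volume 0 1 ∧
        SolvesNSE (cHat q.1 q.2 Ut) (total q.1 q.2 β W)) ∧
      ∃ δ' > 0, ∀ q ∈ K, ∀ U : (ℝ → ℝ) × (ℝ → ℝ), ∀ Ut : X p ε,
        EqOn U.1 (Ubar q.1 q.2 + Ut.pair.1) (Ioo (-1) 1) →
        EqOn U.2 Ut.pair.2 (Ioo (-1) 1) →
        ‖Ut‖ < δ' →
        (∃ chat : Fin 3 → ℝ, SolvesNSE chat U) →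
        ∃ β ∈ Metric.ball (0 : B4) δ,
          EqOn U.1 (total q.1 q.2 β (V (q, β) : X p ε)).1 (Ioo (-1) 1) ∧
          EqOn U.2 (total q.1 q.2 β (V (q, β) : X p ε)).2 (Ioo (-1) 1) := by
  obtain ⟨pX, hpX⟩ := exists_proj p ε
  -- For parameters in `K` the difference already lies in X₁ and the projection does nothing; it
  -- only provides a smooth X₁-valued extension to the neighbourhood of `K`.
  let V : Prm × B4 → X1 p ε := fun x => pX (S x - fderiv ℝ S (x.1, 0) (0, x.2))
  have hV : ∀ q ∈ K, ∀ β ∈ Metric.ball (0 : B4) δ,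
      (V (q, β) : X p ε) = S (q, β) - fderiv ℝ S (q, 0) (0, β) ∧
        IsLinearized q.1 q.2 β (fderiv ℝ S (q, 0) (0, β)) := fun q hq β hβ => by
    have h1 := (hfam q hq).deriv _ (hasFDerivAt_slice hO hδ hS (hKO hq)) β
    have h2 := hasData_sub ((hfam q hq).isSol β hβ).2 (h1.hasData (hfam q hq).init)
    exact ⟨congrArg Subtype.val (hpX ⟨_, h2⟩), h1⟩
  have hpert : ∀ q ∈ K, ∀ β ∈ Metric.ball (0 : B4) δ,
      (∀ x ∈ Dom, (perturbation q.1 q.2 β (V (q, β) : X p ε)).1 x = (S (q, β)).pair.1 x) ∧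
      ∀ x ∈ Dom, (perturbation q.1 q.2 β (V (q, β) : X p ε)).2 x = (S (q, β)).pair.2 x := by
    intro q hq β hβ
    obtain ⟨e1, h1⟩ := hV q hq β hβ
    obtain ⟨e2, e3⟩ := eqOn_sum_basisV (hfam q hq).sol h1
    constructor <;> intro x hx <;> rw [perturbation, e1]
    · rw [Prod.fst_add, Pi.add_apply, ← e2 x hx]
      exact add_sub_cancel _ _
    · rw [Prod.snd_add, Pi.add_apply, ← e3 x hx]
      exact add_sub_cancel _ _
  have htot : ∀ q ∈ K, ∀ β ∈ Metric.ball (0 : B4) δ,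
      (∀ x ∈ Dom, (total q.1 q.2 β (V (q, β) : X p ε)).1 x
        = ((Ubar q.1 q.2, (0 : ℝ → ℝ)) + (S (q, β)).pair).1 x) ∧
      ∀ x ∈ Dom, (total q.1 q.2 β (V (q, β) : X p ε)).2 x
        = ((Ubar q.1 q.2, (0 : ℝ → ℝ)) + (S (q, β)).pair).2 x := fun q hq β hβ =>
    ⟨fun x hx => congrArg (Ubar q.1 q.2 x + ·) ((hpert q hq β hβ).1 x hx),
      fun x hx => congrArg ((0 : ℝ → ℝ) x + ·) ((hpert q hq β hβ).2 x hx)⟩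
  refine ⟨V, ⟨O, hO, hKO, ?_⟩, fun q hq => ⟨?_, ?_⟩, fun q hq β hβ => ⟨?_, ?_, ?_⟩, ?_⟩
  · exact pX.contDiff.comp_contDiffOn (contDiffOn_sub_slice_deriv hO hδ hS)
  · have h1 : S (q, 0) = 0 := (hfam q hq).zero
    have h2 : V (q, 0) = pX (S (q, 0) - fderiv ℝ S (q, 0) 0) := rfl
    rw [h2, h1, map_zero, sub_zero, map_zero]
  · have h1 := (pX.hasFDerivAt (x := S (q, 0) - fderiv ℝ S (q, 0) (0, 0))).comp (0 : B4)
      (hasFDerivAt_sub_slice_deriv hO hδ hS (hKO hq))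
    rw [ContinuousLinearMap.comp_zero] at h1
    exact h1
  all_goals try
    obtain ⟨N, hN⟩ := isPsiInt_M2 hε0 hε1 (S (q, β)).snd
    have hN' := hN.congr (psiIntegrand_congr (hpert q hq β hβ).2
      (deriv_congr_dom (hpert q hq β hβ).2))
  · exact hN'.intervalIntegrable (by simp) (by simp)
  · exact hN'.intervalIntegrable (by simp) (by simp)
  · have h1 := (hfam q hq).cHat β hβ
    rw [← cHat_congr (hpert q hq β hβ).1 (hpert q hq β hβ).2] at h1
    exact h1.congr (htot q hq β hβ).1 (htot q hq β hβ).2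
  · obtain ⟨Γ, hΓ⟩ := (hK.image continuous_snd).isBounded.exists_norm_le
    have hΓ' : ∀ q ∈ K, |q.2| ≤ max Γ 0 := fun q hq =>
      (hΓ _ (mem_image_of_mem _ hq)).trans (le_max_left _ _)
    set Λ := max Γ 0 with hΛ
    have hΛ0 : 0 ≤ Λ := le_max_right _ _
    -- Three components of β are bounded by ‖Ũ‖ and the remaining one by (1 + Λ)‖Ũ‖, where Λ bounds
    -- |γ| on the compact set `K`; hence the factor 4 + Λ.
    refine ⟨min r (δ / (4 + Λ)), lt_min hr (by positivity), fun q hq U Ut h1 h2 hsm hsol => ?_⟩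
    obtain ⟨chat, hch⟩ := hsol
    obtain ⟨b1, b2, b3, b4⟩ := Ut.abs_zero_le
    -- The inverse of `HasData`: β₁ = f'(0) + γ f(0).
    let β : B4 := !₂[Ut.fst.fn 0, deriv Ut.fst.fn 0 + q.2 * Ut.fst.fn 0, deriv Ut.snd.fn 0,
      Ut.snd.fn 0]
    have hβ : β ∈ Metric.ball (0 : B4) δ := by
      rw [mem_ball_zero_iff]
      have hn : ‖β‖ ≤ |β 0| + |β 1| + |β 2| + |β 3| := by
        have h3 : β = ∑ i, EuclideanSpace.single i (β i) := by
          ext i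
          simp
        have h4 : ‖β‖ ≤ ∑ i, ‖(EuclideanSpace.single i (β i) : B4)‖ := by
          conv_lhs => rw [h3]
          exact norm_sum_le _ _
        simpa [Fin.sum_univ_four, PiLp.norm_single] using h4
      have h5 : |β 1| ≤ ‖Ut‖ + Λ * ‖Ut‖ := by
        refine (abs_add_le _ _).trans (add_le_add b2 ?_)
        rw [abs_mul]
        exact mul_le_mul (hΓ' q hq) b1 (abs_nonneg _) hΛ0
      have h6 : |β 0| ≤ ‖Ut‖ := b1
      have h7 : |β 2| ≤ ‖Ut‖ := b3
      have h8 : |β 3| ≤ ‖Ut‖ := b4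
      have h9 : ‖Ut‖ * (4 + Λ) < δ := by
        rw [← lt_div_iff₀ (by positivity)]
        exact hsm.trans_le (min_le_right _ _)
      linarith
    have e2 : ∀ x ∈ Dom, ((Ubar q.1 q.2, (0 : ℝ → ℝ)) + Ut.pair).2 x = U.2 x := fun x hx => by
      rw [h2 hx, Prod.snd_add, Pi.add_apply]
      exact zero_add _
    have hIs : IsSol q.1 q.2 β Ut :=
      ⟨⟨chat, hch.congr (fun x hx => (h1 hx).symm) e2⟩, rfl, (add_sub_cancel_right _ _).symm,
        rfl, rfl⟩
    have hUt : Ut = S (q, β) :=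
      (hfam q hq).unique β hβ Ut (hsm.trans_le (min_le_left _ _)) hIs
    refine ⟨β, hβ, fun x hx => ?_, fun x hx => ?_⟩
    · rw [(htot q hq β hβ).1 x hx, h1 hx, ← hUt]
      rfl
    · rw [(htot q hq β hβ).2 x hx, ← e2 x hx, ← hUt]

/-! ### Parameters in the regions `I_{2,1}` and `I_{3,1}` -/

/-- Only the definition of infimum and supremum is used, not that the admissible values form a
bounded interval. The empty set is excluded because both extrema would then be the default 0,
against γ⁻ < γ < γ⁺. -/
lemma exists_initialValues_between {c : Fin 3 → ℝ} {γ : ℝ} (h1 : gammaMinus c < γ)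
    (h2 : γ < gammaPlus c) : ∃ γ₁ ∈ initialValues c, ∃ γ₂ ∈ initialValues c, γ₁ < γ ∧ γ < γ₂ := by
  have hne : (initialValues c).Nonempty := by
    rw [nonempty_iff_ne_empty]
    intro h
    unfold gammaMinus gammaPlus at *
    rw [h] at h1 h2
    simp only [Real.sInf_empty, Real.sSup_empty] at h1 h2
    linarith
  obtain ⟨γ₁, hγ₁, h3⟩ := exists_lt_of_csInf_lt hne h1
  obtain ⟨γ₂, hγ₂, h4⟩ := exists_lt_of_lt_csSup hne h2
  exact ⟨γ₁, hγ₁, γ₂, hγ₂, h3, h4⟩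

/-- The bound on ε refers to an arbitrary limit L at 1, so that the same statement serves both
poles: L is identified with 2√(1 + c 1) - 2 only here. -/
lemma isBase_of_mem {c : Fin 3 → ℝ} {γ ε γ₁ γ₂ : ℝ} (hε0 : 0 < ε) (hε1 : ε < 1 / 2)
    (hc0 : c 0 = -1) (hc1 : -1 < c 1) (h1 : γ₁ ∈ initialValues c) (h2 : γ₂ ∈ initialValues c)
    (hγ1 : γ₁ < γ) (hγ2 : γ < γ₂)
    (hadm : ∀ L, Tendsto (Ubar c γ) (𝓝[<] 1) (𝓝 L) → -L / 4 < ε) : IsBase c γ ε := by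
  obtain ⟨hs, hi, hl, hr⟩ := Ubar_asymptotics hc0 hc1 h1 h2 hγ1 hγ2
  refine ⟨hε0, hε1, hc0, hc1, hs, hi, hl, hr, ?_⟩
  have h3 : Tendsto (fun x : ℝ => 2 * x) (𝓝[<] 1) (𝓝 (2 * 1)) :=
    ((continuous_const.mul continuous_id).tendsto 1).mono_left nhdsWithin_le_nhds
  have h4 := hadm (2 * √(1 + c 1) - 2 * 1) ((hr.sub h3).congr fun x => by ring)
  linarith

lemma isBase_of_mem_I21 {q : Prm} {ε : ℝ} (hε0 : 0 < ε) (hε1 : ε < 1 / 2) (hq : q ∈ I21)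
    (hadm : Pole.Admissible .south ε q.1 q.2) : IsBase q.1 q.2 ε := by
  obtain ⟨-, ⟨-, hc0, hc1, -⟩, h1, h2⟩ := hq
  obtain ⟨γ₁, hγ₁, γ₂, hγ₂, h3, h4⟩ := exists_initialValues_between h1 h2
  refine isBase_of_mem hε0 hε1 hc0 hc1 hγ₁ hγ₂ h3 h4 fun L hL => ?_
  have h5 : UbarRight q.1 q.2 = L := hL.limUnder_eq
  rw [← h5]
  exact hadm

/-- Since U - 2 = α - 2(1+x) and ln(1+x) = ln 3 - λ, the product equals -αλ plus terms that vanish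
at -1; the limit is 4. -/
lemma IsBase.logSingular {c : Fin 3 → ℝ} {γ ε : ℝ} (hb : IsBase c γ ε) :
    Pole.LogSingular .south c γ := by
  refine ⟨hb.tendsto_Ubar_left, ?_⟩
  have h0 : Tendsto (fun x : ℝ => 1 + x) (𝓝[>] (-1)) (𝓝 0) :=
    tendsto_one_add_nhdsGT.mono_right nhdsWithin_le_nhds
  have h1 := (((hb.tendsto_alph_left.mul_const (Real.log 3)).sub hb.left).sub
    (h0.const_mul (2 * Real.log 3))).add (tendsto_one_add_mul_lam.const_mul 2)
  norm_num at h1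
  refine h1.congr' ?_
  filter_upwards [dom_mem_left] with x hx
  rw [lam_eq hx.1]
  unfold alph
  ring

/-! ### Reflection of the parameters and of the no-swirl solutions -/

/-- Exchange of `c₁` and `c₂`. -/
def swapC (c : Fin 3 → ℝ) : Fin 3 → ℝ := ![c 1, c 0, c 2]

lemma swapC_swapC (c : Fin 3 → ℝ) : swapC (swapC c) = c := by
  ext i
  fin_cases i <;> rfl

/-- The parameters of the reflected solution. -/
def reflectPrm (q : Prm) : Prm := (swapC q.1, -q.2)

lemma contDiff_reflectPrm : ContDiff ℝ ∞ reflectPrm := by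
  refine ContDiff.prodMk (contDiff_pi.2 fun i => ?_) contDiff_snd.neg
  have h : ∀ j : Fin 3, ContDiff ℝ ∞ fun q : Prm => q.1 j := fun j =>
    (contDiff_apply ℝ ℝ j).comp contDiff_fst
  fin_cases i
  · exact h 1
  · exact h 0
  · exact h 2

lemma P_swapC (c : Fin 3 → ℝ) (x : ℝ) : P (swapC c) x = P c (-x) := by
  simp only [P, swapC, Matrix.cons_val_zero, Matrix.cons_val_one, Matrix.cons_val]
  ring

lemma deriv_neg_comp_neg (f : ℝ → ℝ) (x : ℝ) : deriv (fun y => -f (-y)) x = deriv f (-x) := by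
  rw [deriv.fun_neg, deriv_comp_neg, neg_neg]

/-- The Riccati equation is invariant under x ↦ -x, U ↦ -U, except that P(-x) has the first two
coefficients interchanged. -/
lemma IsNoSwirlSol.reflect {c : Fin 3 → ℝ} {U : ℝ → ℝ} (h : IsNoSwirlSol c U) :
    IsNoSwirlSol (swapC c) fun x => -U (-x) := by
  intro x hx
  obtain ⟨h1, h2⟩ := h (-x) (dom_neg hx)
  refine ⟨(h1.comp x differentiableAt_id.neg).neg, ?_⟩
  rw [deriv_neg_comp_neg, P_swapC, ← h2]
  ring

lemma neg_mem_initialValues {c : Fin 3 → ℝ} {γ : ℝ} (h : γ ∈ initialValues c) :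
    -γ ∈ initialValues (swapC c) := by
  obtain ⟨U, hU, rfl⟩ := h
  exact ⟨_, hU.reflect, by simp⟩

lemma Ubar_reflect {c : Fin 3 → ℝ} {γ : ℝ} (hs : IsNoSwirlSol c (Ubar c γ)) (hi : Ubar c γ 0 = γ) :
    ∀ x ∈ Dom, Ubar (swapC c) (-γ) x = -Ubar c γ (-x) :=
  Ubar_eqOn hs.reflect (by simp [hi])

lemma tendsto_reflect_left {f g : ℝ → ℝ} {L : ℝ} (hf : Tendsto f (𝓝[<] 1) (𝓝 L))
    (hg : ∀ x ∈ Dom, g x = f (-x)) : Tendsto g (𝓝[>] (-1)) (𝓝 L) := by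
  refine (hf.comp (tendsto_neg_nhdsGT_neg (a := (1 : ℝ)))).congr' ?_
  filter_upwards [dom_mem_left] with x hx
  exact (hg x hx).symm

lemma tendsto_reflect_right {f g : ℝ → ℝ} {L : ℝ} (hf : Tendsto f (𝓝[>] (-1)) (𝓝 L))
    (hg : ∀ x ∈ Dom, g x = f (-x)) : Tendsto g (𝓝[<] 1) (𝓝 L) := by
  refine (hf.comp (tendsto_neg_nhdsLT (a := (1 : ℝ)))).congr' ?_
  filter_upwards [dom_mem_right] with x hx
  exact (hg x hx).symm

/-- Reflection reverses the order of the initial values and carries U(-1) to -U(1), so the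
admissibility condition at the north pole becomes the one at the south pole. -/
lemma isBase_reflectPrm_of_mem_I31 {q : Prm} {ε : ℝ} (hε0 : 0 < ε) (hε1 : ε < 1 / 2) (hq : q ∈ I31)
    (hadm : Pole.Admissible .north ε q.1 q.2) : IsBase (reflectPrm q).1 (reflectPrm q).2 ε := by
  obtain ⟨-, ⟨-, hc0, hc1, -⟩, h1, h2⟩ := hq
  obtain ⟨γ₁, hγ₁, γ₂, hγ₂, h3, h4⟩ := exists_initialValues_between h1 h2
  refine isBase_of_mem hε0 hε1 hc1 hc0 (neg_mem_initialValues hγ₂) (neg_mem_initialValues hγ₁)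
    (neg_lt_neg h4) (neg_lt_neg h3) fun L hL => ?_
  have hmem := Ubar_asymptotics (c := swapC q.1) hc1 hc0 (neg_mem_initialValues hγ₂)
    (neg_mem_initialValues hγ₁) (neg_lt_neg h4) (neg_lt_neg h3)
  have h5 := Ubar_reflect hmem.1 hmem.2.1
  rw [swapC_swapC, neg_neg] at h5
  have h6 : UbarLeft q.1 q.2 = -L := (tendsto_reflect_left hL.neg h5).limUnder_eq
  rw [← h6]
  exact hadm

lemma logSingular_north {q : Prm} {ε : ℝ} (hb : IsBase (reflectPrm q).1 (reflectPrm q).2 ε) :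
    Pole.LogSingular .north q.1 q.2 := by
  have h1 := Ubar_reflect hb.sol hb.init
  have e1 : swapC (reflectPrm q).1 = q.1 := swapC_swapC q.1
  have e2 : -(reflectPrm q).2 = q.2 := neg_neg q.2
  rw [e1, e2] at h1
  obtain ⟨h2, h3⟩ := hb.logSingular
  refine ⟨tendsto_reflect_right h2.neg h1, tendsto_reflect_right h3.neg fun x hx => ?_⟩
  rw [h1 x hx, ← sub_eq_add_neg]
  ring

/-! ### Reflection of the function spaces -/

lemma abs_mul_reflect {S : Set ℝ} (hS : ∀ x ∈ S, -x ∈ S) {w w' f g : ℝ → ℝ} (hf : WBdd S w f)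
    (h : ∀ x ∈ S, w' x = w (-x) ∧ |g x| = |f (-x)|) : ∀ x ∈ S, |w' x * g x| ≤ wnorm S w f := by
  intro x hx
  rw [abs_mul, (h x hx).1, (h x hx).2, ← abs_mul]
  exact le_wnorm hf (hS x hx)

lemma abs_iteratedDeriv_comp_neg (n : ℕ) (f : ℝ → ℝ) (x : ℝ) :
    |iteratedDeriv n (fun y => f (-y)) x| = |iteratedDeriv n f (-x)| := by
  rw [iteratedDeriv_comp_neg, smul_eq_mul, abs_mul, abs_pow, abs_neg, abs_one, one_pow, one_mul]

lemma abs_deriv_comp_neg (f : ℝ → ℝ) (x : ℝ) :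
    |deriv (fun y => f (-y)) x| = |deriv f (-x)| := by
  rw [deriv_comp_neg, abs_neg]

section spaces

variable {p p' : Pole} {ε : ℝ}

lemma wt_reflect (hp : p'.sign = -p.sign) (x : ℝ) :
    wt0 p' ε x = wt0 p ε (-x) ∧ wt1 p' ε x = wt1 p ε (-x) := by
  unfold wt0 wt1
  rw [hp, neg_mul, mul_neg]
  exact ⟨rfl, rfl⟩

lemma half_neg {x : ℝ} (hx : x ∈ Ioo (-(1 / 2) : ℝ) (1 / 2)) : -x ∈ Ioo (-(1 / 2) : ℝ) (1 / 2) :=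
  ⟨by linarith [hx.2], by linarith [hx.1]⟩

lemma exists_reflect_M1 (hp : p'.sign = -p.sign) (f : M1 p ε) :
    ∃ g : M1 p' ε, (∀ x, g.fn x = f.fn (-x)) ∧ ‖g‖ ≤ ‖f‖ := by
  have hf := f.isM1
  have b0 := abs_mul_reflect (w' := wt0 p' ε) (g := fun x => f.fn (-x)) (fun _ => dom_neg) hf.bdd0
    fun x _ => ⟨(wt_reflect hp x).1, rfl⟩
  have b1 := abs_mul_reflect (w' := wt1 p' ε) (fun _ => dom_neg) hf.bdd1
    fun x _ => ⟨(wt_reflect hp x).2, abs_deriv_comp_neg f.fn x⟩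
  have b2 := abs_mul_reflect (w' := fun _ => 1) (fun _ => half_neg) hf.bdd2
    fun x _ => ⟨rfl, abs_iteratedDeriv_comp_neg 2 f.fn x⟩
  have b3 := abs_mul_reflect (w' := fun _ => 1) (fun _ => half_neg) hf.bdd3
    fun x _ => ⟨rfl, abs_iteratedDeriv_comp_neg 3 f.fn x⟩
  have hg : IsM1 p' ε fun x => f.fn (-x) :=
    { outside := fun x hx => hf.outside _ fun h => hx ⟨by linarith [h.2], by linarith [h.1]⟩
      smooth3 := hf.smooth3.comp contDiff_neg.contDiffOn fun _ => half_neg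
      smooth1 := hf.smooth1.comp contDiff_neg.contDiffOn fun _ => dom_neg
      cont := hf.cont.comp continuous_neg.continuousOn fun x hx =>
        ⟨by linarith [hx.2], by linarith [hx.1]⟩
      left := by rw [neg_neg]; exact hf.right
      right := hf.left
      bdd0 := wbdd_of_le b0
      bdd1 := wbdd_of_le b1
      bdd2 := wbdd_of_le b2
      bdd3 := wbdd_of_le b3 }
  obtain ⟨g, hgf⟩ := M1.exists_mk hg
  refine ⟨g, fun x => congrFun hgf x, ?_⟩
  rw [M1.norm_def, M1.norm_def, hgf]
  exact add_le_add (add_le_add (add_le_add (wnorm_le (wnorm_nonneg _ _ _) b0)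
    (wnorm_le (wnorm_nonneg _ _ _) b1)) (wnorm_le (wnorm_nonneg _ _ _) b2))
    (wnorm_le (wnorm_nonneg _ _ _) b3)

lemma exists_reflect_M2 (f : M2 ε) :
    ∃ g : M2 ε, (∀ x, g.fn x = f.fn (-x)) ∧ ‖g‖ ≤ ‖f‖ := by
  have hf := f.isM2
  have b0 := abs_mul_reflect (w' := wphi ε) (g := fun x => f.fn (-x)) (fun _ => dom_neg) hf.bdd0
    fun x _ => ⟨(wphi_neg_arg _ x).symm, rfl⟩
  have b1 := abs_mul_reflect (w' := wphi (1 + ε)) (fun _ => dom_neg) hf.bdd1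
    fun x _ => ⟨(wphi_neg_arg _ x).symm, abs_deriv_comp_neg f.fn x⟩
  have b2 := abs_mul_reflect (w' := wphi (2 + ε)) (fun _ => dom_neg) hf.bdd2
    fun x _ => ⟨(wphi_neg_arg _ x).symm, abs_iteratedDeriv_comp_neg 2 f.fn x⟩
  have hg : IsM2 ε fun x => f.fn (-x) :=
    { outside := fun x hx => hf.outside _ fun h => hx ⟨by linarith [h.2], by linarith [h.1]⟩
      smooth2 := hf.smooth2.comp contDiff_neg.contDiffOn fun _ => dom_neg
      bdd0 := wbdd_of_le b0
      bdd1 := wbdd_of_le b1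
      bdd2 := wbdd_of_le b2 }
  obtain ⟨g, hgf⟩ := M2.exists_mk hg
  refine ⟨g, fun x => congrFun hgf x, ?_⟩
  rw [M2.norm_def, M2.norm_def, hgf]
  exact add_le_add (add_le_add (wnorm_le (wnorm_nonneg _ _ _) b0)
    (wnorm_le (wnorm_nonneg _ _ _) b1)) (wnorm_le (wnorm_nonneg _ _ _) b2)

/-- `W'` is the reflection of `W`. -/
def IsRefl (W : X p ε) (W' : X p' ε) : Prop :=
  (∀ x, W'.fst.fn x = -W.fst.fn (-x)) ∧ ∀ x, W'.snd.fn x = W.snd.fn (-x)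

lemma IsRefl.symm {W : X p ε} {W' : X p' ε} (h : IsRefl W W') : IsRefl W' W :=
  ⟨fun x => by rw [h.1, neg_neg, neg_neg], fun x => by rw [h.2, neg_neg]⟩

lemma IsRefl.unique {W : X p ε} {W' W'' : X p' ε} (h : IsRefl W W') (h' : IsRefl W W'') :
    W' = W'' := by
  have e1 : W'.fst = W''.fst := M1.fn_injective (funext fun x => (h.1 x).trans (h'.1 x).symm)
  have e2 : W'.snd = W''.snd := M2.fn_injective (funext fun x => (h.2 x).trans (h'.2 x).symm)
  exact WithLp.ofLp_injective 1 (Prod.ext e1 e2)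

lemma exists_reflect (ε : ℝ) (hp : p'.sign = -p.sign) :
    ∃ R : X p ε →L[ℝ] X p' ε, (∀ W, IsRefl W (R W)) ∧ ∀ W, ‖R W‖ ≤ ‖W‖ := by
  choose A hA hA' using fun f : M1 p ε => exists_reflect_M1 hp f
  choose B hB hB' using fun f : M2 ε => exists_reflect_M2 f
  let T : X p ε → X p' ε := fun W => WithLp.toLp 1 (-A W.fst, B W.snd)
  have hT : ∀ W, IsRefl W (T W) := fun W =>
    ⟨fun x => congrArg Neg.neg (hA W.fst x), hB W.snd⟩
  have hn : ∀ W, ‖T W‖ ≤ ‖W‖ := fun W => by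
    rw [X.norm_eq, X.norm_eq]
    refine add_le_add ?_ (hB' W.snd)
    exact (norm_neg (A W.fst)).le.trans (hA' W.fst)
  let L : X p ε →ₗ[ℝ] X p' ε :=
    { toFun := T
      map_add' := fun V W => (hT (V + W)).unique
        ⟨fun x => by
          change (T V).fst.fn x + (T W).fst.fn x = -(V.fst.fn (-x) + W.fst.fn (-x))
          rw [(hT V).1, (hT W).1, neg_add],
        fun x => by
          change (T V).snd.fn x + (T W).snd.fn x = V.snd.fn (-x) + W.snd.fn (-x)
          rw [(hT V).2, (hT W).2]⟩
      map_smul' := fun r W => (hT (r • W)).unique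
        ⟨fun x => by
          change r * (T W).fst.fn x = -(r * W.fst.fn (-x))
          rw [(hT W).1, mul_neg],
        fun x => by
          change r * (T W).snd.fn x = r * W.snd.fn (-x)
          rw [(hT W).2]⟩ }
  exact ⟨L.mkContinuous 1 fun W => by rw [one_mul]; exact hn W, hT, hn⟩

end spaces

/-! ### Reflection of the equations -/

/-- Differentiation contributes one sign and each of the three integrations another, so the signs
cancel. -/
lemma psi_reflect (f : ℝ → ℝ) (x : ℝ) :
    psi (fun y => f (-y)) (fun y => f (-y)) x = psi f f (-x) := by
  have key : ∀ k : ℝ → ℝ, (prim fun s => -k (-s)) = fun t => prim k (-t) := fun k => by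
    funext t
    have h1 : (fun s => -k (-s)) = fun s => (-1) * k (-s) := by
      funext s
      ring
    rw [h1, prim_const_mul, prim_comp_neg]
    ring
  have h0 : psiIntegrand (fun y => f (-y)) (deriv fun y => f (-y))
      = fun s => -psiIntegrand f (deriv f) (-s) := by
    funext s
    simp only [psiIntegrand, deriv_comp_neg, neg_sq]
    ring
  rw [psi_eq, psi_eq, h0, key]
  have h1 : (prim fun t => prim (psiIntegrand f (deriv f)) (-t))
      = fun l => -prim (prim (psiIntegrand f (deriv f))) (-l) :=
    funext fun l => prim_comp_neg _ l
  rw [h1, key]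

/-- The reflection of a pair of functions. -/
def reflectPair (U : (ℝ → ℝ) × (ℝ → ℝ)) : (ℝ → ℝ) × (ℝ → ℝ) :=
  (fun x => -U.1 (-x), fun x => U.2 (-x))

lemma SolvesNSE.reflect {chat : Fin 3 → ℝ} {U : (ℝ → ℝ) × (ℝ → ℝ)} (h : SolvesNSE chat U) :
    SolvesNSE (swapC chat) (reflectPair U) := by
  obtain ⟨h1, h2, h3⟩ := h
  refine ⟨(h1.comp contDiff_neg.contDiffOn fun _ => dom_neg).neg,
    h2.comp contDiff_neg.contDiffOn fun _ => dom_neg, fun x hx => ?_⟩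
  obtain ⟨e1, e2⟩ := h3 (-x) (dom_neg hx)
  simp only [reflectPair]
  rw [deriv_neg_comp_neg, psi_reflect, P_swapC, iteratedDeriv_comp_neg, deriv_comp_neg, smul_eq_mul]
  constructor
  · linear_combination e1
  · linear_combination e2

/-! ### Reflection of the data at 0 and of solution families -/

section families

variable {p p' : Pole} {ε γ : ℝ} {c : Fin 3 → ℝ}

/-- The reflection of the data at `0`. -/
def reflectData : B4 ≃ₗᵢ[ℝ] B4 :=
  LinearIsometryEquiv.piLpCongrRight 2
    ![LinearIsometryEquiv.neg ℝ, LinearIsometryEquiv.refl ℝ ℝ, LinearIsometryEquiv.neg ℝ,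
      LinearIsometryEquiv.refl ℝ ℝ]

lemma reflectData_apply (β : B4) : reflectData β 0 = -β 0 ∧ reflectData β 1 = β 1 ∧
    reflectData β 2 = -β 2 ∧ reflectData β 3 = β 3 := ⟨rfl, rfl, rfl, rfl⟩

lemma reflectData_reflectData (β : B4) : reflectData (reflectData β) = β := by
  obtain ⟨a0, a1, a2, a3⟩ := reflectData_apply β
  obtain ⟨b0, b1, b2, b3⟩ := reflectData_apply (reflectData β)
  ext i
  fin_cases i
  · exact b0.trans (by rw [a0, neg_neg]; rfl)
  · exact b1.trans a1
  · exact b2.trans (by rw [a2, neg_neg]; rfl)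
  · exact b3.trans a3

lemma IsRefl.deriv {W : X p ε} {W' : X p' ε} (h : IsRefl W W') (x : ℝ) :
    deriv W'.fst.fn x = deriv W.fst.fn (-x) ∧ deriv W'.snd.fn x = -deriv W.snd.fn (-x) := by
  rw [funext h.1, funext h.2, deriv_neg_comp_neg, deriv_comp_neg]
  exact ⟨rfl, rfl⟩

lemma HasData.reflect {β : B4} {W : X p ε} {W' : X p' ε} (h : HasData γ β W) (hW : IsRefl W W') :
    HasData (-γ) (reflectData β) W' := by
  obtain ⟨h0, h1, h2, h3⟩ := h
  obtain ⟨b0, b1, b2, b3⟩ := reflectData_apply β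
  have hd := hW.deriv 0
  unfold HasData
  rw [hW.1, hW.2, hd.1, hd.2, neg_zero, h0, h1, h2, h3, b0, b1, b2, b3]
  exact ⟨rfl, by ring, rfl, rfl⟩

lemma total_reflect {W : X p ε} {W' : X p' ε} (hs : IsNoSwirlSol c (Ubar c γ))
    (hi : Ubar c γ 0 = γ) (hW : IsRefl W W') :
    (∀ x ∈ Dom, ((Ubar (swapC c) (-γ), (0 : ℝ → ℝ)) + W'.pair).1 x
      = (reflectPair ((Ubar c γ, 0) + W.pair)).1 x) ∧
    ∀ x ∈ Dom, ((Ubar (swapC c) (-γ), (0 : ℝ → ℝ)) + W'.pair).2 x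
      = (reflectPair ((Ubar c γ, 0) + W.pair)).2 x := by
  constructor <;> intro x hx
  · change Ubar (swapC c) (-γ) x + W'.fst.fn x = -(Ubar c γ (-x) + W.fst.fn (-x))
    rw [Ubar_reflect hs hi x hx, hW.1, neg_add]
  · change 0 + W'.snd.fn x = 0 + W.snd.fn (-x)
    rw [hW.2]

lemma IsSol.reflect {β : B4} {W : X p ε} {W' : X p' ε} (hs : IsNoSwirlSol c (Ubar c γ))
    (hi : Ubar c γ 0 = γ) (hW : IsRefl W W') (h : IsSol c γ β W) :
    IsSol (swapC c) (-γ) (reflectData β) W' := by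
  obtain ⟨⟨chat, hch⟩, hd⟩ := h
  have ht := total_reflect hs hi hW
  exact ⟨⟨swapC chat, hch.reflect.congr ht.1 ht.2⟩, hd.reflect hW⟩

lemma cHat_reflect {W : X p ε} {W' : X p' ε} (hs : IsNoSwirlSol c (Ubar c γ))
    (hi : Ubar c γ 0 = γ) (hW : IsRefl W W') :
    cHat (swapC c) (-γ) W'.pair = swapC (cHat c γ W.pair) := by
  have h1 : ∀ x, psi W'.snd.fn W'.snd.fn x = psi W.snd.fn W.snd.fn (-x) := fun x => by
    rw [funext hW.2, psi_reflect]
  have h2 : iteratedDeriv 2 (phi (swapC c) (-γ) W'.fst.fn) 0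
      = iteratedDeriv 2 (phi c γ W.fst.fn) 0 := by
    rw [iteratedDeriv_congr_dom (g := fun x => phi c γ W.fst.fn (-x)) (fun x hx => ?_) 2 0
      zero_mem_Ioo, iteratedDeriv_comp_neg]
    · simp
    · unfold phi
      rw [(hW.deriv x).1, hW.1, Ubar_reflect hs hi x hx]
      ring
  have e1 : W'.pair.1 = W'.fst.fn := rfl
  have e2 : W'.pair.2 = W'.snd.fn := rfl
  unfold cHat
  rw [e1, e2, h1, h1, h2, neg_neg]
  rfl

lemma IsLinearized.reflect {β : B4} {W : X p ε} {W' : X p' ε} (hs : IsNoSwirlSol c (Ubar c γ))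
    (hi : Ubar c γ 0 = γ) (hW : IsRefl W W') (h : IsLinearized c γ β W) :
    IsLinearized (swapC c) (-γ) (reflectData β) W' := by
  obtain ⟨⟨h1, h2⟩, h3, h4, h5⟩ := h
  obtain ⟨b0, b1, b2, b3⟩ := reflectData_apply β
  have hd : deriv W'.snd.fn = fun x => -deriv W.snd.fn (-x) := funext fun x => (hW.deriv x).2
  have comp : ∀ {f : ℝ → ℝ} {f' x : ℝ}, HasDerivAt f f' (-x) →
      HasDerivAt (fun y => -f (-y)) f' x := fun {f f' x} hf => by
    have := (hf.comp x (hasDerivAt_neg x)).neg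
    rw [mul_neg, mul_one, neg_neg] at this
    exact this
  refine ⟨⟨?_, fun x hx => ?_⟩, ?_, ?_, fun x hx => ?_⟩
  · rw [hW.1, neg_zero, h1, b0]
  · rw [funext hW.1]
    convert comp (h2 (-x) (dom_neg hx)) using 1
    simp only [alph]
    rw [Ubar_reflect hs hi x hx, b1, neg_sq]
    congr 1
    ring
  · rw [hW.2, neg_zero, h3, b3]
  · rw [(hW.deriv 0).2, neg_zero, h4, b2]
  · rw [hd]
    convert comp (h5 (-x) (dom_neg hx)) using 1
    rw [Ubar_reflect hs hi x hx, neg_sq]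
    congr 1
    ring

/-- Every property of the family is transported by conjugation with the reflections of X and of β.
Contractivity of the backward map `R'` preserves the uniqueness radius. -/
lemma IsSolFamily.reflect {r δ : ℝ} {S : B4 → X p ε} (h : IsSolFamily r δ c γ S)
    {R : X p ε →L[ℝ] X p' ε} (hR : ∀ W, IsRefl W (R W)) {R' : X p' ε →L[ℝ] X p ε}
    (hR' : ∀ W, IsRefl W (R' W)) (hn : ∀ W, ‖R' W‖ ≤ ‖W‖) :
    IsSolFamily r δ (swapC c) (-γ) fun β => R (S (reflectData β)) := by
  have hs := h.sol
  have hi := h.init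
  obtain ⟨hs', hi'⟩ := Ubar_spec (neg_mem_initialValues ⟨_, hs, hi⟩)
  have hmem : ∀ β ∈ Metric.ball (0 : B4) δ, reflectData β ∈ Metric.ball (0 : B4) δ :=
    fun β hβ => by rwa [mem_ball_zero_iff, LinearIsometryEquiv.norm_map, ← mem_ball_zero_iff]
  have hRR : ∀ W, R (R' W) = W := fun W => (hR (R' W)).unique (hR' W).symm
  have hRR' : ∀ W, R' (R W) = W := fun W => (hR' (R W)).unique (hR W).symm
  refine ⟨hs', hi', fun β hβ => ?_, fun β hβ => ?_, fun β hβ W hW hsol => ?_, ?_,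
    fun D hD β => ?_⟩
  · have := (h.isSol _ (hmem β hβ)).reflect hs hi (hR _)
    rwa [reflectData_reflectData] at this
  · have ht := total_reflect hs hi (hR (S (reflectData β)))
    rw [cHat_reflect hs hi (hR _)]
    exact (h.cHat _ (hmem β hβ)).reflect.congr ht.1 ht.2
  · have h1 := hsol.reflect hs' hi' (hR' W)
    rw [swapC_swapC, neg_neg] at h1
    rw [← h.unique _ (hmem β hβ) (R' W) ((hn W).trans_lt hW) h1, hRR]
  · rw [map_zero, h.zero, map_zero]
  · have h0 : reflectData (0 : B4) = 0 := map_zero _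
    have hρ : HasFDerivAt (fun β : B4 => reflectData β)
        (reflectData : B4 →L[ℝ] B4) 0 := (reflectData : B4 →L[ℝ] B4).hasFDerivAt
    have h1 : HasFDerivAt (fun β => R' (R (S (reflectData (reflectData β)))))
        (R'.comp (D.comp (reflectData : B4 →L[ℝ] B4))) 0 := by
      have hD' : HasFDerivAt (fun β => R (S (reflectData β))) D (reflectData (0 : B4)) := by
        rwa [h0]
      exact R'.hasFDerivAt.comp (0 : B4) (hD'.comp (0 : B4) hρ)
    -- The reflections are involutive, so a derivative of the reflected family yields one of `S` by
    -- conjugating back; only then does the linearized system for `S` apply.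
    have h2 : HasFDerivAt S (R'.comp (D.comp (reflectData : B4 →L[ℝ] B4))) 0 := by
      refine h1.congr_of_eventuallyEq (Eventually.of_forall fun β => ?_)
      simp only [hRR', reflectData_reflectData]
    have h3 := (h.deriv _ h2 (reflectData β)).reflect hs hi (hR _)
    rw [reflectData_reflectData] at h3
    have e : R ((R'.comp (D.comp (reflectData : B4 →L[ℝ] B4))) (reflectData β)) = D β := by
      have e1 : (R'.comp (D.comp (reflectData : B4 →L[ℝ] B4))) (reflectData β)
          = R' (D (reflectData (reflectData β))) := rfl
      rw [e1, hRR, reflectData_reflectData]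
    rwa [e] at h3

end families

/-! ### Local families at the two poles -/

/-- The coordinate of `c` which equals `-1` on the region of the pole. -/
def Pole.slice : Pole → Set Prm
  | .south => {q | q.1 0 = -1}
  | .north => {q | q.1 1 = -1}

/-- A retraction onto the slice. -/
def Pole.toSlice : Pole → Prm → Prm
  | .south => fun q => (![-1, q.1 1, q.1 2], q.2)
  | .north => fun q => (![q.1 0, -1, q.1 2], q.2)

lemma Pole.toSlice_mem (p : Pole) (q : Prm) : p.toSlice q ∈ p.slice := by
  cases p <;> rfl

lemma Pole.toSlice_eq (p : Pole) {q : Prm} (hq : q ∈ p.slice) : p.toSlice q = q := by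
  cases p
  · refine Prod.ext (funext fun i => ?_) rfl
    fin_cases i
    · exact Eq.symm hq
    · rfl
    · rfl
  · refine Prod.ext (funext fun i => ?_) rfl
    fin_cases i
    · rfl
    · exact Eq.symm hq
    · rfl

lemma Pole.contDiff_toSlice (p : Pole) : ContDiff ℝ ∞ p.toSlice := by
  have h : ∀ j : Fin 3, ContDiff ℝ ∞ fun q : Prm => q.1 j := fun j =>
    (contDiff_apply ℝ ℝ j).comp contDiff_fst
  cases p
  · refine ContDiff.prodMk (contDiff_pi.2 fun i => ?_) contDiff_snd
    fin_cases i
    · exact contDiff_const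
    · exact h 1
    · exact h 2
  · refine ContDiff.prodMk (contDiff_pi.2 fun i => ?_) contDiff_snd
    fin_cases i
    · exact h 0
    · exact contDiff_const
    · exact h 2

lemma Pole.region_subset_slice (p : Pole) : p.region ⊆ p.slice := by
  cases p
  · exact fun q hq => hq.2.1.2.1
  · exact fun q hq => hq.2.1.2.2.1

/-- At the south pole this is the local theorem itself. At the north pole the local theorem is
applied at the reflected parameter, and the resulting family is pulled back through the reflections
of parameters, data and functions. -/
lemma Pole.exists_local (p : Pole) {q₀ : Prm} {ε : ℝ} (hε0 : 0 < ε) (hε1 : ε < 1 / 2)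
    (hq₀ : q₀ ∈ p.region) (hadm : p.Admissible ε q₀.1 q₀.2) :
    p.LogSingular q₀.1 q₀.2 ∧ ∃ r > 0, ∃ δ > 0, ∃ O : Set Prm, IsOpen O ∧ q₀ ∈ O ∧
      ∃ S : Prm × B4 → X p ε, ContDiffOn ℝ ∞ S (O ×ˢ Metric.ball 0 δ) ∧
      ∀ q ∈ O, q ∈ p.slice → (IsSolFamily r δ q.1 q.2 fun β => S (q, β)) ∧
        ∀ β ∈ Metric.ball (0 : B4) δ, ‖S (q, β)‖ < r := by
  cases p
  · have hb := isBase_of_mem_I21 hε0 hε1 hq₀ hadm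
    exact ⟨hb.logSingular, hb.exists_local⟩
  · have hb := isBase_reflectPrm_of_mem_I31 hε0 hε1 hq₀ hadm
    refine ⟨logSingular_north hb, ?_⟩
    obtain ⟨r, hr, δ, hδ, O, hO, hqO, S, hS, hfam⟩ := hb.exists_local
    obtain ⟨R, hR, hRn⟩ := exists_reflect (p := .south) (p' := .north) ε rfl
    obtain ⟨R', hR', hRn'⟩ := exists_reflect (p := .north) (p' := .south) ε (neg_neg _).symm
    have hmem : ∀ β ∈ Metric.ball (0 : B4) δ, reflectData β ∈ Metric.ball (0 : B4) δ :=
      fun β hβ => by rwa [mem_ball_zero_iff, LinearIsometryEquiv.norm_map, ← mem_ball_zero_iff]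
    refine ⟨r, hr, δ, hδ, reflectPrm ⁻¹' O, hO.preimage contDiff_reflectPrm.continuous, hqO,
      fun x => R (S (reflectPrm x.1, reflectData x.2)), ?_, fun q hq hqs => ?_⟩
    · refine R.contDiff.comp_contDiffOn (hS.comp ?_ fun x hx => ⟨hx.1, hmem _ hx.2⟩)
      exact ((contDiff_reflectPrm.comp contDiff_fst).prodMk
        (reflectData.contDiff.comp contDiff_snd)).contDiffOn
    · obtain ⟨h1, h2⟩ := hfam (reflectPrm q) hq hqs
      have h3 := h1.reflect hR hR' hRn'
      have e1 : swapC (reflectPrm q).1 = q.1 := swapC_swapC q.1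
      have e2 : -(reflectPrm q).2 = q.2 := neg_neg q.2
      rw [e1, e2] at h3
      exact ⟨h3, fun β hβ => (hRn _).trans_lt (h2 _ (hmem β hβ))⟩

end SwirlNSE

end

/-! ### The theorem, from the local families by gluing over `K` -/

theorem theorem4p1 (p : Pole) (K : Set ((Fin 3 → ℝ) × ℝ)) (hK : IsCompact K)
    (hKI : K ⊆ p.region) (ε : ℝ) (hε0 : 0 < ε) (hε1 : ε < 1 / 2)
    (hε : ∀ q ∈ K, p.Admissible ε q.1 q.2) :
    (∀ q ∈ K, p.LogSingular q.1 q.2) ∧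
    ∃ δ > 0, ∃ V : ((Fin 3 → ℝ) × ℝ) × EuclideanSpace ℝ (Fin 4) → X1 p ε,
      (∃ O : Set ((Fin 3 → ℝ) × ℝ), IsOpen O ∧ K ⊆ O ∧
        ContDiffOn ℝ ∞ V (O ×ˢ Metric.ball 0 δ)) ∧
      (∀ q ∈ K, V (q, 0) = 0 ∧
        HasFDerivAt (fun β => V (q, β))
          (0 : EuclideanSpace ℝ (Fin 4) →L[ℝ] X1 p ε) 0) ∧
      (∀ q ∈ K, ∀ β ∈ Metric.ball (0 : EuclideanSpace ℝ (Fin 4)) δ,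
        let W : X p ε := (V (q, β) : X p ε)
        let Ut := perturbation q.1 q.2 β W
        IntervalIntegrable (psiInner Ut.2 Ut.2) volume 0 (-1) ∧
        IntervalIntegrable (psiInner Ut.2 Ut.2) volume 0 1 ∧
        SolvesNSE (cHat q.1 q.2 Ut) (total q.1 q.2 β W)) ∧
      ∃ δ' > 0, ∀ q ∈ K, ∀ U : (ℝ → ℝ) × (ℝ → ℝ), ∀ Ut : X p ε,
        EqOn U.1 (Ubar q.1 q.2 + Ut.pair.1) (Ioo (-1) 1) →
        EqOn U.2 Ut.pair.2 (Ioo (-1) 1) →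
        ‖Ut‖ < δ' →
        (∃ chat : Fin 3 → ℝ, SolvesNSE chat U) →
        ∃ β ∈ Metric.ball (0 : EuclideanSpace ℝ (Fin 4)) δ,
          EqOn U.1 (total q.1 q.2 β (V (q, β) : X p ε)).1 (Ioo (-1) 1) ∧
          EqOn U.2 (total q.1 q.2 β (V (q, β) : X p ε)).2 (Ioo (-1) 1) := by
  have hloc := fun q hq => p.exists_local hε0 hε1 (hKI hq) (hε q hq)
  obtain ⟨r, hr, δ, hδ, O, hO, hKO, S, hS, hfam⟩ :=
    exists_glued_family hK p.contDiff_toSlice p.toSlice_mem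
      (fun q hq => p.toSlice_eq (p.region_subset_slice (hKI hq))) fun q hq => (hloc q hq).2
  exact ⟨fun q hq => (hloc q hq).1, δ, hδ,
    exists_map_of_family hK hε0 hε1 hr hδ hO hKO hS hfam⟩
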